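/- Let $N\ge 1$. The Yangian $Y(\mathfrak{gl}_N)$ is the unital associative $\mathbb C$-algebra with generators $T_{ab}^{\{s\}}$ ($1\le a,b\le N$, $s\ge 1$) and relations $$(u-v)\,[T_{ab}(u),T_{cd}(v)]=T_{cb}(v)T_{ad}(u)-T_{cb}(u)T_{ad}(v),\qquad T_{ab}(u)=\delta_{ab}+\sum_{s\ge1}T_{ab}^{\{s\}}u^{-s},$$ with coproduct $\Delta(T_{ab}(u))=\sum_{c}T_{cb}(u)\otimes T_{ac}(u)$. A nonzero vector $v$ of a $Y(\mathfrak{gl}_N)$-module is a weight singular vector if $T_{ba}(u)v=0$ for all $a<b$ and $T_{aa}(u)v=\langle T_{aa}(u)v\rangle\,v$ with $\langle T_{aa}(u)v\rangle\in\mathbb C[[u^{-1}]]$ for all $a$. Let $R(u)=u+\sum_{a,b}E_{ab}\otimes E_{ba}$ and $T(u)=\sum_{a,b}E_{ab}\otimes T_{ab}(u)$. For $\xi=(\xi^1,\dots,\xi^{N-1})\in\mathbb Z_{\ge0}^{N-1}$, set $\xi^{<a}=\xi^1+\dots+\xi^{a-1}$ and $|\xi|=\xi^1+\dots+\xi^{N-1}$,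 and for variables $t=(t^1_1,\dots,t^1_{\xi^1};\dots;t^{N-1}_1,\dots,t^{N-1}_{\xi^{N-1}})$ put $$\widehat{\mathbb B}_\xi(t)=(\mathrm{tr}^{\otimes|\xi|}\otimes\mathrm{id})\Bigl(T^{(1,|\xi|+1)}(t^1_1)\cdots T^{(|\xi|,|\xi|+1)}(t^{N-1}_{\xi^{N-1}})\prod^{\longrightarrow}_{(a,i)<(b,j)}R^{(\xi^{<b}+j,\,\xi^{<a}+i)}(t^b_j-t^a_i)\;E_{21}^{\otimes\xi^1}\otimes\dots\otimes E_{N,N-1}^{\otimes\xi^{N-1}}\otimes1\Bigr),$$ where superscripts indicate tensor factors, pairs $(a,i)$ are ordered lexicographically, and the factors of the product over $(a,i)<(b,j)$ stand from left to right in the lexicographic order of $((a,i),(b,j))$. Put $$\mathbb B_\xi(t)=\widehat{\mathbb B}_\xi(t)\prod_{a=1}^{N-1}\prod_{1\le i<j\le\xi^a}\frac1{t^a_j-t^a_i+1}\prod_{1\le a<b<N}\prod_{i=1}^{\xi^a}\prod_{j=1}^{\xi^b}\frac1{t^b_j-t^a_i}.$$ Further, let $$\overline{\mathrm{Sym}}{}^{\,\xi}_t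 f(t)=\sum_{\sigma\in S_{\xi^1}\times\dots\times S_{\xi^{N-1}}}\sigma\Bigl(f(t)\prod_{a=1}^{N-1}\prod_{1\le i<j\le\xi^a}\frac{t^a_i-t^a_j-1}{t^a_i-t^a_j}\Bigr),$$ where $\sigma=(\sigma^1,\dots,\sigma^{N-1})$ acts by the substitution $t^a_i\mapsto t^a_{\sigma^a(i)}$, and let $t_{(\eta,\zeta]}=(t^a_{\eta^a+1},\dots,t^a_{\zeta^a})_{a=1,\dots,N-1}$ for $\eta\le\zeta\le\xi$ (componentwise). Let $V_1,\dots,V_n$ be $Y(\mathfrak{gl}_N)$-modules and let $v_r\in V_r$ be weight singular vectors. Then for every $\xi\in\mathbb Z_{\ge0}^{N-1}$, with $\mathbb B_\xi(t)$ on the left side acting in $V_1\otimes\dots\otimes V_n$ through the iterated coproduct, $$\mathbb B_\xi(t)(v_1\otimes\dots\otimes v_n)=\sum_{\eta}\ \prod_{a=1}^{N-1}\prod_{r=1}^n\frac1{(\eta^a_r-\eta^a_{r-1})!}\ \overline{\mathrm{Sym}}{}^{\,\xi}_t\Biggl[\ \prod_{a=1}^{N-2}\prod_{r=1}^{n-1}\prod_{i=\eta^{a+1}_{r-1}+1}^{\eta^{a+1}_r}\prod_{j=\eta^a_r+1}^{\xi^a}\frac{t^{a+1}_i-t^a_j+1}{t^{a+1}_i-t^a_j}$$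 $$\times\prod_{a=1}^{N-1}\prod_{r=1}^n\Bigl(\prod_{i=1}^{\eta^a_{r-1}}\langle T_{aa}(t^a_i)v_r\rangle\prod_{j=\eta^a_r+1}^{\xi^a}\langle T_{a+1,a+1}(t^a_j)v_r\rangle\Bigr)\ \mathbb B_{\eta_1-\eta_0}(t_{(\eta_0,\eta_1]})v_1\otimes\dots\otimes\mathbb B_{\eta_n-\eta_{n-1}}(t_{(\eta_{n-1},\eta_n]})v_n\Biggr],$$ where the sum is over all chains $0=\eta_0\le\eta_1\le\dots\le\eta_n=\xi$ in $\mathbb Z_{\ge0}^{N-1}$ (componentwise order). The identity is one of vector-valued series in $t^{-1}$ that are polynomial in $t$, multiplied by rational functions of $t$; equivalently, for any linear order on the set of variables, it holds after the rational functions are expanded as iterated Laurent series in the variables $t^{-1}$. -/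

import Mathlib

open scoped TensorProduct

namespace NestedBethe

/-- Index set of the generators `T_{ab}^{s+1}`, `a, b = 1, …, N`, `s ≥ 0`, of `Y(gl_N)`, where
`N = m + 1`; matrix indices `1, …, N` are the elements of `Fin (m + 1)`. -/
abbrev YangianGen (m : ℕ) : Type := Fin (m + 1) × Fin (m + 1) × ℕ

/-- The coefficient of `u^{-s}` in `T_{ab}(u) = δ_{ab} + ∑_{s ≥ 1} T_{ab}^{s} u^{-s}`, in the free algebra. -/
noncomputable def freeT (m : ℕ) (a b : Fin (m + 1)) : ℕ → FreeAlgebra ℂ (YangianGen m)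
  | 0 => if a = b then 1 else 0
  | s + 1 => FreeAlgebra.ι ℂ (a, b, s)

/-- The defining relations: the coefficients of `u^{-r} v^{-s}`, `r, s ≥ 0`, in
`(u - v) [T_{ab}(u), T_{cd}(v)] = T_{cb}(v) T_{ad}(u) - T_{cb}(u) T_{ad}(v)`
(the coefficients with `r = -1` or `s = -1` vanish on both sides). -/
inductive YangianRel (m : ℕ) :
    FreeAlgebra ℂ (YangianGen m) → FreeAlgebra ℂ (YangianGen m) → Prop
  | rtt (a b c d : Fin (m + 1)) (r s : ℕ) : YangianRel m
      ((freeT m a b (r + 1) * freeT m c d s - freeT m c d s * freeT m a b (r + 1))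
        - (freeT m a b r * freeT m c d (s + 1) - freeT m c d (s + 1) * freeT m a b r))
      (freeT m c b s * freeT m a d r - freeT m c b r * freeT m a d s)

/-- The Yangian `Y(gl_N)`, `N = m + 1`. -/
def Yangian (m : ℕ) : Type := RingQuot (YangianRel m)

noncomputable instance (m : ℕ) : Ring (Yangian m) := inferInstanceAs (Ring (RingQuot _))

noncomputable instance (m : ℕ) : Algebra ℂ (Yangian m) :=
  inferInstanceAs (Algebra ℂ (RingQuot _))

/-- The quotient map onto the Yangian. -/
noncomputable def Yangian.mkHom (m : ℕ) : FreeAlgebra ℂ (YangianGen m) →ₐ[ℂ] Yangian m :=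
  RingQuot.mkAlgHom ℂ (YangianRel m)

/-- The generating series `T_{ab}(u)`, as a power series in `u^{-1}`. -/
noncomputable def Yangian.T (m : ℕ) (a b : Fin (m + 1)) : PowerSeries (Yangian m) :=
  PowerSeries.mk fun s => Yangian.mkHom m (freeT m a b s)

/-- The series `F a b` over an algebra `A`, in the variable `u^{-1}`, satisfy the defining relations
of `Y(gl_N)`. -/
structure IsYangianFamily {m : ℕ} {A : Type*} [Ring A]
    (F : Fin (m + 1) → Fin (m + 1) → PowerSeries A) : Prop where
  coeff_zero : ∀ a b, PowerSeries.coeff 0 (F a b) = if a = b then 1 else 0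
  rtt : ∀ (a b c d : Fin (m + 1)) (r s : ℕ),
    (PowerSeries.coeff (r + 1) (F a b) * PowerSeries.coeff s (F c d)
        - PowerSeries.coeff s (F c d) * PowerSeries.coeff (r + 1) (F a b))
      - (PowerSeries.coeff r (F a b) * PowerSeries.coeff (s + 1) (F c d)
        - PowerSeries.coeff (s + 1) (F c d) * PowerSeries.coeff r (F a b))
    = PowerSeries.coeff s (F c b) * PowerSeries.coeff r (F a d)
      - PowerSeries.coeff r (F c b) * PowerSeries.coeff s (F a d)

theorem isYangianFamily_T (m : ℕ) : IsYangianFamily (Yangian.T m) where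
  coeff_zero a b := by
    rw [Yangian.T, PowerSeries.coeff_mk, freeT]
    by_cases h : a = b <;> simp [h]
  rtt a b c d r s := by
    have h : Yangian.mkHom m _ = Yangian.mkHom m _ :=
      RingQuot.mkAlgHom_rel ℂ (YangianRel.rtt (m := m) a b c d r s)
    simpa only [Yangian.T, PowerSeries.coeff_mk, map_sub, map_mul] using h

/-- Auxiliary homomorphism from the free algebra. -/
noncomputable def liftFree {m : ℕ} {A : Type*} [Ring A] [Algebra ℂ A]
    (F : Fin (m + 1) → Fin (m + 1) → PowerSeries A) :
    FreeAlgebra ℂ (YangianGen m) →ₐ[ℂ] A :=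
  FreeAlgebra.lift ℂ fun g => PowerSeries.coeff (g.2.2 + 1) (F g.1 g.2.1)

theorem liftFree_freeT {m : ℕ} {A : Type*} [Ring A] [Algebra ℂ A]
    {F : Fin (m + 1) → Fin (m + 1) → PowerSeries A} (hF : IsYangianFamily F)
    (a b : Fin (m + 1)) (s : ℕ) :
    liftFree F (freeT m a b s) = PowerSeries.coeff s (F a b) := by
  cases s with
  | zero => 
    rw [hF.coeff_zero]
    by_cases h : a = b <;> simp [freeT, h]
  | succ s => simp [freeT, liftFree]

/-- The homomorphism from `Y(gl_N)` that sends `T_{ab}(u)` to `F a b`. -/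
noncomputable def Yangian.lift {m : ℕ} {A : Type*} [Ring A] [Algebra ℂ A]
    (F : Fin (m + 1) → Fin (m + 1) → PowerSeries A) (hF : IsYangianFamily F) :
    Yangian m →ₐ[ℂ] A :=
  RingQuot.liftAlgHom ℂ ⟨liftFree F, by
    rintro _ _ ⟨a, b, c, d, r, s⟩
    simp only [map_sub, map_mul, liftFree_freeT hF]
    exact hF.rtt a b c d r s⟩

theorem Yangian.lift_T {m : ℕ} {A : Type*} [Ring A] [Algebra ℂ A]
    (F : Fin (m + 1) → Fin (m + 1) → PowerSeries A) (hF : IsYangianFamily F)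
    (a b : Fin (m + 1)) (s : ℕ) :
    Yangian.lift F hF (PowerSeries.coeff s (Yangian.T m a b)) = PowerSeries.coeff s (F a b) := by
  rw [← liftFree_freeT hF]
  simp only [Yangian.T, PowerSeries.coeff_mk]
  exact RingQuot.liftAlgHom_mkAlgHom_apply (S := ℂ) (s := YangianRel m) (liftFree F)
    (by
      rintro _ _ ⟨a, b, c, d, r, s⟩
      simp only [map_sub, map_mul, liftFree_freeT hF]
      exact hF.rtt a b c d r s) _

theorem isYangianFamily_map {m : ℕ} {A B : Type*} [Ring A] [Ring B] (f : A →+* B)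
    {F : Fin (m + 1) → Fin (m + 1) → PowerSeries A} (hF : IsYangianFamily F) :
    IsYangianFamily fun a b => PowerSeries.map f (F a b) where
  coeff_zero a b := by
    rw [PowerSeries.coeff_map, hF.coeff_zero]
    by_cases h : a = b <;> simp [h]
  rtt a b c d r s := by
    have h := congrArg f (hF.rtt a b c d r s)
    simpa only [PowerSeries.coeff_map, map_sub, map_mul] using h

theorem isYangianFamily_one {m : ℕ} {A : Type*} [Ring A] :
    IsYangianFamily (m := m) fun a b => if a = b then (1 : PowerSeries A) else 0 where
  coeff_zero a b := by by_cases h : a = b <;> simp [h]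
  rtt a b c d r s := by
    have key : ∀ (k l : ℕ) (a b c d : Fin (m + 1)),
        PowerSeries.coeff k (if a = b then (1 : PowerSeries A) else 0) *
        PowerSeries.coeff l (if c = d then (1 : PowerSeries A) else 0) =
        if k = 0 ∧ l = 0 ∧ a = b ∧ c = d then 1 else 0 := by
      intro k l a b c d
      by_cases h1 : a = b <;> by_cases h2 : c = d <;> by_cases h3 : k = 0 <;>
        by_cases h4 : l = 0 <;> simp [h1, h2, h3, h4, PowerSeries.coeff_one]
    simp only [key]
    grind

/-- The coproduct formula `Δ(T_{ab}(u)) = ∑_c T_{cb}(u) ⊗ T_{ac}(u)`, where `F` is the image of the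
first and `G` the image of the second tensor factor. -/
noncomputable def comulFamily {m : ℕ} {A : Type*} [Ring A]
    (F G : Fin (m + 1) → Fin (m + 1) → PowerSeries A) (a b : Fin (m + 1)) : PowerSeries A :=
  ∑ c, F c b * G a c

section
variable {A : Type*} [Ring A]

theorem coeff_CY (f g : PowerSeries A) (r s : ℕ) :
    PowerSeries.coeff r (PowerSeries.coeff s
      (PowerSeries.C f * PowerSeries.map (PowerSeries.C (R := A)) g)) =
      PowerSeries.coeff r f * PowerSeries.coeff s g := by
  rw [PowerSeries.coeff_C_mul, PowerSeries.coeff_map, PowerSeries.coeff_mul_C]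

theorem coeff_YC (f g : PowerSeries A) (r s : ℕ) :
    PowerSeries.coeff r (PowerSeries.coeff s
      (PowerSeries.map (PowerSeries.C (R := A)) g * PowerSeries.C f)) =
      PowerSeries.coeff s g * PowerSeries.coeff r f := by
  rw [PowerSeries.coeff_mul_C, PowerSeries.coeff_map, PowerSeries.coeff_C_mul]

theorem coeff_Cx (z : PowerSeries (PowerSeries A)) (s : ℕ) :
    PowerSeries.coeff s (PowerSeries.C PowerSeries.X * z) =
      PowerSeries.X * PowerSeries.coeff s z :=
  PowerSeries.coeff_C_mul ..

theorem rtt_iff (m : ℕ) (F : Fin (m + 1) → Fin (m + 1) → PowerSeries A)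
    (h0 : ∀ a b, PowerSeries.coeff 0 (F a b) = if a = b then 1 else 0) :
    IsYangianFamily F ↔ ∀ a b c d : Fin (m + 1),
      ((PowerSeries.X : PowerSeries (PowerSeries A)) - PowerSeries.C PowerSeries.X) *
          (PowerSeries.C (F a b) * PowerSeries.map (PowerSeries.C (R := A)) (F c d)) +
        PowerSeries.X * (PowerSeries.C PowerSeries.X *
          (PowerSeries.C (F c b) * PowerSeries.map (PowerSeries.C (R := A)) (F a d))) =
      ((PowerSeries.X : PowerSeries (PowerSeries A)) - PowerSeries.C PowerSeries.X) *
          (PowerSeries.map (PowerSeries.C (R := A)) (F c d) * PowerSeries.C (F a b)) +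
        PowerSeries.X * (PowerSeries.C PowerSeries.X *
          (PowerSeries.map (PowerSeries.C (R := A)) (F c b) * PowerSeries.C (F a d))) := by
  constructor
  · intro hF a b c d
    ext s r
    rcases s with _ | s <;> rcases r with _ | r <;>
    simp only [map_add, map_sub, sub_mul, PowerSeries.coeff_succ_X_mul,
      PowerSeries.coeff_zero_X_mul, coeff_Cx, coeff_CY, coeff_YC, map_zero]
    · rw [h0 c d]; split_ifs <;> simp
    · rw [h0 a b]; split_ifs <;> simp
    · have := hF.rtt a b c d r s
      rw [← sub_eq_zero] at this ⊢
      rw [← this]; abel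
  · intro h
    refine ⟨h0, fun a b c d r s => ?_⟩
    have := congrArg (fun z => PowerSeries.coeff (r + 1) (PowerSeries.coeff (s + 1) z))
      (h a b c d)
    simp only [map_add, map_sub, sub_mul, PowerSeries.coeff_succ_X_mul,
      coeff_Cx, coeff_CY, coeff_YC] at this
    rw [← sub_eq_zero] at this ⊢
    rw [← this]; abel
end

theorem isYangianFamily_comul {m : ℕ} {A : Type*} [Ring A]
    {F G : Fin (m + 1) → Fin (m + 1) → PowerSeries A}
    (hF : IsYangianFamily F) (hG : IsYangianFamily G)
    (hFG : ∀ a b c d r s,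
      Commute (PowerSeries.coeff r (F a b)) (PowerSeries.coeff s (G c d))) :
    IsYangianFamily (comulFamily F G) := by
  have h0 : ∀ a b, PowerSeries.coeff 0 (comulFamily F G a b) = if a = b then 1 else 0 := by
    intro a b
    have hF0 := hF.coeff_zero
    have hG0 := hG.coeff_zero
    simp only [PowerSeries.coeff_zero_eq_constantCoeff] at hF0 hG0 ⊢
    simp [comulFamily, hF0, hG0]
  rw [rtt_iff m _ h0]
  have hF' := (rtt_iff m F hF.coeff_zero).1 hF
  have hG' := (rtt_iff m G hG.coeff_zero).1 hG
  have c1 : ∀ a b c d, Commute (PowerSeries.C (G a b))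
      (PowerSeries.map (PowerSeries.C (R := A)) (F c d)) := by
    intro a b c d
    ext s r
    rw [coeff_CY, coeff_YC]
    exact (hFG c d a b s r).symm
  have c2 : ∀ a b c d, Commute (PowerSeries.map (PowerSeries.C (R := A)) (G a b))
      (PowerSeries.C (F c d)) := by
    intro a b c d
    ext s r
    rw [coeff_CY, coeff_YC]
    exact (hFG c d a b r s).symm
  intro a b c d
  have cX : ∀ z : PowerSeries (PowerSeries A), Commute PowerSeries.X z :=
    fun z => (PowerSeries.commute_X z).symm
  have cx : ∀ z : PowerSeries (PowerSeries A), Commute (PowerSeries.C PowerSeries.X) z := by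
    intro z
    ext s : 1
    rw [PowerSeries.coeff_C_mul, PowerSeries.coeff_mul_C]
    exact (PowerSeries.commute_X _).symm
  set y : PowerSeries (PowerSeries A) := PowerSeries.X
  set x : PowerSeries (PowerSeries A) := PowerSeries.C PowerSeries.X
  have cyx : ∀ z, Commute (y - x) z := fun z => (cX z).sub_left (cx z)
  have cxy : ∀ z, Commute (y * x) z := fun z => (cX z).mul_left (cx z)
  simp only [← mul_assoc y x] at hF' hG' ⊢
  generalize y - x = p at *
  generalize y * x = q at *
  obtain ⟨Fx, hFx⟩ : ∃ Fx, Fx = fun a b => (PowerSeries.C (F a b) : PowerSeries (PowerSeries A)) :=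
    ⟨_, rfl⟩
  obtain ⟨Gx, hGx⟩ : ∃ Gx, Gx = fun a b => (PowerSeries.C (G a b) : PowerSeries (PowerSeries A)) :=
    ⟨_, rfl⟩
  obtain ⟨Fy, hFy⟩ : ∃ Fy, Fy = fun a b => PowerSeries.map (PowerSeries.C (R := A)) (F a b) :=
    ⟨_, rfl⟩
  obtain ⟨Gy, hGy⟩ : ∃ Gy, Gy = fun a b => PowerSeries.map (PowerSeries.C (R := A)) (G a b) :=
    ⟨_, rfl⟩
  replace hF' : ∀ a b c d, p * (Fx a b * Fy c d) + q * (Fx c b * Fy a d) =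
    p * (Fy c d * Fx a b) + q * (Fy c b * Fx a d) := by subst hFx hFy; exact hF'
  replace hG' : ∀ a b c d, p * (Gx a b * Gy c d) + q * (Gx c b * Gy a d) =
    p * (Gy c d * Gx a b) + q * (Gy c b * Gx a d) := by subst hGx hGy; exact hG'
  replace c1 : ∀ a b c d, Commute (Gx a b) (Fy c d) := by subst hGx hFy; exact c1
  replace c2 : ∀ a b c d, Commute (Gy a b) (Fx c d) := by subst hGy hFx; exact c2
  have ex : ∀ a b, PowerSeries.C (comulFamily F G a b) = ∑ e, Fx e b * Gx a e := by
    intro a b; subst hFx hGx; simp [comulFamily]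
  have ey : ∀ a b, PowerSeries.map (PowerSeries.C (R := A)) (comulFamily F G a b) =
      ∑ e, Fy e b * Gy a e := by
    intro a b; subst hFy hGy; simp [comulFamily]
  simp only [ex, ey, Finset.sum_mul_sum]
  clear hFx hGx hFy hGy ex ey hF hG hFG h0
  have h1 : ∀ a b c d e f, Fx e b * Gx a e * (Fy f d * Gy c f) =
      Fx e b * Fy f d * (Gx a e * Gy c f) := fun a b c d e f => by
    rw [mul_assoc, ← mul_assoc (Gx a e), (c1 a e f d).eq]; simp only [mul_assoc]
  have h2 : ∀ a b c d e f, Fy e b * Gy a e * (Fx f d * Gx c f) =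
      Fy e b * Fx f d * (Gy a e * Gx c f) := fun a b c d e f => by
    rw [mul_assoc, ← mul_assoc (Gy a e), (c2 a e f d).eq]; simp only [mul_assoc]
  simp only [h1, h2, Finset.mul_sum]
  have p1 : ∀ u v w, p * (u * v * w) = u * v * (p * w) := fun u v w => by
    rw [← mul_assoc, (cyx (u * v)).eq, mul_assoc]
  have q1 : ∀ u v w, q * (u * v * w) = u * v * (q * w) := fun u v w => by
    rw [← mul_assoc, (cxy (u * v)).eq, mul_assoc]
  calc _ = ∑ e, ∑ f, Fx e b * Fy f d * (p * (Gx a e * Gy c f) + q * (Gx c e * Gy a f)) := by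
        simp only [p1, q1, mul_add, Finset.sum_add_distrib]
    _ = ∑ e, ∑ f, Fx e b * Fy f d * (p * (Gy c f * Gx a e)) +
          ∑ e, ∑ f, Fx e b * Fy f d * (q * (Gy c e * Gx a f)) := by
        simp only [hG', mul_add, Finset.sum_add_distrib]
    _ = ∑ e, ∑ f, (p * (Fx e b * Fy f d) + q * (Fx f b * Fy e d)) * (Gy c f * Gx a e) := by
        rw [Finset.sum_comm (f := fun e f => Fx e b * Fy f d * (q * (Gy c e * Gx a f)))]
        simp only [← p1, ← q1, add_mul, Finset.sum_add_distrib, mul_assoc]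
    _ = ∑ e, ∑ f, (p * (Fy f d * Fx e b) + q * (Fy f b * Fx e d)) * (Gy c f * Gx a e) := by
        simp only [hF']
    _ = _ := by
        rw [Finset.sum_comm]
        simp only [add_mul, Finset.sum_add_distrib, mul_assoc]

/-- The operator `1 ⊗ ⋯ ⊗ f ⊗ ⋯ ⊗ 1`, with `f` on the `r`-th factor of `⨂ V i`. -/
noncomputable def onFactor {n : ℕ} (V : Fin n → Type*) [∀ r, AddCommGroup (V r)]
    [∀ r, Module ℂ (V r)] (r : Fin n) :
    Module.End ℂ (V r) →ₐ[ℂ] Module.End ℂ (⨂[ℂ] i, V i) :=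
  AlgHom.ofLinearMap
    ((PiTensorProduct.mapMultilinear (R := ℂ) (s := V) (t := V)).toLinearMap
      (fun _ => LinearMap.id) r)
    (by
      rw [MultilinearMap.toLinearMap_apply, PiTensorProduct.mapMultilinear_apply,
        Module.End.one_eq_id, Function.update_eq_self]
      exact PiTensorProduct.map_id)
    (by
      intro f g
      simp only [MultilinearMap.toLinearMap_apply, PiTensorProduct.mapMultilinear_apply]
      rw [← PiTensorProduct.map_mul]
      congr 1
      funext i
      by_cases h : i = r
      · subst h; simp
      · simp [h]; rfl)

theorem onFactor_tprod {n : ℕ} (V : Fin n → Type*) [∀ r, AddCommGroup (V r)]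
    [∀ r, Module ℂ (V r)] (r : Fin n) (f : Module.End ℂ (V r)) (v : ∀ i, V i) :
    onFactor V r f (⨂ₜ[ℂ] i, v i) = ⨂ₜ[ℂ] i, Function.update v r (f (v r)) i := by
  simp only [onFactor, AlgHom.ofLinearMap_apply, MultilinearMap.toLinearMap_apply,
    PiTensorProduct.mapMultilinear_apply, PiTensorProduct.map_tprod]
  congr 1
  funext i
  by_cases h : i = r
  · subst h; simp
  · simp [h]

theorem onFactor_commute {n : ℕ} (V : Fin n → Type*) [∀ r, AddCommGroup (V r)]
    [∀ r, Module ℂ (V r)] {r s : Fin n} (h : r ≠ s) (f : Module.End ℂ (V r))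
    (g : Module.End ℂ (V s)) : Commute (onFactor V r f) (onFactor V s g) := by
  refine PiTensorProduct.ext (MultilinearMap.ext fun v => ?_)
  simp only [LinearMap.compMultilinearMap_apply, Module.End.mul_apply, onFactor_tprod]
  rw [Function.update_of_ne h, Function.update_of_ne h.symm, Function.update_comm h]

section tensor
variable {m n : ℕ} (V : Fin n → Type*) [∀ r, AddCommGroup (V r)] [∀ r, Module ℂ (V r)]
  [∀ r, Module (Yangian m) (V r)] [∀ r, IsScalarTower ℂ (Yangian m) (V r)]

/-- The operators `1 ⊗ ⋯ ⊗ T_{ab}(u) ⊗ ⋯ ⊗ 1`, with `T_{ab}(u)` on the `r`-th factor. -/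
noncomputable def factorFamily (r : Fin n) (a b : Fin (m + 1)) :
    PowerSeries (Module.End ℂ (⨂[ℂ] i, V i)) :=
  PowerSeries.map
    ((onFactor V r).comp (Algebra.lsmul ℂ ℂ (V r) : Yangian m →ₐ[ℂ] Module.End ℂ (V r))).toRingHom
    (Yangian.T m a b)

/-- The action of `T_{ab}(u)` on the tensor factors in the list, by iteration of the coproduct: with
one more factor `r` in front, `T_{ab}(u)` acts as `∑_c T_{cb}(u) ⊗ T_{ac}(u)`, the first operator on
the factor `r` and the second one on the remaining factors. On the empty tensor product `T_{ab}(u)` acts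
by the counit `δ_{ab}`. -/
noncomputable def tensorFamily : List (Fin n) → Fin (m + 1) → Fin (m + 1) →
    PowerSeries (Module.End ℂ (⨂[ℂ] i, V i))
  | [] => fun a b => if a = b then 1 else 0
  | r :: l => comulFamily (factorFamily V r) (tensorFamily l)

theorem tensorFamily_commute (l : List (Fin n)) (X : Module.End ℂ (⨂[ℂ] i, V i))
    (hX : ∀ r ∈ l, ∀ a b s, Commute X (PowerSeries.coeff s (factorFamily (m := m) V r a b)))
    (a b : Fin (m + 1)) (s : ℕ) : Commute X (PowerSeries.coeff s (tensorFamily V l a b)) := by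
  induction l generalizing a b s with
  | nil =>
    simp only [tensorFamily]
    split_ifs
    · rw [PowerSeries.coeff_one]; split_ifs <;> simp
    · simp
  | cons r l ih =>
    simp only [tensorFamily, comulFamily, map_sum, PowerSeries.coeff_mul]
    refine Commute.sum_right _ _ _ fun c _ => Commute.sum_right _ _ _ fun p _ => ?_
    exact (hX r (by simp) _ _ _).mul_right
      (ih (fun r hr => hX r (List.mem_cons_of_mem _ hr)) _ _ _)

theorem isYangianFamily_tensorFamily (l : List (Fin n)) (hl : l.Nodup) :
    IsYangianFamily (tensorFamily (m := m) V l) := by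
  induction l with
  | nil => exact isYangianFamily_one
  | cons r l ih =>
    rw [List.nodup_cons] at hl
    refine isYangianFamily_comul (isYangianFamily_map _ (isYangianFamily_T m)) (ih hl.2) ?_
    intro a b c d i j
    refine tensorFamily_commute V l _ (fun r' hr' a' b' s' => ?_) c d j
    have hne : r ≠ r' := fun h => hl.1 (h ▸ hr')
    simp only [factorFamily, PowerSeries.coeff_map]
    exact onFactor_commute V hne _ _

/-- The `Y(gl_N)`-module structure on `V_1 ⊗ ⋯ ⊗ V_n` given by the iterated coproduct. -/
noncomputable def tensorAction : Yangian m →ₐ[ℂ] Module.End ℂ (⨂[ℂ] i, V i) :=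
  Yangian.lift (tensorFamily V (List.finRange n))
    (isYangianFamily_tensorFamily V _ (List.nodup_finRange n))
end tensor

/-- `v` is a weight singular vector and `lam a` is the eigenvalue `⟨T_{aa}(u) v⟩`, a power series in
`u^{-1}`: `T_{ba}(u) v = 0` for `a < b` and `T_{aa}(u) v = lam_a(u) v`. -/
structure IsWeightSingular {m : ℕ} {V : Type*} [AddCommGroup V] [Module ℂ V]
    [Module (Yangian m) V] (v : V) (lam : Fin (m + 1) → PowerSeries ℂ) : Prop where
  ne_zero : v ≠ 0
  singular : ∀ a b : Fin (m + 1), a < b → ∀ s, PowerSeries.coeff s (Yangian.T m b a) • v = 0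
  eigen : ∀ (a : Fin (m + 1)) (s : ℕ),
    PowerSeries.coeff s (Yangian.T m a a) • v = PowerSeries.coeff s (lam a) • v

/-! ### Series in the variables

The variables `t_k` are labelled by a finite set `ι`. A rational function of the variables, and a series
in `ℂ[t][[t^{-1}]]`, is regarded as an element of one field, the field of Hahn series in the `t_k^{-1}`
with the monomials ordered lexicographically. This field contains both `ℂ(t)` and `ℂ[t][[t^{-1}]]`.
Similarly for coefficients in a vector space or an algebra. -/

/-- Exponents of Laurent monomials: `g` stands for `∏_k t_k^{-g k}`. -/
abbrev Expo (ι : Type*) : Type _ := Lex (ι → ℤ)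

/-- The field that contains the rational functions and the scalar series in the variables. -/
abbrev ScalarSeries (ι : Type*) [LinearOrder ι] : Type _ := HahnSeries (Expo ι) ℂ

/-- Series in the variables with coefficients in a vector space `W`, a vector space over
`ScalarSeries ι`. -/
abbrev VectorSeries (ι : Type*) [LinearOrder ι] (W : Type*) [AddCommGroup W] [Module ℂ W] : Type _ :=
  HahnModule (Expo ι) ℂ W

/-- The embedding `s ↦ t_k^{-s}` of exponents. -/
noncomputable def expoEmb {ι : Type*} [LinearOrder ι] [Finite ι] (k : ι) : ℕ ↪o Expo ι :=
  OrderEmbedding.ofStrictMono (fun s => toLex (Pi.single k (s : ℤ))) fun a b h =>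
    Pi.toLex_strictMono (Pi.single_strictMono k (by exact_mod_cast h))

/-- The value `f(t_k)` of a power series `f(u)` in `u^{-1}`. -/
noncomputable def evalAt {ι : Type*} [LinearOrder ι] [Finite ι] {A : Type*} [Semiring A]
    (f : PowerSeries A) (k : ι) : HahnSeries (Expo ι) A :=
  HahnSeries.embDomain (expoEmb k) (HahnSeries.toPowerSeries.symm f)

/-- The variable `t_k`. -/
noncomputable def tvar {ι : Type*} [LinearOrder ι] (k : ι) : ScalarSeries ι :=
  HahnSeries.single (toLex (Pi.single k (-1))) 1

/-- A scalar series regarded as a series with coefficients in an algebra. -/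
noncomputable def scalarTo {ι : Type*} [LinearOrder ι] (A : Type*) [Ring A] [Algebra ℂ A]
    (c : ScalarSeries ι) : HahnSeries (Expo ι) A :=
  c.map (algebraMap ℂ A)

/-! ### The elements `B_ξ(t)`

A collection of variables `t^a_i`, `a = 1, …, N - 1`, `i = 1, …, ξ^a`, is given by a map
`t : Fin m → ℕ → ι`; the indices `i` start from `0`, and only the values `t a i` with `i < ξ a` are used. -/

/-- The set of pairs `(a, i)`, `1 ≤ i ≤ ξ^a`. -/
abbrev Slot {m : ℕ} (ξ : Fin m → ℕ) : Type := Σ a : Fin m, Fin (ξ a)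

/-- The lexicographic order of the pairs `(a, i)`. -/
def slotLT {m : ℕ} {ξ : Fin m → ℕ} (p q : Slot ξ) : Prop :=
  p.1 < q.1 ∨ (p.1 = q.1 ∧ (p.2 : ℕ) < q.2)

/-- All the pairs `(a, i)` in increasing lexicographic order. -/
def slots {m : ℕ} (ξ : Fin m → ℕ) : List (Slot ξ) :=
  (List.finRange m).flatMap fun a => (List.finRange (ξ a)).map fun i => ⟨a, i⟩

open Classical in
/-- All the pairs `(p, q)` with `p < q`, in increasing lexicographic order. -/
noncomputable def slotPairs {m : ℕ} (ξ : Fin m → ℕ) : List (Slot ξ × Slot ξ) :=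
  (slots ξ).flatMap fun p => ((slots ξ).filter fun q => slotLT p q).map fun q => (p, q)

/-- Matrices over `A` of the size `N^{|ξ|}`, that is, elements of `End(ℂ^N)^{⊗|ξ|} ⊗ A`; the tensor factors
are labelled by the pairs `(a, i)`. -/
abbrev TensorMatrix {m : ℕ} (ξ : Fin m → ℕ) (A : Type*) : Type _ :=
  Matrix (Slot ξ → Fin (m + 1)) (Slot ξ → Fin (m + 1)) A

open Classical in
/-- The matrix `M` acting in the tensor factor with label `p`. -/
noncomputable def atSlot {m : ℕ} {ξ : Fin m → ℕ} {A : Type*} [Zero A] (p : Slot ξ)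
    (M : Matrix (Fin (m + 1)) (Fin (m + 1)) A) : TensorMatrix ξ A :=
  Matrix.of fun f g => if ∀ q, q ≠ p → f q = g q then M (f p) (g p) else 0

/-- The R-matrix `R(u) = u + ∑_{a, b} E_{ab} ⊗ E_{ba}` acting in the tensor factors `p` and `q`. -/
noncomputable def rMatrix {m : ℕ} {ξ : Fin m → ℕ} {K : Type*} [Field K] (p q : Slot ξ) (u : K) :
    TensorMatrix ξ K :=
  u • (1 : TensorMatrix ξ K) + ∑ a, ∑ b, atSlot p (Matrix.single a b 1) * atSlot q (Matrix.single b a 1)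

/-- The matrix `E_{21}^{⊗ξ^1} ⊗ ⋯ ⊗ E_{N,N-1}^{⊗ξ^{N-1}}`. -/
noncomputable def loweringMatrix {m : ℕ} (ξ : Fin m → ℕ) (K : Type*) [Field K] : TensorMatrix ξ K :=
  Matrix.single (fun p => p.1.succ) (fun p => p.1.castSucc) 1

/-- The ordered product of `R(t^b_j - t^a_i)` over `(a, i) < (b, j)`. -/
noncomputable def rProduct {m : ℕ} (ξ : Fin m → ℕ) {ι : Type*} [LinearOrder ι] [Finite ι]
    (t : Fin m → ℕ → ι) : TensorMatrix ξ (ScalarSeries ι) :=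
  ((slotPairs ξ).map fun pq =>
    rMatrix pq.2 pq.1 (tvar (t pq.2.1 pq.2.2) - tvar (t pq.1.1 pq.1.2))).prod

/-- The ordered product `T^{(1)}(t^1_1) ⋯ T^{(|ξ|)}(t^{N-1}_{ξ^{N-1}})`. -/
noncomputable def tProduct {m : ℕ} (ξ : Fin m → ℕ) {ι : Type*} [LinearOrder ι] [Finite ι]
    (t : Fin m → ℕ → ι) : TensorMatrix ξ (HahnSeries (Expo ι) (Yangian m)) :=
  ((slots ξ).map fun p =>
    atSlot p (Matrix.of fun a b => evalAt (Yangian.T m a b) (t p.1 p.2))).prod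

/-- The series `𝔹̂_ξ(t)`: the trace over all the matrix factors of the product of `T`-matrices, R-matrices
and `E_{21}^{⊗ξ^1} ⊗ ⋯ ⊗ E_{N,N-1}^{⊗ξ^{N-1}}`. -/
noncomputable def betheHat {m : ℕ} (ξ : Fin m → ℕ) {ι : Type*} [LinearOrder ι] [Finite ι]
    (t : Fin m → ℕ → ι) : HahnSeries (Expo ι) (Yangian m) :=
  Matrix.trace (tProduct ξ t *
    (rProduct ξ t * loweringMatrix ξ (ScalarSeries ι)).map (scalarTo (Yangian m)))

/-- `𝔹_ξ(t) = 𝔹̂_ξ(t) ∏_a ∏_{i<j} (t^a_j - t^a_i + 1)^{-1} ∏_{a<b} ∏_i ∏_j (t^b_j - t^a_i)^{-1}`. -/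
noncomputable def bethe {m : ℕ} (ξ : Fin m → ℕ) {ι : Type*} [LinearOrder ι] [Finite ι]
    (t : Fin m → ℕ → ι) : HahnSeries (Expo ι) (Yangian m) :=
  betheHat ξ t * scalarTo (Yangian m)
    ((∏ a, ∏ j ∈ Finset.range (ξ a), ∏ i ∈ Finset.range j,
        1 / (tvar (t a j) - tvar (t a i) + 1)) *
      ∏ b, ∏ a ∈ Finset.Iio b, ∏ i ∈ Finset.range (ξ a), ∏ j ∈ Finset.range (ξ b),
        1 / (tvar (t b j) - tvar (t a i)))

/-- The vector-valued weight function `𝔹_ξ(t) w` in a `Y(gl_N)`-module `W`; the module structure is given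
by the homomorphism `ρ`. -/
noncomputable def weightFunction {m : ℕ} {W : Type*} [AddCommGroup W] [Module ℂ W]
    (ρ : Yangian m →ₐ[ℂ] Module.End ℂ W) (w : W) (ξ : Fin m → ℕ)
    {ι : Type*} [LinearOrder ι] [Finite ι] (t : Fin m → ℕ → ι) : VectorSeries ι W :=
  HahnModule.of ℂ ((bethe ξ t).map (ρ.toLinearMap.flip w))

/-! ### Tensor products of series and symmetrization -/

theorem isPWO_pi_support {ι : Type*} [LinearOrder ι] {n : ℕ} {V : Fin n → Type*}
    [∀ r, AddCommGroup (V r)] [∀ r, Module ℂ (V r)] (f : ∀ r, VectorSeries ι (V r)) :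
    (Set.univ.pi fun r => ((HahnModule.of ℂ).symm (f r)).support).IsPWO :=
  Set.IsPWO.pi fun r => ((HahnModule.of ℂ).symm (f r)).isPWO_support

theorem finite_fiber {ι : Type*} [LinearOrder ι] [Finite ι] {n : ℕ} {V : Fin n → Type*}
    [∀ r, AddCommGroup (V r)] [∀ r, Module ℂ (V r)] (f : ∀ r, VectorSeries ι (V r))
    (g : Expo ι) :
    {h : Fin n → Expo ι |
      (∀ r, ((HahnModule.of ℂ).symm (f r)).coeff (h r) ≠ 0) ∧ ∑ r, h r = g}.Finite := by
  refine IsAntichain.finite_of_partiallyWellOrderedOn (r := (· ≤ ·)) ?_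
    ((isPWO_pi_support f).mono fun h hh r _ => hh.1 r)
  intro h hh h' hh' hne hle
  have hle' : ∀ r ∈ Finset.univ, h r ≤ h' r := fun r _ => hle r
  have := (Finset.sum_eq_sum_iff_of_le hle').1 (hh.2.trans hh'.2.symm)
  exact hne (funext fun r => this r (Finset.mem_univ r))

/-- The tensor product `f_1 ⊗ ⋯ ⊗ f_n` of vector-valued series. -/
noncomputable def tensorSeries {ι : Type*} [LinearOrder ι] [Finite ι] {n : ℕ} {V : Fin n → Type*}
    [∀ r, AddCommGroup (V r)] [∀ r, Module ℂ (V r)] (f : ∀ r, VectorSeries ι (V r)) :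
    VectorSeries ι (⨂[ℂ] r, V r) :=
  HahnModule.of ℂ
    { coeff := fun g => ∑ h ∈ (finite_fiber f g).toFinset,
        ⨂ₜ[ℂ] r, ((HahnModule.of ℂ).symm (f r)).coeff (h r)
      isPWO_support' := by
        have hm : Monotone fun h : Fin n → Expo ι => ∑ r, h r :=
          fun h h' hh => Finset.sum_le_sum fun r _ => hh r
        refine ((isPWO_pi_support f).image_of_monotone hm).mono fun g hg => ?_
        obtain ⟨h, hh, -⟩ := Finset.exists_ne_zero_of_sum_ne_zero hg
        rw [Set.Finite.mem_toFinset] at hh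
        exact ⟨h, fun r _ => hh.1 r, hh.2⟩ }

/-- The collection `t^a_{σ^a_1}, …, t^a_{σ^a_{ξ^a}}`, `a = 1, …, N - 1`. -/
def permVars {m : ℕ} {ι : Type*} (ξ : Fin m → ℕ) (σ : ∀ a, Equiv.Perm (Fin (ξ a)))
    (t : Fin m → ℕ → ι) : Fin m → ℕ → ι :=
  fun a i => if h : i < ξ a then t a (σ a ⟨i, h⟩) else t a i

/-- The product over `a` of `W_{ξ^a}(t^a_1, …) = ∏_{i<j} (t^a_i - t^a_j - 1) / (t^a_i - t^a_j)`. -/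
noncomputable def symWeight {m : ℕ} (ξ : Fin m → ℕ) {ι : Type*} [LinearOrder ι] [Finite ι]
    (t : Fin m → ℕ → ι) : ScalarSeries ι :=
  ∏ a, ∏ j ∈ Finset.range (ξ a), ∏ i ∈ Finset.range j,
    (tvar (t a i) - tvar (t a j) - 1) / (tvar (t a i) - tvar (t a j))

/-- The symmetrization of the expression `f(t) ∏_a W_{ξ^a}(t^a_1, …, t^a_{ξ^a})` with respect to
`S_{ξ^1} × ⋯ × S_{ξ^{N-1}}`. -/
noncomputable def symBar {m : ℕ} (ξ : Fin m → ℕ) {ι : Type*} [LinearOrder ι] [Finite ι]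
    {M : Type*} [AddCommGroup M] [Module (ScalarSeries ι) M]
    (f : (Fin m → ℕ → ι) → M) (t : Fin m → ℕ → ι) : M :=
  ∑ σ : ∀ a, Equiv.Perm (Fin (ξ a)), symWeight ξ (permVars ξ σ t) • f (permVars ξ σ t)

open Classical in
/-- The chains `0 = η_0 ≤ η_1 ≤ ⋯ ≤ η_n = ξ`, componentwise. -/
noncomputable def chains {m : ℕ} (n : ℕ) (ξ : Fin m → ℕ) : Finset (Fin (n + 1) → Fin m → ℕ) :=
  (Finset.Iic fun _ => ξ).filter fun η =>
    η 0 = 0 ∧ η (Fin.last n) = ξ ∧ ∀ r : Fin n, η r.castSucc ≤ η r.succ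

end NestedBethe

open NestedBethe

set_option linter.unusedSectionVars false
set_option linter.unusedVariables false

/-! The formula is the nested algebraic Bethe ansatz for a coproduct, followed by a resummation over
permutations. All scalars lie in the field `ScalarSeries ι`. A variable is a label `p` with
parameter `u p`, and `T(u p)` becomes a matrix of linear operators over that field. Only the RTT
relations between the labels in use matter (`IsRTT`), and the coproduct becomes the product of
entrywise commuting families.

Nesting. The R-matrices between slots of the first color act on equal rows of `T` and collapse to
scalars. The R-matrices between a slot of the first color and a later slot turn into an L-operator
in the first slot. The first matrix index never survives in the later slots, so what remains is the
same construction for the lower right block of `T` multiplied by L-operators. Up to the explicit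
normalization of the Bethe series, the trace formula is thus the recursion `nestedBethe`
(`flatBethe_eq`, `trace_eq_flatBethe`, `weightFunction_eq`). Facts about this recursion are
transported by the principle `nestedBethe_rel`: a relation respected by all the entries of the
families is respected by the Bethe operators.

Two factors. For a product `T₂ * T₁` the contracted first row at `p` is a sum `a p p + A p * b p`,
with `A` the corner entry of `T₂`, `b` the contracted row of `T₁`, and `a` the part that uses both.
These sums commute, and `A`, `b`, `a` obey exchange relations, realized on functions of lists of
slots (`exchSpace`). The product over the first color therefore expands over subsets with no
unwanted terms (`ExchangeRel.prod_eq`). On the weight vector the operators `A` become scalars, and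
the lower families regroup into a product of two commuting families of the same kind, with
L-operators attached to each (`nestedBethe_mul_succ`). Induction on the rank gives `finBethe_mul`;
the factors `(x - y + 1) / (x - y)` between neighbouring colors are the eigenvalues of these
L-operators.

Several factors. Iteration gives a sum over all maps `φ` from the variables to the tensor factors
(`finBethe_prodFam`, `weightFunction_tensor`). It contains no factorials and no symmetrization.

Resummation. A chain `η` together with a permutation `σ` determines one map `φ`: the variables in
the block `r` of the permuted list go to the factor `r`. The weight of the symmetrization splits
into pairs in different blocks, which supply the coefficient of `φ`, and pairs in the same block.
The latter sum to products of factorials, by the identity `∑_σ ∏_{i<j} (y_{σ i} - y_{σ j} - 1) /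
(y_{σ i} - y_{σ j}) = k!` (`sum_perm_prod_symFactor`). After division by the factorials in the
formula every `φ` occurs with total weight one (`sum_chains_blockWeight`). -/

namespace NestedBethe

universe v

/-! ### Abstract exchange relations and the expansion over subsets -/

section star
variable {K : Type*} [Field K] {O : Type*} [Ring O] [Algebra K O] {Λ : Type*} [DecidableEq Λ]

/-- The product of `f p` over `p ∈ s`, in some order. -/
noncomputable def fprod (f : Λ → O) (s : Finset Λ) : O := (s.toList.map f).prod

theorem fprod_eq_of_perm {f : Λ → O} {s : Finset Λ} {l : List Λ} (hl : l.Perm s.toList)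
    (h : ∀ p ∈ s, ∀ q ∈ s, Commute (f p) (f q)) : fprod f s = (l.map f).prod := by
  refine (List.Perm.prod_eq' (hl.map f).symm ?_)
  refine List.pairwise_map.2 (List.Pairwise.imp_of_mem (R := fun _ _ => True) ?_ ?_)
  · intro a b ha hb _
    exact h a (by simpa using ha) b (by simpa using hb)
  · exact List.pairwise_of_forall (by simp)

theorem fprod_empty (f : Λ → O) : fprod f ∅ = 1 := by simp [fprod]

theorem fprod_insert {f : Λ → O} {s : Finset Λ} {p : Λ} (hp : p ∉ s)
    (h : ∀ x ∈ insert p s, ∀ y ∈ insert p s, Commute (f x) (f y)) :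
    fprod f (insert p s) = f p * fprod f s := by
  rw [fprod_eq_of_perm (Finset.toList_insert hp).symm h]
  simp [fprod]

theorem commute_fprod_right {f : Λ → O} {s : Finset Λ} {x : O} (h : ∀ p ∈ s, Commute x (f p)) :
    Commute x (fprod f s) := by
  refine Commute.list_prod_right _ _ ?_
  intro y hy
  obtain ⟨p, hp, rfl⟩ := List.mem_map.1 hy
  exact h p (by simpa using hp)

/-- The exchange relations of the elements `A p`, `b p`, `a p q`, where `u p` is the value of the
spectral parameter with label `p`. -/
structure ExchangeRel (u : Λ → K) (s : Finset Λ) (A b : Λ → O) (a : Λ → Λ → O) : Prop where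
  inj : ∀ p ∈ s, ∀ q ∈ s, p ≠ q → u p - u q ≠ 0
  AA : ∀ p ∈ s, ∀ q ∈ s, Commute (A p) (A q)
  bb : ∀ p ∈ s, ∀ q ∈ s, Commute (b p) (b q)
  aa : ∀ p ∈ s, ∀ q ∈ s, Commute (a p p) (a q q)
  Ab : ∀ p ∈ s, ∀ q ∈ s, Commute (A p) (b q)
  Aa : ∀ p ∈ s, ∀ q ∈ s, ∀ r ∈ s, p ≠ q → A p * a q r =
    (1 - (u p - u q)⁻¹) • (a q r * A p) + (u p - u q)⁻¹ • (a p r * A q)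
  ab : ∀ p ∈ s, ∀ q ∈ s, ∀ r ∈ s, p ≠ q → a r p * b q =
    (1 - (u q - u p)⁻¹) • (b q * a r p) - (u p - u q)⁻¹ • (b p * a r q)
  aaa : ∀ p ∈ s, ∀ q ∈ s, ∀ r ∈ s, p ≠ q → p ≠ r → q ≠ r →
    ((1 - (u p - u q)⁻¹) * (u p - u r)⁻¹) • (a q q * a p r) +
      ((u p - u q)⁻¹ * (u q - u r)⁻¹) • (a p q * a q r) =
    ((u p - u r)⁻¹ * (1 - (u r - u q)⁻¹)) • (a p r * a q q)

variable {u : Λ → K} {s : Finset Λ} {A b : Λ → O} {a : Λ → Λ → O}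

theorem ExchangeRel.mono (h : ExchangeRel u s A b a) {s' : Finset Λ} (hs : s' ⊆ s) :
    ExchangeRel u s' A b a where
  inj p hp q hq := h.inj p (hs hp) q (hs hq)
  AA p hp q hq := h.AA p (hs hp) q (hs hq)
  bb p hp q hq := h.bb p (hs hp) q (hs hq)
  aa p hp q hq := h.aa p (hs hp) q (hs hq)
  Ab p hp q hq := h.Ab p (hs hp) q (hs hq)
  Aa p hp q hq r hr := h.Aa p (hs hp) q (hs hq) r (hs hr)
  ab p hp q hq r hr := h.ab p (hs hp) q (hs hq) r (hs hr)
  aaa p hp q hq r hr := h.aaa p (hs hp) q (hs hq) r (hs hr)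

/-- The usual Bethe ansatz count. Either `a r p` keeps its parameter while it passes all the `b q`,
or its parameter is exchanged with exactly one of them. Commutativity of the `b q` makes the
coefficients of the exchanged terms symmetric in `J`. -/
theorem ExchangeRel.a_mul_b (h : ExchangeRel u s A b a) {J : Finset Λ} (hJ : J ⊆ s)
    {p r : Λ} (hp : p ∈ s) (hpJ : p ∉ J) (hr : r ∈ s) :
    a r p * fprod b J = (∏ q ∈ J, (1 - (u q - u p)⁻¹)) • (fprod b J * a r p) -
      ∑ q ∈ J, ((u p - u q)⁻¹ * ∏ q' ∈ J.erase q, (1 - (u q' - u q)⁻¹)) •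
        (b p * fprod b (J.erase q) * a r q) := by
  induction J using Finset.induction_on generalizing p with
  | empty => simp [fprod_empty]
  | insert q J hq ih =>
    have hJs : J ⊆ s := fun x hx => hJ (Finset.mem_insert_of_mem hx)
    have hqs : q ∈ s := hJ (Finset.mem_insert_self _ _)
    have hpq : p ≠ q := fun e => hpJ (e ▸ Finset.mem_insert_self _ _)
    have hpJ' : p ∉ J := fun e => hpJ (Finset.mem_insert_of_mem e)
    have hb : ∀ x ∈ insert q J, ∀ y ∈ insert q J, Commute (b x) (b y) :=
      fun x hx y hy => h.bb x (hJ hx) y (hJ hy)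
    -- A partial fraction identity: the term with the parameter `u x` arises both directly and
    -- through an intermediate exchange with `q`, and the two contributions merge.
    have key : ∀ x ∈ J, (u p - u x)⁻¹ * (1 - (u q - u p)⁻¹) =
        (u p - u x)⁻¹ * (1 - (u q - u x)⁻¹) + (u p - u q)⁻¹ * (u q - u x)⁻¹ := by
      intro x hx
      have h1 := h.inj p hp x (hJs hx) (fun e => hpJ' (e ▸ hx))
      have h2 := h.inj q hqs x (hJs hx) (fun e => hq (e ▸ hx))
      have h3 := h.inj p hp q hqs hpq
      have h4 : u q - u p ≠ 0 := fun e => h3 (by linear_combination -e)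
      field_simp
      ring
    have hsum : ∀ x ∈ J, ((u p - u x)⁻¹ * ∏ q' ∈ (insert q J).erase x, (1 - (u q' - u x)⁻¹)) •
        (b p * fprod b ((insert q J).erase x) * a r x) =
        (1 - (u q - u p)⁻¹) • (b q * (((u p - u x)⁻¹ * ∏ q' ∈ J.erase x, (1 - (u q' - u x)⁻¹)) •
          (b p * fprod b (J.erase x) * a r x))) -
        (u p - u q)⁻¹ • (b p * (((u q - u x)⁻¹ * ∏ q' ∈ J.erase x, (1 - (u q' - u x)⁻¹)) •
          (b q * fprod b (J.erase x) * a r x))) := by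
      intro x hx
      have hqx : q ≠ x := fun e => hq (e ▸ hx)
      have hqe : q ∉ J.erase x := fun e => hq (Finset.mem_of_mem_erase e)
      rw [Finset.erase_insert_of_ne hqx, Finset.prod_insert hqe, fprod_insert hqe]
      swap
      · intro y hy z hz
        exact hb y (Finset.insert_subset_insert _ (Finset.erase_subset _ _) hy) z
          (Finset.insert_subset_insert _ (Finset.erase_subset _ _) hz)
      have hc : b q * (b p * fprod b (J.erase x) * a r x) =
          b p * (b q * fprod b (J.erase x) * a r x) := by
        rw [← mul_assoc, ← mul_assoc, ← mul_assoc, ← mul_assoc, (h.bb q hqs p hp).eq]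
      rw [mul_smul_comm, mul_smul_comm, hc, smul_smul, smul_smul, ← sub_smul, ← mul_assoc (b p)]
      congr 1
      · linear_combination (-∏ q' ∈ J.erase x, (1 - (u q' - u x)⁻¹)) * key x hx
      · simp only [mul_assoc]
    rw [fprod_insert hq hb, ← mul_assoc, h.ab p hp q hqs r hr hpq, sub_mul, smul_mul_assoc,
      smul_mul_assoc, mul_assoc, mul_assoc, ih hJs hp hpJ', ih hJs hqs hq,
      Finset.sum_insert hq, Finset.sum_congr rfl hsum, Finset.sum_sub_distrib,
      ← Finset.smul_sum, ← Finset.smul_sum, ← Finset.mul_sum, ← Finset.mul_sum,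
      Finset.prod_insert hq, Finset.erase_insert hq]
    simp only [mul_sub, smul_sub, mul_smul_comm, smul_smul, mul_assoc]
    abel

/-- The same count for `A p`. The two ways of producing `A x` now have different operator parts, `a
q q * a p x` and `a p q * a q x`, so the merging needs the operator identity `aaa` instead of a
scalar one. -/
theorem ExchangeRel.A_mul_a (h : ExchangeRel u s A b a) {I : Finset Λ} (hI : I ⊆ s)
    {p : Λ} (hp : p ∈ s) (hpI : p ∉ I) :
    A p * fprod (fun i => a i i) I =
      (∏ i ∈ I, (1 - (u p - u i)⁻¹)) • (fprod (fun i => a i i) I * A p) +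
      ∑ i ∈ I, ((u p - u i)⁻¹ * ∏ i' ∈ I.erase i, (1 - (u i - u i')⁻¹)) •
        (a p i * fprod (fun i => a i i) (I.erase i) * A i) := by
  induction I using Finset.induction_on generalizing p with
  | empty => simp [fprod_empty]
  | insert q J hq ih =>
    have hJs : J ⊆ s := fun x hx => hI (Finset.mem_insert_of_mem hx)
    have hqs : q ∈ s := hI (Finset.mem_insert_self _ _)
    have hpq : p ≠ q := fun e => hpI (e ▸ Finset.mem_insert_self _ _)
    have hpJ' : p ∉ J := fun e => hpI (Finset.mem_insert_of_mem e)
    have hb : ∀ x ∈ insert q J, ∀ y ∈ insert q J, Commute (a x x) (a y y) :=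
      fun x hx y hy => h.aa x (hI hx) y (hI hy)
    have hsum : ∀ x ∈ J, ((u p - u x)⁻¹ * ∏ q' ∈ (insert q J).erase x, (1 - (u x - u q')⁻¹)) •
        (a p x * fprod (fun i => a i i) ((insert q J).erase x) * A x) =
        (1 - (u p - u q)⁻¹) • (a q q * (((u p - u x)⁻¹ * ∏ q' ∈ J.erase x, (1 - (u x - u q')⁻¹)) •
          (a p x * fprod (fun i => a i i) (J.erase x) * A x))) +
        (u p - u q)⁻¹ • (a p q * (((u q - u x)⁻¹ * ∏ q' ∈ J.erase x, (1 - (u x - u q')⁻¹)) •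
          (a q x * fprod (fun i => a i i) (J.erase x) * A x))) := by
      intro x hx
      have hqx : q ≠ x := fun e => hq (e ▸ hx)
      have hpx : p ≠ x := fun e => hpJ' (e ▸ hx)
      have hqe : q ∉ J.erase x := fun e => hq (Finset.mem_of_mem_erase e)
      rw [Finset.erase_insert_of_ne hqx, Finset.prod_insert hqe, fprod_insert hqe]
      swap
      · intro y hy z hz
        exact hb y (Finset.insert_subset_insert _ (Finset.erase_subset _ _) hy) z
          (Finset.insert_subset_insert _ (Finset.erase_subset _ _) hz)
      have key := h.aaa p hp q hqs x (hJs hx) hpq hpx hqx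
      have key2 := congrArg (fun z => (∏ q' ∈ J.erase x, (1 - (u x - u q')⁻¹)) •
        (z * (fprod (fun i => a i i) (J.erase x) * A x))) key
      simp only [add_mul, smul_mul_assoc, smul_add, smul_smul, mul_smul_comm, mul_assoc] at key2 ⊢
      rw [show (u p - u x)⁻¹ * ((1 - (u x - u q)⁻¹) * ∏ q' ∈ J.erase x, (1 - (u x - u q')⁻¹)) =
        (∏ q' ∈ J.erase x, (1 - (u x - u q')⁻¹)) * ((u p - u x)⁻¹ * (1 - (u x - u q)⁻¹)) by ring,
        ← key2]
      congr 2 <;> ring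
    rw [fprod_insert hq hb, ← mul_assoc, h.Aa p hp q hqs q hqs hpq, add_mul, smul_mul_assoc,
      smul_mul_assoc, mul_assoc, mul_assoc, ih hJs hp hpJ', ih hJs hqs hq,
      Finset.sum_insert hq, Finset.sum_congr rfl hsum, Finset.sum_add_distrib,
      ← Finset.smul_sum, ← Finset.smul_sum, ← Finset.mul_sum, ← Finset.mul_sum,
      Finset.prod_insert hq, Finset.erase_insert hq]
    simp only [mul_add, smul_add, mul_smul_comm, smul_smul, mul_assoc]
    abel

/-- Expansion of the product of the commuting elements `a p p + A p * b p` in the normally ordered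
products. -/
theorem ExchangeRel.prod_eq (h : ExchangeRel u s A b a)
    (hΦ : ∀ p ∈ s, ∀ q ∈ s, Commute (a p p + A p * b p) (a q q + A q * b q)) :
    fprod (fun p => a p p + A p * b p) s =
      ∑ I ∈ s.powerset, (∏ i ∈ I, ∏ j ∈ s \ I, (1 - (u j - u i)⁻¹)) •
        (fprod b (s \ I) * fprod (fun i => a i i) I * fprod A (s \ I)) := by
  induction s using Finset.induction_on with
  | empty => simp [fprod_empty]
  | insert p s hps ih =>
    have hsub : s ⊆ insert p s := Finset.subset_insert _ _
    have hp : p ∈ insert p s := Finset.mem_insert_self _ _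
    rw [fprod_insert hps hΦ, ih (h.mono hsub) fun x hx y hy => hΦ x (hsub hx) y (hsub hy),
      Finset.sum_powerset_insert hps, Finset.mul_sum]
    -- The new factor contributes two wanted terms, with `p` added to the complement or to `I`, and
    -- two sums of unwanted terms, in which an element of `I` or of its complement is exchanged with
    -- `p`.
    have hc : ∀ I ∈ s.powerset,
        (a p p + A p * b p) * ((∏ i ∈ I, ∏ j ∈ s \ I, (1 - (u j - u i)⁻¹)) •
          (fprod b (s \ I) * fprod (fun i => a i i) I * fprod A (s \ I))) =
        (∏ i ∈ I, ∏ j ∈ insert p s \ I, (1 - (u j - u i)⁻¹)) •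
          (fprod b (insert p s \ I) * fprod (fun i => a i i) I * fprod A (insert p s \ I)) +
        (∏ i ∈ insert p I, ∏ j ∈ insert p s \ insert p I, (1 - (u j - u i)⁻¹)) •
          (fprod b (insert p s \ insert p I) * fprod (fun i => a i i) (insert p I) *
            fprod A (insert p s \ insert p I)) +
        (∑ i ∈ I, ((∏ i ∈ I, ∏ j ∈ s \ I, (1 - (u j - u i)⁻¹)) *
            ((u p - u i)⁻¹ * ∏ i' ∈ I.erase i, (1 - (u i - u i')⁻¹))) •
          (b p * fprod b (s \ I) * a p i * fprod (fun i => a i i) (I.erase i) * (A i *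
            fprod A (s \ I))) -
          ∑ j ∈ s \ I, ((∏ i ∈ I, ∏ j ∈ s \ I, (1 - (u j - u i)⁻¹)) *
            ((u p - u j)⁻¹ * ∏ j' ∈ (s \ I).erase j, (1 - (u j' - u j)⁻¹))) •
          (b p * fprod b ((s \ I).erase j) * a p j * fprod (fun i => a i i) I *
            fprod A (s \ I))) := by
      intro I hI
      rw [Finset.mem_powerset] at hI
      have hpI : p ∉ I := fun e => hps (hI e)
      have hI' : I ⊆ insert p s := hI.trans hsub
      have hJ' : s \ I ⊆ insert p s := Finset.sdiff_subset.trans hsub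
      have hpJ : p ∉ s \ I := fun e => hps (Finset.sdiff_subset e)
      have e1 : insert p s \ I = insert p (s \ I) := Finset.insert_sdiff_of_notMem _ hpI
      have e2 : insert p s \ insert p I = s \ I := by
        rw [Finset.insert_sdiff_insert, Finset.sdiff_insert_of_notMem hps]
      have hins : ∀ J ⊆ s, insert p J ⊆ insert p s := fun J hJ => Finset.insert_subset_insert _ hJ
      rw [e1, e2, fprod_insert hpJ fun x hx y hy => h.bb x (hins _ Finset.sdiff_subset hx) y
          (hins _ Finset.sdiff_subset hy),
        fprod_insert hpJ fun x hx y hy => h.AA x (hins _ Finset.sdiff_subset hx) y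
          (hins _ Finset.sdiff_subset hy),
        fprod_insert hpI fun x hx y hy => h.aa x (hins _ hI hx) y (hins _ hI hy),
        Finset.prod_insert hpI]
      have hcAb : A p * b p * fprod b (s \ I) = b p * fprod b (s \ I) * A p := by
        rw [(h.Ab p hp p hp).eq, mul_assoc, mul_assoc,
          (commute_fprod_right (f := b) (s := s \ I) fun q hq => h.Ab p hp q (hJ' hq)).eq]
      rw [add_mul, mul_smul_comm, mul_smul_comm, ← mul_assoc, ← mul_assoc,
        h.a_mul_b hJ' hp hpJ hp, ← mul_assoc, ← mul_assoc, hcAb, mul_assoc (b p * _) (A p),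
        h.A_mul_a hI' hp hpI]
      have e3 : ∏ i ∈ I, ∏ j ∈ insert p (s \ I), (1 - (u j - u i)⁻¹) =
          (∏ i ∈ I, (1 - (u p - u i)⁻¹)) * ∏ i ∈ I, ∏ j ∈ s \ I, (1 - (u j - u i)⁻¹) := by
        rw [← Finset.prod_mul_distrib]
        exact Finset.prod_congr rfl fun i _ => Finset.prod_insert hpJ
      rw [e3]
      simp only [sub_mul, mul_add, add_mul, Finset.sum_mul, Finset.mul_sum, smul_add, smul_sub,
        mul_smul_comm, smul_mul_assoc, smul_smul, Finset.smul_sum, mul_assoc]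
      rw [mul_comm (∏ i ∈ I, (1 - (u p - u i)⁻¹)) (∏ i ∈ I, ∏ j ∈ s \ I, (1 - (u j - u i)⁻¹)),
        mul_comm (∏ j ∈ s \ I, (1 - (u j - u p)⁻¹)) (∏ i ∈ I, ∏ j ∈ s \ I, (1 - (u j - u i)⁻¹))]
      abel
    rw [Finset.sum_congr rfl hc, Finset.sum_add_distrib, Finset.sum_add_distrib, add_eq_left,
      Finset.sum_sub_distrib, sub_eq_zero, Finset.sum_sigma', Finset.sum_sigma']
    -- The unwanted terms cancel in pairs: the exchange with `i ∈ I` for the subset `I` matches the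
    -- exchange with `i` in the complement for the subset `I.erase i`.
    refine Finset.sum_bij' (fun x _ => ⟨x.1.erase x.2, x.2⟩) (fun x _ => ⟨insert x.2 x.1, x.2⟩)
      ?_ ?_ ?_ ?_ ?_
    · rintro ⟨I, i⟩ hx
      simp only [Finset.mem_sigma, Finset.mem_powerset, Finset.mem_sdiff] at hx ⊢
      exact ⟨(Finset.erase_subset _ _).trans hx.1, hx.1 hx.2, Finset.notMem_erase _ _⟩
    · rintro ⟨I, i⟩ hx
      simp only [Finset.mem_sigma, Finset.mem_powerset, Finset.mem_sdiff] at hx ⊢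
      exact ⟨Finset.insert_subset hx.2.1 hx.1, Finset.mem_insert_self _ _⟩
    · rintro ⟨I, i⟩ hx
      simp only [Finset.mem_sigma] at hx
      simp [Finset.insert_erase hx.2]
    · rintro ⟨I, i⟩ hx
      simp only [Finset.mem_sigma, Finset.mem_sdiff] at hx
      simp [Finset.erase_insert hx.2.2]
    · rintro ⟨I, i⟩ hx
      simp only [Finset.mem_sigma, Finset.mem_powerset] at hx
      obtain ⟨hI, hi⟩ := hx
      have his : i ∈ s := hI hi
      have e1 : s \ I.erase i = insert i (s \ I) := by
        ext x; simp only [Finset.mem_sdiff, Finset.mem_erase, Finset.mem_insert]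
        constructor
        · rintro ⟨h1, h2⟩; by_cases e : x = i
          · exact Or.inl e
          · exact Or.inr ⟨h1, fun h3 => h2 ⟨e, h3⟩⟩
        · rintro (rfl | ⟨h1, h2⟩)
          · exact ⟨his, fun h => h.1 rfl⟩
          · exact ⟨h1, fun h => h2 h.2⟩
      have hni : i ∉ s \ I := fun e => (Finset.mem_sdiff.1 e).2 hi
      dsimp only
      rw [e1, Finset.erase_insert hni, fprod_insert (f := A) hni]
      swap
      · intro x hx y hy
        have hh : insert i (s \ I) ⊆ insert p s :=
          (Finset.insert_subset his Finset.sdiff_subset).trans hsub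
        exact h.AA x (hh hx) y (hh hy)
      congr 1
      conv_lhs => rw [← Finset.insert_erase hi, Finset.prod_insert (Finset.notMem_erase _ _)]
      have e4 : ∏ i_1 ∈ I.erase i, ∏ j ∈ insert i (s \ I), (1 - (u j - u i_1)⁻¹) =
          (∏ i' ∈ I.erase i, (1 - (u i - u i')⁻¹)) *
            ∏ i' ∈ I.erase i, ∏ j ∈ s \ I, (1 - (u j - u i')⁻¹) := by
        rw [← Finset.prod_mul_distrib]
        exact Finset.prod_congr rfl fun i _ => Finset.prod_insert hni
      rw [e4]
      simp only [Finset.insert_erase hi]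
      ring

end star

/-! ### RTT families, L-operators and the nested recursion -/

section families
variable {K : Type*} [Field K] {Λ : Type} [DecidableEq Λ] {N m : ℕ}
  {V V' : Type v} [AddCommGroup V] [Module K V] [AddCommGroup V'] [Module K V']

/-- Matrices of operators `T p`, the values of `T(u)` at the points with labels `p`. -/
abbrev OpFamily (K : Type*) [Field K] (Λ : Type) (N : ℕ) (V : Type v) [AddCommGroup V]
    [Module K V] : Type _ := Λ → Matrix (Fin N) (Fin N) (Module.End K V)

/-- The RTT relations for the labels in `S`. -/
def IsRTT (u : Λ → K) (S : Set Λ) (T : OpFamily K Λ N V) : Prop :=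
  ∀ p ∈ S, ∀ q ∈ S, ∀ a b c d,
    (u p - u q) • (T p a b * T q c d) + T p c b * T q a d =
      (u p - u q) • (T q c d * T p a b) + T q c b * T p a d

/-- All the entries of two families commute. -/
def FamCommute (X Y : OpFamily K Λ N V) : Prop :=
  ∀ p q a b c d, Commute (X p a b) (Y q c d)

theorem IsRTT.mono {u : Λ → K} {S S' : Set Λ} {T : OpFamily K Λ N V} (h : IsRTT u S T)
    (hS : S' ⊆ S) : IsRTT u S' T :=
  fun p hp q hq => h p (hS hp) q (hS hq)

/-- This is the relation for the labels in the opposite order; it moves the exchanged indices to the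
other pair of factors. -/
theorem IsRTT.rel' {u : Λ → K} {S : Set Λ} {T : OpFamily K Λ N V} (h : IsRTT u S T)
    {p q : Λ} (hp : p ∈ S) (hq : q ∈ S) (a b c d : Fin N) :
    (u p - u q) • (T p a b * T q c d) + T q a d * T p c b =
      (u p - u q) • (T q c d * T p a b) + T p a d * T q c b := by
  have := h q hq p hp c d a b
  rw [← neg_sub (u p) (u q), neg_smul, neg_smul] at this
  have h2 : -((u p - u q) • (T q c d * T p a b)) + T q a d * T p c b =
      -((u p - u q) • (T p a b * T q c d)) + T p a d * T q c b := this
  rw [neg_add_eq_iff_eq_add] at h2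
  rw [h2]
  abel

/-- Commuting entries allow the `X` and `Y` parts to be separated. The relation for `X` is applied
first; its exchange term, after renaming of the summation indices, is the one needed to apply the
relation for `Y`. -/
theorem IsRTT.mul {u : Λ → K} {S : Set Λ} {X Y : OpFamily K Λ N V} (hX : IsRTT u S X)
    (hY : IsRTT u S Y) (h : FamCommute X Y) : IsRTT u S (X * Y) := by
  intro p hp q hq a b c d
  have e : ∀ (p q : Λ) (a b c d : Fin N), (X * Y) p a b * (X * Y) q c d =
      ∑ e, ∑ f, (X p a e * X q c f) * (Y p e b * Y q f d) := by
    intro p q a b c d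
    simp only [Pi.mul_apply, Matrix.mul_apply, Finset.sum_mul_sum]
    refine Finset.sum_congr rfl fun e _ => Finset.sum_congr rfl fun f _ => ?_
    rw [mul_assoc, ← mul_assoc (Y p e b), ← (h q p c f e b).eq]
    simp only [mul_assoc]
  have e' : ∀ (p q : Λ) (a b c d : Fin N), (X * Y) p a b * (X * Y) q c d =
      ∑ e, ∑ f, (X p a f * X q c e) * (Y p f b * Y q e d) := by
    intro p q a b c d
    rw [e, Finset.sum_comm]
  rw [e p q a b c d, e p q c b a d, e' q p c d a b, e' q p c b a d]
  have h1 : ∑ e, ∑ f, ((u p - u q) • (X p a e * X q c f * (Y p e b * Y q f d)) +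
      X p c e * X q a f * (Y p e b * Y q f d)) =
      ∑ e, ∑ f, ((u p - u q) • (X q c f * X p a e * (Y p e b * Y q f d)) +
        X q c e * X p a f * (Y p e b * Y q f d)) := by
    refine Finset.sum_congr rfl fun e _ => Finset.sum_congr rfl fun f _ => ?_
    have := congrArg (fun z => z * (Y p e b * Y q f d)) (hX p hp q hq a e c f)
    simpa only [add_mul, smul_mul_assoc] using this
  have h2 : ∑ e, ∑ f, ((u p - u q) • (X q c f * X p a e * (Y p e b * Y q f d)) +
        X q c f * X p a e * (Y p f b * Y q e d)) =
      ∑ e, ∑ f, ((u p - u q) • (X q c f * X p a e * (Y q f d * Y p e b)) +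
        X q c f * X p a e * (Y q f b * Y p e d)) := by
    refine Finset.sum_congr rfl fun e _ => Finset.sum_congr rfl fun f _ => ?_
    have := congrArg (fun z => X q c f * X p a e * z) (hY p hp q hq e b f d)
    simpa only [mul_add, mul_smul_comm] using this
  simp only [Finset.smul_sum, Finset.sum_add_distrib] at h1 h2 ⊢
  rw [h1, Finset.sum_comm (f := fun e f => X q c e * X p a f * (Y p e b * Y q f d)), h2]

theorem isRTT_one (u : Λ → K) (S : Set Λ) : IsRTT u S (1 : OpFamily K Λ N V) := by
  intro p _ q _ a b c d
  simp only [Pi.one_apply, Matrix.one_apply]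
  split_ifs <;> simp_all

theorem FamCommute.symm {X Y : OpFamily K Λ N V} (h : FamCommute X Y) : FamCommute Y X :=
  fun p q a b c d => (h q p c d a b).symm

theorem FamCommute.mul_left {X Y Z : OpFamily K Λ N V} (h : FamCommute X Z)
    (h' : FamCommute Y Z) : FamCommute (X * Y) Z := by
  intro p q a b c d
  simp only [Pi.mul_apply, Matrix.mul_apply]
  exact Commute.sum_left _ _ _ fun e _ => (h p q a e c d).mul_left (h' p q e b c d)

theorem FamCommute.mul_right {X Y Z : OpFamily K Λ N V} (h : FamCommute X Y)
    (h' : FamCommute X Z) : FamCommute X (Y * Z) :=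
  (h.symm.mul_left h'.symm).symm

theorem famCommute_one_right (X : OpFamily K Λ N V) : FamCommute X 1 := by
  intro p q a b c d
  rw [Pi.one_apply, Matrix.one_apply]
  split_ifs
  · exact Commute.one_right _
  · exact Commute.zero_right _

theorem FamCommute.mul_eq {X Y : OpFamily K Λ N V} (h : FamCommute X Y) (p : Λ) (a b : Fin N) :
    (X * Y) p a b = ∑ c, Y p c b * X p a c := by
  simp only [Pi.mul_apply, Matrix.mul_apply]
  exact Finset.sum_congr rfl fun c _ => (h p p a c c b).eq

/-! ### Functions of the indices in labelled slots -/

/-- Vectors of `V` that depend on indices in slots labelled by `Λ`. -/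
abbrev SlotSpace (Λ : Type) (N : ℕ) (V : Type v) : Type v := (Λ → Fin N) → V

/-- An operator applied to all the values of a function. -/
def liftOp (I : Type*) : Module.End K V →ₐ[K] Module.End K (I → V) where
  toFun X := X.compLeft I
  map_one' := rfl
  map_mul' _ _ := rfl
  map_zero' := rfl
  map_add' _ _ := rfl
  commutes' _ := rfl

@[simp] theorem liftOp_apply (I : Type*) (X : Module.End K V) (x : I → V) (f : I) :
    liftOp I X x f = X (x f) := rfl

/-- The matrix unit `E_{ba}` acting in the slot `p`. -/
def slotE (p : Λ) (b a : Fin N) : Module.End K (SlotSpace Λ N V) where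
  toFun x f := if f p = b then x (Function.update f p a) else 0
  map_add' x y := by ext f; simp only [Pi.add_apply]; split_ifs <;> simp
  map_smul' c x := by ext f; simp only [Pi.smul_apply, RingHom.id_apply]; split_ifs <;> simp

theorem slotE_apply (p : Λ) (b a : Fin N) (x : SlotSpace Λ N V) (f : Λ → Fin N) :
    slotE (K := K) p b a x f = if f p = b then x (Function.update f p a) else 0 := rfl

theorem slotE_mul (p : Λ) (a b c d : Fin N) :
    slotE (K := K) (V := V) p b a * slotE p d c = if a = d then slotE p b c else 0 := by
  ext x f
  rw [Module.End.mul_apply, slotE_apply, slotE_apply]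
  simp only [Function.update_self, Function.update_idem]
  split_ifs <;> simp_all [slotE_apply]

theorem slotE_commute {p q : Λ} (h : p ≠ q) (a b c d : Fin N) :
    Commute (slotE (K := K) (V := V) p b a) (slotE q d c) := by
  ext x f
  simp only [Module.End.mul_apply, slotE_apply, Function.update_of_ne h, Function.update_of_ne h.symm,
    Function.update_comm h]
  split_ifs <;> rfl

theorem liftOp_commute_slotE (X : Module.End K V) (p : Λ) (a b : Fin N) :
    Commute (liftOp (Λ → Fin N) X) (slotE p b a) := by
  ext x f
  simp only [Module.End.mul_apply, slotE_apply, liftOp_apply]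
  split_ifs <;> simp

/-- The L-operator `1 + ∑ E_{ba} / (u_q - u_p)` in the slot `p`. -/
def slotL (u : Λ → K) (p : Λ) : OpFamily K Λ N (SlotSpace Λ N V) :=
  fun q => Matrix.of fun a b => (if a = b then (1 : K) else 0) • 1 + (u q - u p)⁻¹ • slotE p b a

theorem slotL_eq (u : Λ → K) (p q : Λ) (a b : Fin N) :
    slotL (V := V) u p q a b = (if a = b then (1 : K) else 0) • 1 + (u q - u p)⁻¹ • slotE p b a :=
  rfl

theorem slotL_apply (u : Λ → K) (p q : Λ) (a b : Fin N) (x : SlotSpace Λ N V) (f : Λ → Fin N) :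
    slotL (V := V) u p q a b x f = (if a = b then x f else 0) +
      (u q - u p)⁻¹ • (if f p = b then x (Function.update f p a) else 0) := by
  rw [slotL_eq, LinearMap.add_apply, LinearMap.smul_apply, Pi.add_apply, LinearMap.smul_apply,
    Pi.smul_apply, Pi.smul_apply, slotE_apply]
  congr 1
  split_ifs <;> simp

/-- The slot carries an evaluation representation with parameter `u p`: by `slotE_mul` the relation
reduces to rational identities in `u q - u p` and `u r - u p`. -/
theorem isRTT_slotL {u : Λ → K} {S : Set Λ} {p : Λ} (hS : ∀ q ∈ S, u q - u p ≠ 0) :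
    IsRTT u S (slotL (N := N) (V := V) u p) := by
  intro q hq r hr a b c d
  have h1 := hS q hq
  have h2 := hS r hr
  have hE : ∀ (a b c d : Fin N), slotE (K := K) (V := V) p b a * slotE p d c =
      (if a = d then (1 : K) else 0) • slotE p b c := by
    intro a b c d
    rw [slotE_mul]
    split_ifs <;> simp
  have hx : u q - u r = (u q - u p) - (u r - u p) := by ring
  simp only [slotL_eq, add_mul, mul_add, smul_mul_assoc, mul_smul_comm, hE, one_mul, mul_one,
    hx]
  generalize u q - u p = x at *
  generalize u r - u p = y at *
  match_scalars <;> field_simp <;> ring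

theorem slotL_commute (u : Λ → K) {p q : Λ} (h : p ≠ q) :
    FamCommute (slotL (N := N) (V := V) u p) (slotL u q) := by
  intro r s a b c d
  rw [slotL_eq, slotL_eq]
  have h1 : ∀ (c : K) (x : Module.End K (SlotSpace Λ N V)), Commute (c • 1) x :=
    fun c x => (Commute.one_left x).smul_left c
  exact (h1 _ _).add_left (((h1 _ _).symm).add_right
    (((slotE_commute h a b c d).smul_left _).smul_right _))

/-- The family acting on all the values of a function. -/
def liftFam (I : Type*) (X : OpFamily K Λ N V) : OpFamily K Λ N (I → V) :=
  fun p => (X p).map (liftOp I)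

theorem liftFam_apply (I : Type*) (X : OpFamily K Λ N V) (p : Λ) (a b : Fin N) (x : I → V) (f : I) :
    liftFam I X p a b x f = X p a b (x f) := rfl

theorem liftFam_eq (I : Type*) (X : OpFamily K Λ N V) (p : Λ) (a b : Fin N) :
    liftFam I X p a b = liftOp I (X p a b) := rfl

theorem liftFam_mul (I : Type*) (X Y : OpFamily K Λ N V) :
    liftFam I (X * Y) = liftFam I X * liftFam I Y := by
  funext p
  exact Matrix.map_mul (f := (liftOp I : Module.End K V →ₐ[K] _))

theorem liftFam_one (I : Type*) : liftFam I (1 : OpFamily K Λ N V) = 1 := by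
  funext p
  exact Matrix.map_one _ (map_zero _) (map_one _)

theorem IsRTT.liftFam {u : Λ → K} {S : Set Λ} {X : OpFamily K Λ N V} (h : IsRTT u S X)
    (I : Type*) : IsRTT u S (liftFam I X) := by
  intro p hp q hq a b c d
  have := congrArg (liftOp I) (h p hp q hq a b c d)
  simp only [map_add, map_mul, map_smul] at this
  exact this

theorem FamCommute.liftFam {X Y : OpFamily K Λ N V} (h : FamCommute X Y) (I : Type*) :
    FamCommute (liftFam I X) (liftFam I Y) :=
  fun p q a b c d => (h p q a b c d).map (liftOp I)

theorem liftFam_commute_slotL (X : OpFamily K Λ N V) (u : Λ → K) (p : Λ) :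
    FamCommute (liftFam (Λ → Fin N) X) (slotL u p) := by
  intro r s a b c d
  rw [slotL_eq]
  exact (((Commute.one_right _).smul_right _)).add_right
    ((liftOp_commute_slotE _ _ _ _).smul_right _)

/-- The restriction of a family to the indices different from the first one. -/
def truncFam (X : OpFamily K Λ (N + 1) V) : OpFamily K Λ N V :=
  fun p => (X p).submatrix Fin.succ Fin.succ

theorem truncFam_apply (X : OpFamily K Λ (N + 1) V) (p : Λ) (a b : Fin N) :
    truncFam X p a b = X p a.succ b.succ := rfl

theorem IsRTT.truncFam {u : Λ → K} {S : Set Λ} {X : OpFamily K Λ (N + 1) V} (h : IsRTT u S X) :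
    IsRTT u S (truncFam X) :=
  fun p hp q hq _ _ _ _ => h p hp q hq _ _ _ _

theorem FamCommute.truncFam {X Y : OpFamily K Λ (N + 1) V} (h : FamCommute X Y) :
    FamCommute (truncFam X) (truncFam Y) :=
  fun p q _ _ _ _ => h p q _ _ _ _

/-- The product of the L-operators in the slots of the list. -/
def slotLs (u : Λ → K) (w : List Λ) : OpFamily K Λ N (SlotSpace Λ N V) :=
  (w.map fun p => slotL u p).prod

theorem slotLs_cons (u : Λ → K) (p : Λ) (w : List Λ) :
    slotLs (N := N) (V := V) u (p :: w) = slotL u p * slotLs u w := by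
  simp [slotLs]

theorem slotLs_nil (u : Λ → K) : slotLs (N := N) (V := V) u [] = 1 := rfl

theorem slotLs_append (u : Λ → K) (w w' : List Λ) :
    slotLs (N := N) (V := V) u (w ++ w') = slotLs u w * slotLs u w' := by
  simp [slotLs]

theorem FamCommute.slotLs_right {X : OpFamily K Λ N (SlotSpace Λ N V)} {u : Λ → K} {w : List Λ}
    (h : ∀ p ∈ w, FamCommute X (slotL u p)) : FamCommute X (slotLs u w) := by
  induction w with
  | nil => exact famCommute_one_right X
  | cons p w ih =>
    rw [slotLs_cons]
    exact (h p (by simp)).mul_right (ih fun q hq => h q (by simp [hq]))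

theorem liftFam_commute_slotLs (X : OpFamily K Λ N V) (u : Λ → K) (w : List Λ) :
    FamCommute (liftFam (Λ → Fin N) X) (slotLs u w) :=
  .slotLs_right fun p _ => liftFam_commute_slotL X u p

theorem slotL_commute_slotLs (u : Λ → K) {p : Λ} {w : List Λ} (h : p ∉ w) :
    FamCommute (slotL (N := N) (V := V) u p) (slotLs u w) :=
  .slotLs_right fun q hq => slotL_commute u fun e => h (e ▸ hq)

theorem slotLs_commute_slotLs (u : Λ → K) {w w' : List Λ} (h : ∀ p ∈ w, p ∉ w') :
    FamCommute (slotLs (N := N) (V := V) u w) (slotLs u w') :=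
  .slotLs_right fun q hq => (slotL_commute_slotLs u fun hq' => h q hq' hq).symm

theorem isRTT_slotLs {u : Λ → K} {S : Set Λ} {w : List Λ} (hw : w.Nodup)
    (hS : ∀ p ∈ w, ∀ q ∈ S, u q - u p ≠ 0) :
    IsRTT u S (slotLs (N := N) (V := V) u w) := by
  induction w with
  | nil => exact isRTT_one u S
  | cons p w ih =>
    rw [slotLs_cons]
    rw [List.nodup_cons] at hw
    exact (isRTT_slotL (hS p (by simp))).mul (ih hw.2 fun q hq => hS q (by simp [hq]))
      (slotL_commute_slotLs u hw.1)

/-! ### Nested Bethe operators -/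

/-- The contraction of the slot `p` with the row `X` of operators. -/
def rowOp (X : Fin N → Module.End K V) (p : Λ) : Module.End K (SlotSpace Λ N V) where
  toFun x f := ∑ g, X g (x (Function.update f p g))
  map_add' x y := by ext f; simp [Finset.sum_add_distrib]
  map_smul' c x := by ext f; simp [Finset.smul_sum]

theorem rowOp_apply (X : Fin N → Module.End K V) (p : Λ) (x : SlotSpace Λ N V) (f : Λ → Fin N) :
    rowOp X p x f = ∑ g, X g (x (Function.update f p g)) := rfl

/-- The product of the contractions of the slots of the list, the first slot being contracted
first. -/
def rowOps (X : Λ → Fin N → Module.End K V) : List Λ → Module.End K (SlotSpace Λ N V)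
  | [] => 1
  | p :: w => rowOps X w * rowOp (X p) p

open Classical in
/-- The function that equals `v` if all the indices in the slots of the list are zero. -/
noncomputable def slotVec (w : List Λ) : V →ₗ[K] SlotSpace Λ (m + 1) V where
  toFun v f := if ∀ p ∈ w, f p = 0 then v else 0
  map_add' x y := by ext f; simp only [Pi.add_apply]; split_ifs <;> simp
  map_smul' c x := by ext f; simp only [Pi.smul_apply, RingHom.id_apply]; split_ifs <;> simp

open Classical in
theorem slotVec_apply (w : List Λ) (v : V) (f : Λ → Fin (m + 1)) :
    slotVec (K := K) w v f = if ∀ p ∈ w, f p = 0 then v else 0 := rfl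

/-- The first row of a family, without the first entry. -/
def firstRow (T : OpFamily K Λ (m + 1) V) (p : Λ) (g : Fin m) : Module.End K V := T p 0 g.succ

/-- The nested Bethe operators; the labels of the variables of the color `a` form the list `P a`. -/
noncomputable def nestedBethe (u : Λ → K) : (m : ℕ) → (P : Fin m → List Λ) → {V : Type v} →
    [AddCommGroup V] → [Module K V] → OpFamily K Λ (m + 1) V → V →ₗ[K] V
  | 0, _, _, _, _, _ => LinearMap.id
  | m + 1, P, V, _, _, T =>
    LinearMap.proj (R := K) (φ := fun _ : Λ → Fin (m + 1) => V) (fun _ => 0) ∘ₗ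
      rowOps (firstRow T) (P 0) ∘ₗ
        nestedBethe u m (fun a => P a.succ)
          (liftFam (Λ → Fin (m + 1)) (truncFam T) * slotLs u (P 0)) ∘ₗ slotVec (P 0)

theorem nestedBethe_zero (u : Λ → K) (P : Fin 0 → List Λ) (T : OpFamily K Λ 1 V) (v : V) :
    nestedBethe u 0 P T v = v := rfl

theorem nestedBethe_succ (u : Λ → K) (P : Fin (m + 1) → List Λ) (T : OpFamily K Λ (m + 2) V)
    (v : V) :
    nestedBethe u (m + 1) P T v = rowOps (firstRow T) (P 0) (nestedBethe u m (fun a => P a.succ)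
      (liftFam (Λ → Fin (m + 1)) (truncFam T) * slotLs u (P 0)) (slotVec (K := K) (P 0) v)) (fun _ => 0) :=
  rfl

/-- The labels that occur in the lists. -/
def labels (P : Fin m → List Λ) : Set Λ := {p | ∃ a, p ∈ P a}

/-- All the labels in the lists are different. -/
structure IsSimple (P : Fin m → List Λ) : Prop where
  nodup : ∀ a, (P a).Nodup
  disj : ∀ a b, a ≠ b → ∀ p ∈ P a, p ∉ P b

theorem IsSimple.tail {P : Fin (m + 1) → List Λ} (h : IsSimple P) :
    IsSimple fun a : Fin m => P a.succ where
  nodup a := h.nodup _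
  disj a b hab := h.disj _ _ fun e => hab (Fin.succ_injective _ e)

theorem labels_tail_subset (P : Fin (m + 1) → List Λ) :
    labels (fun a : Fin m => P a.succ) ⊆ labels P := fun _ ⟨a, ha⟩ => ⟨a.succ, ha⟩

theorem mem_labels_zero {P : Fin (m + 1) → List Λ} {p : Λ} (h : p ∈ P 0) : p ∈ labels P := ⟨0, h⟩

theorem labels_succ (P : Fin (m + 1) → List Λ) :
    labels P = labels (fun a : Fin m => P a.succ) ∪ {p | p ∈ P 0} := by
  ext p
  simp only [labels, Set.mem_ofPred_eq, Set.mem_union, Fin.exists_fin_succ]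
  tauto

theorem IsSimple.notMem_zero {P : Fin (m + 1) → List Λ} (h : IsSimple P) {p : Λ}
    (hp : p ∈ labels fun a : Fin m => P a.succ) : p ∉ P 0 := by
  obtain ⟨a, ha⟩ := hp
  exact h.disj _ _ (Fin.succ_ne_zero a) p ha

/-- The linear relation between functions, whose values are in the relation. -/
def slotRel (N : ℕ) (Λ : Type) (R : Submodule K (V × V')) :
    Submodule K (SlotSpace Λ N V × SlotSpace Λ N V') where
  carrier := {z | ∀ f, (z.1 f, z.2 f) ∈ R}
  zero_mem' f := R.zero_mem
  add_mem' h h' f := R.add_mem (h f) (h' f)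
  smul_mem' c _ h f := R.smul_mem c (h f)

theorem sum_mem_rel {ι : Type*} {R : Submodule K (V × V')} {s : Finset ι} {x : ι → V} {y : ι → V'}
    (h : ∀ i ∈ s, (x i, y i) ∈ R) : (∑ i ∈ s, x i, ∑ i ∈ s, y i) ∈ R := by
  have : (∑ i ∈ s, x i, ∑ i ∈ s, y i) = ∑ i ∈ s, (x i, y i) := by
    ext <;> simp [Prod.fst_sum, Prod.snd_sum]
  rw [this]
  exact Submodule.sum_mem _ h

theorem ite_mem_rel {R : Submodule K (V × V')} {x : V} {y : V'} (h : (x, y) ∈ R) (p : Prop)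
    [Decidable p] : (if p then x else 0, if p then y else 0) ∈ R := by
  split_ifs
  · exact h
  · exact R.zero_mem

/-- L-operators have scalar coefficients and only change the argument of a function, so they
preserve every relation imposed value by value. -/
theorem slotLs_rel {u : Λ → K} {R : Submodule K (V × V')} (w : List Λ) (p : Λ) (a b : Fin N)
    {z : SlotSpace Λ N V × SlotSpace Λ N V'} (hz : z ∈ slotRel N Λ R) :
    (slotLs (V := V) u w p a b z.1, slotLs (V := V') u w p a b z.2) ∈ slotRel N Λ R := by
  induction w generalizing a z with
  | nil =>
    rw [slotLs_nil, slotLs_nil, Pi.one_apply, Pi.one_apply, Matrix.one_apply, Matrix.one_apply]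
    split_ifs
    · exact hz
    · exact Submodule.zero_mem _
  | cons q w ih =>
    rw [slotLs_cons, slotLs_cons, Pi.mul_apply, Pi.mul_apply, Matrix.mul_apply, Matrix.mul_apply,
      LinearMap.sum_apply, LinearMap.sum_apply]
    refine sum_mem_rel fun c _ => ?_
    have h1 := ih c hz
    intro f
    simp only [Module.End.mul_apply, slotL_apply]
    exact R.add_mem (ite_mem_rel (h1 f) _) (R.smul_mem _ (ite_mem_rel (h1 _) _))

/-- If the entries of the families respect linear relations that depend on the set of unused labels,
so do the nested Bethe operators. -/
theorem nestedBethe_rel {u : Λ → K} {P : Fin m → List Λ} (hP : IsSimple P)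
    {T : OpFamily K Λ (m + 1) V} {T' : OpFamily K Λ (m + 1) V'}
    {R : Set Λ → Submodule K (V × V')}
    (hR : ∀ X, ∀ p ∈ X, p ∈ labels P → ∀ a b, ∀ z ∈ R X,
      (T p a b z.1, T' p a b z.2) ∈ R (X \ {p}))
    {X : Set Λ} (hX : labels P ⊆ X) {z : V × V'} (hz : z ∈ R X) :
    (nestedBethe u m P T z.1, nestedBethe u m P T' z.2) ∈ R (X \ labels P) := by
  induction m generalizing V V' X with
  | zero =>
    have : labels P = ∅ := Set.eq_empty_of_forall_notMem fun p ⟨a, _⟩ => a.elim0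
    rw [this, Set.sdiff_empty]
    exact hz
  | succ m ih =>
    -- The labels of the later colors are consumed first, at the lower level, with the relation
    -- imposed on every value. The labels of `P 0` are consumed afterwards, one by one, by the
    -- contractions.
    have h1 := ih hP.tail (T := liftFam (Λ → Fin (m + 1)) (truncFam T) * slotLs u (P 0))
      (T' := liftFam (Λ → Fin (m + 1)) (truncFam T') * slotLs u (P 0))
      (R := fun X => slotRel (m + 1) Λ (R X)) (X := X)
      (z := (slotVec (K := K) (P 0) z.1, slotVec (K := K) (P 0) z.2)) ?_ ((labels_tail_subset P).trans hX) ?_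
    · have key : ∀ (w : List Λ) (Y : Set Λ) (y : SlotSpace Λ (m + 1) V × SlotSpace Λ (m + 1) V'),
          w.Nodup → (∀ p ∈ w, p ∈ Y ∧ p ∈ labels P) → y ∈ slotRel (m + 1) Λ (R Y) →
          (rowOps (firstRow T) w y.1, rowOps (firstRow T') w y.2) ∈
            slotRel (m + 1) Λ (R (Y \ {p | p ∈ w})) := by
        intro w
        induction w with
        | nil =>
          intro Y y _ _ hy
          have : Y \ {p | p ∈ ([] : List Λ)} = Y := by simp
          rw [this]
          exact hy
        | cons p w ihw =>
          intro Y y hw hwY hy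
          rw [List.nodup_cons] at hw
          have h2 : (rowOp (firstRow T p) p y.1, rowOp (firstRow T' p) p y.2) ∈
              slotRel (m + 1) Λ (R (Y \ {p})) := by
            intro f
            simp only [rowOp_apply]
            exact sum_mem_rel fun g _ =>
              hR Y p (hwY p (by simp)).1 (hwY p (by simp)).2 _ _ _ (hy _)
          have h3 := ihw (Y \ {p}) _ hw.2 (fun q hq => ⟨⟨(hwY q (by simp [hq])).1,
            fun e => hw.1 (e ▸ hq)⟩, (hwY q (by simp [hq])).2⟩) h2
          have e : (Y \ {p}) \ {q | q ∈ w} = Y \ {q | q ∈ p :: w} := by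
            ext q; simp only [Set.mem_sdiff, Set.mem_singleton_iff, Set.mem_ofPred_eq, List.mem_cons]
            tauto
          rw [e] at h3
          exact h3
      have h2 := key (P 0) (X \ labels fun a : Fin m => P a.succ) _ (hP.nodup 0)
        (fun p hp => ⟨⟨hX (mem_labels_zero hp), fun e => hP.notMem_zero e hp⟩,
          mem_labels_zero hp⟩) h1 (fun _ => 0)
      rw [labels_succ, ← Set.sdiff_sdiff]
      exact h2
    · intro Y p hpY hp a b y hy
      simp only [Pi.mul_apply, Matrix.mul_apply, LinearMap.sum_apply]
      refine sum_mem_rel fun c _ => ?_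
      intro f
      exact hR Y p hpY (labels_tail_subset P hp) _ _ _ (slotLs_rel _ _ _ _ hy f)
    · intro f
      simp only [slotVec_apply]
      split_ifs
      · exact hz
      · exact Submodule.zero_mem _

/-- Linear maps that intertwine two families intertwine the nested Bethe operators. -/
theorem nestedBethe_intertwine {u : Λ → K} {P : Fin m → List Λ} (hP : IsSimple P)
    {T : OpFamily K Λ (m + 1) V} {T' : OpFamily K Λ (m + 1) V'} (φ : V →ₗ[K] V')
    (h : ∀ p ∈ labels P, ∀ a b x, φ (T p a b x) = T' p a b (φ x)) (x : V) :
    φ (nestedBethe u m P T x) = nestedBethe u m P T' (φ x) := by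
  -- The relation is the graph of `φ`, the same for all sets of unused labels.
  have := nestedBethe_rel (u := u) hP (T := T) (T' := T') (R := fun _ => φ.graph) ?_
    (le_refl (labels P)) (z := (x, φ x)) (by simp)
  · simpa [eq_comm] using this
  · intro X p _ hp a b z hz
    rw [LinearMap.mem_graph_iff] at hz ⊢
    simp [hz, h p hp]

end families

/-! ### Contractions of RTT rows with Zamolodchikov–Faddeev vectors -/

section zf
variable {K : Type*} [Field K] {O : Type*} [Ring O] [Algebra K O] {Λ : Type*}
  {N : ℕ}

/-- The exchange relations of Zamolodchikov–Faddeev type. -/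
def IsZF (u : Λ → K) (s : Set Λ) (Y : Λ → Fin N → O) : Prop :=
  ∀ p ∈ s, ∀ q ∈ s, p ≠ q → ∀ c d,
    (u p - u q) • (Y p c * Y q d) + Y p d * Y q c = (u p - u q + 1) • (Y q d * Y p c)

/-- The exchange relations of the entries of a row of an RTT family. -/
def IsRow (u : Λ → K) (s : Set Λ) (X : Λ → Fin N → O) : Prop :=
  ∀ p ∈ s, ∀ q ∈ s, ∀ c d,
    (u p - u q + 1) • (X p c * X q d) = (u p - u q) • (X q d * X p c) + X q c * X p d

theorem sum_mul_sum_rearrange {X Y X' Y' : Fin N → O} (h : ∀ c d, Commute (Y c) (X' d)) :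
    (∑ c, X c * Y c) * ∑ d, X' d * Y' d = ∑ c, ∑ d, X c * X' d * (Y c * Y' d) := by
  rw [Finset.sum_mul_sum]
  refine Finset.sum_congr rfl fun c _ => Finset.sum_congr rfl fun d _ => ?_
  rw [mul_assoc, ← mul_assoc (Y c), (h c d).eq]
  simp only [mul_assoc]

/-- The R-matrix that reorders the rows is the inverse, up to the scalar `u p - u q + 1`, of the one
that reorders the vectors, so the two cancel in the contraction. -/
theorem commute_sum_row_zf {u : Λ → K} {s : Set Λ} {X Y : Λ → Fin N → O} (hX : IsRow u s X)
    (hY : IsZF u s Y) (hXY : ∀ p q c d, Commute (X p c) (Y q d))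
    (h1 : ∀ p ∈ s, ∀ q ∈ s, u p - u q + 1 ≠ 0) {p q : Λ} (hp : p ∈ s) (hq : q ∈ s) :
    Commute (∑ c, X p c * Y p c) (∑ c, X q c * Y q c) := by
  by_cases hpq : p = q
  · rw [hpq]
  -- The relations produce the products with the coefficient `u p - u q + 1`, which is nonzero by
  -- `h1` and is cancelled here.
  refine smul_right_injective O (h1 p hp q hq) ?_
  beta_reduce
  rw [sum_mul_sum_rearrange fun c d => (hXY q p d c).symm,
    sum_mul_sum_rearrange fun c d => (hXY p q d c).symm]
  have e1 : ∀ c d, (u p - u q + 1) • (X p c * X q d * (Y p c * Y q d)) =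
      (u p - u q) • (X q d * X p c * (Y p c * Y q d)) + X q c * X p d * (Y p c * Y q d) := by
    intro c d
    have := congrArg (fun z => z * (Y p c * Y q d)) (hX p hp q hq c d)
    simpa only [add_mul, smul_mul_assoc] using this
  have e2 : ∀ c d, (u p - u q) • (X q d * X p c * (Y p c * Y q d)) + X q d * X p c * (Y p d * Y q c) =
      (u p - u q + 1) • (X q d * X p c * (Y q d * Y p c)) := by
    intro c d
    have := congrArg (fun z => X q d * X p c * z) (hY p hp q hq hpq c d)
    simpa only [mul_add, mul_smul_comm] using this
  simp only [Finset.smul_sum, e1, Finset.sum_add_distrib]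
  rw [Finset.sum_comm (f := fun c d => X q c * X p d * (Y p c * Y q d)), Finset.sum_comm
    (f := fun c d => (u p - u q + 1) • (X q c * X p d * (Y q c * Y p d)))]
  simp only [← Finset.sum_add_distrib, e2]

end zf

/-! ### Exchange relations for the two parts of a coproduct row -/

section
variable {K : Type*} [Field K] {O : Type*} [Ring O] [Algebra K O] {Λ : Type*} [DecidableEq Λ]
  {N : ℕ}

/-- The RTT relations for matrices over an algebra. -/
def IsRTTMat {n : ℕ} (u : Λ → K) (s : Set Λ) (T : Λ → Matrix (Fin n) (Fin n) O) : Prop :=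
  ∀ p ∈ s, ∀ q ∈ s, ∀ a b c d,
    (u p - u q) • (T p a b * T q c d) + T p c b * T q a d =
      (u p - u q) • (T q c d * T p a b) + T q c b * T p a d

theorem IsRTTMat.rel' {n : ℕ} {u : Λ → K} {s : Set Λ} {T : Λ → Matrix (Fin n) (Fin n) O}
    (h : IsRTTMat u s T)
    {p q : Λ} (hp : p ∈ s) (hq : q ∈ s) (a b c d : Fin n) :
    (u p - u q) • (T p a b * T q c d) + T q a d * T p c b =
      (u p - u q) • (T q c d * T p a b) + T p a d * T q c b := by
  have := h q hq p hp c d a b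
  rw [← neg_sub (u p) (u q), neg_smul, neg_smul, neg_add_eq_iff_eq_add] at this
  rw [this]
  abel

theorem IsRTTMat.isRow {u : Λ → K} {s : Set Λ} {T : Λ → Matrix (Fin (N + 1)) (Fin (N + 1)) O}
    (h : IsRTTMat u s T) : IsRow u s fun p (g : Fin N) => T p 0 g.succ := by
  intro p hp q hq c d
  have := h p hp q hq 0 c.succ 0 d.succ
  rw [add_smul, one_smul, this]

/-- A matrix with the RTT relations dresses a Zamolodchikov–Faddeev vector into another one: the RTT
relation exchanges the row indices, and the relation for `Y` then reorders the vectors. -/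
theorem IsRTTMat.isZF {u : Λ → K} {s : Set Λ} {T : Λ → Matrix (Fin (N + 1)) (Fin (N + 1)) O}
    (h : IsRTTMat u s T) {Y : Λ → Fin N → O} (hY : IsZF u s Y)
    (hTY : ∀ p q a b c, Commute (T p a b) (Y q c)) :
    IsZF u s fun p c => ∑ g : Fin N, T p c.succ g.succ * Y p g := by
  intro p hp q hq hpq c d
  beta_reduce
  rw [sum_mul_sum_rearrange fun _ _ => (hTY _ _ _ _ _).symm,
    sum_mul_sum_rearrange fun _ _ => (hTY _ _ _ _ _).symm,
    sum_mul_sum_rearrange fun _ _ => (hTY _ _ _ _ _).symm]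
  have h1 : ∀ e f : Fin N, (u p - u q) • (T p c.succ e.succ * T q d.succ f.succ * (Y p e * Y q f)) +
      T p d.succ e.succ * T q c.succ f.succ * (Y p e * Y q f) =
      (u p - u q) • (T q d.succ f.succ * T p c.succ e.succ * (Y p e * Y q f)) +
      T q d.succ e.succ * T p c.succ f.succ * (Y p e * Y q f) := by
    intro e f
    have := congrArg (fun z => z * (Y p e * Y q f)) (h p hp q hq c.succ e.succ d.succ f.succ)
    simpa only [add_mul, smul_mul_assoc] using this
  simp only [Finset.smul_sum, ← Finset.sum_add_distrib, h1]
  simp only [Finset.sum_add_distrib]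
  rw [Finset.sum_comm (f := fun e f : Fin N => T q d.succ e.succ * T p c.succ f.succ *
    (Y p e * Y q f)), ← Finset.sum_add_distrib, Finset.sum_comm (s := Finset.univ) (t := Finset.univ)
    (f := fun (e f : Fin N) => (u p - u q + 1) • (T q d.succ e.succ * T p c.succ f.succ * _))]
  refine Finset.sum_congr rfl fun e _ => ?_
  rw [← Finset.sum_add_distrib]
  refine Finset.sum_congr rfl fun f _ => ?_
  have := congrArg (fun z => T q d.succ f.succ * T p c.succ e.succ * z) (hY p hp q hq hpq e f)
  simpa only [mul_add, mul_smul_comm] using this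

/-- These are the two parts of the first row of `T₂ * T₁` contracted with `Y`: the intermediate
index is either zero or a successor. In the second case the first row of `T₂` is contracted with the
dressed vector `Y'`, which is again of Zamolodchikov–Faddeev type. Every relation combines one RTT
relation with one relation for `Y` or `Y'`. -/
theorem exchangeRel_of_isRTTMat {u : Λ → K} {s : Finset Λ}
    {T₁ T₂ : Λ → Matrix (Fin (N + 1)) (Fin (N + 1)) O} {Y : Λ → Fin N → O}
    (h1 : IsRTTMat u s T₁) (h2 : IsRTTMat u s T₂) (hY : IsZF u s Y)
    (h12 : ∀ p q a b c d, Commute (T₁ p a b) (T₂ q c d))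
    (h1Y : ∀ p q a b c, Commute (T₁ p a b) (Y q c))
    (h2Y : ∀ p q a b c, Commute (T₂ p a b) (Y q c))
    (hu : ∀ p ∈ s, ∀ q ∈ s, p ≠ q → u p - u q ≠ 0)
    (hu1 : ∀ p ∈ s, ∀ q ∈ s, u p - u q + 1 ≠ 0) :
    ExchangeRel u s (fun p => T₂ p 0 0) (fun p => ∑ g : Fin N, T₁ p 0 g.succ * Y p g)
      (fun p q => ∑ c : Fin N, T₂ p 0 c.succ * ∑ g : Fin N, T₁ q c.succ g.succ * Y q g) := by
  have hY' := h1.isZF hY h1Y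
  set Y' : Λ → Fin N → O := fun q c => ∑ g : Fin N, T₁ q c.succ g.succ * Y q g with hY'def
  have h2Y' : ∀ p q a b c, Commute (T₂ p a b) (Y' q c) := fun p q a b c =>
    Commute.sum_right _ _ _ fun g _ => (h12 _ _ _ _ _ _).symm.mul_right (h2Y _ _ _ _ _)
  refine ⟨hu, ?_, fun p hp q hq => commute_sum_row_zf h1.isRow hY (fun _ _ _ _ => h1Y _ _ _ _ _)
    hu1 hp hq, fun p hp q hq => commute_sum_row_zf h2.isRow hY' (fun _ _ _ _ => h2Y' _ _ _ _ _)
    hu1 hp hq, ?_, ?_, ?_, ?_⟩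
  · intro p hp q hq
    have := h2 p hp q hq 0 0 0 0
    refine smul_right_injective O (hu1 p hp q hq) ?_
    beta_reduce
    rw [add_smul, one_smul, this, add_smul, one_smul]
  · intro p hp q hq
    exact Commute.sum_right _ _ _ fun g _ => (h12 _ _ _ _ _ _).symm.mul_right (h2Y _ _ _ _ _)
  · intro p hp q hq r hr hpq
    have hx := hu p hp q hq hpq
    rw [Finset.mul_sum, Finset.sum_mul, Finset.sum_mul, Finset.smul_sum, Finset.smul_sum,
      ← Finset.sum_add_distrib]
    refine Finset.sum_congr rfl fun c _ => ?_
    have h3 := congrArg (fun z => (u p - u q)⁻¹ • z) (h2.rel' hp hq 0 0 0 c.succ)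
    simp only [smul_add, smul_smul, inv_mul_cancel₀ hx, one_smul] at h3
    have h4 : T₂ p 0 0 * T₂ q 0 c.succ = (1 - (u p - u q)⁻¹) • (T₂ q 0 c.succ * T₂ p 0 0) +
        (u p - u q)⁻¹ • (T₂ p 0 c.succ * T₂ q 0 0) := by
      rw [sub_smul, one_smul, sub_add_eq_add_sub, eq_sub_iff_add_eq]
      exact h3
    rw [← mul_assoc, h4, add_mul, smul_mul_assoc, smul_mul_assoc, mul_assoc, mul_assoc,
      (h2Y' p r 0 0 c).eq, (h2Y' q r 0 0 c).eq, mul_assoc, mul_assoc]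
  · intro p hp q hq r hr hpq
    have hx := hu p hp q hq hpq
    have hx' : u q - u p ≠ 0 := hu q hq p hp (Ne.symm hpq)
    -- The part of the relation that involves `T₁` and `Y` only: RTT between a lower row and the
    -- first row of `T₁`, then the exchange of the vectors. The entries of `T₂` pass through.
    have key : ∀ c, Y' p c * ∑ g : Fin N, T₁ q 0 g.succ * Y q g =
        (1 - (u q - u p)⁻¹) • ((∑ g : Fin N, T₁ q 0 g.succ * Y q g) * Y' p c) -
          (u p - u q)⁻¹ • ((∑ g : Fin N, T₁ p 0 g.succ * Y p g) * Y' q c) := by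
      intro c
      rw [hY'def]
      beta_reduce
      rw [sum_mul_sum_rearrange fun _ _ => (h1Y _ _ _ _ _).symm,
        sum_mul_sum_rearrange fun _ _ => (h1Y _ _ _ _ _).symm,
        sum_mul_sum_rearrange fun _ _ => (h1Y _ _ _ _ _).symm]
      have e1 : (1 - (u q - u p)⁻¹) = (u p - u q)⁻¹ * (u p - u q + 1) := by
        have : u q - u p = -(u p - u q) := by ring
        rw [this]
        field_simp
        ring
      rw [e1, mul_smul, ← smul_sub, eq_inv_smul_iff₀ hx, eq_sub_iff_add_eq, Finset.smul_sum,
        ← Finset.sum_add_distrib]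
      have h3 : ∀ e f : Fin N, (u p - u q) • (T₁ p c.succ e.succ * T₁ q 0 f.succ *
          (Y p e * Y q f)) + T₁ p 0 e.succ * T₁ q c.succ f.succ * (Y p e * Y q f) =
          (u p - u q) • (T₁ q 0 f.succ * T₁ p c.succ e.succ * (Y p e * Y q f)) +
          T₁ q 0 e.succ * T₁ p c.succ f.succ * (Y p e * Y q f) := by
        intro e f
        have := congrArg (fun z => z * (Y p e * Y q f)) (h1 p hp q hq c.succ e.succ 0 f.succ)
        simpa only [add_mul, smul_mul_assoc] using this
      simp only [Finset.smul_sum, ← Finset.sum_add_distrib, h3]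
      simp only [Finset.sum_add_distrib]
      rw [Finset.sum_comm (f := fun e f : Fin N => T₁ q 0 e.succ * T₁ p c.succ f.succ *
        (Y p e * Y q f)), ← Finset.sum_add_distrib, Finset.sum_comm (s := Finset.univ)
        (t := Finset.univ) (f := fun (e f : Fin N) => (u p - u q + 1) •
          (T₁ q 0 e.succ * T₁ p c.succ f.succ * _))]
      refine Finset.sum_congr rfl fun e _ => ?_
      rw [← Finset.sum_add_distrib]
      refine Finset.sum_congr rfl fun f _ => ?_
      have := congrArg (fun z => T₁ q 0 f.succ * T₁ p c.succ e.succ * z) (hY p hp q hq hpq e f)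
      simpa only [mul_add, mul_smul_comm] using this
    have hcb : ∀ (c : Fin N) (q : Λ), Commute (T₂ r 0 c.succ) (∑ g : Fin N, T₁ q 0 g.succ * Y q g) :=
      fun c q => Commute.sum_right _ _ _ fun g _ =>
        (h12 _ _ _ _ _ _).symm.mul_right (h2Y _ _ _ _ _)
    rw [Finset.sum_mul, Finset.mul_sum, Finset.mul_sum, Finset.smul_sum, Finset.smul_sum,
      ← Finset.sum_sub_distrib]
    refine Finset.sum_congr rfl fun c _ => ?_
    rw [mul_assoc, key, mul_sub, mul_smul_comm, mul_smul_comm, ← mul_assoc, ← mul_assoc,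
      (hcb c q).eq, (hcb c p).eq, mul_assoc, mul_assoc]
  · intro p hp q hq r hr hpq hpr hqr
    have hx := hu p hp q hq hpq
    have hy := hu q hq r hr hqr
    have hz := hu p hp r hr hpr
    have hy' := hu r hr q hq (Ne.symm hqr)
    have hS : ∀ p q, (∑ c : Fin N, T₂ p 0 c.succ * ∑ g : Fin N, T₁ q c.succ g.succ * Y q g) =
        ∑ c : Fin N, T₂ p 0 c.succ * Y' q c := fun _ _ => rfl
    clear_value Y'
    rw [hS, hS, hS, hS]
    rw [sum_mul_sum_rearrange fun _ _ => (h2Y' _ _ _ _ _).symm,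
      sum_mul_sum_rearrange fun _ _ => (h2Y' _ _ _ _ _).symm,
      sum_mul_sum_rearrange fun _ _ => (h2Y' _ _ _ _ _).symm]
    -- The first row of `T₂` is reordered so that both terms on the left acquire a common form, to
    -- which the exchange of `Y' q` and `Y' r` applies.
    have h3 : ∀ c d : Fin N, (1 - (u p - u q)⁻¹) • (T₂ q 0 c.succ * T₂ p 0 d.succ) =
        T₂ p 0 d.succ * T₂ q 0 c.succ - (u p - u q)⁻¹ • (T₂ p 0 c.succ * T₂ q 0 d.succ) := by
      intro c d
      have := congrArg (fun z => (u p - u q)⁻¹ • z) (h2.rel' hp hq 0 d.succ 0 c.succ)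
      simp only [smul_add, smul_smul, inv_mul_cancel₀ hx, one_smul] at this
      rw [sub_smul, one_smul, sub_eq_sub_iff_add_eq_add, ← this]
    have h4 : ∀ c d : Fin N, ((1 - (u p - u q)⁻¹) * (u p - u r)⁻¹) •
          (T₂ q 0 c.succ * T₂ p 0 d.succ * (Y' q c * Y' r d)) +
        ((u p - u q)⁻¹ * (u q - u r)⁻¹) • (T₂ p 0 c.succ * T₂ q 0 d.succ * (Y' q c * Y' r d)) =
        ((u q - u r)⁻¹ * (u p - u r)⁻¹) • ((u q - u r) •
          (T₂ p 0 d.succ * T₂ q 0 c.succ * (Y' q c * Y' r d)) +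
          T₂ p 0 c.succ * T₂ q 0 d.succ * (Y' q c * Y' r d)) := by
      intro c d
      rw [mul_comm (1 - _), mul_smul, ← smul_mul_assoc (1 - (u p - u q)⁻¹), h3, sub_mul,
        smul_mul_assoc]
      have e1 : u p = u q + (u p - u q) := by ring
      match_scalars
      · field_simp
      · field_simp
        ring
    simp only [Finset.smul_sum, ← Finset.sum_add_distrib, h4]
    simp only [smul_add, Finset.sum_add_distrib]
    rw [Finset.sum_comm (f := fun c d : Fin N => ((u q - u r)⁻¹ * (u p - u r)⁻¹) •
      (T₂ p 0 c.succ * T₂ q 0 d.succ * (Y' q c * Y' r d))), ← Finset.sum_add_distrib,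
      Finset.sum_comm (s := Finset.univ)
        (t := Finset.univ) (f := fun (e f : Fin N) => ((u p - u r)⁻¹ * (1 - (u r - u q)⁻¹)) •
          (T₂ p 0 e.succ * T₂ q 0 f.succ * _))]
    refine Finset.sum_congr rfl fun c _ => ?_
    rw [← Finset.sum_add_distrib]
    refine Finset.sum_congr rfl fun d _ => ?_
    have := congrArg (fun z => ((u q - u r)⁻¹ * (u p - u r)⁻¹) •
      (T₂ p 0 d.succ * T₂ q 0 c.succ * z)) (hY' q hq r hr hqr c d)
    simp only [mul_add, mul_smul_comm, smul_add] at this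
    rw [this, smul_smul]
    congr 1
    have : u r - u q = -(u q - u r) := by ring
    rw [this]
    field_simp
    ring

end

/-! ### Exchange of slots and independence of the order of the variables -/

section exchange
variable {K : Type*} [Field K] {Λ : Type} [DecidableEq Λ] {N m : ℕ}
  {V V' : Type v} [AddCommGroup V] [Module K V] [AddCommGroup V'] [Module K V']

theorem intertwine_mul {O : Type*} [Ring O] {n : ℕ} {S : O} {X X' Y Y' : Matrix (Fin n) (Fin n) O}
    (h : ∀ a b, S * X a b = X' a b * S) (h' : ∀ a b, S * Y a b = Y' a b * S) (a b : Fin n) :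
    S * (X * Y) a b = (X' * Y') a b * S := by
  simp only [Matrix.mul_apply, Finset.mul_sum, Finset.sum_mul]
  refine Finset.sum_congr rfl fun c _ => ?_
  rw [← mul_assoc, h, mul_assoc, h', mul_assoc]

/-- The exchange of the indices in two slots. -/
def slotSwap (p q : Λ) : Module.End K (SlotSpace Λ N V) where
  toFun x f := x (f ∘ Equiv.swap p q)
  map_add' _ _ := rfl
  map_smul' _ _ := rfl

theorem slotSwap_apply (p q : Λ) (x : SlotSpace Λ N V) (f : Λ → Fin N) :
    slotSwap (K := K) p q x f = x (f ∘ Equiv.swap p q) := rfl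

theorem slotSwap_mul_slotE (p q r : Λ) (a b : Fin N) :
    slotSwap (K := K) (V := V) p q * slotE r b a = slotE (Equiv.swap p q r) b a * slotSwap p q := by
  ext x f
  simp only [Module.End.mul_apply, slotSwap_apply, slotE_apply, Function.comp_apply]
  rw [Function.update_comp_equiv, Equiv.symm_swap, Equiv.swap_apply_self]

theorem slotSwap_mul_liftOp (p q : Λ) (X : Module.End K V) :
    slotSwap (N := N) p q * liftOp _ X = liftOp _ X * slotSwap p q := rfl

/-- The quadratic term in the product of two L-operators is a matrix unit times the permutation;
this reduces the exchange of L-operators to scalar identities. -/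
theorem sum_slotE_mul_slotE {p q : Λ} (h : p ≠ q) (a b : Fin N) :
    ∑ c, slotE (K := K) (V := V) q c a * slotE p b c = slotE p b a * slotSwap p q := by
  ext x f
  simp only [Module.End.mul_apply, LinearMap.sum_apply, Finset.sum_apply, slotE_apply,
    slotSwap_apply, Function.update_of_ne h]
  rw [Finset.sum_ite_eq]
  simp only [Finset.mem_univ, if_true]
  congr 2
  funext r
  simp only [Function.comp_apply]
  by_cases h1 : r = p
  · subst h1; simp [h.symm]
  · by_cases h2 : r = q
    · subst h2; simp [h1]
    · rw [Equiv.swap_apply_of_ne_of_ne h1 h2]; simp [h1, h2]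

theorem slotSwap_mul_slotL (u : Λ → K) {p q r : Λ} (hp : r ≠ p) (hq : r ≠ q) (s : Λ) (a b : Fin N) :
    slotSwap (V := V) p q * slotL u r s a b = slotL u r s a b * slotSwap p q := by
  rw [slotL_eq, mul_add, add_mul, mul_smul_comm, smul_mul_assoc, mul_smul_comm, smul_mul_assoc,
    slotSwap_mul_slotE, Equiv.swap_apply_of_ne_of_ne hp hq, mul_one, one_mul]

/-- The R-matrix in two slots. -/
def slotR (u : Λ → K) (p q : Λ) : Module.End K (SlotSpace Λ N V) := (u p - u q) • 1 + slotSwap p q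

theorem slotR_apply (u : Λ → K) (p q : Λ) (x : SlotSpace Λ N V) :
    slotR u p q x = (u p - u q) • x + slotSwap (K := K) p q x := rfl

theorem slotR_mul (u : Λ → K) (p q : Λ) (x : Module.End K (SlotSpace Λ N V)) :
    slotR u p q * x = (u p - u q) • x + slotSwap p q * x := by
  rw [slotR, add_mul, smul_mul_assoc, one_mul]

theorem mul_slotR (u : Λ → K) (p q : Λ) (x : Module.End K (SlotSpace Λ N V)) :
    x * slotR u p q = (u p - u q) • x + x * slotSwap p q := by
  rw [slotR, mul_add, mul_smul_comm, mul_one]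

/-- The Yang–Baxter equation for two slots and the family label `s`. Both sides are expanded in
matrix units and the permutation, and the coefficients agree as rational functions. -/
theorem slotR_mul_slotL (u : Λ → K) {p q s : Λ} (h : p ≠ q) (hp : u s - u p ≠ 0)
    (hq : u s - u q ≠ 0) (a b : Fin N) :
    slotR (V := V) u p q * (slotL u q * slotL u p : OpFamily K Λ N (SlotSpace Λ N V)) s a b =
      (slotL u p * slotL u q : OpFamily K Λ N (SlotSpace Λ N V)) s a b * slotR u p q := by
  have e : ∀ (p q : Λ) (h : p ≠ q), (slotL u q * slotL u p : OpFamily K Λ N (SlotSpace Λ N V)) s a b =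
      (if a = b then (1 : K) else 0) • 1 + (u s - u p)⁻¹ • slotE p b a +
        (u s - u q)⁻¹ • slotE q b a +
        ((u s - u p)⁻¹ * (u s - u q)⁻¹) • (slotE p b a * slotSwap p q) := by
    intro p q h
    rw [← sum_slotE_mul_slotE h, Pi.mul_apply, Matrix.mul_apply]
    simp only [slotL_eq, add_mul, mul_add, smul_mul_assoc, mul_smul_comm, one_mul, mul_one, smul_add,
      smul_smul, Finset.sum_add_distrib, ite_smul, mul_ite, ite_mul, zero_smul, mul_zero, zero_mul,
      one_smul, smul_ite, smul_zero, Finset.sum_ite_eq, Finset.sum_ite_eq', Finset.mem_univ, if_true,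
      Finset.smul_sum]
    abel
  have hS : slotSwap (K := K) (V := V) (N := N) p q * slotSwap p q = 1 := by
    ext x f
    simp only [Module.End.mul_apply, slotSwap_apply, Module.End.one_apply, Function.comp_assoc]
    refine congrArg x ?_
    funext r
    simp
  have hS' : slotSwap (K := K) (V := V) (N := N) q p = slotSwap p q := by
    ext x f
    rw [slotSwap_apply, slotSwap_apply, Equiv.swap_comm]
  have h1 := slotSwap_mul_slotE (K := K) (V := V) p q p a b
  have h2 := slotSwap_mul_slotE (K := K) (V := V) p q q a b
  rw [Equiv.swap_apply_left] at h1
  rw [Equiv.swap_apply_right] at h2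
  rw [e p q h, e q p h.symm, hS', slotR_mul, mul_slotR]
  simp only [add_mul, mul_add, smul_mul_assoc, mul_smul_comm, one_mul, mul_one, smul_add, smul_smul,
    ← mul_assoc, h1, h2]
  simp only [mul_assoc, hS, mul_one]
  match_scalars <;> field_simp <;> ring

/-- The matrices of the values of the exchange operators intertwine the products of L-operators. -/
theorem slotR_mul_slotLs (u : Λ → K) {p q s : Λ} (h : p ≠ q) (hp : u s - u p ≠ 0)
    (hq : u s - u q ≠ 0) {l w : List Λ} (hl : (l ++ q :: p :: w).Nodup) (X : OpFamily K Λ N V)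
    (a b : Fin N) :
    slotR u p q * (liftFam (Λ → Fin N) X * slotLs u (l ++ q :: p :: w) :
        OpFamily K Λ N (SlotSpace Λ N V)) s a b =
      (liftFam (Λ → Fin N) X * slotLs u (l ++ p :: q :: w) :
        OpFamily K Λ N (SlotSpace Λ N V)) s a b * slotR u p q := by
  have hc : ∀ w : List Λ, p ∉ w → q ∉ w → ∀ a b, slotR (V := V) u p q *
      slotLs (N := N) u w s a b = slotLs u w s a b * slotR u p q := by
    intro w
    induction w with
    | nil =>
      intro _ _ a b
      rw [slotLs_nil, Pi.one_apply, Matrix.one_apply]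
      split_ifs
      · rw [mul_one, one_mul]
      · rw [mul_zero, zero_mul]
    | cons r w ih =>
      intro h1 h2
      rw [slotLs_cons]
      refine intertwine_mul (fun a b => ?_) (ih (fun h => h1 (by simp [h])) (fun h => h2 (by simp [h])))
      rw [slotR_mul, mul_slotR, slotSwap_mul_slotL u (fun h => h1 (by simp [h]))
        (fun h => h2 (by simp [h]))]
  simp only [List.nodup_append, List.nodup_cons, List.mem_cons, not_or, ne_eq] at hl
  simp only [slotLs_append, slotLs_cons, ← mul_assoc]
  rw [mul_assoc _ (slotL u q) (slotL u p), mul_assoc _ (slotL u p) (slotL u q)]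
  refine intertwine_mul (intertwine_mul (intertwine_mul (fun a b => ?_) (hc l ?_ ?_))
    (slotR_mul_slotL u h hp hq)) (hc w ?_ ?_) a b
  · rw [liftFam_eq, slotR_mul, mul_slotR, slotSwap_mul_liftOp]
  · exact fun h => hl.2.2 p h p (by simp) rfl
  · exact fun h => hl.2.2 q h q (by simp) rfl
  · exact hl.2.1.2.1
  · exact fun h => hl.2.1.1.2 h

variable (N V) in
/-- The functions of lists of slots that have the exchange symmetry of nested Bethe vectors. -/
def exchSpace (u : Λ → K) : Submodule K (List Λ → SlotSpace Λ N V) where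
  carrier := {G | (∀ w, ¬ w.Nodup → G w = 0) ∧ ∀ l p q w f, p ≠ q →
    (u p - u q) • G (l ++ q :: p :: w) f + G (l ++ q :: p :: w) (f ∘ Equiv.swap p q) =
      (u p - u q + 1) • G (l ++ p :: q :: w) f}
  zero_mem' := ⟨fun _ _ => rfl, fun _ _ _ _ _ _ => by simp⟩
  add_mem' := by
    intro G H hG hH
    refine ⟨fun w hw => by rw [Pi.add_apply, hG.1 w hw, hH.1 w hw, add_zero], fun l p q w f h => ?_⟩
    have h1 := hG.2 l p q w f h
    have h2 := hH.2 l p q w f h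
    simp only [Pi.add_apply, smul_add, ← h1, ← h2]
    abel
  smul_mem' := by
    intro c G hG
    refine ⟨fun w hw => by rw [Pi.smul_apply, hG.1 w hw, smul_zero], fun l p q w f h => ?_⟩
    have h1 := hG.2 l p q w f h
    simp only [Pi.smul_apply]
    rw [smul_comm _ c, smul_comm _ c, ← h1, smul_add]

/-- An operator applied to all the values. -/
def exchOp (u : Λ → K) : Module.End K V →ₐ[K] Module.End K (exchSpace N V u) where
  toFun X := (liftOp (List Λ) (liftOp (Λ → Fin N) X)).restrict (by
    intro G hG
    refine ⟨fun w hw => ?_, fun l p q w f h => ?_⟩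
    · rw [liftOp_apply, hG.1 w hw, map_zero]
    · have := congrArg X (hG.2 l p q w f h)
      rw [map_add, map_smul, map_smul] at this
      exact this)
  map_one' := rfl
  map_mul' _ _ := rfl
  map_zero' := rfl
  map_add' _ _ := rfl
  commutes' _ := rfl

theorem exchOp_apply (u : Λ → K) (X : Module.End K V) (G : exchSpace N V u) (w : List Λ)
    (f : Λ → Fin N) : (exchOp u X G).1 w f = X (G.1 w f) := rfl

/-- The operator that adds the slot `p` with the index `c`. -/
def exchPsi (u : Λ → K) (p : Λ) (c : Fin N) : Module.End K (exchSpace N V u) where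
  toFun G := ⟨fun w f => G.1 (p :: w) (Function.update f p c), by
    refine ⟨fun w hw => ?_, fun l p' q' w f h => ?_⟩
    · have : ¬ (p :: w).Nodup := fun h => hw (List.nodup_cons.1 h).2
      funext f
      exact congrFun (G.2.1 _ this) _
    · have h1 := G.2.2 (p :: l) p' q' w (Function.update f p c) h
      by_cases hp : p = p' ∨ p = q'
      · have e : ∀ p' q', (p = p' ∨ p = q') → ¬ (p :: (l ++ q' :: p' :: w)).Nodup := by
          intro p' q' hp h
          refine (List.nodup_cons.1 h).1 ?_
          rcases hp with rfl | rfl <;> simp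
        beta_reduce
        rw [G.2.1 _ (e p' q' hp), G.2.1 _ (e q' p' hp.symm)]
        simp
      · push Not at hp
        rw [Function.update_comp_equiv, Equiv.symm_swap, Equiv.swap_apply_of_ne_of_ne hp.1 hp.2] at h1
        exact h1⟩
  map_add' _ _ := rfl
  map_smul' _ _ := rfl

theorem exchPsi_apply (u : Λ → K) (p : Λ) (c : Fin N) (G : exchSpace N V u) (w : List Λ)
    (f : Λ → Fin N) : (exchPsi u p c G).1 w f = G.1 (p :: w) (Function.update f p c) := rfl

theorem exchOp_commute_exchPsi (u : Λ → K) (X : Module.End K V) (p : Λ) (c : Fin N) :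
    Commute (exchOp u X) (exchPsi u p c) := rfl

/-- The exchange symmetry of the functions, taken at the head of the list, is literally the
Zamolodchikov–Faddeev relation for the operators that prepend a slot. -/
theorem isZF_exchPsi (u : Λ → K) (s : Set Λ) : IsZF u s (exchPsi (N := N) (V := V) u) := by
  intro p _ q _ h c d
  refine LinearMap.ext fun G => Subtype.ext ?_
  funext w f
  have h1 := G.2.2 [] p q w (Function.update (Function.update f p c) q d) h
  have e : Function.update (Function.update f p c) q d ∘ Equiv.swap p q =
      Function.update (Function.update f p d) q c := by
    rw [Function.update_comp_equiv, Function.update_comp_equiv, Equiv.symm_swap,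
      Equiv.swap_apply_right, Equiv.swap_apply_left, Function.update_comm h.symm]
    funext r
    by_cases h1 : r = p
    · subst h1; simp [h]
    · by_cases h2 : r = q
      · subst h2; simp
      · simp [h1, h2, Equiv.swap_apply_of_ne_of_ne h1 h2]
  rw [e] at h1
  have h2 : Function.update (Function.update f p c) q d = Function.update (Function.update f q d) p c :=
    Function.update_comm h _ _ _
  have h3 := h1
  simp only [List.nil_append] at h3
  change (u p - u q) • G.1 (q :: p :: w) (Function.update (Function.update f p c) q d) +
    G.1 (q :: p :: w) (Function.update (Function.update f p d) q c) =
    (u p - u q + 1) • G.1 (p :: q :: w) (Function.update (Function.update f q d) p c)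
  rw [h3, ← h2]

/-- The contraction of a new slot with a row. -/
def exchRow (u : Λ → K) (T : OpFamily K Λ (N + 1) V) (p : Λ) : Module.End K (exchSpace N V u) :=
  ∑ g : Fin N, exchOp u (T p 0 g.succ) * exchPsi u p g

theorem exchRow_apply (u : Λ → K) (T : OpFamily K Λ (N + 1) V) (p : Λ) (G : exchSpace N V u)
    (w : List Λ) : (exchRow u T p G).1 w = rowOp (firstRow T p) p (G.1 (p :: w)) := by
  funext f
  rw [exchRow, LinearMap.sum_apply, AddSubmonoidClass.coe_finsetSum]
  simp only [Finset.sum_apply, Module.End.mul_apply, exchOp_apply, exchPsi_apply, rowOp_apply, firstRow]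

/-- Each `exchRow` prepends a slot and contracts it, so a product of them evaluates the function on
a longer list and contracts the added slots. The leftmost factor supplies the innermost added slot,
hence the reversal. -/
theorem exchRow_prod_apply (u : Λ → K) (T : OpFamily K Λ (N + 1) V) (l : List Λ)
    (G : exchSpace N V u) (w : List Λ) :
    (((l.reverse.map (exchRow u T)).prod G).1 w) = rowOps (firstRow T) l (G.1 (l ++ w)) := by
  induction l generalizing G with
  | nil => rfl
  | cons p l ih =>
    rw [List.reverse_cons, List.map_append, List.prod_append, Module.End.mul_apply, ih]
    simp only [List.map_cons, List.map_nil, List.prod_cons, List.prod_nil, mul_one, exchRow_apply, rowOps,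
      Module.End.mul_apply, List.cons_append]

theorem isRTTMat_exchOp {u : Λ → K} {S : Set Λ} {T : OpFamily K Λ (m + 1) V} (h : IsRTT u S T) :
    IsRTTMat u S fun p => (T p).map (exchOp (N := N) u) := by
  intro p hp q hq a b c d
  have := congrArg (exchOp (N := N) u) (h p hp q hq a b c d)
  simp only [map_add, map_mul, map_smul] at this
  exact this

/-- This is `commute_sum_row_zf` with the first row of `T` and the slot-adding operators. -/
theorem exchRow_commute {u : Λ → K} {S : Set Λ} {T : OpFamily K Λ (N + 1) V} (h : IsRTT u S T)
    (h1 : ∀ p q, u p - u q + 1 ≠ 0) {p q : Λ} (hp : p ∈ S) (hq : q ∈ S) :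
    Commute (exchRow u T p) (exchRow u T q) :=
  commute_sum_row_zf (isRTTMat_exchOp h).isRow (isZF_exchPsi u S)
    (fun p q c d => exchOp_commute_exchPsi _ _ _ _) (fun p _ q _ => h1 p q) hp hq

open Classical in
/-- The nested Bethe vectors of the next level as functions of the list of slots. -/
noncomputable def betheSeed (u : Λ → K) (P : Fin m → List Λ) (X : OpFamily K Λ (m + 1) V) (v : V) :
    List Λ → SlotSpace Λ (m + 1) V := fun w =>
  if w.Nodup ∧ ∀ p ∈ w, p ∉ labels P then
    nestedBethe u m P (liftFam (Λ → Fin (m + 1)) X * slotLs u w) (slotVec (K := K) w v) else 0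

theorem slotVec_perm {w w' : List Λ} (h : w.Perm w') :
    slotVec (K := K) (m := m) (V := V) w = slotVec w' := by
  ext x f
  simp only [slotVec_apply, h.mem_iff]

theorem slotSwap_slotVec {w : List Λ} {p q : Λ} (hp : p ∈ w) (hq : q ∈ w) (v : V) :
    slotSwap (K := K) (N := m + 1) p q (slotVec (K := K) w v) = slotVec (K := K) w v := by
  funext f
  rw [slotSwap_apply, slotVec_apply, slotVec_apply]
  congr 1
  refine propext ⟨fun h r hr => ?_, fun h r hr => ?_⟩
  · have hr' : Equiv.swap p q r ∈ w := by
      rw [Equiv.swap_apply_def]; split_ifs <;> assumption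
    have := h _ hr'
    simpa using this
  · refine h _ ?_
    rw [Equiv.swap_apply_def]; split_ifs <;> assumption

/-- The R-matrix in two adjacent slots intertwines the families for the two orders of these slots,
hence also the nested Bethe operators. On the vacuum vector the permutation is trivial, so the
R-matrix acts there by `u p - u q + 1`, the factor in the definition of `exchSpace`. -/
theorem betheSeed_mem {u : Λ → K} (hu : Function.Injective u) {P : Fin m → List Λ}
    (hP : IsSimple P) (X : OpFamily K Λ (m + 1) V) (v : V) :
    betheSeed u P X v ∈ exchSpace (m + 1) V u := by
  refine ⟨fun w hw => if_neg fun h => hw h.1, fun l p q w f h => ?_⟩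
  have hperm : (l ++ q :: p :: w).Perm (l ++ p :: q :: w) := (List.Perm.swap _ _ _).append_left l
  by_cases hw : (l ++ q :: p :: w).Nodup ∧ ∀ r ∈ l ++ q :: p :: w, r ∉ labels P
  · have hw' : (l ++ p :: q :: w).Nodup ∧ ∀ r ∈ l ++ p :: q :: w, r ∉ labels P :=
      ⟨hperm.nodup_iff.1 hw.1, fun r hr => hw.2 r (hperm.mem_iff.2 hr)⟩
    simp only [betheSeed]
    rw [if_pos hw, if_pos hw']
    have hp : p ∈ l ++ q :: p :: w := by simp
    have hq : q ∈ l ++ q :: p :: w := by simp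
    have key := nestedBethe_intertwine (u := u) hP
      (T := liftFam (Λ → Fin (m + 1)) X * slotLs u (l ++ q :: p :: w))
      (T' := liftFam (Λ → Fin (m + 1)) X * slotLs u (l ++ p :: q :: w))
      (slotR u p q) ?_ (slotVec (K := K) (l ++ q :: p :: w) v)
    · have := congrFun key f
      rw [slotR_apply, slotR_apply, slotSwap_slotVec hp hq, Pi.add_apply,
        Pi.smul_apply, slotSwap_apply] at this
      rw [this, ← slotVec_perm hperm, add_smul, map_add, map_smul, one_smul]
      rfl
    · intro s hs a b x
      have hsp : ∀ r ∈ l ++ q :: p :: w, u s - u r ≠ 0 := fun r hr e =>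
        hw.2 r hr (hu (sub_eq_zero.1 e) ▸ hs)
      exact LinearMap.congr_fun (slotR_mul_slotLs u h (hsp p hp) (hsp q hq) hw.1 X a b) x
  · have hw' : ¬ ((l ++ p :: q :: w).Nodup ∧ ∀ r ∈ l ++ p :: q :: w, r ∉ labels P) := fun h' =>
      hw ⟨hperm.nodup_iff.2 h'.1, fun r hr => h'.2 r (hperm.mem_iff.1 hr)⟩
    simp only [betheSeed]
    rw [if_neg hw, if_neg hw']
    simp

/-- The nested Bethe vector does not depend on the order of the variables of each color. -/
theorem nestedBethe_perm {u : Λ → K} (hu : Function.Injective u) (hu1 : ∀ p q, u p - u q + 1 ≠ 0)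
    {P P' : Fin m → List Λ} (hP : IsSimple P) (h : ∀ a, (P a).Perm (P' a))
    {T : OpFamily K Λ (m + 1) V} (hT : IsRTT u (labels P) T) (x : V) :
    nestedBethe u m P T x = nestedBethe u m P' T x := by
  induction m generalizing V with
  | zero => rfl
  | succ m ih =>
    rw [nestedBethe_succ, nestedBethe_succ]
    have hseed : ∀ w, w.Perm (P 0) → nestedBethe u m (fun a => P a.succ)
        (liftFam (Λ → Fin (m + 1)) (truncFam T) * slotLs u w) (slotVec (K := K) w x) =
        betheSeed u (fun a => P a.succ) (truncFam T) x w := by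
      intro w hw
      rw [betheSeed, if_pos]
      exact ⟨hw.nodup_iff.2 (hP.nodup 0), fun p hp hp' => hP.notMem_zero hp' (hw.mem_iff.1 hp)⟩
    have hrtt : IsRTT u (labels fun a => P a.succ)
        (liftFam (Λ → Fin (m + 1)) (truncFam T) * slotLs u (P' 0)) := by
      refine ((hT.mono (labels_tail_subset P)).truncFam.liftFam _).mul
        (isRTT_slotLs ((h 0).nodup_iff.1 (hP.nodup 0)) fun p hp q hq e => ?_)
        (liftFam_commute_slotLs _ _ _)
      exact hP.notMem_zero (hu (sub_eq_zero.1 e) ▸ hq) ((h 0).mem_iff.2 hp)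
    -- The later colors are reordered by induction at the lower level. What remains is the order of
    -- the slots of the first color, which is the order of the commuting operators `exchRow`.
    rw [← ih hP.tail (fun a => h a.succ) hrtt, hseed _ (List.Perm.refl _), hseed _ (h 0).symm]
    set G : exchSpace (m + 1) V u := ⟨_, betheSeed_mem hu hP.tail (truncFam T) x⟩ with hG
    have e1 := exchRow_prod_apply u T (P 0) G []
    have e2 := exchRow_prod_apply u T (P' 0) G []
    rw [List.append_nil] at e1 e2
    change rowOps (firstRow T) (P 0) (G.1 (P 0)) _ = rowOps (firstRow T) (P' 0) (G.1 (P' 0)) _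
    rw [← e1, ← e2]
    refine congrArg (fun z : Module.End K (exchSpace (m + 1) V u) => (z G).1 [] fun _ => 0) ?_
    refine List.Perm.prod_eq' (List.Perm.map (exchRow u T) (((List.reverse_perm _).trans (h 0)).trans
      (List.reverse_perm _).symm)) ?_
    refine List.pairwise_map.2 (List.Pairwise.imp_of_mem (R := fun _ _ => True) ?_
      (List.pairwise_of_forall (by simp)))
    intro p q hp hq _
    rw [List.mem_reverse] at hp hq
    exact exchRow_commute hT hu1 (mem_labels_zero hp) (mem_labels_zero hq)

end exchange

/-! ### Operators in slots and weight vectors -/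

section slots
variable {K : Type*} [Field K] {Λ : Type} [DecidableEq Λ] {N m : ℕ}
  {V V' : Type v} [AddCommGroup V] [Module K V] [AddCommGroup V'] [Module K V']

/-- The operator that fixes the index in a slot. -/
def slotSet (p : Λ) (g : Fin N) : Module.End K (SlotSpace Λ N V) where
  toFun x f := x (Function.update f p g)
  map_add' _ _ := rfl
  map_smul' _ _ := rfl

theorem slotSet_apply (p : Λ) (g : Fin N) (x : SlotSpace Λ N V) (f : Λ → Fin N) :
    slotSet (K := K) p g x f = x (Function.update f p g) := rfl

theorem liftOp_commute_slotSet (X : Module.End K V) (p : Λ) (g : Fin N) :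
    Commute (liftOp _ X) (slotSet p g) := rfl

theorem slotSet_commute {p q : Λ} (h : p ≠ q) (a b : Fin N) :
    Commute (slotSet (K := K) (V := V) p a) (slotSet q b) := by
  ext x f
  simp only [Module.End.mul_apply, slotSet_apply, Function.update_comm h]

theorem slotSet_commute_slotE {p q : Λ} (h : p ≠ q) (g a b : Fin N) :
    Commute (slotSet (K := K) (V := V) p g) (slotE q b a) := by
  ext x f
  simp only [Module.End.mul_apply, slotSet_apply, slotE_apply, Function.update_of_ne h.symm,
    Function.update_comm h]

theorem rowOp_eq (X : Fin N → Module.End K V) (p : Λ) :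
    rowOp X p = ∑ g, liftOp _ (X g) * slotSet p g := by
  ext x f
  rw [LinearMap.sum_apply, Finset.sum_apply]
  rfl

/-- The action of a matrix of operators in a slot. -/
def slotOp (X : Matrix (Fin N) (Fin N) (Module.End K V)) (p : Λ) :
    Module.End K (SlotSpace Λ N V) where
  toFun x f := ∑ g, X (f p) g (x (Function.update f p g))
  map_add' x y := by ext f; simp [Finset.sum_add_distrib]
  map_smul' c x := by ext f; simp [Finset.smul_sum]

theorem slotOp_apply (X : Matrix (Fin N) (Fin N) (Module.End K V)) (p : Λ) (x : SlotSpace Λ N V)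
    (f : Λ → Fin N) : slotOp X p x f = ∑ g, X (f p) g (x (Function.update f p g)) := rfl

theorem slotOp_eq (X : Matrix (Fin N) (Fin N) (Module.End K V)) (p : Λ) :
    slotOp X p = ∑ e, ∑ g, liftOp _ (X e g) * slotE p e g := by
  ext x f
  simp only [LinearMap.sum_apply, Finset.sum_apply, Module.End.mul_apply, liftOp_apply, slotE_apply,
    slotOp_apply]
  rw [Finset.sum_comm]
  refine Finset.sum_congr rfl fun g _ => ?_
  rw [Finset.sum_eq_single (f p)]
  · simp
  · intro b _ hb
    rw [if_neg hb.symm, map_zero]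
  · simp

/-- The product of the actions in the slots of the list, the first slot being treated first. -/
def slotOps (X : OpFamily K Λ N V) : List Λ → Module.End K (SlotSpace Λ N V)
  | [] => 1
  | p :: w => slotOps X w * slotOp (X p) p

theorem commute_rowOp {p : Λ} {X : Fin N → Module.End K V} {S : Module.End K (SlotSpace Λ N V)}
    (h1 : ∀ g, Commute S (liftOp _ (X g))) (h2 : ∀ g, Commute S (slotSet p g)) :
    Commute S (rowOp X p) := by
  rw [rowOp_eq]
  exact Commute.sum_right _ _ _ fun g _ => (h1 g).mul_right (h2 g)

theorem commute_rowOps {X : Λ → Fin N → Module.End K V} {w : List Λ}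
    {S : Module.End K (SlotSpace Λ N V)} (h1 : ∀ p ∈ w, ∀ g, Commute S (liftOp _ (X p g)))
    (h2 : ∀ p ∈ w, ∀ g, Commute S (slotSet p g)) : Commute S (rowOps X w) := by
  induction w with
  | nil => exact Commute.one_right _
  | cons p w ih =>
    exact (ih (fun q hq => h1 q (by simp [hq])) (fun q hq => h2 q (by simp [hq]))).mul_right
      (commute_rowOp (h1 p (by simp)) (h2 p (by simp)))

theorem commute_slotOp {p : Λ} {X : Matrix (Fin N) (Fin N) (Module.End K V)}
    {S : Module.End K (SlotSpace Λ N V)}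
    (h1 : ∀ a b, Commute S (liftOp _ (X a b))) (h2 : ∀ a b, Commute S (slotE p a b)) :
    Commute S (slotOp X p) := by
  rw [slotOp_eq]
  exact Commute.sum_right _ _ _ fun e _ => Commute.sum_right _ _ _ fun g _ =>
    (h1 e g).mul_right (h2 e g)

theorem commute_slotOps {X : OpFamily K Λ N V} {w : List Λ}
    {S : Module.End K (SlotSpace Λ N V)} (h1 : ∀ p ∈ w, ∀ a b, Commute S (liftOp _ (X p a b)))
    (h2 : ∀ p ∈ w, ∀ a b, Commute S (slotE p a b)) : Commute S (slotOps X w) := by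
  induction w with
  | nil => exact Commute.one_right _
  | cons p w ih =>
    exact (ih (fun q hq => h1 q (by simp [hq])) (fun q hq => h2 q (by simp [hq]))).mul_right
      (commute_slotOp (h1 p (by simp)) (h2 p (by simp)))

theorem commute_slotL {p : Λ} (u : Λ → K) {S : Module.End K (SlotSpace Λ N V)}
    (h : ∀ a b, Commute S (slotE p a b)) (q : Λ) (a b : Fin N) : Commute S (slotL u p q a b) := by
  rw [slotL_eq]
  exact ((Commute.one_right _).smul_right _).add_right ((h _ _).smul_right _)

theorem commute_matrix_mul {O : Type*} [Ring O] {n : ℕ} {S : O} {X Y : Matrix (Fin n) (Fin n) O}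
    (h : ∀ a b, Commute S (X a b)) (h' : ∀ a b, Commute S (Y a b)) (a b : Fin n) :
    Commute S ((X * Y) a b) :=
  intertwine_mul (fun a b => (h a b)) (fun a b => (h' a b)) a b

theorem commute_slotLs {w : List Λ} (u : Λ → K) {S : Module.End K (SlotSpace Λ N V)}
    (h : ∀ p ∈ w, ∀ a b, Commute S (slotE p a b)) (q : Λ) (a b : Fin N) :
    Commute S (slotLs u w q a b) := by
  induction w generalizing a b with
  | nil =>
    rw [slotLs_nil, Pi.one_apply, Matrix.one_apply]
    split_ifs
    · exact Commute.one_right _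
    · exact Commute.zero_right _
  | cons p w ih =>
    rw [slotLs_cons, Pi.mul_apply]
    exact commute_matrix_mul (commute_slotL u (h p (by simp)) q)
      (ih fun r hr => h r (by simp [hr])) a b

/-- A contraction sums over the index in its slot, so the previous index there is irrelevant;
contractions of other slots do not restore the dependence. -/
theorem rowOps_congr {X : Λ → Fin N → Module.End K V} {w : List Λ} (hw : w.Nodup)
    (x : SlotSpace Λ N V) {f f' : Λ → Fin N} (h : ∀ p, p ∉ w → f p = f' p) :
    rowOps X w x f = rowOps X w x f' := by
  induction w generalizing x f with
  | nil =>
    have : f = f' := funext fun p => h p (by simp)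
    rw [this]
  | cons p w ih =>
    rw [List.nodup_cons] at hw
    have h1 : rowOps X (p :: w) x f = rowOps X (p :: w) x (Function.update f p (f' p)) := by
      have e : slotSet (K := K) p (f' p) * rowOps X (p :: w) = rowOps X (p :: w) := by
        have hc : Commute (slotSet (K := K) p (f' p)) (rowOps X w) :=
          commute_rowOps (fun q hq g => (liftOp_commute_slotSet _ _ _).symm) fun q hq g =>
            slotSet_commute (ne_of_mem_of_not_mem hq hw.1).symm _ _
        rw [rowOps, ← mul_assoc, hc.eq, mul_assoc]
        congr 1
        ext x f
        simp [slotSet_apply, rowOp_apply]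
      exact (congrFun (LinearMap.congr_fun e x) f).symm
    rw [h1]
    refine ih hw.2 _ fun q hq => ?_
    by_cases hqp : q = p
    · subst hqp; simp
    · rw [Function.update_of_ne hqp]
      exact h q (by simp [hqp, hq])

/-- The RTT relation in matrix form: the L-operator in the slot `p` plays the role of the R-matrix
between the index of the slot and the family at `q`, and `D` at `p` acts in the slot as the second
matrix. -/
theorem slotOp_mul {u : Λ → K} {S : Set Λ} {D : OpFamily K Λ N V} (hD : IsRTT u S D) {p q : Λ}
    (hp : p ∈ S) (hq : q ∈ S) (hpq : u p - u q ≠ 0) (a b : Fin N) :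
    slotOp (D p) p * (liftFam (Λ → Fin N) D * slotL u p : OpFamily K Λ N (SlotSpace Λ N V)) q a b =
      (slotL u p * liftFam (Λ → Fin N) D : OpFamily K Λ N (SlotSpace Λ N V)) q a b *
        slotOp (D p) p := by
  ext x f
  have e1 : ∀ (x : SlotSpace Λ N V) f, (liftFam (Λ → Fin N) D * slotL u p :
      OpFamily K Λ N (SlotSpace Λ N V)) q a b x f = D q a b (x f) +
        (u q - u p)⁻¹ • if f p = b then ∑ c, D q a c (x (Function.update f p c)) else 0 := by
    intro x f
    rw [Pi.mul_apply, Matrix.mul_apply, LinearMap.sum_apply, Finset.sum_apply]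
    simp only [Module.End.mul_apply, liftFam_apply, slotL_apply, map_add, map_smul,
      Finset.sum_add_distrib, ← Finset.smul_sum]
    congr 2
    · rw [Finset.sum_eq_single b]
      · simp
      · intro c _ hc
        simp [hc]
      · simp
    · split_ifs <;> simp
  have e2 : ∀ (x : SlotSpace Λ N V) f, (slotL u p * liftFam (Λ → Fin N) D :
      OpFamily K Λ N (SlotSpace Λ N V)) q a b x f = D q a b (x f) +
        (u q - u p)⁻¹ • D q (f p) b (x (Function.update f p a)) := by
    intro x f
    rw [Pi.mul_apply, Matrix.mul_apply, LinearMap.sum_apply, Finset.sum_apply]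
    simp only [Module.End.mul_apply, liftFam_apply, slotL_apply,
      Finset.sum_add_distrib, ← Finset.smul_sum]
    congr 2
    · simp
    · simp
  rw [Module.End.mul_apply, Module.End.mul_apply, slotOp_apply, e2]
  simp only [e1, slotOp_apply, Function.update_self, Function.update_idem, map_add, map_smul,
    Finset.sum_add_distrib, ← Finset.smul_sum, map_sum]
  rw [Finset.sum_eq_single_of_mem (f := fun g => D p (f p) g (if g = b then
    ∑ c, D q a c (x (Function.update f p c)) else 0)) b (Finset.mem_univ _)
    (fun c _ hc => by rw [if_neg hc, map_zero]), if_pos rfl, map_sum]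
  simp only [Finset.smul_sum, ← Finset.sum_add_distrib]
  refine Finset.sum_congr rfl fun g _ => ?_
  have := LinearMap.congr_fun (hD.rel' hp hq (f p) g a b) (x (Function.update f p g))
  simp only [LinearMap.add_apply, LinearMap.smul_apply, Module.End.mul_apply] at this
  have hx : (u q - u p)⁻¹ = - (u p - u q)⁻¹ := by rw [← inv_neg, neg_sub]
  rw [hx]
  -- After the denominators are cleared the identity is termwise in `g` the relation `IsRTT.rel'`.
  refine smul_right_injective V hpq ?_
  simp only [smul_add, smul_neg, smul_smul, mul_inv_cancel₀ hpq, neg_smul, smul_neg, one_smul]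
  rw [← sub_eq_add_neg, ← sub_eq_add_neg, sub_eq_sub_iff_add_eq_add]
  exact this

/-- Iteration of `slotOp_mul`: the operator for one slot commutes with the L-operators of all the
others. It is used to move a family past a group of L-operators when the product of two families is
regrouped. -/
theorem slotOps_mul {u : Λ → K} {S : Set Λ} {D : OpFamily K Λ N V} (hD : IsRTT u S D) {w : List Λ}
    {q : Λ} (hw : w.Nodup) (hwS : ∀ p ∈ w, p ∈ S ∧ u p - u q ≠ 0) (hq : q ∈ S) (a b : Fin N) :
    slotOps D w * (liftFam (Λ → Fin N) D * slotLs u w : OpFamily K Λ N (SlotSpace Λ N V)) q a b =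
      (slotLs u w * liftFam (Λ → Fin N) D : OpFamily K Λ N (SlotSpace Λ N V)) q a b *
        slotOps D w := by
  induction w generalizing a b with
  | nil => rw [slotLs_nil, mul_one, one_mul, slotOps, mul_one, one_mul]
  | cons p w ih =>
    rw [List.nodup_cons] at hw
    have h1 := fun a b => slotOp_mul hD (hwS p (by simp)).1 hq (hwS p (by simp)).2 a b
    have h2 : ∀ a b, slotOp (D p) p * slotLs u w q a b = slotLs u w q a b * slotOp (D p) p :=
      commute_slotLs u (fun r hr a b => (commute_slotOp
        (fun a' b' => (liftOp_commute_slotE _ _ _ _).symm)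
        fun a' b' => slotE_commute (ne_of_mem_of_not_mem hr hw.1) _ _ _ _).symm) q
    have h3 : ∀ a b, slotOps D w * slotL u p q a b = slotL u p q a b * slotOps D w :=
      commute_slotL u (fun a b => (commute_slotOps (fun r hr a' b' => (liftOp_commute_slotE _ _ _ _).symm)
        fun r hr a' b' => slotE_commute (ne_of_mem_of_not_mem hr hw.1).symm _ _ _ _).symm) q
    have h4 := fun a b => ih hw.2 (fun r hr => hwS r (by simp [hr])) a b
    have h5 := intertwine_mul h1 h2 a b
    have h6 := intertwine_mul h3 h4 a b
    rw [slotLs_cons, slotOps, ← mul_assoc, mul_assoc (slotOps D w)]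
    refine (congrArg (slotOps D w * ·) h5).trans ?_
    rw [← mul_assoc, mul_assoc (slotL u p)]
    refine (congrArg (· * slotOp (D p) p) ?_).trans (mul_assoc _ _ _)
    rw [← Pi.mul_apply, mul_assoc]
    exact h6

/-! ### Weight vectors -/

/-- The vector `v` is a weight singular vector with respect to the family `T` at the points with labels
in `S`. -/
def IsWeight (S : Set Λ) (T : OpFamily K Λ N V) (lam : Λ → Fin N → K) (v : V) : Prop :=
  ∀ p ∈ S, (∀ a b, a < b → T p b a v = 0) ∧ ∀ a, T p a a v = lam p a • v

theorem IsWeight.mono {S S' : Set Λ} {T : OpFamily K Λ N V} {lam : Λ → Fin N → K} {v : V}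
    (h : IsWeight S T lam v) (hS : S' ⊆ S) : IsWeight S' T lam v := fun p hp => h p (hS hp)

theorem IsWeight.mul {S : Set Λ} {X Y : OpFamily K Λ N V} {lam mu : Λ → Fin N → K} {v : V}
    (hX : IsWeight S X lam v) (hY : IsWeight S Y mu v) (h : FamCommute X Y) :
    IsWeight S (X * Y) (fun p a => lam p a * mu p a) v := by
  -- Intermediate indices other than `a` contribute nothing: for `c > a` the factor `Y` annihilates
  -- `v`, and for `c < a` the two factors are interchanged and `X` annihilates `v`.
  have key : ∀ p ∈ S, ∀ a b c, a ≤ b → c ≠ a → X p b c (Y p c a v) = 0 := by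
    intro p hp a b c hab hc
    rcases lt_or_gt_of_ne hc with h1 | h1
    · have e := LinearMap.congr_fun (h p p b c c a).eq v
      rw [Module.End.mul_apply, Module.End.mul_apply] at e
      rw [e, (hX p hp).1 c b (h1.trans_le hab), map_zero]
    · rw [(hY p hp).1 a c h1, map_zero]
  intro p hp
  refine ⟨fun a b hab => ?_, fun a => ?_⟩
  · rw [Pi.mul_apply, Matrix.mul_apply, LinearMap.sum_apply]
    refine Finset.sum_eq_zero fun c _ => ?_
    rw [Module.End.mul_apply]
    by_cases hc : c = a
    · rw [hc, (hY p hp).2, map_smul, (hX p hp).1 a b hab, smul_zero]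
    · exact key p hp a b c hab.le hc
  · rw [Pi.mul_apply, Matrix.mul_apply, LinearMap.sum_apply]
    refine (Finset.sum_eq_single_of_mem a (Finset.mem_univ _)
      (fun c _ hc => key p hp a a c le_rfl hc)).trans ?_
    change X p a a (Y p a a v) = (lam p a * mu p a) • v
    rw [(hY p hp).2, map_smul, (hX p hp).2, smul_smul, mul_comm]

theorem IsWeight.truncFam {S : Set Λ} {T : OpFamily K Λ (N + 1) V} {lam : Λ → Fin (N + 1) → K}
    {v : V} (h : IsWeight S T lam v) : IsWeight S (truncFam T) (fun p a => lam p a.succ) v :=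
  fun p hp => ⟨fun a b hab => (h p hp).1 _ _ (Fin.succ_lt_succ_iff.2 hab), fun a => (h p hp).2 _⟩

theorem IsWeight.liftFam {S : Set Λ} {T : OpFamily K Λ (m + 1) V} {lam : Λ → Fin (m + 1) → K}
    {v : V} (h : IsWeight S T lam v) (w : List Λ) :
    IsWeight S (liftFam (Λ → Fin (m + 1)) T) lam (slotVec (K := K) w v) := by
  intro p hp
  refine ⟨fun a b hab => ?_, fun a => ?_⟩
  · funext f
    rw [liftFam_apply, slotVec_apply]
    split_ifs
    · exact (h p hp).1 a b hab
    · exact map_zero _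
  · funext f
    rw [liftFam_apply, Pi.smul_apply, slotVec_apply]
    split_ifs
    · exact (h p hp).2 a
    · rw [map_zero, smul_zero]

theorem slotVec_update {w : List Λ} {p : Λ} (hp : p ∈ w) (v : V) (f : Λ → Fin (m + 1))
    {c : Fin (m + 1)} (hc : c ≠ 0) : slotVec (K := K) w v (Function.update f p c) = 0 := by
  rw [slotVec_apply, if_neg]
  intro h
  exact hc (by simpa using h p hp)

/-- The index zero is the highest one in the evaluation representation. Only the matrix unit
`E_{00}` acts nontrivially, and it adds `(u q - u p)⁻¹` to the eigenvalue of the first diagonal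
entry. -/
theorem isWeight_slotL (u : Λ → K) {w : List Λ} {p : Λ} (hp : p ∈ w) (v : V) :
    IsWeight Set.univ (slotL u p) (fun q a => if a = 0 then 1 + (u q - u p)⁻¹ else 1)
      (slotVec (K := K) (m := m) w v) := by
  intro q _
  refine ⟨fun a b hab => ?_, fun a => ?_⟩
  · funext f
    rw [slotL_apply, if_neg hab.ne', zero_add, slotVec_update hp v f ((Fin.zero_le a).trans_lt hab).ne']
    simp
  · funext f
    rw [slotL_apply, if_pos rfl, Pi.smul_apply]
    by_cases h1 : f p = a
    · rw [if_pos h1, ← h1, Function.update_eq_self]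
      beta_reduce
      split_ifs with h2
      · rw [add_smul, one_smul]
      · rw [slotVec_apply, if_neg (fun h => h2 (h p hp))]
        simp
    · rw [if_neg h1, smul_zero, add_zero]
      beta_reduce
      split_ifs with h2
      · rw [slotVec_apply, if_neg (fun h => h1 ((h p hp).trans h2.symm)), smul_zero]
      · rw [one_smul]

theorem isWeight_one (v : V) : IsWeight (K := K) (Set.univ : Set Λ) (1 : OpFamily K Λ N V)
    (fun _ _ => 1) v := by
  intro p _
  refine ⟨fun a b hab => ?_, fun a => ?_⟩
  · rw [Pi.one_apply, Matrix.one_apply_ne hab.ne', LinearMap.zero_apply]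
  · rw [Pi.one_apply, Matrix.one_apply_eq, one_smul, Module.End.one_apply]

theorem isWeight_slotLs (u : Λ → K) {w w' : List Λ} (hw : w.Nodup) (h : ∀ p ∈ w, p ∈ w') (v : V) :
    IsWeight Set.univ (slotLs u w)
      (fun q a => if a = 0 then (w.map fun p => 1 + (u q - u p)⁻¹).prod else 1)
      (slotVec (K := K) (m := m) w' v) := by
  induction w with
  | nil =>
    rw [slotLs_nil]
    simpa using isWeight_one _
  | cons p w ih =>
    rw [List.nodup_cons] at hw
    have := (isWeight_slotL u (h p (by simp)) v).mul (ih hw.2 fun q hq => h q (by simp [hq]))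
      (slotL_commute_slotLs u hw.1)
    rw [slotLs_cons]
    convert this using 3
    split_ifs <;> simp

/-- The vacuum has index zero in the slot, so only the column zero of `D` acts. Singularity removes
its entries below the diagonal, and the diagonal entry acts by its eigenvalue. -/
theorem slotOps_slotVec {S : Set Λ} {D : OpFamily K Λ (m + 1) V} {lam : Λ → Fin (m + 1) → K} {v : V}
    (h : IsWeight S D lam v) {w w' : List Λ} (hw : ∀ p ∈ w, p ∈ S ∧ p ∈ w') :
    slotOps D w (slotVec (K := K) w' v) = (w.map fun p => lam p 0).prod • slotVec (K := K) w' v := by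
  induction w with
  | nil => simp [slotOps]
  | cons p w ih =>
    have h1 : slotOp (D p) p (slotVec (K := K) w' v) = lam p 0 • slotVec (K := K) w' v := by
      funext f
      rw [slotOp_apply, Finset.sum_eq_single_of_mem 0 (Finset.mem_univ _) fun g _ hg => by
        rw [slotVec_update (hw p (by simp)).2 v f hg, map_zero], Pi.smul_apply]
      by_cases h2 : f p = 0
      · rw [← h2, Function.update_eq_self, h2, slotVec_apply]
        split_ifs
        · exact (h p (hw p (by simp)).1).2 0
        · simp
      · rw [slotVec_apply w' v f, if_neg (fun h => h2 (h p (hw p (by simp)).2)), smul_zero,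
          slotVec_apply]
        split_ifs
        · exact (h p (hw p (by simp)).1).1 0 _ (Fin.pos_of_ne_zero h2)
        · simp
    rw [slotOps, Module.End.mul_apply, h1, map_smul, ih fun q hq => hw q (by simp [hq])]
    simp [smul_smul]

end slots

/-! ### Composition of Bethe operators and decomposition of the product row -/

section regroup
variable {K : Type*} [Field K] {Λ : Type} [DecidableEq Λ] {N m : ℕ}
  {V V' : Type v} [AddCommGroup V] [Module K V] [AddCommGroup V'] [Module K V']

open Classical in
/-- The restriction of the indices: they vanish in the slots of the first list, and the function is
constant in all the slots that are not in the second one. -/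
noncomputable def slotMask (I J : List Λ) : Module.End K (SlotSpace Λ (m + 1) V) where
  toFun x f := if ∀ p ∈ I, f p = 0 then x (fun p => if p ∈ J then f p else 0) else 0
  map_add' x y := by ext f; simp only [Pi.add_apply]; split_ifs <;> simp
  map_smul' c x := by ext f; simp only [Pi.smul_apply, RingHom.id_apply]; split_ifs <;> simp

open Classical in
theorem slotMask_apply (I J : List Λ) (x : SlotSpace Λ (m + 1) V) (f : Λ → Fin (m + 1)) :
    slotMask (K := K) I J x f = if ∀ p ∈ I, f p = 0 then x (fun p => if p ∈ J then f p else 0) else 0 :=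
  rfl

theorem slotMask_commute_liftOp (I J : List Λ) (X : Module.End K V) :
    Commute (slotMask (m := m) I J) (liftOp _ X) := by
  ext x f
  simp only [Module.End.mul_apply, liftOp_apply, slotMask_apply]
  split_ifs <;> simp

theorem mask_update {J : List Λ} {p : Λ} (hp : p ∈ J) (f : Λ → Fin (m + 1)) (g : Fin (m + 1)) :
    (fun q => if q ∈ J then Function.update f p g q else 0) =
      Function.update (fun q => if q ∈ J then f q else 0) p g := by
  funext q
  by_cases h : q = p
  · subst h; simp [hp]
  · simp [h]

theorem forall_update_iff {I : List Λ} {p : Λ} (hp : p ∉ I) (f : Λ → Fin (m + 1)) (g : Fin (m + 1)) :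
    (∀ q ∈ I, Function.update f p g q = 0) ↔ ∀ q ∈ I, f q = 0 := by
  refine forall₂_congr fun q hq => ?_
  rw [Function.update_of_ne (ne_of_mem_of_not_mem hq hp)]

theorem slotMask_commute_slotSet {I J : List Λ} {p : Λ} (hI : p ∉ I) (hJ : p ∈ J) (g : Fin (m + 1)) :
    Commute (slotMask (K := K) (V := V) I J) (slotSet p g) := by
  ext x f
  simp only [Module.End.mul_apply, slotSet_apply, slotMask_apply, forall_update_iff hI,
    mask_update hJ]

theorem slotMask_commute_slotE {I J : List Λ} {p : Λ} (hI : p ∉ I) (hJ : p ∈ J)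
    (a b : Fin (m + 1)) : Commute (slotMask (K := K) (V := V) I J) (slotE p a b) := by
  ext x f
  simp only [Module.End.mul_apply, slotE_apply, slotMask_apply, forall_update_iff hI,
    mask_update hJ, hJ, if_true]
  split_ifs <;> rfl

theorem slotMask_slotVec (I J : List Λ) (v : V) :
    slotMask (K := K) (m := m) I J (slotVec (K := K) J v) = slotVec (K := K) (I ++ J) v := by
  funext f
  rw [slotMask_apply, slotVec_apply, slotVec_apply]
  have h1 : (∀ p ∈ J, (if p ∈ J then f p else 0) = 0) ↔ ∀ p ∈ J, f p = 0 :=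
    forall₂_congr fun p hp => by rw [if_pos hp]
  have h2 : (∀ p ∈ I ++ J, f p = 0) ↔ (∀ p ∈ I, f p = 0) ∧ ∀ p ∈ J, f p = 0 := by
    simp only [List.mem_append, or_imp, forall_and]
  simp only [h1, h2, ite_and]

theorem commute_liftFam_mul_slotLs {X : OpFamily K Λ N V} {w : List Λ} (u : Λ → K)
    {S : Module.End K (SlotSpace Λ N V)} {q : Λ} (h1 : ∀ a b, Commute S (liftOp _ (X q a b)))
    (h2 : ∀ p ∈ w, ∀ a b, Commute S (slotE p a b)) (a b : Fin N) :
    Commute S ((liftFam (Λ → Fin N) X * slotLs u w : OpFamily K Λ N (SlotSpace Λ N V)) q a b) :=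
  commute_matrix_mul h1 (commute_slotLs u h2 q) a b

/-- The composition of nested Bethe operators for commuting families. -/
theorem nestedBethe_comp (u : Λ → K) {Q R : Fin (m + 1) → List Λ} (hQ : IsSimple Q) (hR : IsSimple R)
    (hQR : ∀ p ∈ Q 0, p ∉ R 0) {T₁ T₂ : OpFamily K Λ (m + 2) V} (h12 : FamCommute T₁ T₂) (v : V) :
    rowOps (firstRow T₁) (R 0) (rowOps (firstRow T₂) (Q 0) (nestedBethe u m (fun a => Q a.succ)
      (liftFam (Λ → Fin (m + 1)) (truncFam T₂) * slotLs u (Q 0)) (nestedBethe u m (fun a => R a.succ)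
        (liftFam (Λ → Fin (m + 1)) (truncFam T₁) * slotLs u (R 0))
          (slotVec (K := K) (Q 0 ++ R 0) v)))) (fun _ => 0) =
      nestedBethe u (m + 1) Q T₂ (nestedBethe u (m + 1) R T₁ v) := by
  have hl : ∀ p q a b c d, Commute (liftOp (Λ → Fin (m + 1)) (T₁ p a b)) (liftOp _ (T₂ q c d)) :=
    fun p q a b c d => (h12 p q a b c d).map _
  have hrow : ∀ (S : Module.End K (SlotSpace Λ (m + 1) V)),
      (∀ p g, Commute S (liftOp _ (firstRow T₁ p g))) → (∀ p ∈ R 0, ∀ g, Commute S (slotSet p g)) →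
      Commute S (rowOps (firstRow T₁) (R 0)) := fun S hS hS' =>
    commute_rowOps (fun p hp g => hS p g) hS'
  have hc : Commute (rowOps (firstRow T₂) (Q 0)) (rowOps (firstRow T₁) (R 0)) := by
    refine hrow _ (fun p g => (commute_rowOps (fun q hq g' => hl _ _ _ _ _ _)
      fun q hq g' => liftOp_commute_slotSet _ _ _).symm) fun p hp g => ?_
    refine (commute_rowOps (fun q hq g' => (liftOp_commute_slotSet _ _ _).symm) fun q hq g' => ?_).symm
    exact slotSet_commute (ne_of_mem_of_not_mem hq fun h => hQR _ h hp).symm _ _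
  have hc' : ∀ q a b, Commute (rowOps (firstRow T₁) (R 0))
      ((liftFam (Λ → Fin (m + 1)) (truncFam T₂) * slotLs u (Q 0) :
        OpFamily K Λ (m + 1) (SlotSpace Λ (m + 1) V)) q a b) := by
    refine fun q => commute_liftFam_mul_slotLs u (fun a b => ?_) fun p hp a b => ?_
    · exact (hrow _ (fun p g => (hl _ _ _ _ _ _).symm) fun p _ g => liftOp_commute_slotSet _ _ _).symm
    · exact (hrow _ (fun p g => (liftOp_commute_slotE _ _ _ _).symm) fun r hr g =>
        (slotSet_commute_slotE (ne_of_mem_of_not_mem hr (hQR p hp)) _ _ _).symm).symm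
  -- The contractions for `T₁` commute with everything built from `T₂`, because the families commute
  -- and the slots are disjoint. They are moved to the right past the contractions and the Bethe
  -- operator for `T₂`.
  rw [← Module.End.mul_apply, ← hc.eq, Module.End.mul_apply]
  rw [nestedBethe_intertwine hQ.tail _ (fun q _ a b x => LinearMap.congr_fun (hc' q a b).eq x)]
  rw [nestedBethe_succ u Q]
  refine congrArg (fun z => rowOps (firstRow T₂) (Q 0) (nestedBethe u m (fun a => Q a.succ)
    (liftFam (Λ → Fin (m + 1)) (truncFam T₂) * slotLs u (Q 0)) z) fun _ => 0) ?_
  have hR0 : ∀ p ∈ R 0, p ∉ Q 0 := fun p hp hq => hQR p hq hp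
  have hM : ∀ q a b, Commute (slotMask (Q 0) (R 0))
      ((liftFam (Λ → Fin (m + 1)) (truncFam T₁) * slotLs u (R 0) :
        OpFamily K Λ (m + 1) (SlotSpace Λ (m + 1) V)) q a b) := fun q =>
    commute_liftFam_mul_slotLs u (fun a b => slotMask_commute_liftOp _ _ _) fun p hp a b =>
      slotMask_commute_slotE (hR0 p hp) hp _ _
  have hM' := hrow (slotMask (Q 0) (R 0)) (fun p g => slotMask_commute_liftOp _ _ _)
    fun p hp g => slotMask_commute_slotSet (hR0 p hp) hp _
  -- The joint vacuum is the vacuum in the slots of `R 0` followed by a mask that freezes the slots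
  -- of `Q 0`. The mask commutes with everything built from `T₁` and is taken out on the left.
  rw [← slotMask_slotVec (K := K),
    ← nestedBethe_intertwine hR.tail _ (fun q _ a b x => LinearMap.congr_fun (hM q a b).eq x),
    ← Module.End.mul_apply, ← hM'.eq, Module.End.mul_apply, nestedBethe_succ u R]
  funext f
  rw [slotMask_apply, slotVec_apply]
  -- Once the slots of `R 0` are contracted nothing depends on their indices, so the remaining value
  -- is that at the zero function.
  congr 1
  exact rowOps_congr (hR.nodup 0) _ fun p hp => if_neg hp

/-- The operator with the entries of the first row of the second family. -/
def exchPair (u : Λ → K) (T₁ T₂ : OpFamily K Λ (N + 1) V) (p q : Λ) :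
    Module.End K (exchSpace N V u) :=
  ∑ c : Fin N, exchOp u (T₂ p 0 c.succ) * ∑ g : Fin N, exchOp u (T₁ q c.succ g.succ) * exchPsi u q g

theorem exchPair_apply (u : Λ → K) (T₁ T₂ : OpFamily K Λ (N + 1) V) (p : Λ) (G : exchSpace N V u)
    (w : List Λ) : (exchPair u T₁ T₂ p p G).1 w =
      rowOp (firstRow T₂ p) p (slotOp (truncFam T₁ p) p (G.1 (p :: w))) := by
  funext f
  rw [exchPair, LinearMap.sum_apply, AddSubmonoidClass.coe_finsetSum]
  simp only [Finset.sum_apply, Module.End.mul_apply, exchOp_apply, rowOp_apply, firstRow,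
    LinearMap.sum_apply, slotOp_apply, Function.update_self, Function.update_idem, map_sum,
    AddSubmonoidClass.coe_finsetSum, exchPsi_apply, truncFam_apply]

theorem exchPair_prod_apply (u : Λ → K) {T₁ T₂ : OpFamily K Λ (N + 1) V} (h12 : FamCommute T₁ T₂)
    {l : List Λ} (hl : l.Nodup) (G : exchSpace N V u) (w : List Λ) :
    (((l.reverse.map fun p => exchPair u T₁ T₂ p p).prod G).1 w) =
      rowOps (firstRow T₂) l (slotOps (truncFam T₁) l (G.1 (l ++ w))) := by
  induction l generalizing G with
  | nil => rfl
  | cons p l ih =>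
    rw [List.nodup_cons] at hl
    rw [List.reverse_cons, List.map_append, List.prod_append, Module.End.mul_apply, ih hl.2]
    simp only [List.map_cons, List.map_nil, List.prod_cons, List.prod_nil, mul_one, exchPair_apply,
      rowOps, slotOps, Module.End.mul_apply, List.cons_append]
    -- Each factor of the product acts by `T₁` in its slot and then contracts the slot with `T₂`.
    -- Since the slots differ and the families commute, all the actions can be carried out before
    -- all the contractions.
    have hc : Commute (slotOps (truncFam T₁) l) (rowOp (firstRow T₂ p) p) := by
      refine commute_rowOp (fun g => (commute_slotOps (fun q hq a b => ?_) fun q hq a b => ?_).symm)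
        fun g => (commute_slotOps (fun q hq a b => ?_) fun q hq a b => ?_).symm
      · exact (h12 _ _ _ _ _ _).symm.map _
      · exact liftOp_commute_slotE _ _ _ _
      · exact (liftOp_commute_slotSet _ _ _).symm
      · exact slotSet_commute_slotE (ne_of_mem_of_not_mem hq hl.1).symm _ _ _
    refine congrArg _ ?_
    rw [← Module.End.mul_apply, hc.eq, Module.End.mul_apply]

/-- The sum over the intermediate index of `T₂ * T₁` is split into the index zero and the other
ones. -/
theorem exchRow_mul (u : Λ → K) {T₁ T₂ : OpFamily K Λ (N + 1) V} (p : Λ) :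
    exchRow u (T₂ * T₁) p = exchPair u T₁ T₂ p p + exchOp u (T₂ p 0 0) * exchRow u T₁ p := by
  have h : ∀ g : Fin N, (T₂ * T₁) p 0 g.succ = T₂ p 0 0 * T₁ p 0 g.succ +
      ∑ c : Fin N, T₂ p 0 c.succ * T₁ p c.succ g.succ := by
    intro g
    rw [Pi.mul_apply, Matrix.mul_apply, Fin.sum_univ_succ]
  simp only [exchRow, exchPair, h, map_add, map_mul, map_sum, add_mul, Finset.sum_add_distrib,
    Finset.mul_sum, Finset.sum_mul, ← mul_assoc]
  rw [add_comm, Finset.sum_comm]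

end regroup

/-! ### The first color for a product of two families -/

section coproduct
variable {K : Type*} [Field K] {Λ : Type} [DecidableEq Λ] {N m : ℕ}
  {V V' : Type v} [AddCommGroup V] [Module K V] [AddCommGroup V'] [Module K V']

/-- The relation of equality of vectors that are singular and eigenvectors with respect to the entries
of the first column of `T`. -/
def columnRel (S S₀ : Set Λ) (T : OpFamily K Λ (m + 2) V) (lam : Λ → K) (X : Set Λ) :
    Submodule K (V × V) where
  carrier := {z | z.1 = z.2 ∧ ∀ q ∈ X, q ∈ S →
    (∀ c : Fin (m + 1), T q c.succ 0 z.1 = 0) ∧ (q ∈ S₀ → T q 0 0 z.1 = lam q • z.1)}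
  zero_mem' := by simp
  add_mem' := by
    rintro ⟨x, x'⟩ ⟨y, y'⟩ ⟨h, h1⟩ ⟨h', h1'⟩
    refine ⟨congrArg₂ (· + ·) h h', fun q hq hqS => ⟨fun c => ?_, fun hq0 => ?_⟩⟩
    · exact (map_add _ _ _).trans (by rw [(h1 q hq hqS).1, (h1' q hq hqS).1, add_zero])
    · exact (map_add _ _ _).trans (by
        rw [(h1 q hq hqS).2 hq0, (h1' q hq hqS).2 hq0, ← smul_add]; rfl)
  smul_mem' := by
    rintro c ⟨x, x'⟩ ⟨h, h1⟩
    refine ⟨congrArg (c • ·) h, fun q hq hqS => ⟨fun c => ?_, fun hq0 => ?_⟩⟩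
    · exact (map_smul _ _ _).trans (by rw [(h1 q hq hqS).1, smul_zero])
    · exact (map_smul _ _ _).trans (by rw [(h1 q hq hqS).2 hq0, smul_comm]; rfl)

theorem mem_columnRel_map_of_commute {S S₀ X : Set Λ} {T : OpFamily K Λ (m + 2) V} {lam : Λ → K}
    {F : Module.End K V} (hF : ∀ q a b, Commute F (T q a b)) {x : V}
    (hx : (x, x) ∈ columnRel S S₀ T lam X) : (F x, F x) ∈ columnRel S S₀ T lam X := by
  refine ⟨rfl, fun q hq hqS => ⟨fun c => ?_, fun hq0 => ?_⟩⟩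
  · have := LinearMap.congr_fun (hF q c.succ 0).eq x
    exact this.symm.trans ((congrArg F ((hx.2 q hq hqS).1 c)).trans (map_zero _))
  · have := LinearMap.congr_fun (hF q 0 0).eq x
    exact this.symm.trans ((congrArg F ((hx.2 q hq hqS).2 hq0)).trans (map_smul _ _ _))

/-- For `q ≠ p` the RTT relation between `T q c 0` and `T p a.succ e.succ` has exchange terms ending
in entries of the first column below the diagonal. These annihilate `x`, so the two operators
commute on `x`. This needs `q ≠ p`, so the label `p` is removed from `X`. -/
theorem mem_columnRel_map {u : Λ → K} (hu : Function.Injective u) {S S₀ X : Set Λ}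
    {T : OpFamily K Λ (m + 2) V} (hT : IsRTT u S T) {lam : Λ → K} {p : Λ} (hp : p ∈ X) (hpS : p ∈ S)
    (a e : Fin (m + 1)) {x : V} (hx : (x, x) ∈ columnRel S S₀ T lam X) :
    (T p a.succ e.succ x, T p a.succ e.succ x) ∈ columnRel S S₀ T lam (X \ {p}) := by
  refine ⟨rfl, fun q hq hqS => ?_⟩
  have hqp : u q - u p ≠ 0 := fun e => hq.2 (hu (sub_eq_zero.1 e))
  have h1 := hx.2 q hq.1 hqS
  have h2 := hx.2 p hp hpS
  have key : ∀ c : Fin (m + 2), T q c 0 (T p a.succ e.succ x) = T p a.succ e.succ (T q c 0 x) := by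
    intro c
    have := LinearMap.congr_fun (hT.rel' hqS hpS c 0 a.succ e.succ) x
    simp only [LinearMap.add_apply, LinearMap.smul_apply, Module.End.mul_apply] at this
    rw [h1.1 a, h2.1 a, map_zero, map_zero, add_zero, add_zero] at this
    exact smul_right_injective V hqp this
  refine ⟨fun c => (key _).trans ?_, fun hq0 => (key _).trans ?_⟩
  · exact (congrArg _ (h1.1 c)).trans (map_zero _)
  · exact (congrArg _ (h1.2 hq0)).trans (map_smul _ _ _)

/-- Truncation of `T₂ * T₁` differs from the product of truncations by `T₂ a.succ 0 * T₁ 0 c.succ`.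
On the vectors that occur in the recursion this vanishes, because the first column of `T₂`
annihilates them below the diagonal. The invariant `columnRel` carries this property and the
eigenvalues of `T₂ q 0 0` through the recursion, together with the equality of the two vectors. -/
theorem nestedBethe_truncFam_mul {u : Λ → K} (hu : Function.Injective u) {S S₀ : Set Λ}
    {P : Fin m → List Λ} (hP : IsSimple P) (hPS : labels P ⊆ S) {T₁ T₂ : OpFamily K Λ (m + 2) V}
    (hT : IsRTT u S T₂) (h12 : FamCommute T₁ T₂) {lam : Λ → Fin (m + 2) → K} {v : V}
    (hv : IsWeight S T₂ lam v) (w : List Λ) (f : Λ → Fin (m + 1)) :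
    (nestedBethe u m P (liftFam (Λ → Fin (m + 1)) (truncFam (T₂ * T₁)) * slotLs u w)
        (slotVec (K := K) w v) f,
      nestedBethe u m P (liftFam (Λ → Fin (m + 1)) (truncFam T₂ * truncFam T₁) * slotLs u w)
        (slotVec (K := K) w v) f) ∈ columnRel S S₀ T₂ (fun q => lam q 0) (Set.univ \ labels P) := by
  refine nestedBethe_rel (u := u) hP (R := fun X => slotRel (m + 1) Λ (columnRel S S₀ T₂
    (fun q => lam q 0) X)) ?_ (Set.subset_univ _)
    (z := (slotVec (K := K) w v, slotVec (K := K) w v)) ?_ f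
  · intro X p hpX hp a b z hz
    simp only [Pi.mul_apply, Matrix.mul_apply, LinearMap.sum_apply]
    refine sum_mem_rel fun c _ => ?_
    intro f
    have h1 := slotLs_rel (u := u) w p c b hz f
    simp only [Module.End.mul_apply, liftFam_apply]
    set x := slotLs (V := V) u w p c b z.1 f with hx
    have e : slotLs (V := V) u w p c b z.2 f = x := h1.1.symm
    replace h1 : (x, slotLs (V := V) u w p c b z.2 f) ∈ columnRel S S₀ T₂ (fun q => lam q 0) X := h1
    rw [e] at h1 ⊢
    have hpS := hPS hp
    -- The factors of the extra term commute, so the entry of the first column of `T₂` can be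
    -- applied to `x` first.
    have h3 : truncFam (T₂ * T₁) p a c x = (truncFam T₂ * truncFam T₁) p a c x := by
      rw [truncFam_apply, Pi.mul_apply, Pi.mul_apply, Matrix.mul_apply, Matrix.mul_apply,
        Fin.sum_univ_succ, LinearMap.add_apply, (h12 p p 0 c.succ a.succ 0).symm.eq,
        Module.End.mul_apply, (h1.2 p hpX hpS).1 a, map_zero, zero_add]
      rfl
    change (truncFam (T₂ * T₁) p a c x, (truncFam T₂ * truncFam T₁) p a c x) ∈ _
    rw [h3, Pi.mul_apply, Matrix.mul_apply, LinearMap.sum_apply]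
    refine sum_mem_rel fun e _ => ?_
    exact mem_columnRel_map hu hT hpX hpS a e
      (mem_columnRel_map_of_commute (fun q a b => h12 _ _ _ _ _ _) h1)
  · intro f
    refine ⟨rfl, fun q _ hq => ⟨fun c => ?_, fun _ => ?_⟩⟩
    · simp only [slotVec_apply]
      split_ifs
      · exact (hv q hq).1 0 _ (Fin.succ_pos c)
      · exact map_zero _
    · simp only [slotVec_apply]
      split_ifs
      · exact (hv q hq).2 0
      · rw [map_zero, smul_zero]

theorem list_prod_apply_of_eigen {W : Type*} [AddCommGroup W] [Module K W] {F : Λ → Module.End K W}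
    {c : Λ → K} {x : W} {l : List Λ} (h : ∀ p ∈ l, F p x = c p • x) :
    (l.map F).prod x = (l.map c).prod • x := by
  induction l with
  | nil => simp
  | cons p l ih =>
    rw [List.map_cons, List.prod_cons, Module.End.mul_apply, ih fun q hq => h q (by simp [hq]), map_smul,
      h p (by simp), smul_smul, List.map_cons, List.prod_cons, mul_comm]

/-- The first step of the computation of the nested Bethe vectors for a product of two families. -/
theorem nestedBethe_mul_succ {u : Λ → K} (hu : Function.Injective u) (hu1 : ∀ p q, u p - u q + 1 ≠ 0)
    {s : Finset Λ} {P : Fin (m + 1) → List Λ} (hP : IsSimple P) (hs : P 0 = s.toList)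
    {T₁ T₂ : OpFamily K Λ (m + 2) V} (hT₁ : IsRTT u (labels P) T₁) (hT₂ : IsRTT u (labels P) T₂)
    (h12 : FamCommute T₁ T₂) {lam₁ lam₂ : Λ → Fin (m + 2) → K} {v : V}
    (hv₁ : IsWeight (labels P) T₁ lam₁ v) (hv₂ : IsWeight (labels P) T₂ lam₂ v) :
    nestedBethe u (m + 1) P (T₂ * T₁) v = ∑ I ∈ s.powerset,
      ((∏ i ∈ I, ∏ j ∈ s \ I, (1 - (u j - u i)⁻¹)) *
        ((∏ j ∈ s \ I, lam₂ j 0) * ∏ i ∈ I, lam₁ i 1)) •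
      rowOps (firstRow T₁) (s \ I).toList (rowOps (firstRow T₂) I.toList
        (nestedBethe u m (fun a => P a.succ)
          ((liftFam (Λ → Fin (m + 1)) (truncFam T₂) * slotLs u I.toList) *
            (liftFam (Λ → Fin (m + 1)) (truncFam T₁) * slotLs u (s \ I).toList))
          (slotVec (K := K) (I.toList ++ (s \ I).toList) v))) (fun _ => 0) := by
  have hs' : ∀ {p}, p ∈ s → p ∈ labels P := fun {p} hp => mem_labels_zero (by simpa [hs] using hp)
  -- The seed is built from the product of the truncated families; `hcol` identifies its values with
  -- those for the truncated product.
  set G : exchSpace (m + 1) V u :=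
    ⟨_, betheSeed_mem hu hP.tail (truncFam T₂ * truncFam T₁) v⟩ with hG
  have hGw : ∀ w : List Λ, w.Nodup → (∀ p ∈ w, p ∈ s) → G.1 w = nestedBethe u m (fun a => P a.succ)
      (liftFam (Λ → Fin (m + 1)) (truncFam T₂ * truncFam T₁) * slotLs u w) (slotVec (K := K) w v) := by
    intro w hw hws
    exact if_pos ⟨hw, fun p hp hp' => hP.notMem_zero hp' (by simpa [hs] using hws p hp)⟩
  have hcol := fun w f => nestedBethe_truncFam_mul hu (S := labels P) (S₀ := {p | p ∈ P 0}) hP.tail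
    (labels_tail_subset P) hT₂ h12 hv₂ w f
  -- In the expansion over subsets the operators `A` stand on the right, where by this fact they act
  -- on the seed as scalars.
  have hGA : ∀ p ∈ s, exchOp u (T₂ p 0 0) G = lam₂ p 0 • G := by
    intro p hp
    refine Subtype.ext ?_
    funext w f
    have hp0 : p ∈ P 0 := by simpa [hs] using hp
    have hc := hcol w f
    have hc2 := (hc.2 p ⟨Set.mem_univ _, fun h => hP.notMem_zero h hp0⟩ (hs' hp)).2 hp0
    rw [exchOp_apply, Submodule.coe_smul, Pi.smul_apply, Pi.smul_apply]
    change T₂ p 0 0 (betheSeed _ _ _ _ w f) = _ • betheSeed _ _ _ _ w f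
    simp only [betheSeed]
    split_ifs
    · rw [hc.1] at hc2
      exact hc2
    · rw [Pi.zero_apply, map_zero, smul_zero]
  have hG0 : nestedBethe u (m + 1) P (T₂ * T₁) v =
      ((fprod (fun p => exchPair u T₁ T₂ p p + exchOp u (T₂ p 0 0) * exchRow u T₁ p) s :
        Module.End K (exchSpace (m + 1) V u)) G).1 []
        (fun _ => 0) := by
    have h1 : nestedBethe u m (fun a => P a.succ)
        (liftFam (Λ → Fin (m + 1)) (truncFam (T₂ * T₁)) * slotLs u (P 0)) (slotVec (K := K) (P 0) v) =
        G.1 (P 0) := by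
      rw [hGw _ (hP.nodup 0) (by simp [hs])]
      exact funext fun f => (hcol (P 0) f).1
    have h2 := exchRow_prod_apply u (T₂ * T₁) (P 0) G []
    rw [List.append_nil] at h2
    rw [nestedBethe_succ, h1, ← h2]
    simp only [← exchRow_mul]
    rw [fprod_eq_of_perm (l := (P 0).reverse) ((List.reverse_perm _).trans (by rw [hs]))]
    exact fun p hp q hq => exchRow_commute (hT₂.mul hT₁ h12.symm) hu1 (hs' hp) (hs' hq)
  have hER := exchangeRel_of_isRTTMat (u := u) (s := s)
    (T₁ := fun p => (T₁ p).map (exchOp (N := m + 1) u))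
    (T₂ := fun p => (T₂ p).map (exchOp (N := m + 1) u)) (Y := exchPsi u)
    (isRTTMat_exchOp (hT₁.mono fun p hp => hs' hp)) (isRTTMat_exchOp (hT₂.mono fun p hp => hs' hp))
    (isZF_exchPsi u _) (fun p q a b c d => (h12 p q a b c d).map (exchOp u))
    (fun _ _ _ _ _ => exchOp_commute_exchPsi _ _ _ _)
    (fun _ _ _ _ _ => exchOp_commute_exchPsi _ _ _ _)
    (fun p _ q _ h e => h (hu (sub_eq_zero.1 e))) (fun p _ q _ => hu1 p q)
  -- The commutativity assumed in the expansion is that of the contracted rows of `T₂ * T₁`, which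
  -- is an RTT family itself.
  have hstar := hER.prod_eq (fun p hp q hq => by
    have := exchRow_commute (hT₂.mul hT₁ h12.symm) hu1 (hs' hp) (hs' hq)
    rw [exchRow_mul, exchRow_mul] at this
    exact this)
  change fprod (fun p => exchPair u T₁ T₂ p p + exchOp u (T₂ p 0 0) * exchRow u T₁ p) s =
    ∑ I ∈ s.powerset, (∏ i ∈ I, ∏ j ∈ s \ I, (1 - (u j - u i)⁻¹)) •
      (fprod (exchRow u T₁) (s \ I) * fprod (fun i => exchPair u T₁ T₂ i i) I *
        fprod (fun p => exchOp u (T₂ p 0 0)) (s \ I)) at hstar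
  rw [hG0, hstar, LinearMap.sum_apply, AddSubmonoidClass.coe_finsetSum, Finset.sum_apply,
    Finset.sum_apply]
  refine Finset.sum_congr rfl fun I hI => ?_
  rw [Finset.mem_powerset] at hI
  have hJ : ∀ p ∈ s \ I, p ∈ s := fun p hp => (Finset.mem_sdiff.1 hp).1
  have e1 : fprod (fun p => exchOp u (T₂ p 0 0)) (s \ I) G = (∏ j ∈ s \ I, lam₂ j 0) • G := by
    rw [fprod, list_prod_apply_of_eigen (c := fun p => lam₂ p 0) fun p hp => hGA p (hJ p (by simpa using hp)),
      Finset.prod_map_toList]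
  have e2 : fprod (exchRow u T₁) (s \ I) = ((s \ I).toList.reverse.map (exchRow u T₁)).prod :=
    fprod_eq_of_perm (List.reverse_perm _) fun p hp q hq => hER.bb p (hJ p hp) q (hJ q hq)
  have e3 : fprod (fun i => exchPair u T₁ T₂ i i) I =
      (I.toList.reverse.map fun i => exchPair u T₁ T₂ i i).prod :=
    fprod_eq_of_perm (List.reverse_perm _) fun p hp q hq => hER.aa p (hI hp) q (hI hq)
  rw [LinearMap.smul_apply, Module.End.mul_apply, Module.End.mul_apply, e1, map_smul, map_smul,
    smul_smul, Submodule.coe_smul, Pi.smul_apply, Pi.smul_apply, e2, exchRow_prod_apply, e3,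
    exchPair_prod_apply u h12 I.nodup_toList, List.append_nil]
  have hnd : (I.toList ++ (s \ I).toList).Nodup := by
    refine List.nodup_append.2 ⟨I.nodup_toList, Finset.nodup_toList _, ?_⟩
    intro a ha b hb
    rw [Finset.mem_toList] at ha hb
    exact fun e => (Finset.mem_sdiff.1 hb).2 (e ▸ ha)
  rw [hGw _ hnd (by
    intro p hp
    rw [List.mem_append, Finset.mem_toList, Finset.mem_toList] at hp
    exact hp.elim (fun h => hI h) (hJ p))]
  -- The action of `T₁` in the slots of `I` intertwines the order in which both families precede all
  -- the L-operators with the order in which the L-operators of `I` stand before `T₁`. Each family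
  -- is then grouped with its own L-operators. On the vacuum the intertwiner is the scalar `∏ i ∈ I,
  -- lam₁ i 1`.
  have hinter := nestedBethe_intertwine (u := u) hP.tail
    (T := liftFam (Λ → Fin (m + 1)) (truncFam T₂ * truncFam T₁) *
      slotLs u (I.toList ++ (s \ I).toList))
    (T' := (liftFam (Λ → Fin (m + 1)) (truncFam T₂) * slotLs u I.toList) *
            (liftFam (Λ → Fin (m + 1)) (truncFam T₁) * slotLs u (s \ I).toList))
    (slotOps (truncFam T₁) I.toList) (by
      intro q hq a b x
      have hqs : ∀ p ∈ I.toList, p ∈ labels P ∧ u p - u q ≠ 0 := by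
        intro p hp
        rw [Finset.mem_toList] at hp
        refine ⟨hs' (hI hp), fun e => ?_⟩
        have := hP.notMem_zero hq
        rw [hs, Finset.mem_toList] at this
        exact this (hu (sub_eq_zero.1 e) ▸ hI hp)
      have h2 : ∀ a b, slotOps (truncFam T₁) I.toList * liftFam (Λ → Fin (m + 1)) (truncFam T₂) q a b =
          liftFam (Λ → Fin (m + 1)) (truncFam T₂) q a b * slotOps (truncFam T₁) I.toList := by
        intro a b
        exact (commute_slotOps (fun p _ a' b' => (h12 _ _ _ _ _ _).symm.map _)
          fun p _ a' b' => liftOp_commute_slotE _ _ _ _).symm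
      have h3 : ∀ a b, slotOps (truncFam T₁) I.toList * slotLs u (s \ I).toList q a b =
          slotLs u (s \ I).toList q a b * slotOps (truncFam T₁) I.toList := by
        refine commute_slotLs u (fun r hr a b => (commute_slotOps (fun p _ a' b' =>
          (liftOp_commute_slotE _ _ _ _).symm) fun p hp a' b' => slotE_commute ?_ _ _ _ _).symm) q
        rintro rfl
        rw [Finset.mem_toList] at hr hp
        exact (Finset.mem_sdiff.1 hr).2 hp
      have h4 := intertwine_mul h2 (intertwine_mul (fun a b =>
        slotOps_mul hT₁.truncFam I.nodup_toList hqs (labels_tail_subset P hq) a b) h3) a b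
      have h5 : (liftFam (Λ → Fin (m + 1)) (truncFam T₂) *
          ((liftFam (Λ → Fin (m + 1)) (truncFam T₁) * slotLs u I.toList) * slotLs u (s \ I).toList)) =
          liftFam (Λ → Fin (m + 1)) (truncFam T₂ * truncFam T₁) *
            slotLs u (I.toList ++ (s \ I).toList) := by
        rw [liftFam_mul, slotLs_append]; simp only [mul_assoc]
      have h6 : (liftFam (Λ → Fin (m + 1)) (truncFam T₂) *
          ((slotLs u I.toList * liftFam (Λ → Fin (m + 1)) (truncFam T₁)) * slotLs u (s \ I).toList)) =
          (liftFam (Λ → Fin (m + 1)) (truncFam T₂) * slotLs u I.toList) *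
            (liftFam (Λ → Fin (m + 1)) (truncFam T₁) * slotLs u (s \ I).toList) := by
        simp only [mul_assoc]
      rw [← h5, ← h6]
      exact LinearMap.congr_fun h4 x) (slotVec (K := K) (I.toList ++ (s \ I).toList) v)
  rw [hinter, slotOps_slotVec hv₁.truncFam (fun p hp => ⟨hs' (hI (by simpa using hp)), by simp [hp]⟩),
    Finset.prod_map_toList, map_smul, map_smul, map_smul, Pi.smul_apply, smul_smul, mul_assoc]
  rfl

end coproduct

/-! ### Separation of the first color in sums and products -/

theorem sum_piFinset_succ {m : ℕ} {α M : Type*} [AddCommMonoid M] (S : Fin (m + 1) → Finset α)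
    (g : (Fin (m + 1) → α) → M) : ∑ Q ∈ Fintype.piFinset S, g Q =
      ∑ I ∈ S 0, ∑ Q ∈ Fintype.piFinset (fun a => S a.succ), g (Fin.cons I Q) := by
  rw [← Finset.sum_product']
  refine Finset.sum_nbij' (fun Q => (Q 0, Fin.tail Q)) (fun z => Fin.cons z.1 z.2) ?_ ?_ ?_ ?_ ?_
  · intro Q hQ
    rw [Fin.mem_piFinset_iff_zero_tail] at hQ
    exact Finset.mem_product.2 hQ
  · intro z hz
    rw [Fin.mem_piFinset_iff_zero_tail]
    exact Finset.mem_product.1 hz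
  · intro Q _
    exact Fin.cons_self_tail Q
  · intro z _
    rfl
  · intro Q _
    rw [Fin.cons_self_tail]

theorem prod_neighbours_succ {m : ℕ} {M : Type*} [CommMonoid M] (G : Fin (m + 1) → Fin (m + 1) → M) :
    (∏ a : Fin (m + 1), ∏ b : Fin (m + 1), if b.val = a.val + 1 then G a b else 1) =
      (∏ b : Fin m, if b.castSucc = 0 then G 0 b.succ else 1) *
        ∏ a : Fin m, ∏ b : Fin m, if b.val = a.val + 1 then G a.succ b.succ else 1 := by
  have h0 : ∀ a : Fin (m + 1), ¬ (0 : Fin (m + 1)).val = a.val + 1 := fun a => by simp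
  rw [Fin.prod_univ_succ]
  congr 1
  · rw [Fin.prod_univ_succ, if_neg (h0 _), one_mul]
    refine Finset.prod_congr rfl fun b _ => ?_
    have h : b.succ.val = (0 : Fin (m + 1)).val + 1 ↔ b.castSucc = 0 := by
      rw [Fin.ext_iff]; simp
    rw [if_congr h rfl rfl]
  · refine Finset.prod_congr rfl fun a _ => ?_
    rw [Fin.prod_univ_succ, if_neg (h0 _), one_mul]
    refine Finset.prod_congr rfl fun b _ => ?_
    have h : b.succ.val = a.succ.val + 1 ↔ b.val = a.val + 1 := by simp
    rw [if_congr h rfl rfl]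

/-! ### Bethe vectors for a product of two families -/

section coproduct
variable {K : Type*} [Field K] {Λ : Type} [DecidableEq Λ] {m : ℕ}
  {V V' : Type v} [AddCommGroup V] [Module K V] [AddCommGroup V'] [Module K V']

/-- The coefficient in the formula for nested Bethe vectors for a product of two families. -/
def splitCoeff (u : Λ → K) (P Q : Fin m → Finset Λ) (lam₁ lam₂ : Λ → Fin (m + 1) → K) : K :=
  (∏ a, ((∏ i ∈ Q a, ∏ j ∈ P a \ Q a, (1 - (u j - u i)⁻¹)) *
    ((∏ j ∈ P a \ Q a, lam₂ j a.castSucc) * ∏ i ∈ Q a, lam₁ i a.succ))) *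
  ∏ a : Fin m, ∏ b : Fin m, if b.val = a.val + 1 then
    ∏ j ∈ P b \ Q b, ∏ i ∈ Q a, (1 + (u j - u i)⁻¹) else 1

/-- The factors between the first two colors are absorbed into the eigenvalues of the next level:
they are the eigenvalues of the L-operators of `Q 0` on their vacuum. The coefficient contains
`lam₁` only at successor indices, so the modification `c₁` of the index zero is arbitrary. -/
theorem splitCoeff_succ (u : Λ → K) (P Q : Fin (m + 1) → Finset Λ)
    (lam₁ lam₂ : Λ → Fin (m + 2) → K) (c₁ : Λ → K) :
    splitCoeff u P Q lam₁ lam₂ =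
      ((∏ i ∈ Q 0, ∏ j ∈ P 0 \ Q 0, (1 - (u j - u i)⁻¹)) *
        ((∏ j ∈ P 0 \ Q 0, lam₂ j 0) * ∏ i ∈ Q 0, lam₁ i 1)) *
      splitCoeff u (fun a : Fin m => P a.succ) (fun a => Q a.succ)
        (fun q a => lam₁ q a.succ * if a = 0 then c₁ q else 1)
        (fun q a => lam₂ q a.succ * if a = 0 then ∏ i ∈ Q 0, (1 + (u q - u i)⁻¹) else 1) := by
  have h1 : ∀ x : Fin m, (if x.castSucc = 0 then ∏ j ∈ P x.succ \ Q x.succ, ∏ i ∈ Q 0,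
      (1 + (u j - u i)⁻¹) else 1) = ∏ j ∈ P x.succ \ Q x.succ,
        if x.castSucc = 0 then ∏ i ∈ Q 0, (1 + (u j - u i)⁻¹) else 1 := by
    intro x
    split_ifs <;> simp
  rw [splitCoeff, splitCoeff, prod_neighbours_succ, Fin.prod_univ_succ]
  simp only [h1, Fin.castSucc_zero, Fin.succ_zero_eq_one, Fin.succ_ne_zero, if_false, mul_one,
    Finset.prod_mul_distrib, Fin.succ_castSucc]
  ring

/-- Nested Bethe operators for sets of labels. -/
noncomputable def finBethe (u : Λ → K) (m : ℕ) (P : Fin m → Finset Λ) (T : OpFamily K Λ (m + 1) V) :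
    V →ₗ[K] V := nestedBethe u m (fun a => (P a).toList) T

theorem isSimple_toList_iff {P : Fin m → Finset Λ} :
    (IsSimple fun a => (P a).toList) ↔ ∀ a b, a ≠ b → Disjoint (P a) (P b) := by
  constructor
  · intro h a b hab
    rw [Finset.disjoint_left]
    intro p hp
    simpa using h.disj a b hab p (by simpa using hp)
  · intro h
    refine ⟨fun a => Finset.nodup_toList _, fun a b hab p hp => ?_⟩
    have := Finset.disjoint_left.1 (h a b hab) (by simpa using hp)
    simpa using this

theorem IsSimple.of_subset {P Q : Fin m → Finset Λ} (h : IsSimple fun a => (P a).toList)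
    (hQ : ∀ a, Q a ⊆ P a) : IsSimple fun a => (Q a).toList := by
  rw [isSimple_toList_iff] at h ⊢
  exact fun a b hab => (h a b hab).mono (hQ a) (hQ b)

/-- The nested Bethe vectors for a product of two commuting families. -/
theorem finBethe_mul {u : Λ → K} (hu : Function.Injective u) (hu1 : ∀ p q, u p - u q + 1 ≠ 0)
    {P : Fin m → Finset Λ} (hP : IsSimple fun a => (P a).toList)
    {T₁ T₂ : OpFamily K Λ (m + 1) V} (hT₁ : IsRTT u (labels fun a => (P a).toList) T₁)
    (hT₂ : IsRTT u (labels fun a => (P a).toList) T₂)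
    (h12 : FamCommute T₁ T₂) {lam₁ lam₂ : Λ → Fin (m + 1) → K} {v : V}
    (hv₁ : IsWeight (labels fun a => (P a).toList) T₁ lam₁ v)
    (hv₂ : IsWeight (labels fun a => (P a).toList) T₂ lam₂ v) :
    finBethe u m P (T₂ * T₁) v = ∑ Q ∈ Fintype.piFinset fun a => (P a).powerset,
      splitCoeff u P Q lam₁ lam₂ • finBethe u m Q T₂ (finBethe u m (fun a => P a \ Q a) T₁ v) := by
  induction m generalizing V with
  | zero =>
    have h : (Fintype.piFinset fun a : Fin 0 => (P a).powerset) = {P} := by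
      ext Q
      rw [Finset.mem_singleton, Fintype.mem_piFinset]
      exact ⟨fun _ => Subsingleton.elim _ _, fun _ a => a.elim0⟩
    rw [h, Finset.sum_singleton]
    simp [splitCoeff, finBethe, nestedBethe]
  | succ m ih =>
    rw [finBethe, nestedBethe_mul_succ hu hu1 hP rfl hT₁ hT₂ h12 hv₁ hv₂, sum_piFinset_succ]
    refine Finset.sum_congr rfl fun I hI => ?_
    rw [Finset.mem_powerset] at hI
    have hlab := labels_tail_subset fun a => (P a).toList
    have hnot : ∀ p ∈ P 0, ∀ q ∈ labels (fun a : Fin m => (P a.succ).toList), u q - u p ≠ 0 := by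
      intro p hp q hq e
      have := hP.notMem_zero hq
      exact this (by simpa [hu (sub_eq_zero.1 e)] using hp)
    have hIJ : ∀ p ∈ I.toList, p ∉ (P 0 \ I).toList := by
      intro p hp
      rw [Finset.mem_toList] at hp ⊢
      exact fun h => (Finset.mem_sdiff.1 h).2 hp
    have hrtt : ∀ (s : Finset Λ) (T : OpFamily K Λ (m + 2) V), s ⊆ P 0 →
        IsRTT u (labels fun a => (P a).toList) T →
        IsRTT u (labels fun a : Fin m => (P a.succ).toList)
          (liftFam (Λ → Fin (m + 1)) (truncFam T) * slotLs u s.toList) := by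
      intro s T hs hT
      exact ((hT.mono hlab).truncFam.liftFam _).mul (isRTT_slotLs s.nodup_toList
        fun p hp q hq => hnot p (hs (by simpa using hp)) q hq) (liftFam_commute_slotLs _ _ _)
    -- The regrouped families commute because the L-operators attached to them sit in disjoint sets
    -- of slots. This makes the induction hypothesis applicable at the lower level.
    have hcomm : FamCommute
        (liftFam (Λ → Fin (m + 1)) (truncFam T₁) * slotLs u (P 0 \ I).toList)
        (liftFam (Λ → Fin (m + 1)) (truncFam T₂) * slotLs u I.toList) := by
      refine ((h12.truncFam.liftFam _).mul_right (liftFam_commute_slotLs _ _ _)).mul_left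
        (((liftFam_commute_slotLs _ _ _).symm).mul_right (slotLs_commute_slotLs u hIJ).symm)
    have hwt : ∀ (s : Finset Λ) (T : OpFamily K Λ (m + 2) V) (lam : Λ → Fin (m + 2) → K),
        (∀ p ∈ s.toList, p ∈ I.toList ++ (P 0 \ I).toList) →
        IsWeight (labels fun a => (P a).toList) T lam v →
        IsWeight (labels fun a : Fin m => (P a.succ).toList)
          (liftFam (Λ → Fin (m + 1)) (truncFam T) * slotLs u s.toList)
          (fun q a => lam q a.succ * if a = 0 then ∏ i ∈ s, (1 + (u q - u i)⁻¹) else 1)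
          (slotVec (K := K) (I.toList ++ (P 0 \ I).toList) v) := by
      intro s T lam hs hw
      have h1 := ((hw.mono hlab).truncFam.liftFam (I.toList ++ (P 0 \ I).toList)).mul
        ((isWeight_slotLs u s.nodup_toList hs v).mono (Set.subset_univ _))
        (liftFam_commute_slotLs _ _ _)
      simpa only [Finset.prod_map_toList] using h1
    -- Both lower families satisfy the hypotheses on the joint vacuum, each with the first
    -- eigenvalue multiplied by that of its own L-operators.
    have key := ih (P := fun a => P a.succ) hP.tail (hrtt _ _ Finset.sdiff_subset hT₁)
      (hrtt _ _ hI hT₂) hcomm (hwt _ _ _ (fun p hp => List.mem_append_right _ hp) hv₁)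
      (hwt _ _ _ (fun p hp => List.mem_append_left _ hp) hv₂)
    change finBethe u m (fun a => P a.succ) _ _ = _ at key
    change _ • rowOps _ _ (rowOps _ _ (finBethe u m (fun a => P a.succ) _ _)) _ = _
    rw [key]
    simp only [map_sum, map_smul, Finset.sum_apply, Pi.smul_apply, Finset.smul_sum, smul_smul]
    refine Finset.sum_congr rfl fun Q hQ => ?_
    rw [Fintype.mem_piFinset] at hQ
    have hQ' : ∀ a, (Fin.cons I Q : Fin (m + 1) → Finset Λ) a ⊆ P a := by
      intro a
      refine Fin.cases hI (fun a => ?_) a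
      exact Finset.mem_powerset.1 (hQ a)
    -- The subset `I` of the first color is combined with the subsets `Q` of the other ones, and the
    -- two levels are reassembled into the composition of two Bethe operators.
    have hcomp := nestedBethe_comp u (Q := fun a => ((Fin.cons I Q : Fin (m + 1) → Finset Λ) a).toList)
      (R := fun a => (P a \ (Fin.cons I Q : Fin (m + 1) → Finset Λ) a).toList)
      (hP.of_subset hQ') (hP.of_subset fun a => Finset.sdiff_subset) hIJ h12 v
    rw [splitCoeff_succ (c₁ := fun q => ∏ i ∈ P 0 \ I, (1 + (u q - u i)⁻¹))]
    exact congrArg _ hcomp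

end coproduct

/-! ### Bethe vectors for a product of several families -/

section factors
variable {K : Type*} [Field K] {Λ : Type} [DecidableEq Λ] {m : ℕ}
  {V V' : Type v} [AddCommGroup V] [Module K V] [AddCommGroup V'] [Module K V']

/-- The labels of each color in a set. -/
def colorSets (c : Λ → Fin m) (S : Finset Λ) (a : Fin m) : Finset Λ := S.filter fun p => c p = a

theorem isSimple_colorSets (c : Λ → Fin m) (S : Finset Λ) :
    IsSimple fun a => (colorSets c S a).toList := by
  rw [isSimple_toList_iff]
  intro a b hab
  rw [Finset.disjoint_left]
  intro p hp hp'
  exact hab ((Finset.mem_filter.1 hp).2.symm.trans (Finset.mem_filter.1 hp').2)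

theorem prod_colorSets {M : Type*} [CommMonoid M] (c : Λ → Fin m) (S : Finset Λ)
    (F : Fin m → Λ → M) : ∏ a, ∏ p ∈ colorSets c S a, F a p = ∏ p ∈ S, F (c p) p := by
  rw [← Finset.prod_fiberwise S c]
  refine Finset.prod_congr rfl fun a _ => Finset.prod_congr rfl fun p hp => ?_
  rw [(Finset.mem_filter.1 hp).2]

theorem colorSets_sdiff (c : Λ → Fin m) (S S' : Finset Λ) (a : Fin m) :
    colorSets c S a \ colorSets c S' a = colorSets c (S \ S') a := by
  ext p
  simp only [colorSets, Finset.mem_sdiff, Finset.mem_filter]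
  tauto

theorem sum_piFinset_colorSets {M : Type*} [AddCommMonoid M] (c : Λ → Fin m) (S : Finset Λ)
    (g : (Fin m → Finset Λ) → M) :
    ∑ Q ∈ Fintype.piFinset (fun a => (colorSets c S a).powerset), g Q =
      ∑ S' ∈ S.powerset, g (colorSets c S') := by
  symm
  refine Finset.sum_nbij' (fun S' => colorSets c S') (fun Q => S.filter fun p => p ∈ Q (c p))
    ?_ ?_ ?_ ?_ fun _ _ => rfl
  · intro S' hS'
    rw [Finset.mem_powerset] at hS'
    rw [Fintype.mem_piFinset]
    exact fun a => Finset.mem_powerset.2 (Finset.filter_subset_filter _ hS')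
  · intro Q _
    exact Finset.mem_powerset.2 (Finset.filter_subset _ _)
  · intro S' hS'
    rw [Finset.mem_powerset] at hS'
    ext p
    simp only [colorSets, Finset.mem_filter, and_true, and_iff_right_iff_imp]
    exact fun h => hS' h
  · intro Q hQ
    rw [Fintype.mem_piFinset] at hQ
    funext a
    ext p
    have h := hQ a
    rw [Finset.mem_powerset] at h
    simp only [colorSets, Finset.mem_filter]
    constructor
    · rintro ⟨⟨_, h1⟩, rfl⟩
      exact h1
    · intro hp
      have := Finset.mem_filter.1 (h hp)
      exact ⟨⟨this.1, this.2 ▸ hp⟩, this.2⟩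

/-- The pairwise factor in the coefficients. -/
def pairCoeff (u : Λ → K) (c : Λ → Fin m) (j i : Λ) : K :=
  (if c j = c i then 1 - (u j - u i)⁻¹ else 1) *
    if (c j).val = (c i).val + 1 then 1 + (u j - u i)⁻¹ else 1

theorem splitCoeff_colorSets (u : Λ → K) (c : Λ → Fin m) (S S' : Finset Λ)
    (lam₁ lam₂ : Λ → Fin (m + 1) → K) :
    splitCoeff u (colorSets c S) (colorSets c S') lam₁ lam₂ =
      (∏ i ∈ S', ∏ j ∈ S \ S', pairCoeff u c j i) *
        ((∏ j ∈ S \ S', lam₂ j (c j).castSucc) * ∏ i ∈ S', lam₁ i (c i).succ) := by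
  have h0 : ∀ (a : Fin m) (F : Λ → K), ∏ j ∈ colorSets c (S \ S') a, F j =
      ∏ j ∈ S \ S', if c j = a then F j else 1 := by
    intro a F
    rw [colorSets, Finset.prod_filter]
  have h1 : ∏ a, ∏ i ∈ colorSets c S' a, ∏ j ∈ colorSets c (S \ S') a, (1 - (u j - u i)⁻¹) =
      ∏ i ∈ S', ∏ j ∈ S \ S', if c j = c i then 1 - (u j - u i)⁻¹ else 1 := by
    rw [prod_colorSets c S' fun a i => ∏ j ∈ colorSets c (S \ S') a, (1 - (u j - u i)⁻¹)]
    simp only [h0]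
  have h2 : ∏ a : Fin m, ∏ b : Fin m, (if b.val = a.val + 1 then ∏ j ∈ colorSets c (S \ S') b,
      ∏ i ∈ colorSets c S' a, (1 + (u j - u i)⁻¹) else 1) =
      ∏ i ∈ S', ∏ j ∈ S \ S', if (c j).val = (c i).val + 1 then 1 + (u j - u i)⁻¹ else 1 := by
    have e : ∀ a b : Fin m, (if b.val = a.val + 1 then ∏ j ∈ colorSets c (S \ S') b,
      ∏ i ∈ colorSets c S' a, (1 + (u j - u i)⁻¹) else 1) = ∏ i ∈ colorSets c S' a,
        ∏ j ∈ colorSets c (S \ S') b, if b.val = a.val + 1 then 1 + (u j - u i)⁻¹ else 1 := by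
      intro a b
      rw [Finset.prod_comm]
      split_ifs <;> simp
    simp only [e]
    have e2 : ∀ a : Fin m, ∏ b : Fin m, ∏ i ∈ colorSets c S' a, ∏ j ∈ colorSets c (S \ S') b,
        (if b.val = a.val + 1 then 1 + (u j - u i)⁻¹ else 1) = ∏ i ∈ colorSets c S' a,
        ∏ j ∈ S \ S', if (c j).val = a.val + 1 then 1 + (u j - u i)⁻¹ else 1 := by
      intro a
      rw [Finset.prod_comm]
      refine Finset.prod_congr rfl fun i _ => ?_
      exact prod_colorSets c (S \ S') fun b j => if b.val = a.val + 1 then 1 + (u j - u i)⁻¹ else 1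
    simp only [e2]
    exact prod_colorSets c S' fun a i =>
      ∏ j ∈ S \ S', if (c j).val = a.val + 1 then 1 + (u j - u i)⁻¹ else 1
  rw [splitCoeff]
  simp only [colorSets_sdiff, Finset.prod_mul_distrib, h1, h2, pairCoeff]
  rw [prod_colorSets c _ fun a i => lam₁ i a.succ, prod_colorSets c _ fun a i => lam₂ i a.castSucc]
  ring

/-- The off-diagonal entries of the identity family vanish, so a nonempty first color is contracted
with zero rows; an empty one adds no L-operators. -/
theorem nestedBethe_one (u : Λ → K) (P : Fin m → List Λ) (v : V) :
    nestedBethe u m P (1 : OpFamily K Λ (m + 1) V) v = if ∀ a, P a = [] then v else 0 := by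
  induction m generalizing V with
  | zero => simp [nestedBethe]
  | succ m ih =>
    rw [nestedBethe_succ]
    have ht : truncFam (1 : OpFamily K Λ (m + 2) V) = 1 := by
      funext p
      exact Matrix.submatrix_one _ (Fin.succ_injective _)
    have hr : ∀ p, firstRow (1 : OpFamily K Λ (m + 2) V) p = 0 := by
      intro p
      funext g
      exact Matrix.one_apply_ne (Fin.succ_ne_zero g).symm
    cases h : P 0 with
    | nil =>
      rw [slotLs_nil, mul_one, ht, liftFam_one, ih]
      have e : (∀ a, P a = []) ↔ ∀ a : Fin m, P a.succ = [] := by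
        rw [Fin.forall_fin_succ]; simp [h]
      simp only [e]
      split_ifs
      · simp [rowOps, slotVec_apply]
      · simp
    | cons p w =>
      have h0 : ¬ ∀ a, P a = [] := fun h' => by simp [h' 0] at h
      rw [if_neg h0, rowOps, Module.End.mul_apply]
      have : rowOp (firstRow (1 : OpFamily K Λ (m + 2) V) p) p = 0 := by
        ext x f
        simp [rowOp_apply, hr]
      rw [this, LinearMap.zero_apply, map_zero, Pi.zero_apply]

variable {R : Type} [LinearOrder R]

/-- The family for the tensor product of several factors. -/
def prodFam (T : R → OpFamily K Λ (m + 1) V) : List R → OpFamily K Λ (m + 1) V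
  | [] => 1
  | r :: l => prodFam T l * T r

theorem famCommute_prodFam {T : R → OpFamily K Λ (m + 1) V} {X : OpFamily K Λ (m + 1) V} {l : List R}
    (h : ∀ r ∈ l, FamCommute X (T r)) : FamCommute X (prodFam T l) := by
  induction l with
  | nil => exact famCommute_one_right X
  | cons r l ih => exact (ih fun s hs => h s (by simp [hs])).mul_right (h r (by simp))

theorem isRTT_prodFam {u : Λ → K} {S : Set Λ} {T : R → OpFamily K Λ (m + 1) V}
    (h : Pairwise fun r s => FamCommute (T r) (T s)) (hT : ∀ r, IsRTT u S (T r)) {l : List R}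
    (hl : l.Nodup) : IsRTT u S (prodFam T l) := by
  induction l with
  | nil => exact isRTT_one u S
  | cons r l ih =>
    rw [List.nodup_cons] at hl
    exact (ih hl.2).mul (hT r)
      (famCommute_prodFam fun s hs => h (ne_of_mem_of_not_mem hs hl.1).symm).symm

theorem isWeight_prodFam {S : Set Λ} {T : R → OpFamily K Λ (m + 1) V}
    (h : Pairwise fun r s => FamCommute (T r) (T s)) {lam : R → Λ → Fin (m + 1) → K} {v : V}
    {l : List R} (hv : ∀ r ∈ l, IsWeight S (T r) (lam r) v) (hl : l.Nodup) :
    IsWeight S (prodFam T l) (fun p a => ∏ r ∈ l.toFinset, lam r p a) v := by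
  induction l with
  | nil =>
    rw [prodFam]
    simpa using (isWeight_one v).mono (Set.subset_univ S)
  | cons r l ih =>
    rw [List.nodup_cons] at hl
    have := (ih (fun s hs => hv s (by simp [hs])) hl.2).mul (hv r (by simp))
      (famCommute_prodFam fun s hs => h (ne_of_mem_of_not_mem hs hl.1).symm).symm
    have e : ∀ p a, ∏ s ∈ (r :: l).toFinset, lam s p a = (∏ s ∈ l.toFinset, lam s p a) * lam r p a := by
      intro p a
      rw [List.toFinset_cons, Finset.prod_insert (by simpa using hl.1), mul_comm]
    simp only [e]
    exact this

/-- The factor from the eigenvalues of the diagonal entries in the factor `s` at the point `p`, if `p`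
belongs to the factor `r`. -/
def eigenCoeff (lam : R → Λ → Fin (m + 1) → K) (c : Λ → Fin m) (p : Λ) (r s : R) : K :=
  if s < r then lam s p (c p).succ else if r < s then lam s p (c p).castSucc else 1

/-- The coefficient that corresponds to a distribution of labels. -/
def distCoeff (u : Λ → K) (lam : R → Λ → Fin (m + 1) → K) (c : Λ → Fin m) (S : Finset Λ)
    (L : Finset R) (φ : Λ → R) : K :=
  (∏ i ∈ S, ∏ j ∈ S, if φ j < φ i then pairCoeff u c j i else 1) *
    ∏ p ∈ S, ∏ s ∈ L, eigenCoeff lam c p (φ p) s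

theorem distCoeff_congr (u : Λ → K) (lam : R → Λ → Fin (m + 1) → K) (c : Λ → Fin m) {S : Finset Λ}
    (L : Finset R) {φ ψ : Λ → R} (h : ∀ p ∈ S, φ p = ψ p) :
    distCoeff u lam c S L φ = distCoeff u lam c S L ψ := by
  rw [distCoeff, distCoeff]
  congr 1
  · refine Finset.prod_congr rfl fun i hi => Finset.prod_congr rfl fun j hj => ?_
    rw [h i hi, h j hj]
  · refine Finset.prod_congr rfl fun p hp => ?_
    rw [h p hp]

/-- The new factor `r` precedes all the others. A pair of labels with `φ j < φ i` and not both
outside `r` must have `φ j = r ≠ φ i`; these pairs form the coefficient for two families, and the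
rest is the coefficient for the labels outside `r`. -/
theorem distCoeff_cons (u : Λ → K) (lam : R → Λ → Fin (m + 1) → K) (c : Λ → Fin m) (S : Finset Λ)
    {L : Finset R} {r : R} (hr : ∀ s ∈ L, r < s) {φ : Λ → R} (hφ : ∀ p ∈ S, φ p = r ∨ φ p ∈ L) :
    distCoeff u lam c S (insert r L) φ =
      splitCoeff u (colorSets c S) (colorSets c (S.filter fun p => φ p ≠ r)) (lam r)
        (fun p a => ∏ s ∈ L, lam s p a) * distCoeff u lam c (S.filter fun p => φ p ≠ r) L φ := by
  have hrL : r ∉ L := fun h => lt_irrefl _ (hr r h)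
  set S' := S.filter fun p => φ p ≠ r with hS'
  have hsub : S' ⊆ S := Finset.filter_subset _ _
  have h1 : ∀ p ∈ S', r < φ p := fun p hp =>
    hr _ ((hφ p (hsub hp)).resolve_left (Finset.mem_filter.1 hp).2)
  have h2 : ∀ p ∈ S \ S', φ p = r := by
    intro p hp
    rw [Finset.mem_sdiff, hS', Finset.mem_filter] at hp
    by_contra hne
    exact hp.2 ⟨hp.1, hne⟩
  have hsplit : ∀ F : Λ → K, ∏ p ∈ S, F p = (∏ p ∈ S \ S', F p) * ∏ p ∈ S', F p := fun F =>
    (Finset.prod_sdiff hsub).symm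
  have e1 : ∏ i ∈ S, ∏ j ∈ S, (if φ j < φ i then pairCoeff u c j i else 1) =
      (∏ i ∈ S', ∏ j ∈ S \ S', pairCoeff u c j i) *
        ∏ i ∈ S', ∏ j ∈ S', if φ j < φ i then pairCoeff u c j i else 1 := by
    rw [hsplit]
    have : ∏ i ∈ S \ S', ∏ j ∈ S, (if φ j < φ i then pairCoeff u c j i else 1) = 1 := by
      refine Finset.prod_eq_one fun i hi => Finset.prod_eq_one fun j hj => if_neg ?_
      rw [h2 i hi, not_lt]
      by_cases hjS : j ∈ S'
      · exact (h1 j hjS).le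
      · exact (h2 j (Finset.mem_sdiff.2 ⟨hj, hjS⟩)).ge
    rw [this, one_mul, ← Finset.prod_mul_distrib]
    refine Finset.prod_congr rfl fun i hi => ?_
    rw [hsplit]
    congr 1
    refine Finset.prod_congr rfl fun j hj => if_pos ?_
    rw [h2 j hj]
    exact h1 i hi
  have e2 : ∏ p ∈ S, ∏ s ∈ insert r L, eigenCoeff lam c p (φ p) s =
      ((∏ j ∈ S \ S', ∏ s ∈ L, lam s j (c j).castSucc) * ∏ i ∈ S', lam r i (c i).succ) *
        ∏ p ∈ S', ∏ s ∈ L, eigenCoeff lam c p (φ p) s := by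
    rw [hsplit, mul_assoc, ← Finset.prod_mul_distrib]
    congr 1
    · refine Finset.prod_congr rfl fun p hp => ?_
      rw [Finset.prod_insert hrL, h2 p hp, eigenCoeff, if_neg (lt_irrefl r), if_neg (lt_irrefl r),
        one_mul]
      refine Finset.prod_congr rfl fun s hs => ?_
      rw [eigenCoeff, if_neg (hr s hs).not_gt, if_pos (hr s hs)]
    · refine Finset.prod_congr rfl fun p hp => ?_
      rw [Finset.prod_insert hrL, eigenCoeff, if_pos (h1 p hp)]
  rw [distCoeff, e1, e2, splitCoeff_colorSets, distCoeff]
  ring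

/-- The composition of the nested Bethe operators in the factors in the list for a distribution of
labels. -/
noncomputable def distBethe (u : Λ → K) (c : Λ → Fin m) (T : R → OpFamily K Λ (m + 1) V) (S : Finset Λ)
    (φ : Λ → R) : List R → V →ₗ[K] V
  | [] => LinearMap.id
  | r :: l => distBethe u c T S φ l ∘ₗ finBethe u m (colorSets c (S.filter fun p => φ p = r)) (T r)

theorem distBethe_congr (u : Λ → K) (c : Λ → Fin m) (T : R → OpFamily K Λ (m + 1) V) {S S' : Finset Λ}
    {φ φ' : Λ → R} {l : List R} (h : ∀ r ∈ l, S.filter (fun p => φ p = r) =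
      S'.filter fun p => φ' p = r) : distBethe u c T S φ l = distBethe u c T S' φ' l := by
  induction l with
  | nil => rfl
  | cons r l ih =>
    rw [distBethe, distBethe, ih fun s hs => h s (by simp [hs]), h r (by simp)]

theorem IsWeight.finBethe {u : Λ → K} {c : Λ → Fin m} {S : Finset Λ} {S₀ : Set Λ}
    {T T' : OpFamily K Λ (m + 1) V} (h : FamCommute T T') {lam : Λ → Fin (m + 1) → K} {v : V}
    (hv : IsWeight S₀ T lam v) : IsWeight S₀ T lam (finBethe u m (colorSets c S) T' v) := by
  have key : ∀ p a b, T p a b (NestedBethe.finBethe u m (colorSets c S) T' v) =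
      NestedBethe.finBethe u m (colorSets c S) T' (T p a b v) := fun p a b =>
    nestedBethe_intertwine (isSimple_colorSets c S) (T p a b)
      (fun q _ a' b' x => LinearMap.congr_fun (h p q a b a' b').eq x) v
  intro p hp
  refine ⟨fun a b hab => ?_, fun a => ?_⟩
  · rw [key, (hv p hp).1 a b hab, map_zero]
  · rw [key, (hv p hp).2 a, map_smul]

/-- Iteration of `finBethe_mul`: the first factor takes a subset of the labels, and the others are
distributed further. A distribution is represented by a function on all labels with the default
value `d` outside `S`, so that each distribution is counted once. -/
theorem finBethe_prodFam {u : Λ → K} (hu : Function.Injective u) [Fintype Λ]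
    (hu1 : ∀ p q, u p - u q + 1 ≠ 0) (c : Λ → Fin m) {T : R → OpFamily K Λ (m + 1) V}
    (h : Pairwise fun r s => FamCommute (T r) (T s)) (hT : ∀ r, IsRTT u Set.univ (T r))
    {lam : R → Λ → Fin (m + 1) → K} (d : R) {l : List R} (hl : l.Pairwise (· < ·)) (S : Finset Λ)
    {v : V} (hv : ∀ r ∈ l, IsWeight Set.univ (T r) (lam r) v) :
    finBethe u m (colorSets c S) (prodFam T l) v =
      ∑ φ ∈ Fintype.piFinset fun p => if p ∈ S then l.toFinset else {d},
        distCoeff u lam c S l.toFinset φ • distBethe u c T S φ l v := by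
  induction l generalizing S v with
  | nil =>
    rw [finBethe, prodFam, nestedBethe_one]
    by_cases hS : S = ∅
    · subst hS
      simp [colorSets, distCoeff, distBethe]
    · obtain ⟨p, hp⟩ := Finset.nonempty_iff_ne_empty.2 hS
      have h1 : ¬ ∀ a, (colorSets c S a).toList = [] := by
        intro h'
        have := h' (c p)
        rw [Finset.toList_eq_nil] at this
        exact Finset.notMem_empty p (this ▸ Finset.mem_filter.2 ⟨hp, rfl⟩)
      have h2 : (Fintype.piFinset fun p => if p ∈ S then ([] : List R).toFinset else {d}) = ∅ := by
        refine Finset.eq_empty_of_forall_notMem fun φ hφ => ?_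
        have := Fintype.mem_piFinset.1 hφ p
        rw [if_pos hp] at this
        simp at this
      rw [if_neg h1, h2, Finset.sum_empty]
  | cons r l ih =>
    rw [List.pairwise_cons] at hl
    have hnd : l.Nodup := hl.2.imp fun h => h.ne
    have hr : ∀ s ∈ l.toFinset, r < s := fun s hs => hl.1 s (by simpa using hs)
    have hrl : ∀ s ∈ l, r ≠ s := fun s hs => (hl.1 s hs).ne
    have hvl : ∀ s ∈ l, IsWeight Set.univ (T s) (lam s) v := fun s hs => hv s (by simp [hs])
    rw [prodFam, finBethe_mul hu hu1 (isSimple_colorSets c S) ((hT r).mono (Set.subset_univ _))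
      ((isRTT_prodFam h hT hnd).mono (Set.subset_univ _))
      (famCommute_prodFam fun s hs => h (hrl s hs))
      ((hv r (by simp)).mono (Set.subset_univ _))
      ((isWeight_prodFam h hvl hnd).mono (Set.subset_univ _)), sum_piFinset_colorSets]
    have e : ∀ S' ∈ S.powerset, splitCoeff u (colorSets c S) (colorSets c S') (lam r)
          (fun p a => ∏ s ∈ l.toFinset, lam s p a) •
        finBethe u m (colorSets c S') (prodFam T l)
          (finBethe u m (fun a => colorSets c S a \ colorSets c S' a) (T r) v) =
        ∑ φ ∈ Fintype.piFinset fun p => if p ∈ S' then l.toFinset else {d},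
          (splitCoeff u (colorSets c S) (colorSets c S') (lam r)
            (fun p a => ∏ s ∈ l.toFinset, lam s p a) * distCoeff u lam c S' l.toFinset φ) •
          distBethe u c T S' φ l (finBethe u m (colorSets c (S \ S')) (T r) v) := by
      intro S' _
      have e0 : (fun a => colorSets c S a \ colorSets c S' a) = colorSets c (S \ S') :=
        funext fun a => colorSets_sdiff c S S' a
      rw [e0, ih hl.2 S' fun s hs => (hvl s hs).finBethe (h (hrl s hs).symm), Finset.smul_sum]
      simp only [smul_smul]
    rw [Finset.sum_congr rfl e, Finset.sum_sigma']
    -- A distribution among `r :: l` corresponds to the set `S'` of labels not sent to `r` together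
    -- with a distribution of `S'` among `l`.
    symm
    refine Finset.sum_bij' (fun φ _ => ⟨S.filter fun p => φ p ≠ r,
      fun p => if p ∈ S ∧ φ p ≠ r then φ p else d⟩)
      (fun z _ p => if p ∈ S \ z.1 then r else z.2 p) ?_ ?_ ?_ ?_ ?_
    · intro φ hφ
      rw [Fintype.mem_piFinset] at hφ
      rw [Finset.mem_sigma, Finset.mem_powerset, Fintype.mem_piFinset]
      refine ⟨Finset.filter_subset _ _, fun p => ?_⟩
      have := hφ p
      simp only [Finset.mem_filter]
      split_ifs with h1
      · rw [if_pos h1.1, List.toFinset_cons, Finset.mem_insert] at this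
        exact this.resolve_left h1.2
      · simp
    · intro z hz
      rw [Finset.mem_sigma, Finset.mem_powerset, Fintype.mem_piFinset] at hz
      rw [Fintype.mem_piFinset]
      intro p
      have := hz.2 p
      by_cases h1 : p ∈ S <;> by_cases h2 : p ∈ z.1 <;> simp [h1, h2] at this ⊢
      · exact Or.inr this
      · exact absurd (hz.1 h2) h1
      · exact this
    · intro φ hφ
      rw [Fintype.mem_piFinset] at hφ
      funext p
      have := hφ p
      by_cases h1 : p ∈ S <;> by_cases h2 : φ p = r <;> simp [h1, h2] at this ⊢
      · exact this.symm
      · exact this.symm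
    · rintro ⟨S', φ⟩ hz
      rw [Finset.mem_sigma, Finset.mem_powerset, Fintype.mem_piFinset] at hz
      dsimp only at hz ⊢
      have hmem : ∀ p, p ∈ S ∧ ¬ (if p ∈ S \ S' then r else φ p) = r ↔ p ∈ S' := by
        intro p
        have := hz.2 p
        by_cases h2 : p ∈ S'
        · have h1 := hz.1 h2
          rw [if_pos h2] at this
          simp [h1, h2, (hr _ this).ne']
        · simp only [h2, iff_false, not_and, not_not]
          intro h1
          rw [if_pos (Finset.mem_sdiff.2 ⟨h1, h2⟩)]
      have hS : (S.filter fun p => (if p ∈ S \ S' then r else φ p) ≠ r) = S' := by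
        ext p
        rw [Finset.mem_filter]
        exact hmem p
      have hf : (fun p => if p ∈ S ∧ (if p ∈ S \ S' then r else φ p) ≠ r then
          (if p ∈ S \ S' then r else φ p) else d) = φ := by
        funext p
        rw [if_congr (hmem p) rfl rfl]
        split_ifs with h1 h2
        · exact absurd h1 (Finset.mem_sdiff.1 h2).2
        · rfl
        · have := hz.2 p
          rw [if_neg h1, Finset.mem_singleton] at this
          exact this.symm
      rw [hS, hf]
    · intro φ hφ
      rw [Fintype.mem_piFinset] at hφ
      have hφ' : ∀ p ∈ S, φ p = r ∨ φ p ∈ l.toFinset := by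
        intro p hp
        have := hφ p
        rw [if_pos hp, List.toFinset_cons, Finset.mem_insert] at this
        exact this
      have e1 : S \ (S.filter fun p => φ p ≠ r) = S.filter fun p => φ p = r := by
        ext p
        simp only [Finset.mem_sdiff, Finset.mem_filter, not_and, not_not]
        tauto
      rw [List.toFinset_cons, distCoeff_cons u lam c S hr hφ', e1, distBethe, LinearMap.comp_apply,
        distCoeff_congr u lam c (ψ := fun p => if p ∈ S ∧ φ p ≠ r then φ p else d) _ fun p hp => by
          rw [if_pos (Finset.mem_filter.1 hp)]]
      rw [distBethe_congr u c T (S' := S.filter fun p => φ p ≠ r)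
        (φ' := fun p => if p ∈ S ∧ φ p ≠ r then φ p else d)]
      intro s hs
      ext p
      simp only [Finset.mem_filter]
      by_cases h1 : p ∈ S <;> by_cases h2 : φ p = r <;> simp [h1, h2, hrl s hs]

end factors

/-! ### The product of R-matrices without nesting -/

section flat
variable {K : Type*} [Field K] {Λ : Type} [DecidableEq Λ] {N m : ℕ}
  {V V' : Type v} [AddCommGroup V] [Module K V] [AddCommGroup V'] [Module K V']

/-- The contraction of the slot `p` with the row `α p` of a family of operators. -/
def famRow (Y : OpFamily K Λ N (SlotSpace Λ N V)) (α : Λ → Fin N) (p : Λ) :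
    Module.End K (SlotSpace Λ N V) := ∑ b, Y p (α p) b * slotSet p b

/-- The product of the contractions of the slots in the list, the last slot being contracted first. -/
def famRows (Y : OpFamily K Λ N (SlotSpace Λ N V)) (α : Λ → Fin N) :
    List Λ → Module.End K (SlotSpace Λ N V)
  | [] => 1
  | p :: l => famRow Y α p * famRows Y α l

/-- The product of R-matrices in the slots `q` and `p` for all `q` in the list. -/
def slotRs (u : Λ → K) (p : Λ) : List Λ → Module.End K (SlotSpace Λ N V)
  | [] => 1
  | q :: l => slotR u q p * slotRs u p l

/-- The product of R-matrices for all pairs of slots in the list. -/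
def slotRProd (u : Λ → K) : List Λ → Module.End K (SlotSpace Λ N V)
  | [] => 1
  | p :: l => slotRs u p l * slotRProd u l

/-- The vector that corresponds to a basis vector in the slots of the list. -/
def slotBasis (l : List Λ) (β : Λ → Fin N) (v : V) : SlotSpace Λ N V :=
  fun f => if ∀ p ∈ l, f p = β p then v else 0

/-- The Bethe vector written without nesting. -/
def flatBethe (u : Λ → K) (α β : Λ → Fin N) (l : List Λ) (T : OpFamily K Λ N V) (v : V) :
    SlotSpace Λ N V :=
  famRows (liftFam _ T) α l (slotRProd u l (slotBasis l β v))

theorem slotRs_append (u : Λ → K) (p : Λ) (l l' : List Λ) :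
    slotRs (V := V) (N := N) u p (l ++ l') = slotRs u p l * slotRs u p l' := by
  induction l with
  | nil => simp [slotRs]
  | cons q l ih => rw [List.cons_append, slotRs, slotRs, ih, mul_assoc]

theorem rowOps_append (X : Λ → Fin N → Module.End K V) (l l' : List Λ) :
    rowOps X (l ++ l') = rowOps X l' * rowOps X l := by
  induction l with
  | nil => simp [rowOps]
  | cons q l ih => rw [List.cons_append, rowOps, rowOps, ih, mul_assoc]

theorem commute_slotR {S : Module.End K (SlotSpace Λ N V)} (u : Λ → K) {p q : Λ}
    (h : Commute S (slotSwap p q)) : Commute S (slotR u p q) := by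
  rw [slotR]
  exact ((Commute.one_right S).smul_right _).add_right h

theorem commute_slotRs {S : Module.End K (SlotSpace Λ N V)} (u : Λ → K) {p : Λ} {l : List Λ}
    (h : ∀ q ∈ l, Commute S (slotSwap q p)) : Commute S (slotRs u p l) := by
  induction l with
  | nil => exact Commute.one_right S
  | cons q l ih =>
    exact (commute_slotR u (h q (by simp))).mul_right (ih fun r hr => h r (by simp [hr]))

theorem slotSwap_commute_slotSet {p q r : Λ} (hp : r ≠ p) (hq : r ≠ q) (b : Fin N) :
    Commute (slotSwap (K := K) (V := V) p q) (slotSet r b) := by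
  ext x f
  simp only [Module.End.mul_apply, slotSwap_apply, slotSet_apply]
  rw [Function.update_comp_equiv, Equiv.symm_swap, Equiv.swap_apply_of_ne_of_ne hp hq]

theorem slotSwap_commute_slotE {p q r : Λ} (hp : r ≠ p) (hq : r ≠ q) (a b : Fin N) :
    Commute (slotSwap (K := K) (V := V) p q) (slotE r b a) := by
  have := slotSwap_mul_slotE (K := K) (V := V) p q r a b
  rwa [Equiv.swap_apply_of_ne_of_ne hp hq] at this

theorem commute_famRows {S : Module.End K (SlotSpace Λ N V)}
    {Y : OpFamily K Λ N (SlotSpace Λ N V)} {α : Λ → Fin N} {l : List Λ}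
    (h1 : ∀ p ∈ l, ∀ a b, Commute S (Y p a b)) (h2 : ∀ p ∈ l, ∀ b, Commute S (slotSet p b)) :
    Commute S (famRows Y α l) := by
  induction l with
  | nil => exact Commute.one_right S
  | cons q l ih =>
    refine Commute.mul_right ?_ (ih (fun r hr => h1 r (by simp [hr])) fun r hr => h2 r (by simp [hr]))
    exact Commute.sum_right _ _ _ fun b _ => (h1 q (by simp) _ _).mul_right (h2 q (by simp) _)

theorem famRow_liftFam (T : OpFamily K Λ N V) (α : Λ → Fin N) (p : Λ) :
    famRow (liftFam _ T) α p = rowOp (T p (α p)) p := (rowOp_eq _ _).symm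

/-- Both contractions use the same row `a`, for which the RTT relation degenerates: the R-matrix
acts from the right as a scalar with the order of the contractions changed. -/
theorem rowOp_mul_rowOp_mul_slotR {u : Λ → K} {S : Set Λ} {T : OpFamily K Λ N V} (hT : IsRTT u S T)
    {p q : Λ} (hp : p ∈ S) (hq : q ∈ S) (hpq : p ≠ q) (a : Fin N) :
    rowOp (T p a) p * rowOp (T q a) q * slotR u q p =
      (u q - u p + 1) • (rowOp (T q a) q * rowOp (T p a) p) := by
  ext x f
  have e1 : ∀ g h : Fin N, Function.update (Function.update f p g) q h ∘ Equiv.swap q p =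
      Function.update (Function.update f p h) q g := by
    intro g h
    rw [Function.update_comp_equiv, Function.update_comp_equiv, Equiv.symm_swap,
      Equiv.swap_apply_right, Equiv.swap_apply_left]
    funext r
    by_cases h1 : r = p
    · subst h1; simp [hpq]
    · by_cases h2 : r = q
      · subst h2; simp [h1]
      · simp [h1, h2, Equiv.swap_apply_of_ne_of_ne h2 h1]
  have e2 : ∀ g h : Fin N, Function.update (Function.update f q h) p g =
      Function.update (Function.update f p g) q h := fun g h => Function.update_comm hpq.symm _ _ _
  have key : ∀ (g h : Fin N) (y : V), (u q - u p) • T p a g (T q a h y) + T p a h (T q a g y) =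
      (u q - u p + 1) • T q a h (T p a g y) := by
    intro g h y
    have := LinearMap.congr_fun (hT q hq p hp a h a g) y
    simp only [LinearMap.add_apply, LinearMap.smul_apply, Module.End.mul_apply] at this
    rw [add_smul, one_smul, this]
  simp only [Module.End.mul_apply, LinearMap.smul_apply, Pi.smul_apply, rowOp_apply, slotR_apply,
    Pi.add_apply, slotSwap_apply, e1, e2, map_add, map_smul, map_sum,
    Finset.smul_sum]
  rw [Finset.sum_comm (f := fun g h => T p a g (T q a h (x (Function.update (Function.update f p h) q g)))),
    Finset.sum_comm (f := fun h g => (u q - u p + 1) • T q a h (T p a g _))]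
  simp only [← Finset.sum_add_distrib, key]

/-- The R-matrix between `p` and `q` passes the contractions of the later slots and is absorbed by
the pair of contractions at `p` and `q`; `p` then moves on to the next slot. -/
theorem famRow_mul_famRows_mul_slotRs {u : Λ → K} {S : Set Λ} {T : OpFamily K Λ N V}
    (hT : IsRTT u S T) {α : Λ → Fin N} {p : Λ} {w : List Λ} (hp : p ∈ S)
    (hw : ∀ q ∈ w, q ∈ S ∧ α q = α p) (hnd : (p :: w).Nodup) :
    famRow (liftFam _ T) α p * famRows (liftFam _ T) α w * slotRs u p w =
      (w.map fun q => u q - u p + 1).prod • (famRows (liftFam _ T) α w * famRow (liftFam _ T) α p) := by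
  induction w with
  | nil => simp [famRows, slotRs]
  | cons q w ih =>
    have hnd' : (p :: w).Nodup := by
      rw [List.nodup_cons, List.nodup_cons] at hnd
      exact List.nodup_cons.2 ⟨fun h => hnd.1 (by simp [h]), hnd.2.2⟩
    have hpq : p ≠ q := fun e => (List.nodup_cons.1 hnd).1 (by simp [e])
    have hpw : ∀ r ∈ w, r ≠ p := fun r hr e => (List.nodup_cons.1 hnd').1 (e ▸ hr)
    have hqw : ∀ r ∈ w, r ≠ q := fun r hr e =>
      (List.nodup_cons.1 (List.nodup_cons.1 hnd).2).1 (e ▸ hr)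
    have hc : Commute (slotR u q p) (famRows (liftFam (Λ → Fin N) T) α w) :=
      (commute_slotR u (commute_famRows (fun r _ a b => slotSwap_mul_liftOp q p _)
        fun r hr b => slotSwap_commute_slotSet (hqw r hr) (hpw r hr) b).symm).symm
    have h1 := rowOp_mul_rowOp_mul_slotR hT hp (hw q (by simp)).1 hpq (α p)
    have h2 := ih (fun r hr => hw r (by simp [hr])) hnd'
    have e1 : famRow (liftFam (Λ → Fin N) T) α p * famRow (liftFam _ T) α q * slotR u q p =
        (u q - u p + 1) • (famRow (liftFam _ T) α q * famRow (liftFam _ T) α p) := by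
      rw [famRow_liftFam, famRow_liftFam, (hw q (by simp)).2]
      exact h1
    calc famRow (liftFam (Λ → Fin N) T) α p * famRows (liftFam _ T) α (q :: w) * slotRs u p (q :: w)
        = (famRow (liftFam _ T) α p * famRow (liftFam _ T) α q) *
            (famRows (liftFam _ T) α w * slotR u q p) * slotRs u p w := by
          simp only [famRows, slotRs, mul_assoc]
      _ = (famRow (liftFam _ T) α p * famRow (liftFam _ T) α q * slotR u q p) *
            famRows (liftFam _ T) α w * slotRs u p w := by
          rw [← hc.eq]; simp only [mul_assoc]
      _ = (u q - u p + 1) • (famRow (liftFam _ T) α q *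
            (famRow (liftFam _ T) α p * famRows (liftFam _ T) α w * slotRs u p w)) := by
          rw [e1]; simp only [smul_mul_assoc, mul_assoc]
      _ = _ := by
          rw [h2, List.map_cons, List.prod_cons, mul_smul, mul_smul_comm, famRows]
          simp only [mul_assoc]

/-- Once the index in the slot `q` becomes a column index of the contracting family, the R-matrix
`(u q - u p) + P` is, up to the factor `u q - u p`, the L-operator in the slot `p` at the label `q`.
-/
theorem famRow_mul_slotR {u : Λ → K} {p q : Λ} (h : u q - u p ≠ 0)
    (Z : OpFamily K Λ N (SlotSpace Λ N V)) (α : Λ → Fin N) :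
    famRow Z α q * slotR u q p = (u q - u p) • famRow (Z * slotL u p) α q := by
  have hpq : p ≠ q := fun e => h (by rw [e, sub_self])
  have key : ∀ b : Fin N, slotSet (K := K) (V := V) q b * slotR u q p =
      (u q - u p) • ∑ c, slotL u p q b c * slotSet q c := by
    intro b
    ext x f
    simp only [Module.End.mul_apply, LinearMap.smul_apply, Pi.smul_apply, LinearMap.sum_apply,
      Finset.sum_apply, slotR_apply, slotSet_apply, slotL_apply, Pi.add_apply, slotSwap_apply,
      Finset.sum_add_distrib, ← Finset.smul_sum, smul_add, smul_smul, mul_inv_cancel₀ h, one_smul]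
    congr 1
    · simp
    · rw [Finset.sum_ite_eq]
      simp only [Finset.mem_univ, if_true]
      congr 1
      rw [Function.update_comp_equiv, Equiv.symm_swap, Equiv.swap_apply_left]
      funext r
      by_cases h1 : r = p
      · subst h1; simp [hpq]
      · by_cases h2 : r = q
        · subst h2; simp [h1]
        · simp [h1, h2, Equiv.swap_apply_of_ne_of_ne h2 h1]
  rw [famRow, Finset.sum_mul]
  simp only [mul_assoc, key, mul_smul_comm]
  rw [← Finset.smul_sum, famRow]
  simp only [Pi.mul_apply, Matrix.mul_apply, Finset.sum_mul, Finset.mul_sum, mul_assoc]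
  rw [Finset.sum_comm]

theorem famRows_mul_slotRs {u : Λ → K} {p : Λ} {l : List Λ} (hl : ∀ q ∈ l, u q - u p ≠ 0)
    (hnd : l.Nodup) (Z : OpFamily K Λ N (SlotSpace Λ N V)) (α : Λ → Fin N)
    (hZ : ∀ q ∈ l, ∀ r ∈ l, ∀ a b, Commute (slotSwap q p) (Z r a b)) :
    famRows Z α l * slotRs u p l =
      (l.map fun q => u q - u p).prod • famRows (Z * slotL u p) α l := by
  induction l with
  | nil => simp [famRows, slotRs]
  | cons q l ih =>
    rw [List.nodup_cons] at hnd
    have h1 := famRow_mul_slotR (hl q (by simp)) Z α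
    have h2 := ih (fun r hr => hl r (by simp [hr])) hnd.2 fun r hr s hs =>
      hZ r (by simp [hr]) s (by simp [hs])
    have hpl : ∀ r ∈ l, r ≠ p := fun r hr e => hl r (by simp [hr]) (by rw [e, sub_self])
    have hc : Commute (slotR u q p) (famRows Z α l) :=
      (commute_slotR u (commute_famRows (fun r hr a b => hZ q (by simp) r (by simp [hr]) a b)
        fun r hr b => slotSwap_commute_slotSet (ne_of_mem_of_not_mem hr hnd.1) (hpl r hr) b).symm).symm
    calc famRows Z α (q :: l) * slotRs u p (q :: l)
        = famRow Z α q * (famRows Z α l * slotR u q p) * slotRs u p l := by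
          simp only [famRows, slotRs, mul_assoc]
      _ = (famRow Z α q * slotR u q p) * (famRows Z α l * slotRs u p l) := by
          rw [← hc.eq]; simp only [mul_assoc]
      _ = _ := by
          rw [h1, h2, List.map_cons, List.prod_cons, famRows, smul_mul_assoc, mul_smul_comm, smul_smul]

/-- The scalar factor for the slots of the first color. -/
def flatCoeff (u : Λ → K) (l : List Λ) : List Λ → K
  | [] => 1
  | p :: w => (w.map fun q => u q - u p + 1).prod * (l.map fun q => u q - u p).prod * flatCoeff u l w

/-- The slots of one color, whose row is fixed to be `a`, are processed one at a time, `w₀` being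
those already done. The R-matrices of `p` with the rest of its color become scalars, and those with
the later slots `l` become an L-operator in the slot `p`. -/
theorem famRows_mul_slotRProd {u : Λ → K} (hu : Function.Injective u) {S : Set Λ}
    {T : OpFamily K Λ N V} (hT : IsRTT u S T) {α : Λ → Fin N} (a : Fin N) {w w₀ l : List Λ}
    (hnd : (w ++ (w₀ ++ l)).Nodup) (hw : ∀ p ∈ w, p ∈ S ∧ α p = a) :
    famRows (liftFam _ T) α w * rowOps (fun p => T p a) w₀ *
        famRows (liftFam _ T * slotLs u w₀) α l * slotRProd u (w ++ l) =
      flatCoeff u l w • (rowOps (fun p => T p a) (w₀ ++ w) *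
        famRows (liftFam _ T * slotLs u (w₀ ++ w)) α l * slotRProd u l) := by
  induction w generalizing w₀ with
  | nil => simp [famRows, flatCoeff]
  | cons p w ih =>
    have hperm : ((w ++ ((w₀ ++ [p]) ++ l))).Perm ((p :: w) ++ (w₀ ++ l)) := by
      rw [List.cons_append, List.append_assoc, ← List.append_assoc w w₀, ← List.append_assoc w w₀ l]
      exact List.perm_middle
    have hnd' := hperm.nodup_iff.2 hnd
    have h0 : (p :: w).Nodup := (List.nodup_append.1 hnd).1
    have hp : p ∉ w ++ (w₀ ++ l) := (List.nodup_cons.1 hnd).1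
    have hnd2 : (w ++ (w₀ ++ l)).Nodup := (List.nodup_cons.1 hnd).2
    rw [List.nodup_append] at hnd2
    have hw0 : ∀ q ∈ w, q ∉ w₀ := fun q hq h => hnd2.2.2 q hq q (by simp [h]) rfl
    have hwl : ∀ q ∈ w, q ∉ l := fun q hq h => hnd2.2.2 q hq q (by simp [h]) rfl
    have hw0l : ∀ q ∈ l, q ∉ w₀ := fun q hq h =>
      (List.nodup_append.1 hnd2.2.1).2.2 q h q hq rfl
    have hpw0 : p ∉ w₀ := fun h => hp (by simp [h])
    have hpl : p ∉ l := fun h => hp (by simp [h])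
    have hswap : ∀ q, q ∉ w₀ → ∀ r a b, Commute (slotSwap q p)
        ((liftFam _ T * slotLs u w₀ : OpFamily K Λ N (SlotSpace Λ N V)) r a b) := fun q hq r a b =>
      commute_liftFam_mul_slotLs u (fun a b => slotSwap_mul_liftOp q p _) (fun s hs a b =>
        slotSwap_commute_slotE (ne_of_mem_of_not_mem hs hq) (ne_of_mem_of_not_mem hs hpw0) _ _) a b
    have hc1 : Commute (rowOps (fun p => T p a) w₀ * famRows (liftFam _ T * slotLs u w₀) α l)
        (slotRs u p w) := by
      refine commute_slotRs u fun q hq => (Commute.mul_right ?_ ?_).symm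
      · exact commute_rowOps (fun r hr g => slotSwap_mul_liftOp q p _) fun r hr g =>
          slotSwap_commute_slotSet (ne_of_mem_of_not_mem hr (hw0 q hq))
            (ne_of_mem_of_not_mem hr hpw0) g
      · exact commute_famRows (fun r hr a b => hswap q (hw0 q hq) r a b) fun r hr b =>
          slotSwap_commute_slotSet (ne_of_mem_of_not_mem hr (hwl q hq))
            (ne_of_mem_of_not_mem hr hpl) b
    have hE1 := famRow_mul_famRows_mul_slotRs hT (hw p (by simp)).1
      (fun q hq => ⟨(hw q (by simp [hq])).1, ((hw q (by simp [hq])).2).trans (hw p (by simp)).2.symm⟩) h0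
    have hE2 := famRows_mul_slotRs (u := u) (p := p) (l := l)
      (fun q hq e => hpl ((hu (sub_eq_zero.1 e)) ▸ hq)) (List.nodup_append.1 hnd2.2.1).2.1
      (liftFam _ T * slotLs u w₀ : OpFamily K Λ N (SlotSpace Λ N V)) α
      (fun q hq r hr a b => hswap q (hw0l q hq) r a b)
    have hIH := ih hnd' fun q hq => hw q (by simp [hq])
    have hfr : famRow (liftFam (Λ → Fin N) T) α p = rowOp (T p a) p := by
      rw [famRow_liftFam, (hw p (by simp)).2]
    have hs : slotLs (N := N) (V := V) u (w₀ ++ [p]) = slotLs u w₀ * slotL u p := by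
      rw [slotLs_append, slotLs_cons, slotLs_nil, mul_one]
    have hr : rowOps (fun p => T p a) (w₀ ++ [p]) = rowOp (T p a) p * rowOps (fun p => T p a) w₀ := by
      rw [rowOps_append, rowOps, rowOps, one_mul]
    rw [hs, hr, List.append_assoc, List.singleton_append] at hIH
    calc famRows (liftFam _ T) α (p :: w) * rowOps (fun p => T p a) w₀ *
          famRows (liftFam _ T * slotLs u w₀) α l * slotRProd u ((p :: w) ++ l)
        = famRow (liftFam _ T) α p * famRows (liftFam _ T) α w * ((rowOps (fun p => T p a) w₀ *
          famRows (liftFam _ T * slotLs u w₀) α l) * slotRs u p w) * slotRs u p l *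
            slotRProd u (w ++ l) := by
          simp only [famRows, List.cons_append, slotRProd, slotRs_append, mul_assoc]
      _ = (famRow (liftFam _ T) α p * famRows (liftFam _ T) α w * slotRs u p w) *
            rowOps (fun p => T p a) w₀ * (famRows (liftFam _ T * slotLs u w₀) α l * slotRs u p l) *
            slotRProd u (w ++ l) := by
          rw [hc1.eq]; simp only [mul_assoc]
      _ = ((w.map fun q => u q - u p + 1).prod * (l.map fun q => u q - u p).prod) •
            (famRows (liftFam _ T) α w * (rowOp (T p a) p * rowOps (fun p => T p a) w₀) *
              famRows (liftFam _ T * (slotLs u w₀ * slotL u p)) α l * slotRProd u (w ++ l)) := by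
          rw [hE1, hE2, hfr]
          simp only [smul_mul_assoc, mul_smul_comm, smul_smul, mul_assoc]
          rw [mul_comm (List.prod _)]
      _ = _ := by
          rw [hIH, smul_smul, flatCoeff]

end flat

/-! ### Reduction of rank and comparison with the nested recursion -/

section trunc
variable {K : Type*} [Field K] {Λ : Type} [DecidableEq Λ] {N m : ℕ}
  {V V' : Type v} [AddCommGroup V] [Module K V] [AddCommGroup V'] [Module K V']

/-- The indices in the slots of the list, lowered by one. -/
def predOn (w : List Λ) (f : Λ → Fin (m + 2)) (p : Λ) : Fin (m + 1) :=
  if p ∈ w then Fin.predAbove 0 (f p) else 0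

/-- The embedding of the functions of lowered indices. The values at the functions that vanish at some
label in the list `A` are zero. -/
def truncEmb (w A : List Λ) : SlotSpace Λ (m + 1) (SlotSpace Λ (m + 1) V) →ₗ[K] SlotSpace Λ (m + 2) V where
  toFun z f := if ∀ p ∈ A, f p ≠ 0 then z (fun p => Fin.predAbove 0 (f p)) (predOn w f) else 0
  map_add' x y := by ext f; simp only [Pi.add_apply]; split_ifs <;> simp
  map_smul' c x := by ext f; simp only [Pi.smul_apply, RingHom.id_apply]; split_ifs <;> simp

theorem truncEmb_apply (w A : List Λ) (z : SlotSpace Λ (m + 1) (SlotSpace Λ (m + 1) V))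
    (f : Λ → Fin (m + 2)) : truncEmb (K := K) w A z f =
      if ∀ p ∈ A, f p ≠ 0 then z (fun p => Fin.predAbove 0 (f p)) (predOn w f) else 0 := rfl

theorem truncEmb_congr (w : List Λ) {A A' : List Λ} (h : ∀ p, p ∈ A ↔ p ∈ A') :
    truncEmb (K := K) (m := m) (V := V) w A = truncEmb (K := K) w A' := by
  ext z f
  simp only [truncEmb_apply, h]

theorem truncEmb_of_eq_zero {w A : List Λ} {p : Λ} (hp : p ∈ A)
    (z : SlotSpace Λ (m + 1) (SlotSpace Λ (m + 1) V)) {f : Λ → Fin (m + 2)} (hf : f p = 0) :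
    truncEmb (K := K) w A z f = 0 := by
  rw [truncEmb_apply, if_neg]
  exact fun h => h p hp hf

theorem predOn_update {w : List Λ} {p : Λ} (hp : p ∈ w) (f : Λ → Fin (m + 2)) (g : Fin (m + 1)) :
    predOn w (Function.update f p g.succ) = Function.update (predOn w f) p g := by
  funext q
  by_cases h : q = p
  · subst h; simp [predOn, hp]
  · simp [predOn, h]

theorem predOn_update_of_notMem {w : List Λ} {p : Λ} (hp : p ∉ w) (f : Λ → Fin (m + 2))
    (g : Fin (m + 2)) : predOn w (Function.update f p g) = predOn w f := by
  funext q
  by_cases h : q = p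
  · subst h; simp [predOn, hp]
  · simp [predOn, h]

theorem predAbove_update (p : Λ) (f : Λ → Fin (m + 2)) (g : Fin (m + 1)) :
    (fun q => Fin.predAbove 0 (Function.update f p g.succ q)) =
      Function.update (fun q => Fin.predAbove 0 (f q)) p g := by
  funext q
  by_cases h : q = p
  · subst h; simp
  · simp [h]

theorem forall_update_ne_zero {A : List Λ} {p : Λ} (f : Λ → Fin (m + 2)) (g : Fin (m + 1))
    (hf : f p ≠ 0) : (∀ q ∈ A, Function.update f p g.succ q ≠ 0) ↔ ∀ q ∈ A, f q ≠ 0 := by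
  refine forall₂_congr fun q hq => ?_
  by_cases h : q = p
  · subst h; simp [hf]
  · simp [h]

/-- A function of indices and of frozen indices does not depend on the first ones in the slots of `w`. -/
def IndepOn (w : List Λ) (z : SlotSpace Λ N V) : Prop := ∀ p ∈ w, ∀ f g, z (Function.update f p g) = z f

/-- In `z` the inner function describes the slots of `w` and the outer one the later slots.
Independence of the outer function of the slots of `w` lets the L-operator act on the inner function
alone. -/
theorem slotL_truncEmb (u : Λ → K) {w A : List Λ} {p : Λ} (hp : p ∈ w) (hA : p ∈ A)
    {z : SlotSpace Λ (m + 1) (SlotSpace Λ (m + 1) V)} (hz : IndepOn w z) (q : Λ) (a b : Fin (m + 1)) :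
    slotL (V := V) u p q a.succ b.succ (truncEmb (K := K) w A z) =
      truncEmb (K := K) w A (liftOp _ (slotL u p q a b) z) := by
  funext f
  by_cases hf : f p = 0
  · rw [slotL_apply, truncEmb_of_eq_zero hA _ hf, truncEmb_of_eq_zero hA _ hf,
      if_neg (hf.trans_ne (Fin.succ_ne_zero b).symm)]
    simp
  · rw [slotL_apply, truncEmb_apply, truncEmb_apply, truncEmb_apply,
      if_congr (forall_update_ne_zero f a hf) rfl rfl, predOn_update hp, predAbove_update, hz p hp]
    obtain ⟨c, hc⟩ := Fin.exists_succ_eq.2 hf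
    by_cases h : ∀ p ∈ A, f p ≠ 0
    · rw [if_pos h, if_pos h, if_pos h, liftOp_apply, slotL_apply]
      have e : predOn w f p = c := by simp [predOn, hp, ← hc]
      rw [e, ← hc]
      simp only [Fin.succ_inj]
    · rw [if_neg h, if_neg h, if_neg h]
      simp

/-- The matrix unit would read the value with index zero in the slot `p`, and such values of an
embedded function vanish. -/
theorem slotL_zero_truncEmb (u : Λ → K) {w A : List Λ} {p : Λ} (hA : p ∈ A)
    (z : SlotSpace Λ (m + 1) (SlotSpace Λ (m + 1) V)) (q : Λ) (b : Fin (m + 1)) :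
    slotL (V := V) u p q 0 b.succ (truncEmb (K := K) w A z) = 0 := by
  funext f
  rw [slotL_apply, if_neg (Fin.succ_ne_zero b).symm, truncEmb_of_eq_zero hA _ (by simp)]
  simp

theorem IndepOn.liftOp {w : List Λ} {z : SlotSpace Λ N V} (hz : IndepOn w z) (X : Module.End K V) :
    IndepOn w (liftOp _ X z) := fun p hp f g => by rw [liftOp_apply, liftOp_apply, hz p hp]

theorem slotLs_truncEmb (u : Λ → K) {w A w' : List Λ} (hw : ∀ p ∈ w', p ∈ w ∧ p ∈ A)
    {z : SlotSpace Λ (m + 1) (SlotSpace Λ (m + 1) V)} (hz : IndepOn w z) (q : Λ) (a b : Fin (m + 1)) :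
    slotLs (V := V) u w' q a.succ b.succ (truncEmb (K := K) w A z) =
        truncEmb (K := K) w A (liftOp _ (slotLs u w' q a b) z) ∧
      slotLs (V := V) u w' q 0 b.succ (truncEmb (K := K) w A z) = 0 := by
  induction w' generalizing a with
  | nil =>
    rw [slotLs_nil, slotLs_nil, Pi.one_apply, Pi.one_apply, Matrix.one_apply, Matrix.one_apply,
      Matrix.one_apply_ne (Fin.succ_ne_zero b).symm]
    refine ⟨?_, rfl⟩
    simp only [Fin.succ_inj]
    split_ifs
    · rw [map_one, Module.End.one_apply, Module.End.one_apply]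
    · rw [map_zero, LinearMap.zero_apply, LinearMap.zero_apply, map_zero]
  | cons p w' ih =>
    have hp := hw p (by simp)
    have ih' := fun a => ih (fun r hr => hw r (by simp [hr])) a
    have e : ∀ c : Fin (m + 2), slotLs (V := V) u (p :: w') q c b.succ (truncEmb (K := K) w A z) =
        slotL (V := V) u p q c 0 (slotLs (V := V) u w' q 0 b.succ (truncEmb (K := K) w A z)) +
          ∑ d : Fin (m + 1), slotL (V := V) u p q c d.succ (slotLs (V := V) u w' q d.succ b.succ (truncEmb (K := K) w A z)) := by
      intro c
      rw [slotLs_cons, Pi.mul_apply, Matrix.mul_apply, LinearMap.sum_apply, Fin.sum_univ_succ]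
      rfl
    rw [e, e, (ih' a).2, map_zero, map_zero, zero_add, zero_add]
    constructor
    · rw [slotLs_cons, Pi.mul_apply, Matrix.mul_apply, map_sum, LinearMap.sum_apply, map_sum]
      refine Finset.sum_congr rfl fun d _ => ?_
      rw [(ih' d).1, slotL_truncEmb u hp.1 hp.2 (hz.liftOp _), map_mul, Module.End.mul_apply]
    · refine Finset.sum_eq_zero fun d _ => ?_
      rw [(ih' d).1, slotL_zero_truncEmb u hp.2]

theorem liftOp_truncEmb (X : Module.End K V) (w A : List Λ)
    (z : SlotSpace Λ (m + 1) (SlotSpace Λ (m + 1) V)) :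
    liftOp _ X (truncEmb (K := K) w A z) = truncEmb (K := K) w A (liftOp _ (liftOp _ X) z) := by
  funext f
  rw [liftOp_apply, truncEmb_apply, truncEmb_apply]
  split_ifs
  · rfl
  · rw [map_zero]

/-- The intermediate index zero drops out of the product by the second part of `slotLs_truncEmb`, so
only the truncated family remains. -/
theorem liftFam_mul_slotLs_truncEmb (u : Λ → K) (T : OpFamily K Λ (m + 2) V) {w A : List Λ}
    (hA : ∀ p ∈ w, p ∈ A) {z : SlotSpace Λ (m + 1) (SlotSpace Λ (m + 1) V)} (hz : IndepOn w z)
    (q : Λ) (a b : Fin (m + 1)) :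
    (liftFam _ T * slotLs u w : OpFamily K Λ (m + 2) (SlotSpace Λ (m + 2) V)) q a.succ b.succ
        (truncEmb (K := K) w A z) =
      truncEmb (K := K) w A (liftOp _ ((liftFam (Λ → Fin (m + 1)) (truncFam T) * slotLs u w :
        OpFamily K Λ (m + 1) (SlotSpace Λ (m + 1) V)) q a b) z) := by
  have h := fun a => slotLs_truncEmb (V := V) u (fun p hp => ⟨hp, hA p hp⟩) hz q a b
  rw [Pi.mul_apply, Matrix.mul_apply, LinearMap.sum_apply, Fin.sum_univ_succ, Module.End.mul_apply,
    (h a).2, map_zero, zero_add, Pi.mul_apply, Matrix.mul_apply, map_sum, LinearMap.sum_apply, map_sum]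
  refine Finset.sum_congr rfl fun c _ => ?_
  rw [Module.End.mul_apply, (h c).1, liftFam_eq, liftOp_truncEmb, map_mul]
  rfl

theorem slotSwap_truncEmb {w A : List Λ} {p q : Λ} (hp : p ∈ A) (hq : q ∈ A) (hpw : p ∉ w)
    (hqw : q ∉ w) (z : SlotSpace Λ (m + 1) (SlotSpace Λ (m + 1) V)) :
    slotSwap (K := K) p q (truncEmb (K := K) w A z) = truncEmb (K := K) w A (slotSwap (K := K) p q z) := by
  funext f
  rw [slotSwap_apply, truncEmb_apply, truncEmb_apply]
  have h1 : (∀ r ∈ A, (f ∘ Equiv.swap p q) r ≠ 0) ↔ ∀ r ∈ A, f r ≠ 0 := by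
    have key : ∀ r ∈ A, Equiv.swap p q r ∈ A := by
      intro r hr
      rcases Equiv.swap_apply_eq_iff.1 (rfl : Equiv.swap p q r = _) with _
      by_cases h1 : r = p
      · subst h1; simpa using hq
      · by_cases h2 : r = q
        · subst h2; simpa using hp
        · rwa [Equiv.swap_apply_of_ne_of_ne h1 h2]
    refine ⟨fun h r hr => ?_, fun h r hr => h _ (key r hr)⟩
    have := h _ (key r hr)
    rwa [Function.comp_apply, Equiv.swap_apply_self] at this
  have h2 : predOn w (f ∘ Equiv.swap p q) = predOn w f := by
    funext r
    by_cases h : r ∈ w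
    · simp only [predOn, h, if_true, Function.comp_apply]
      rw [Equiv.swap_apply_of_ne_of_ne (ne_of_mem_of_not_mem h hpw) (ne_of_mem_of_not_mem h hqw)]
    · simp [predOn, h]
  rw [if_congr h1 rfl rfl, h2, slotSwap_apply]
  rfl

theorem slotRs_truncEmb (u : Λ → K) {w A l : List Λ} {p : Λ} (hp : p ∈ A ∧ p ∉ w)
    (hl : ∀ q ∈ l, q ∈ A ∧ q ∉ w) (z : SlotSpace Λ (m + 1) (SlotSpace Λ (m + 1) V)) :
    slotRs u p l (truncEmb (K := K) w A z) = truncEmb (K := K) w A (slotRs u p l z) := by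
  induction l with
  | nil => rfl
  | cons q l ih =>
    have hq := hl q (by simp)
    rw [slotRs, slotRs, Module.End.mul_apply, Module.End.mul_apply, ih fun r hr => hl r (by simp [hr]),
      slotR_apply, slotR_apply, slotSwap_truncEmb hq.1 hp.1 hq.2 hp.2, map_add, map_smul]

theorem slotRProd_truncEmb (u : Λ → K) {w A l : List Λ}
    (hl : ∀ q ∈ l, q ∈ A ∧ q ∉ w) (z : SlotSpace Λ (m + 1) (SlotSpace Λ (m + 1) V)) :
    slotRProd u l (truncEmb (K := K) w A z) = truncEmb (K := K) w A (slotRProd u l z) := by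
  induction l generalizing z with
  | nil => rfl
  | cons q l ih =>
    have hl' := fun r hr => hl r (List.mem_cons_of_mem q hr)
    rw [slotRProd, slotRProd, Module.End.mul_apply, Module.End.mul_apply, ih hl',
      slotRs_truncEmb u (hl q (by simp)) hl']

theorem IndepOn.slotSwap {w : List Λ} {z : SlotSpace Λ N V} (hz : IndepOn w z) {p q : Λ}
    (hp : p ∉ w) (hq : q ∉ w) : IndepOn w (slotSwap (K := K) p q z) := by
  intro r hr f g
  rw [slotSwap_apply, slotSwap_apply, Function.update_comp_equiv, Equiv.symm_swap,
    Equiv.swap_apply_of_ne_of_ne (ne_of_mem_of_not_mem hr hp) (ne_of_mem_of_not_mem hr hq), hz r hr]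

theorem IndepOn.slotRs (u : Λ → K) {w : List Λ} {z : SlotSpace Λ N V} (hz : IndepOn w z) {p : Λ}
    {l : List Λ} (hp : p ∉ w) (hl : ∀ q ∈ l, q ∉ w) : IndepOn w (slotRs u p l z) := by
  induction l with
  | nil => exact hz
  | cons q l ih =>
    have h := ih fun r hr => hl r (by simp [hr])
    intro r hr f g
    rw [NestedBethe.slotRs, Module.End.mul_apply, slotR_apply, Pi.add_apply, Pi.add_apply,
      (h.slotSwap (hl q (by simp)) hp) r hr, Pi.smul_apply, Pi.smul_apply, h r hr]

theorem IndepOn.slotRProd (u : Λ → K) {w : List Λ} {z : SlotSpace Λ N V} (hz : IndepOn w z)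
    {l : List Λ} (hl : ∀ q ∈ l, q ∉ w) : IndepOn w (slotRProd u l z) := by
  induction l with
  | nil => exact hz
  | cons q l ih =>
    have hl' := fun r hr => hl r (List.mem_cons_of_mem q hr)
    exact (ih hl').slotRs u (hl q (by simp)) hl'

theorem indepOn_slotBasis {w l : List Λ} (β : Λ → Fin N) (hl : ∀ q ∈ l, q ∉ w) (v : V) :
    IndepOn w (slotBasis l β v) := by
  intro p hp f g
  have : (∀ q ∈ l, Function.update f p g q = β q) ↔ ∀ q ∈ l, f q = β q :=
    forall₂_congr fun q hq => by rw [Function.update_of_ne (ne_of_mem_of_not_mem hp (hl q hq)).symm]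
  rw [slotBasis, slotBasis, if_congr this rfl rfl]

theorem IndepOn.famRow {w : List Λ} {z : SlotSpace Λ N V} (hz : IndepOn w z) (Y : OpFamily K Λ N V)
    (α : Λ → Fin N) (p : Λ) (hp : p ∉ w) : IndepOn w (famRow (liftFam _ Y) α p z) := by
  intro q hq f g
  rw [NestedBethe.famRow, LinearMap.sum_apply, Finset.sum_apply, Finset.sum_apply]
  refine Finset.sum_congr rfl fun b _ => ?_
  rw [Module.End.mul_apply, liftFam_apply, liftFam_apply, slotSet_apply, slotSet_apply,
    Function.update_comm (ne_of_mem_of_not_mem hq hp), hz q hq]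

theorem IndepOn.famRows {w : List Λ} {z : SlotSpace Λ N V} (hz : IndepOn w z) (Y : OpFamily K Λ N V)
    (α : Λ → Fin N) {l : List Λ} (hl : ∀ p ∈ l, p ∉ w) : IndepOn w (famRows (liftFam _ Y) α l z) := by
  induction l with
  | nil => exact hz
  | cons p l ih =>
    exact (ih fun r hr => hl r (by simp [hr])).famRow Y α p (hl p (by simp))

/-- The term of the contraction with column index zero reads a vanishing value. After the
contraction the slot `q` is no longer constrained and leaves the list of nonzero indices. -/
theorem famRow_truncEmb (u : Λ → K) (T : OpFamily K Λ (m + 2) V) {w A : List Λ}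
    (hA : ∀ p ∈ w, p ∈ A) {z : SlotSpace Λ (m + 1) (SlotSpace Λ (m + 1) V)} (hz : IndepOn w z)
    {α : Λ → Fin (m + 2)} {α' : Λ → Fin (m + 1)} {q : Λ} (hq : q ∉ A) (hα : α q = (α' q).succ) :
    famRow (liftFam _ T * slotLs u w) α q (truncEmb (K := K) w (q :: A) z) =
      truncEmb (K := K) w A (famRow (liftFam _ (liftFam (Λ → Fin (m + 1)) (truncFam T) * slotLs u w)) α' q z) := by
  have hqw : q ∉ w := fun h => hq (hA q h)
  have h0 : slotSet (K := K) q 0 (truncEmb (K := K) w (q :: A) z) = 0 := by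
    funext f
    rw [slotSet_apply, truncEmb_of_eq_zero (List.mem_cons_self) _ (by simp)]
    rfl
  have h1 : ∀ b : Fin (m + 1), slotSet (K := K) q b.succ (truncEmb (K := K) w (q :: A) z) =
      truncEmb (K := K) w A (slotSet (K := K) q b z) := by
    intro b
    funext f
    rw [slotSet_apply, truncEmb_apply, truncEmb_apply, predOn_update_of_notMem hqw, predAbove_update]
    refine if_congr ?_ rfl rfl
    rw [List.forall_mem_cons]
    simp only [Function.update_self, ne_eq, Fin.succ_ne_zero, not_false_eq_true, true_and]
    exact forall₂_congr fun r hr => by rw [Function.update_of_ne (ne_of_mem_of_not_mem hr hq)]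
  have hz' : ∀ b, IndepOn w (slotSet (K := K) q b z) := by
    intro b r hr f g
    rw [slotSet_apply, slotSet_apply, Function.update_comm (ne_of_mem_of_not_mem hr hqw), hz r hr]
  rw [famRow, LinearMap.sum_apply, Fin.sum_univ_succ, Module.End.mul_apply, h0, map_zero, zero_add,
    famRow, LinearMap.sum_apply, map_sum]
  refine Finset.sum_congr rfl fun b _ => ?_
  rw [Module.End.mul_apply, h1, hα, liftFam_mul_slotLs_truncEmb u T hA (hz' b)]
  rfl

theorem famRows_truncEmb (u : Λ → K) (T : OpFamily K Λ (m + 2) V) {w A l : List Λ}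
    (hA : ∀ p ∈ w, p ∈ A) {z : SlotSpace Λ (m + 1) (SlotSpace Λ (m + 1) V)} (hz : IndepOn w z)
    {α : Λ → Fin (m + 2)} {α' : Λ → Fin (m + 1)} (hl : ∀ q ∈ l, q ∉ A ∧ α q = (α' q).succ)
    (hnd : l.Nodup) :
    famRows (liftFam _ T * slotLs u w) α l (truncEmb (K := K) w (l ++ A) z) =
      truncEmb (K := K) w A (famRows (liftFam _ (liftFam (Λ → Fin (m + 1)) (truncFam T) * slotLs u w)) α' l z) := by
  induction l generalizing A with
  | nil => rfl
  | cons p l ih =>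
    rw [List.nodup_cons] at hnd
    have hl' := fun q hq => hl q (List.mem_cons_of_mem p hq)
    have hp := hl p (by simp)
    rw [famRows, Module.End.mul_apply, truncEmb_congr w (A' := l ++ p :: A) (by simp; tauto),
      ih (fun q hq => List.mem_cons_of_mem _ (hA q hq)) (fun q hq => ⟨by
        rw [List.mem_cons, not_or]
        exact ⟨ne_of_mem_of_not_mem hq hnd.1, (hl' q hq).1⟩, (hl' q hq).2⟩) hnd.2,
      famRow_truncEmb u T hA (hz.famRows _ α' fun q hq h => (hl' q hq).1 (hA q h)) hp.1 hp.2]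
    rfl

/-- The initial indices `β` are successors in all the slots, and equal to one in the slots of `w`,
where the lowered index is the vacuum index zero. -/
theorem truncEmb_slotBasis {w l : List Λ} {β : Λ → Fin (m + 2)} {β' : Λ → Fin (m + 1)}
    (hw : ∀ p ∈ w, β p = 1) (hl : ∀ p ∈ l, β p = (β' p).succ) (v : V) :
    truncEmb (K := K) w (l ++ w) (slotBasis l β' (slotVec (K := K) w v)) = slotBasis (w ++ l) β v := by
  funext f
  have key : ∀ p (c : Fin (m + 1)), f p = c.succ ↔ f p ≠ 0 ∧ Fin.predAbove 0 (f p) = c := by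
    intro p c
    refine ⟨fun h => by rw [h]; simp, fun ⟨h1, h2⟩ => ?_⟩
    obtain ⟨d, hd⟩ := Fin.exists_succ_eq.2 h1
    rw [← hd] at h2 ⊢
    simpa using h2
  have h1 : (∀ p ∈ w ++ l, f p = β p) ↔ (∀ p ∈ l ++ w, f p ≠ 0) ∧
      (∀ p ∈ l, Fin.predAbove 0 (f p) = β' p) ∧ ∀ p ∈ w, predOn w f p = 0 := by
    have e1 : (∀ p ∈ w, f p = β p) ↔ ∀ p ∈ w, f p ≠ 0 ∧ predOn w f p = 0 :=
      forall₂_congr fun p hp => by rw [hw p hp, predOn, if_pos hp]; exact key p 0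
    have e2 : (∀ p ∈ l, f p = β p) ↔ ∀ p ∈ l, f p ≠ 0 ∧ Fin.predAbove 0 (f p) = β' p :=
      forall₂_congr fun p hp => by rw [hl p hp]; exact key p _
    simp only [List.forall_mem_append, e1, e2, forall₂_and]
    tauto
  rw [truncEmb_apply, slotBasis, slotBasis, if_congr h1 rfl rfl]
  by_cases h2 : ∀ p ∈ l ++ w, f p ≠ 0
  · by_cases h3 : ∀ p ∈ l, Fin.predAbove 0 (f p) = β' p
    · rw [if_pos h2, if_pos h3, slotVec_apply]
      exact if_congr ⟨fun h => ⟨h2, h3, h⟩, fun h => h.2.2⟩ rfl rfl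
    · rw [if_pos h2, if_neg h3, if_neg (fun h => h3 h.2.1)]
      rfl
  · rw [if_neg h2, if_neg (fun h => h2 h.1)]

theorem rowOps_truncEmb (T : OpFamily K Λ (m + 2) V) {w w' : List Λ} (hw : ∀ p ∈ w', p ∈ w)
    (hnd : w'.Nodup) (y : SlotSpace Λ (m + 1) V) :
    rowOps (fun p => T p 0) w' (truncEmb (K := K) w w' fun _ => y) =
      truncEmb (K := K) w [] fun _ => rowOps (firstRow T) w' y := by
  induction w' generalizing y with
  | nil => rfl
  | cons p w' ih =>
    rw [List.nodup_cons] at hnd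
    have hp := hw p (by simp)
    have e : rowOp (T p 0) p (truncEmb (K := K) w (p :: w') fun _ => y) =
        truncEmb (K := K) w w' fun _ => rowOp (firstRow T p) p y := by
      funext f
      rw [rowOp_apply, Fin.sum_univ_succ, truncEmb_of_eq_zero List.mem_cons_self _ (by simp), map_zero,
        zero_add, truncEmb_apply]
      have h1 : ∀ g : Fin (m + 1), (∀ r ∈ p :: w', Function.update f p g.succ r ≠ 0) ↔
          ∀ r ∈ w', f r ≠ 0 := by
        intro g
        rw [List.forall_mem_cons]
        simp only [Function.update_self, ne_eq, Fin.succ_ne_zero, not_false_eq_true, true_and]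
        exact forall₂_congr fun r hr => by rw [Function.update_of_ne (ne_of_mem_of_not_mem hr hnd.1)]
      simp only [truncEmb_apply, h1, predOn_update hp]
      split_ifs
      · rfl
      · simp
    rw [rowOps, Module.End.mul_apply, e, ih (fun r hr => hw r (by simp [hr])) hnd.2]
    rfl

/-- The normalization factor of the Bethe vectors written without nesting. -/
def flatNorm (u : Λ → K) : (m : ℕ) → (Fin m → List Λ) → K
  | 0, _ => 1
  | m + 1, P => flatCoeff u ((List.finRange m).flatMap fun a => P a.succ) (P 0) *
      flatNorm u m fun a => P a.succ

theorem mem_flatMap_finRange {P : Fin m → List Λ} {p : Λ} :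
    p ∈ (List.finRange m).flatMap P ↔ p ∈ labels P := by
  simp [labels, Set.mem_ofPred_eq]

theorem IsSimple.nodup_flatMap {P : Fin m → List Λ} (h : IsSimple P) :
    ((List.finRange m).flatMap P).Nodup := by
  rw [List.nodup_flatMap]
  refine ⟨fun a _ => h.nodup a, ?_⟩
  refine (List.nodup_finRange m).imp fun {a b} hab => ?_
  exact fun p hp hp' => h.disj a b hab p hp hp'

/-- Induction on the rank. `famRows_mul_slotRProd` disposes of all the R-matrices that involve the
first color, and the embedding turns what remains into the same expression for the truncated family
with L-operators. The value does not depend on `f`, since all the slots have been contracted. -/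
theorem flatBethe_eq {u : Λ → K} (hu : Function.Injective u) {P : Fin m → List Λ} (hP : IsSimple P)
    {T : OpFamily K Λ (m + 1) V} (hT : IsRTT u (labels P) T) {α β : Λ → Fin (m + 1)}
    (hα : ∀ a, ∀ p ∈ P a, α p = a.castSucc) (hβ : ∀ a, ∀ p ∈ P a, β p = a.succ) (v : V)
    (f : Λ → Fin (m + 1)) :
    flatBethe u α β ((List.finRange m).flatMap P) T v f =
      flatNorm u m P • nestedBethe u m P T v := by
  induction m generalizing V with
  | zero => simp [flatBethe, famRows, slotRProd, slotBasis, flatNorm, nestedBethe_zero]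
  | succ m ih =>
    set l := (List.finRange m).flatMap fun a => P a.succ with hl
    have hlP : (List.finRange (m + 1)).flatMap P = P 0 ++ l := by
      rw [List.finRange_succ, List.flatMap_cons, List.flatMap_map]
    have hnd : (P 0 ++ l).Nodup := hlP ▸ hP.nodup_flatMap
    have hnd' := List.nodup_append.1 hnd
    have hlw : ∀ q ∈ l, q ∉ P 0 := fun q hq h => hnd'.2.2 q h q hq rfl
    have hml : ∀ q ∈ l, ∃ a : Fin m, q ∈ P a.succ := fun q hq => mem_flatMap_finRange.1 hq
    have hα0 : ∀ q ∈ l, α q = (Fin.predAbove 0 (α q)).succ := by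
      intro q hq
      obtain ⟨a, ha⟩ := hml q hq
      rw [hα _ q ha, ← Fin.succ_castSucc]; simp
    have hβ0 : ∀ q ∈ l, β q = (Fin.predAbove 0 (β q)).succ := by
      intro q hq
      obtain ⟨a, ha⟩ := hml q hq
      rw [hβ _ q ha]; simp
    -- The first color uses the row zero of `T`, and none of its slots has been processed yet.
    have h1 := famRows_mul_slotRProd hu hT (α := α) 0 (w := P 0) (w₀ := []) (l := l) (by simpa using hnd)
      (fun p hp => ⟨mem_labels_zero hp, by simpa using hα 0 p hp⟩)
    have hfr : famRows (liftFam (Λ → Fin (m + 2)) T) α (P 0 ++ l) =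
        famRows (liftFam _ T) α (P 0) * famRows (liftFam _ T) α l := by
      generalize P 0 = w
      induction w with
      | nil => simp [famRows]
      | cons q w ih => rw [List.cons_append, famRows, famRows, ih, mul_assoc]
    rw [slotLs_nil, mul_one, rowOps, mul_one, List.nil_append, ← hfr] at h1
    have hT' : IsRTT u (labels fun a : Fin m => P a.succ)
        (liftFam (Λ → Fin (m + 1)) (truncFam T) * slotLs u (P 0)) :=
      ((hT.mono (labels_tail_subset P)).truncFam.liftFam _).mul
        (isRTT_slotLs (hP.nodup 0) fun p hp q hq e => hP.notMem_zero hq (hu (sub_eq_zero.1 e) ▸ hp))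
        (liftFam_commute_slotLs _ _ _)
    have h2 := fun f => ih hP.tail hT' (α := fun p => Fin.predAbove 0 (α p))
      (β := fun p => Fin.predAbove 0 (β p))
      (fun a p hp => by
        have := hα _ p hp
        simp only [this, ← Fin.succ_castSucc]; simp)
      (fun a p hp => by
        have := hβ _ p hp
        simp only [this]; simp) (slotVec (K := K) (P 0) v) f
    rw [← hl] at h2
    have h3 : flatBethe u α β (P 0 ++ l) T v = flatCoeff u l (P 0) •
        rowOps (fun p => T p 0) (P 0) (truncEmb (K := K) (P 0) (P 0)
          (flatBethe u (fun p => Fin.predAbove 0 (α p)) (fun p => Fin.predAbove 0 (β p)) l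
            (liftFam (Λ → Fin (m + 1)) (truncFam T) * slotLs u (P 0)) (slotVec (K := K) (P 0) v))) := by
      have e := LinearMap.congr_fun h1 (slotBasis (P 0 ++ l) β v)
      rw [Module.End.mul_apply, LinearMap.smul_apply, Module.End.mul_apply, Module.End.mul_apply] at e
      rw [flatBethe, e, ← truncEmb_slotBasis (K := K) (fun p hp => hβ 0 p hp) hβ0,
        slotRProd_truncEmb u (fun q hq => ⟨by simp [hq], hlw q hq⟩),
        famRows_truncEmb u T (fun p hp => hp)
          ((indepOn_slotBasis _ hlw _).slotRProd u hlw) (fun q hq => ⟨hlw q hq, hα0 q hq⟩) hnd'.2.1]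
      rfl
    rw [hlP, h3, Pi.smul_apply]
    have h4 : flatBethe u (fun p => Fin.predAbove 0 (α p)) (fun p => Fin.predAbove 0 (β p)) l
            (liftFam (Λ → Fin (m + 1)) (truncFam T) * slotLs u (P 0)) (slotVec (K := K) (P 0) v) =
        fun _ => flatNorm u m (fun a => P a.succ) • nestedBethe u m (fun a => P a.succ)
          (liftFam (Λ → Fin (m + 1)) (truncFam T) * slotLs u (P 0)) (slotVec (K := K) (P 0) v) :=
      funext h2
    rw [h4, rowOps_truncEmb T (fun p hp => hp) (hP.nodup 0), truncEmb_apply, if_pos (by simp), map_smul,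
      Pi.smul_apply, smul_smul, flatNorm, nestedBethe_succ]
    congr 1
    exact rowOps_congr (hP.nodup 0) _ fun p hp => by simp [predOn, hp]

end trunc

/-! ### The trace formula as an action on functions of indices -/

section matrix
variable {K : Type*} [Field K] {m : ℕ} {ξ : Fin m → ℕ} {V : Type v} [AddCommGroup V] [Module K V]

/-- The action of a matrix of operators on families of vectors. -/
def matAct {I : Type} [Fintype I] [DecidableEq I] :
    Matrix I I (Module.End K V) →+* Module.End K (I → V) where
  toFun M :=
    { toFun := fun x f => ∑ g, M f g (x g)
      map_add' := fun x y => by ext f; simp [Finset.sum_add_distrib]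
      map_smul' := fun c x => by ext f; simp [Finset.smul_sum] }
  map_one' := by
    refine LinearMap.ext fun x => funext fun f => ?_
    change ∑ g, (1 : Matrix I I (Module.End K V)) f g (x g) = x f
    rw [Finset.sum_eq_single f]
    · rw [Matrix.one_apply_eq, Module.End.one_apply]
    · intro g _ hg
      rw [Matrix.one_apply_ne hg.symm, LinearMap.zero_apply]
    · simp
  map_mul' M M' := by
    refine LinearMap.ext fun x => funext fun f => ?_
    change ∑ g, (M * M') f g (x g) = ∑ h, M f h (∑ g, M' h g (x g))
    simp only [Matrix.mul_apply, LinearMap.sum_apply, map_sum, Module.End.mul_apply]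
    rw [Finset.sum_comm]
  map_zero' := by
    refine LinearMap.ext fun x => funext fun f => ?_
    exact Finset.sum_eq_zero fun g _ => LinearMap.zero_apply _
  map_add' M M' := by
    refine LinearMap.ext fun x => funext fun f => ?_
    exact Finset.sum_add_distrib

theorem matAct_apply {I : Type} [Fintype I] [DecidableEq I] (M : Matrix I I (Module.End K V))
    (x : I → V) (f : I) : matAct M x f = ∑ g, M f g (x g) := rfl

/-- A nonzero entry of `atSlot p M` in the row `f` forces the column to agree with `f` outside `p`,
so the sum over columns is a sum over the index in `p`. -/
theorem matAct_atSlot (p : Slot ξ) (M : Matrix (Fin (m + 1)) (Fin (m + 1)) (Module.End K V)) :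
    matAct (atSlot p M) = slotOp M p := by
  refine LinearMap.ext fun x => funext fun f => ?_
  rw [matAct_apply, slotOp_apply]
  refine Finset.sum_bij_ne_zero (fun g _ _ => g p) (fun _ _ _ => Finset.mem_univ _) ?_ ?_ ?_
  · intro g _ hg g' _ hg' h
    have h1 : ∀ q, q ≠ p → f q = g q := by
      by_contra h
      rw [atSlot, Matrix.of_apply, if_neg h] at hg
      simp at hg
    have h2 : ∀ q, q ≠ p → f q = g' q := by
      by_contra h
      rw [atSlot, Matrix.of_apply, if_neg h] at hg'
      simp at hg'
    funext q
    by_cases hq : q = p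
    · rw [hq, h]
    · rw [← h1 q hq, h2 q hq]
  · intro b _ hb
    refine ⟨Function.update f p b, Finset.mem_univ _, ?_, by simp⟩
    rw [atSlot, Matrix.of_apply, if_pos (fun q hq => (Function.update_of_ne hq _ _).symm)]
    simpa using hb
  · intro g _ hg
    have h1 : ∀ q, q ≠ p → f q = g q := by
      by_contra h
      rw [atSlot, Matrix.of_apply, if_neg h] at hg
      simp at hg
    rw [atSlot, Matrix.of_apply, if_pos h1]
    congr 2
    funext q
    by_cases hq : q = p
    · subst hq; simp
    · rw [Function.update_of_ne hq, h1 q hq]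

theorem atSlot_map {A B : Type*} [Zero A] [Zero B] (φ : A → B) (h0 : φ 0 = 0) (p : Slot ξ)
    (M : Matrix (Fin (m + 1)) (Fin (m + 1)) A) : (atSlot p M).map φ = atSlot p (M.map φ) := by
  ext f g
  simp only [Matrix.map_apply, atSlot, Matrix.of_apply]
  split_ifs
  · rfl
  · exact h0

theorem matAct_atSlot_single (p : Slot ξ) (a b : Fin (m + 1)) :
    matAct ((atSlot p (Matrix.single a b (1 : K))).map (algebraMap K (Module.End K V))) =
      slotE p a b := by
  rw [atSlot_map _ (map_zero _), matAct_atSlot]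
  refine LinearMap.ext fun x => funext fun f => ?_
  rw [slotOp_apply, slotE_apply, Finset.sum_eq_single b]
  · rw [Matrix.map_apply, Matrix.single_apply]
    by_cases h : f p = a
    · simp [h]
    · rw [if_neg h, if_neg (fun e => h e.1.symm), map_zero, LinearMap.zero_apply]
  · intro c _ hc
    rw [Matrix.map_apply, Matrix.single_apply, if_neg (fun e => hc e.2.symm), map_zero,
      LinearMap.zero_apply]
  · simp

/-- The sum of the products of matrix units in two different slots is the permutation of the slots.
-/
theorem matAct_rMatrix {p q : Slot ξ} (h : p ≠ q) (c : K) :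
    matAct ((rMatrix p q c).map (algebraMap K (Module.End K V))) = c • 1 + slotSwap p q := by
  have e : (rMatrix p q c).map (algebraMap K (Module.End K V)) = (c • (1 : TensorMatrix ξ K)).map
      (algebraMap K (Module.End K V)) + ∑ a, ∑ b, (atSlot p (Matrix.single a b (1 : K))).map
        (algebraMap K (Module.End K V)) * (atSlot q (Matrix.single b a (1 : K))).map
          (algebraMap K (Module.End K V)) := by
    simp only [← RingHom.mapMatrix_apply, ← map_mul, ← map_sum, ← map_add]
    rfl
  rw [e, map_add, map_sum]
  simp only [map_sum, map_mul, matAct_atSlot_single]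
  congr 1
  · refine LinearMap.ext fun x => funext fun f => ?_
    rw [matAct_apply, Finset.sum_eq_single f]
    · simp [Matrix.one_apply_eq]
    · intro g _ hg
      simp [Matrix.one_apply_ne hg.symm]
    · simp
  · refine LinearMap.ext fun x => funext fun f => ?_
    simp only [LinearMap.sum_apply, Finset.sum_apply, Module.End.mul_apply, slotE_apply,
      Function.update_of_ne h.symm, slotSwap_apply]
    rw [Finset.sum_eq_single (f p), Finset.sum_eq_single (f q)]
    · rw [if_pos rfl, if_pos rfl]
      congr 1
      funext r
      by_cases h1 : r = p
      · subst h1; simp [h]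
      · by_cases h2 : r = q
        · subst h2; simp
        · simp [h1, h2, Equiv.swap_apply_of_ne_of_ne h1 h2]
    · intro b _ hb
      rw [if_pos rfl, if_neg hb.symm]
    · simp
    · intro a _ ha
      exact Finset.sum_eq_zero fun b _ => if_neg ha.symm
    · simp

/-- The values of a function at the pairs of elements of a list, in the lexicographic order. -/
def pairsList {α β : Type*} (F : α → α → β) : List α → List β
  | [] => []
  | p :: s => s.map (F p) ++ pairsList F s

-- In a list ordered by an asymmetric relation the elements related to a given one are those after
-- it, so filtering the whole list gives its tail.
open Classical in
theorem flatMap_filter_of_pairwise {α β : Type*} {r : α → α → Prop} {l : List α} (hl : l.Pairwise r)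
    (hr : ∀ a b, r a b → ¬ r b a) (F : α → α → β) :
    (l.flatMap fun p => (l.filter fun q => r p q).map (F p)) =
      pairsList F l := by
  induction l with
  | nil => rfl
  | cons p l ih =>
    rw [List.pairwise_cons] at hl
    have h1 : (p :: l).filter (fun q => decide (r p q)) = l := by
      rw [List.filter_cons_of_neg (by simpa using fun h => hr _ _ h h)]
      exact List.filter_eq_self.2 fun q hq => by simpa using hl.1 q hq
    rw [List.flatMap_cons, h1, pairsList, ← ih hl.2]
    congr 1
    refine List.flatMap_congr fun q hq => ?_
    rw [List.filter_cons_of_neg (by simpa using hr _ _ (hl.1 q hq))]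

theorem pairwise_slotLT (ξ : Fin m → ℕ) : (slots ξ).Pairwise slotLT := by
  rw [slots, List.pairwise_flatMap]
  refine ⟨fun a _ => ?_, ?_⟩
  · rw [List.pairwise_map]
    exact (List.pairwise_lt_finRange _).imp fun h => Or.inr ⟨rfl, h⟩
  · refine (List.pairwise_lt_finRange _).imp fun {a b} h => ?_
    simp only [List.mem_map]
    rintro _ ⟨i, _, rfl⟩ _ ⟨j, _, rfl⟩
    exact Or.inl h

theorem mem_slots (p : Slot ξ) : p ∈ slots ξ := by
  simp only [slots, List.mem_flatMap, List.mem_map]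
  exact ⟨p.1, List.mem_finRange _, p.2, List.mem_finRange _, rfl⟩

theorem slotLT_asymm (p q : Slot ξ) (h : slotLT p q) : ¬ slotLT q p := by
  rintro (h' | h') <;> rcases h with h | h
  · exact lt_asymm h h'
  · rw [h.1] at h'; exact lt_irrefl _ h'
  · rw [h'.1] at h; exact lt_irrefl _ h
  · exact lt_asymm h.2 h'.2

theorem nodup_slots (ξ : Fin m → ℕ) : (slots ξ).Nodup :=
  (pairwise_slotLT ξ).imp fun {p q} h => by
    rintro rfl
    exact slotLT_asymm _ _ h h

theorem slotRs_eq_prod {N : ℕ} {Λ : Type} [DecidableEq Λ] (u : Λ → K) (p : Λ) (l : List Λ) :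
    slotRs (V := V) (N := N) u p l = (l.map fun q => slotR u q p).prod := by
  induction l with
  | nil => rfl
  | cons q l ih => rw [slotRs, ih, List.map_cons, List.prod_cons]

theorem slotRProd_eq_prod {N : ℕ} {Λ : Type} [DecidableEq Λ] (u : Λ → K) (l : List Λ) :
    slotRProd (V := V) (N := N) u l = (pairsList (fun p q => slotR u q p) l).prod := by
  induction l with
  | nil => rfl
  | cons p l ih => rw [slotRProd, ih, pairsList, List.prod_append, slotRs_eq_prod]

theorem matAct_rProduct (u : Slot ξ → K) :
    matAct ((((slotPairs ξ).map fun pq => rMatrix pq.2 pq.1 (u pq.2 - u pq.1)).prod).map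
      (algebraMap K (Module.End K V))) = slotRProd u (slots ξ) := by
  rw [slotRProd_eq_prod, ← flatMap_filter_of_pairwise (pairwise_slotLT ξ) slotLT_asymm
    (fun p q => slotR u q p), ← RingHom.mapMatrix_apply, ← RingHom.comp_apply, map_list_prod,
    List.map_map, slotPairs, List.map_flatMap]
  congr 1
  refine List.flatMap_congr fun p _ => ?_
  rw [List.map_map]
  refine List.map_congr_left fun q hq => ?_
  have hpq : q ≠ p := by
    rintro rfl
    simp only [List.mem_filter, decide_eq_true_eq] at hq
    exact slotLT_asymm _ _ hq.2 hq.2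
  exact matAct_rMatrix hpq _

/-- At an argument `f` equal to `α` on the slots each matrix is read in its row `α p`. The slots are
distinct, so the sum in one slot does not disturb the row indices of the others. -/
theorem prod_slotOp_eq_famRows {N : ℕ} {Λ : Type} [DecidableEq Λ] (T : OpFamily K Λ N V)
    (α : Λ → Fin N) {l : List Λ} (hl : l.Nodup) (x : SlotSpace Λ N V) {f : Λ → Fin N}
    (hf : ∀ p ∈ l, f p = α p) :
    (l.map fun p => slotOp (T p) p).prod x f = famRows (liftFam _ T) α l x f := by
  induction l generalizing f with
  | nil => rfl
  | cons p l ih =>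
    rw [List.nodup_cons] at hl
    rw [List.map_cons, List.prod_cons, Module.End.mul_apply, slotOp_apply, famRows,
      Module.End.mul_apply, famRow, LinearMap.sum_apply, Finset.sum_apply, hf p (by simp)]
    refine Finset.sum_congr rfl fun b _ => ?_
    rw [ih hl.2 fun q hq => by
      rw [Function.update_of_ne (ne_of_mem_of_not_mem hq hl.1)]
      exact hf q (by simp [hq])]
    rfl

/-- The lowering matrix is a single matrix unit, so the trace is one entry of the remaining product:
its row consists of the indices `castSucc` and its column of the indices `succ` of the colors. -/
theorem trace_eq_flatBethe (u : Slot ξ → K) (T : OpFamily K (Slot ξ) (m + 1) V) (v : V) :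
    Matrix.trace (((slots ξ).map fun p => atSlot p (T p)).prod *
      (((slotPairs ξ).map fun pq => rMatrix pq.2 pq.1 (u pq.2 - u pq.1)).prod *
        loweringMatrix ξ K).map (algebraMap K (Module.End K V))) v =
      flatBethe u (fun p => p.1.castSucc) (fun p => p.1.succ) (slots ξ) T v fun p => p.1.castSucc := by
  set R := ((slotPairs ξ).map fun pq => rMatrix pq.2 pq.1 (u pq.2 - u pq.1)).prod with hR
  set X := ((slots ξ).map fun p => atSlot p (T p)).prod with hX
  have h1 : (loweringMatrix ξ K).map (algebraMap K (Module.End K V)) =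
      Matrix.single (fun p => p.1.succ) (fun p => p.1.castSucc) 1 := by
    ext f g : 1
    rw [Matrix.map_apply, loweringMatrix, Matrix.single_apply, Matrix.single_apply]
    split_ifs
    · exact map_one _
    · exact map_zero _
  have h2 : (R * loweringMatrix ξ K).map (algebraMap K (Module.End K V)) =
      R.map (algebraMap K (Module.End K V)) *
        Matrix.single (fun p => p.1.succ) (fun p => p.1.castSucc) 1 := by
    rw [← h1, Matrix.map_mul]
  rw [h2, ← mul_assoc, Matrix.trace_mul_single, flatBethe,
    ← prod_slotOp_eq_famRows T _ (nodup_slots ξ) _ (fun p _ => rfl), ← matAct_rProduct, ← hR]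
  have h3 : ((slots ξ).map fun p => slotOp (T p) p).prod = matAct X := by
    rw [hX, map_list_prod, List.map_map]
    congr 1
    exact List.map_congr_left fun p _ => (matAct_atSlot p _).symm
  rw [h3, ← Module.End.mul_apply, ← map_mul, matAct_apply, Finset.sum_eq_single fun p => p.1.succ]
  · rw [slotBasis, if_pos fun _ _ => rfl]
    simp
  · intro g _ hg
    rw [slotBasis, if_neg (fun h => hg (funext fun p => h p (mem_slots p))), map_zero]
  · simp

end matrix

/-! ### Relabelling of slots and the explicit normalization -/

section relabel
variable {K : Type*} [Field K] {Λ Λ' : Type} [DecidableEq Λ] [DecidableEq Λ'] {N m : ℕ}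
  {V : Type v} [AddCommGroup V] [Module K V]

theorem famRows_relabel {e : Λ' → Λ} (he : Function.Injective e) (T : OpFamily K Λ N V)
    {α : Λ → Fin N} {α' : Λ' → Fin N} {l : List Λ'} (hα : ∀ p ∈ l, α (e p) = α' p)
    {x : SlotSpace Λ N V} {y : SlotSpace Λ' N V} (h : ∀ f, x f = y (f ∘ e)) (f : Λ → Fin N) :
    famRows (liftFam _ T) α (l.map e) x f =
      famRows (liftFam _ fun p => T (e p)) α' l y (f ∘ e) := by
  induction l generalizing f with
  | nil => exact h f
  | cons p l ih =>
    have ih' := fun f => ih (fun q hq => hα q (by simp [hq])) f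
    rw [List.map_cons, famRows, famRows, Module.End.mul_apply, Module.End.mul_apply, famRow, famRow,
      LinearMap.sum_apply, LinearMap.sum_apply, Finset.sum_apply, Finset.sum_apply, hα p (by simp)]
    refine Finset.sum_congr rfl fun b _ => ?_
    rw [Module.End.mul_apply, Module.End.mul_apply, liftFam_apply, liftFam_apply, slotSet_apply,
      slotSet_apply, ih', Function.update_comp_eq_of_injective f he p b]

theorem slotRs_relabel {e : Λ' → Λ} (he : Function.Injective e) (u : Λ → K) (p : Λ') (l : List Λ')
    {x : SlotSpace Λ N V} {y : SlotSpace Λ' N V} (h : ∀ f, x f = y (f ∘ e)) (f : Λ → Fin N) :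
    slotRs u (e p) (l.map e) x f = slotRs (fun p => u (e p)) p l y (f ∘ e) := by
  induction l generalizing f with
  | nil => exact h f
  | cons q l ih =>
    rw [List.map_cons, slotRs, slotRs, Module.End.mul_apply, Module.End.mul_apply, slotR_apply,
      slotR_apply, Pi.add_apply, Pi.add_apply, Pi.smul_apply, Pi.smul_apply, slotSwap_apply,
      slotSwap_apply, ih, ih, Function.comp_assoc, Function.comp_assoc, he.swap_comp]

theorem slotRProd_relabel {e : Λ' → Λ} (he : Function.Injective e) (u : Λ → K) (l : List Λ')
    {x : SlotSpace Λ N V} {y : SlotSpace Λ' N V} (h : ∀ f, x f = y (f ∘ e)) (f : Λ → Fin N) :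
    slotRProd u (l.map e) x f = slotRProd (fun p => u (e p)) l y (f ∘ e) := by
  induction l generalizing f with
  | nil => exact h f
  | cons q l ih =>
    rw [List.map_cons, slotRProd, slotRProd, Module.End.mul_apply, Module.End.mul_apply]
    exact slotRs_relabel he u q l ih f

/-- Slots outside the image of `e` never take part, so the dependence on the indices factors through
composition with `e`. This permits one label set for the Bethe vectors of all tensor factors. -/
theorem flatBethe_relabel {e : Λ' → Λ} (he : Function.Injective e) (u : Λ → K) (T : OpFamily K Λ N V)
    {α β : Λ → Fin N} {α' β' : Λ' → Fin N} {l : List Λ'} (hα : ∀ p ∈ l, α (e p) = α' p)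
    (hβ : ∀ p ∈ l, β (e p) = β' p) (v : V) (f : Λ → Fin N) :
    flatBethe u α β (l.map e) T v f =
      flatBethe (fun p => u (e p)) α' β' l (fun p => T (e p)) v (f ∘ e) := by
  refine famRows_relabel he T hα (slotRProd_relabel he u l fun f => ?_) f
  rw [slotBasis, slotBasis]
  refine if_congr ?_ rfl rfl
  rw [List.forall_mem_map]
  exact forall₂_congr fun p hp => by rw [hβ p hp]; rfl

/-- The product of the factors of the normalization for the variables of one color. -/
def pairProd : List K → K
  | [] => 1
  | x :: l => (l.map fun y => y - x + 1).prod * pairProd l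

theorem pairProd_append_singleton (l : List K) (y : K) :
    pairProd (l ++ [y]) = pairProd l * (l.map fun x => y - x + 1).prod := by
  induction l with
  | nil => simp [pairProd]
  | cons x l ih =>
    rw [List.cons_append, pairProd, pairProd, ih, List.map_append, List.prod_append, List.map_cons,
      List.prod_cons]
    simp only [List.map_cons, List.map_nil, List.prod_cons, List.prod_nil]
    ring

theorem prod_map_range (x : ℕ → K) (k : ℕ) : ((List.range k).map x).prod = ∏ i ∈ Finset.range k, x i := by
  induction k with
  | zero => rfl
  | succ k ih => rw [List.range_succ, List.map_append, List.prod_append, ih, Finset.prod_range_succ]; simp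

theorem pairProd_range (x : ℕ → K) (k : ℕ) :
    pairProd ((List.range k).map x) = ∏ j ∈ Finset.range k, ∏ i ∈ Finset.range j, (x j - x i + 1) := by
  induction k with
  | zero => rfl
  | succ k ih =>
    rw [List.range_succ, List.map_append, List.map_singleton, pairProd_append_singleton, ih, List.map_map,
      Finset.prod_range_succ, ← prod_map_range]
    rfl

theorem flatCoeff_eq (u : Λ → K) (l w : List Λ) :
    flatCoeff u l w = pairProd (w.map u) *
      ((w.map u).map fun x => ((l.map u).map fun y => y - x).prod).prod := by
  induction w with
  | nil => simp [flatCoeff, pairProd]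
  | cons p w ih =>
    rw [flatCoeff, ih, List.map_cons, pairProd, List.map_cons, List.prod_cons]
    simp only [List.map_map, Function.comp_def]
    ring

/-- The scalars collected by the recursion are the denominators in the definition of `bethe`: the
pairs of one color come from the first factor of `flatCoeff`, and the pairs of different colors from
the second one. -/
theorem flatNorm_eq (u : Λ → K) (ξ : Fin m → ℕ) (P : Fin m → List Λ) (x : Fin m → ℕ → K)
    (h : ∀ a, (P a).map u = (List.range (ξ a)).map (x a)) :
    flatNorm u m P = (∏ a, ∏ j ∈ Finset.range (ξ a), ∏ i ∈ Finset.range j, (x a j - x a i + 1)) *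
      ∏ b, ∏ a ∈ Finset.Iio b, ∏ i ∈ Finset.range (ξ a), ∏ j ∈ Finset.range (ξ b), (x b j - x a i) := by
  induction m with
  | zero => simp [flatNorm]
  | succ m ih =>
    rw [flatNorm, ih (fun a => ξ a.succ) _ (fun a => x a.succ) (fun a => h a.succ), flatCoeff_eq, h 0,
      pairProd_range, List.map_flatMap, List.map_map, prod_map_range, Fin.prod_univ_succ]
    have e1 : ∀ (F : Fin (m + 1) → Fin (m + 1) → K), ∏ b, ∏ a ∈ Finset.Iio b, F a b =
        (∏ b : Fin m, F 0 b.succ) * ∏ b : Fin m, ∏ a ∈ Finset.Iio b, F a.succ b.succ := by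
      intro F
      have e : ∀ (k : ℕ) (b : Fin k) (G : Fin k → K), ∏ a ∈ Finset.Iio b, G a =
          ∏ a, if a < b then G a else 1 := by
        intro k b G
        rw [← Finset.prod_filter]
        congr 1
        ext a
        simp
      simp only [e, Fin.prod_univ_succ (n := m)]
      simp [Finset.prod_mul_distrib]
    rw [e1 fun a b => ∏ i ∈ Finset.range (ξ a), ∏ j ∈ Finset.range (ξ b), (x b j - x a i)]
    have e2 : ∀ y : K, (((List.finRange m).flatMap fun a => (P a.succ).map u).map fun z => z - y).prod =
        ∏ b : Fin m, ∏ j ∈ Finset.range (ξ b.succ), (x b.succ j - y) := by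
      intro y
      rw [List.map_flatMap, List.flatMap, List.prod_flatten, List.map_map, Fin.prod_univ_def]
      congr 1
      refine List.map_congr_left fun b _ => ?_
      rw [Function.comp_apply, h, List.map_map, prod_map_range]
      rfl
    simp only [Function.comp_apply, e2]
    rw [Finset.prod_comm]
    ring

end relabel

/-! ### Series of operators acting on series of vectors -/

section hahn
variable {ι : Type*} [LinearOrder ι]

/-- Scalars can act directly or as series of scalar operators. The support may shrink in the second
description, for instance when `W` is trivial, so the coefficients are computed over the support of
`c`. -/
theorem scalarTo_smul {W : Type*} [AddCommGroup W] [Module ℂ W] (c : ScalarSeries ι)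
    (y : HahnModule (Expo ι) ℂ W) :
    (HahnModule.of (Module.End ℂ W)).symm (scalarTo (Module.End ℂ W) c •
      HahnModule.of (Module.End ℂ W) ((HahnModule.of ℂ).symm y)) = (HahnModule.of ℂ).symm (c • y) := by
  ext g
  have h : (scalarTo (Module.End ℂ W) c).support ⊆ c.support := fun i hi hc => hi (by
    change algebraMap ℂ (Module.End ℂ W) (c.coeff i) = 0
    rw [hc, map_zero])
  rw [HahnModule.coeff_smul_left c.isPWO_support h, HahnModule.coeff_smul]
  exact Finset.sum_congr rfl fun _ _ => rfl

theorem scalarTo_mul_comm {A : Type*} [Ring A] [Algebra ℂ A] (c : ScalarSeries ι)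
    (x : HahnSeries (Expo ι) A) : scalarTo A c * x = x * scalarTo A c := by
  ext g
  rw [HahnSeries.coeff_mul, HahnSeries.coeff_mul]
  refine Finset.sum_equiv (Equiv.prodComm _ _) (fun _ => Finset.swap_mem_antidiagonal.symm) ?_
  intro i _
  exact Algebra.commutes _ _

/-- The action of series of operators on series of vectors. -/
noncomputable def hahnAct (ι : Type*) [LinearOrder ι] (W : Type*) [AddCommGroup W] [Module ℂ W] :
    HahnSeries (Expo ι) (Module.End ℂ W) →+* Module.End (ScalarSeries ι) (VectorSeries ι W) where
  toFun x :=
    { toFun := fun y => HahnModule.of ℂ ((HahnModule.of (Module.End ℂ W)).symm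
        (x • HahnModule.of (Module.End ℂ W) ((HahnModule.of ℂ).symm y)))
      map_add' := fun y z => smul_add x (HahnModule.of (Module.End ℂ W) ((HahnModule.of ℂ).symm y))
        (HahnModule.of (Module.End ℂ W) ((HahnModule.of ℂ).symm z))
      map_smul' := fun c y => by
        rw [← scalarTo_smul, RingHom.id_apply]
        apply (HahnModule.of ℂ).symm.injective
        rw [← scalarTo_smul]
        simp only [Equiv.symm_apply_apply, Equiv.apply_symm_apply]
        exact congrArg _ (((mul_smul _ _ _).symm.trans (congrArg (· • _) (scalarTo_mul_comm c x).symm)).trans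
          (mul_smul _ _ _)) }
  map_one' := LinearMap.ext fun y =>
    HahnModule.one_smul' (x := HahnModule.of (Module.End ℂ W) ((HahnModule.of ℂ).symm y))
  map_mul' x x' := LinearMap.ext fun y =>
    mul_smul x x' (HahnModule.of (Module.End ℂ W) ((HahnModule.of ℂ).symm y))
  map_zero' := LinearMap.ext fun y =>
    HahnModule.zero_smul' (x := HahnModule.of (Module.End ℂ W) ((HahnModule.of ℂ).symm y))
  map_add' x x' := LinearMap.ext fun y =>
    add_smul x x' (HahnModule.of (Module.End ℂ W) ((HahnModule.of ℂ).symm y))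

variable {W : Type*} [AddCommGroup W] [Module ℂ W]

theorem hahnAct_apply (x : HahnSeries (Expo ι) (Module.End ℂ W)) (y : VectorSeries ι W) :
    (HahnModule.of ℂ).symm (hahnAct ι W x y) = (HahnModule.of (Module.End ℂ W)).symm
      (x • HahnModule.of (Module.End ℂ W) ((HahnModule.of ℂ).symm y)) := rfl

theorem hahnAct_scalarTo (c : ScalarSeries ι) :
    hahnAct ι W (scalarTo _ c) = algebraMap _ (Module.End (ScalarSeries ι) (VectorSeries ι W)) c := by
  refine LinearMap.ext fun y => (HahnModule.of ℂ).symm.injective ?_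
  rw [hahnAct_apply, scalarTo_smul]
  rfl

/-- A constant series. -/
noncomputable def constSeries (ι : Type*) [LinearOrder ι] (w : W) : VectorSeries ι W :=
  HahnModule.of ℂ (HahnSeries.single 0 w)

theorem hahnAct_constSeries (x : HahnSeries (Expo ι) (Module.End ℂ W)) (w : W) :
    hahnAct ι W x (constSeries ι w) = HahnModule.of ℂ (x.map (LinearMap.applyₗ w)) := by
  apply (HahnModule.of ℂ).symm.injective
  ext g
  have hs : ((HahnModule.of (Module.End ℂ W)).symm (HahnModule.of (Module.End ℂ W)
      (HahnSeries.single (0 : Expo ι) w))).support ⊆ {0} := HahnSeries.support_single_subset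
  rw [hahnAct_apply, constSeries, Equiv.symm_apply_apply,
    HahnModule.coeff_smul_right (s := {0}) (Set.isPWO_singleton 0) hs, Equiv.symm_apply_apply, Equiv.symm_apply_apply,
    HahnSeries.map_coeff]
  rw [Finset.sum_eq_single (g, 0)]
  · simp
  · rintro ⟨i, j⟩ hij hne
    rw [Finset.mem_vaddAntidiagonal] at hij
    obtain ⟨-, h2, h3⟩ := hij
    simp only [Set.mem_singleton_iff] at h2
    subst h2
    exfalso
    apply hne
    have : i = g := by simpa using h3
    rw [this]
  · intro h
    have : x.coeff g = 0 := by
      by_contra h'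
      apply h
      rw [Finset.mem_vaddAntidiagonal]
      exact ⟨h', rfl, by simp⟩
    rw [this]
    simp

end hahn

/-! ### Substitution of variables and the RTT relations for series -/

section eval
variable {ι : Type*} [LinearOrder ι] [Finite ι] {A B : Type*} [Ring A] [Ring B]

/-- The coefficients of a power series, extended by zero. -/
noncomputable def intCoeff (f : PowerSeries A) (n : ℤ) : A := if 0 ≤ n then PowerSeries.coeff n.toNat f else 0

theorem intCoeff_natCast (f : PowerSeries A) (n : ℕ) : intCoeff f n = PowerSeries.coeff n f := by
  simp [intCoeff]

theorem intCoeff_of_neg (f : PowerSeries A) {n : ℤ} (hn : n < 0) : intCoeff f n = 0 :=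
  if_neg (not_le.2 hn)

theorem expoEmb_apply (k : ι) (s : ℕ) : expoEmb k s = toLex (Pi.single k (s : ℤ)) := rfl

open Classical in
theorem coeff_evalAt (f : PowerSeries A) (k : ι) (e : Expo ι) :
    (evalAt f k).coeff e = if ∀ j, j ≠ k → ofLex e j = 0 then intCoeff f (ofLex e k) else 0 := by
  by_cases h : e ∈ Set.range (expoEmb k)
  · obtain ⟨s, rfl⟩ := h
    rw [evalAt, HahnSeries.embDomain_coeff, HahnSeries.coeff_toPowerSeries_symm, expoEmb_apply,
      if_pos (fun j hj => by simp [hj])]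
    simp [intCoeff]
  · rw [evalAt, HahnSeries.embDomain_of_notMem_range h]
    split_ifs with h1
    · by_cases h2 : 0 ≤ ofLex e k
      · exfalso
        apply h
        refine ⟨(ofLex e k).toNat, ?_⟩
        rw [expoEmb_apply, Int.toNat_of_nonneg h2]
        apply ofLex.injective
        funext j
        by_cases hj : j = k
        · subst hj; simp
        · rw [ofLex_toLex, Pi.single_eq_of_ne hj, h1 j hj]
      · rw [intCoeff, if_neg h2]
    · rfl

theorem evalAt_add (f g : PowerSeries A) (k : ι) : evalAt (f + g) k = evalAt f k + evalAt g k := by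
  classical
  ext e
  rw [HahnSeries.coeff_add, coeff_evalAt, coeff_evalAt, coeff_evalAt]
  simp only [intCoeff, map_add]
  split_ifs <;> simp

theorem evalAt_zero (k : ι) : evalAt (0 : PowerSeries A) k = 0 := by
  rw [evalAt, map_zero, HahnSeries.embDomain_zero]

theorem evalAt_one (k : ι) : evalAt (1 : PowerSeries A) k = 1 := by
  rw [evalAt, map_one]
  refine HahnSeries.embDomain_single.trans ?_
  rw [expoEmb_apply]
  simp only [Nat.cast_zero, Pi.single_zero]
  rfl

theorem evalAt_mul (f g : PowerSeries A) (k : ι) : evalAt (f * g) k = evalAt f k * evalAt g k := by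
  rw [evalAt, map_mul, HahnSeries.embDomain_mul]
  · rfl
  · intro a b
    simp only [expoEmb_apply, Nat.cast_add, Pi.single_add]
    rfl

theorem evalAt_sum {κ : Type*} (s : Finset κ) (f : κ → PowerSeries A) (k : ι) :
    evalAt (∑ i ∈ s, f i) k = ∑ i ∈ s, evalAt (f i) k := by
  classical
  induction s using Finset.induction_on with
  | empty => exact evalAt_zero k
  | insert i s hi ih => rw [Finset.sum_insert hi, Finset.sum_insert hi, evalAt_add, ih]

theorem evalAt_map (φ : A →+* B) (f : PowerSeries A) (k : ι) :
    (evalAt f k).map φ = evalAt (PowerSeries.map φ f) k := by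
  classical
  ext e
  rw [HahnSeries.map_coeff, coeff_evalAt, coeff_evalAt]
  simp only [intCoeff, PowerSeries.coeff_map]
  split_ifs <;> simp

-- For distinct variables an exponent supported on `k` and `l` has only one decomposition that can
-- contribute: its component at `k` plus its component at `l`.
open Classical in
theorem coeff_evalAt_mul (f g : PowerSeries A) {k l : ι} (hkl : k ≠ l) (e : Expo ι) :
    (evalAt f k * evalAt g l).coeff e = if ∀ j, j ≠ k → j ≠ l → ofLex e j = 0 then
      intCoeff f (ofLex e k) * intCoeff g (ofLex e l) else 0 := by
  rw [HahnSeries.coeff_mul]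
  by_cases h : ∀ j, j ≠ k → j ≠ l → ofLex e j = 0
  · rw [if_pos h, Finset.sum_eq_single
      (toLex (Pi.single k (ofLex e k)), toLex (Pi.single l (ofLex e l)))]
    · rw [coeff_evalAt, coeff_evalAt, if_pos (fun j hj => by simp [hj]),
        if_pos (fun j hj => by simp [hj])]
      simp
    · rintro ⟨i, j⟩ hij hne
      by_contra h0
      have h1 := left_ne_zero_of_mul h0
      have h2 := right_ne_zero_of_mul h0
      rw [coeff_evalAt] at h1 h2
      simp only [ne_eq, ite_eq_right_iff, Classical.not_imp] at h1 h2
      have h3 : i + j = e := (Finset.mem_antidiagonal.1 hij).2.2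
      have h4 : ∀ q, ofLex e q = ofLex i q + ofLex j q := fun q => by rw [← h3]; rfl
      apply hne
      refine Prod.ext (ofLex.injective (funext fun q => ?_)) (ofLex.injective (funext fun q => ?_))
      · by_cases hq : q = k
        · subst hq; simp [h4, h2.1 _ hkl]
        · simp [hq, h1.1 q hq]
      · by_cases hq : q = l
        · subst hq; simp [h4, h1.1 _ hkl.symm]
        · simp [hq, h2.1 q hq]
    · intro hn
      by_contra h0
      apply hn
      rw [Finset.mem_antidiagonal]
      refine ⟨left_ne_zero_of_mul h0, right_ne_zero_of_mul h0, ofLex.injective (funext fun q => ?_)⟩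
      simp only [ofLex_add, ofLex_toLex, Pi.add_apply]
      by_cases hq : q = k
      · subst hq; simp [hkl]
      · by_cases hq' : q = l
        · subst hq'; simp [hkl.symm]
        · simp [hq, hq', h q hq hq']
  · rw [if_neg h]
    refine Finset.sum_eq_zero ?_
    rintro ⟨i, j⟩ hij
    by_contra h0
    have h1 := left_ne_zero_of_mul h0
    have h2 := right_ne_zero_of_mul h0
    rw [coeff_evalAt] at h1 h2
    simp only [ne_eq, ite_eq_right_iff, Classical.not_imp] at h1 h2
    have h3 : i + j = e := (Finset.mem_antidiagonal.1 hij).2.2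
    apply h
    intro q hq hq'
    rw [← h3, ofLex_add, Pi.add_apply, h1.1 q hq, h2.1 q hq', add_zero]

/-- An exponent `g` stands for `t^{-g}`, so multiplication by the variable lowers exponents by one
and the coefficient is read one step higher. -/
theorem coeff_scalarTo_tvar_mul [Algebra ℂ A] (k : ι) (x : HahnSeries (Expo ι) A) (e : Expo ι) :
    (scalarTo A (tvar k) * x).coeff e = x.coeff (e + toLex (Pi.single k 1)) := by
  have h : scalarTo A (tvar k) = HahnSeries.single (toLex (Pi.single k (-1))) (1 : A) := by
    rw [scalarTo, tvar]
    refine (HahnSeries.map_single (algebraMap ℂ A : ℂ →+* A).toMonoidWithZeroHom.toZeroHom).trans ?_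
    congr 1
    exact map_one (algebraMap ℂ A)
  have h2 : e = (e + toLex (Pi.single k 1)) + toLex (Pi.single k (-1)) := by
    rw [add_assoc, ← toLex_add, ← Pi.single_add]
    simp
  conv_lhs => rw [h, h2, HahnSeries.coeff_single_mul_add, one_mul]

/-- Multiplication by a variable involves the coefficients with index `-1`. With coefficients
extended by zero the relation still holds there, because the constant terms of the series are
scalars and commute with everything. -/
theorem IsYangianFamily.intCoeff_rel {m : ℕ} {F : Fin (m + 1) → Fin (m + 1) → PowerSeries A}
    (hF : IsYangianFamily F) (a b c d : Fin (m + 1)) (r s : ℤ) :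
    (intCoeff (F a b) (r + 1) * intCoeff (F c d) s - intCoeff (F c d) s * intCoeff (F a b) (r + 1))
      - (intCoeff (F a b) r * intCoeff (F c d) (s + 1) - intCoeff (F c d) (s + 1) * intCoeff (F a b) r) =
    intCoeff (F c b) s * intCoeff (F a d) r - intCoeff (F c b) r * intCoeff (F a d) s := by
  have h0 : ∀ a b (x : A), intCoeff (F a b) 0 * x - x * intCoeff (F a b) 0 = 0 := by
    intro a b x
    have : intCoeff (F a b) 0 = if a = b then 1 else 0 := by
      rw [← hF.coeff_zero]; exact intCoeff_natCast _ 0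
    rw [this]
    split_ifs <;> simp
  have h0' : ∀ a b (x : A), x * intCoeff (F a b) 0 - intCoeff (F a b) 0 * x = 0 := by
    intro a b x
    rw [← neg_sub, h0, neg_zero]
  rcases lt_or_ge r 0 with hr | hr
  · have e1 := fun a b => intCoeff_of_neg (F a b) hr
    rcases (show r + 1 < 0 ∨ r + 1 = 0 by omega) with h | h
    · simp [e1, intCoeff_of_neg _ h]
    · rw [h, h0]; simp [e1]
  · rcases lt_or_ge s 0 with hs | hs
    · have e1 := fun a b => intCoeff_of_neg (F a b) hs
      rcases (show s + 1 < 0 ∨ s + 1 = 0 by omega) with h | h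
      · simp [e1, intCoeff_of_neg _ h]
      · rw [h, h0']; simp [e1]
    · obtain ⟨r, rfl⟩ := Int.eq_ofNat_of_zero_le hr
      obtain ⟨s, rfl⟩ := Int.eq_ofNat_of_zero_le hs
      have := hF.rtt a b c d r s
      simp only [← intCoeff_natCast] at this
      exact_mod_cast this

theorem IsYangianFamily.evalAt_rel {m : ℕ} [Algebra ℂ A] {F : Fin (m + 1) → Fin (m + 1) → PowerSeries A}
    (hF : IsYangianFamily F) {k l : ι} (hkl : k ≠ l) (a b c d : Fin (m + 1)) :
    (scalarTo A (tvar k) - scalarTo A (tvar l)) * (evalAt (F a b) k * evalAt (F c d) l) +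
        evalAt (F c b) k * evalAt (F a d) l =
      (scalarTo A (tvar k) - scalarTo A (tvar l)) * (evalAt (F c d) l * evalAt (F a b) k) +
        evalAt (F c b) l * evalAt (F a d) k := by
  classical
  ext e
  rw [sub_mul, sub_mul]
  simp only [HahnSeries.coeff_add, HahnSeries.coeff_sub, coeff_scalarTo_tvar_mul,
    coeff_evalAt_mul _ _ hkl, coeff_evalAt_mul _ _ hkl.symm]
  have e1 : (∀ j, j ≠ k → j ≠ l → ofLex (e + toLex (Pi.single k 1) : Expo ι) j = 0) ↔
      ∀ j, j ≠ k → j ≠ l → ofLex e j = 0 :=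
    forall_congr' fun j => forall₂_congr fun h1 h2 => by
      rw [ofLex_add, Pi.add_apply, ofLex_toLex, Pi.single_eq_of_ne h1, add_zero]
  have e2 : (∀ j, j ≠ k → j ≠ l → ofLex (e + toLex (Pi.single l 1) : Expo ι) j = 0) ↔
      ∀ j, j ≠ k → j ≠ l → ofLex e j = 0 :=
    forall_congr' fun j => forall₂_congr fun h1 h2 => by
      rw [ofLex_add, Pi.add_apply, ofLex_toLex, Pi.single_eq_of_ne h2, add_zero]
  have e3 : ∀ e : Expo ι, (∀ j, j ≠ l → j ≠ k → ofLex e j = 0) ↔ ∀ j, j ≠ k → j ≠ l → ofLex e j = 0 :=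
    fun e => forall_congr' fun j => forall_comm
  simp only [e3, e1, e2]
  by_cases h : ∀ j, j ≠ k → j ≠ l → ofLex e j = 0
  · simp only [if_pos h, ofLex_add, ofLex_toLex, Pi.add_apply, Pi.single_eq_same,
      Pi.single_eq_of_ne hkl, Pi.single_eq_of_ne hkl.symm, add_zero]
    have := hF.intCoeff_rel a b c d (ofLex e k) (ofLex e l)
    rw [← sub_eq_zero] at this ⊢
    rw [← this]
    abel
  · simp only [if_neg h]

end eval

/-! ### The weight function as a nested Bethe vector -/

section weight
variable {ι : Type*} [LinearOrder ι]

theorem tvar_coeff (k l : ι) :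
    (tvar l : ScalarSeries ι).coeff (toLex (Pi.single k (-1))) = if l = k then 1 else 0 := by
  rw [tvar]
  split_ifs with h
  · rw [h, HahnSeries.coeff_single_same]
  · refine HahnSeries.coeff_single_of_ne fun e => h ?_
    have := congrFun (toLex.injective e) k
    by_contra hk
    simp [Pi.single_eq_of_ne (Ne.symm hk)] at this

theorem tvar_injective : Function.Injective (tvar : ι → ScalarSeries ι) := by
  intro k l h
  have h1 := tvar_coeff k l
  rw [← h, tvar_coeff, if_pos rfl] at h1
  by_contra hkl
  rw [if_neg (Ne.symm hkl)] at h1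
  exact one_ne_zero h1

/-- For `k ≠ l` the coefficient of the monomial `t_k` is one; for `k = l` the expression is the
constant one. -/
theorem tvar_sub_add_one_ne_zero (k l : ι) : tvar k - tvar l + (1 : ScalarSeries ι) ≠ 0 := by
  intro h
  by_cases hkl : k = l
  · rw [hkl, sub_self, zero_add] at h
    exact one_ne_zero h
  · have h1 := congrArg (fun x => HahnSeries.coeff x (toLex (Pi.single k (-1)))) h
    simp only [HahnSeries.coeff_add, HahnSeries.coeff_sub, tvar_coeff, if_true, HahnSeries.coeff_zero,
      if_neg (Ne.symm hkl), HahnSeries.coeff_one] at h1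
    rw [if_neg] at h1
    · simp at h1
    · intro e
      have := congrFun (toLex.injective (e.trans toLex_zero.symm)) k
      simp at this

/-- A ring homomorphism applied to the coefficients of series. -/
noncomputable def mapSeries {A B : Type*} [Ring A] [Ring B] (φ : A →+* B) :
    HahnSeries (Expo ι) A →+* HahnSeries (Expo ι) B where
  toFun x := x.map φ
  map_one' := by
    ext g
    rw [HahnSeries.map_coeff, HahnSeries.coeff_one, HahnSeries.coeff_one]
    split_ifs
    · exact map_one _
    · exact map_zero _
  map_mul' x y := HahnSeries.map_mul (φ : A →ₙ+* B)
  map_zero' := by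
    ext g
    exact map_zero φ
  map_add' x y := by
    ext g
    exact map_add φ _ _

theorem mapSeries_apply {A B : Type*} [Ring A] [Ring B] (φ : A →+* B) (x : HahnSeries (Expo ι) A) :
    mapSeries φ x = x.map φ := rfl

theorem mapSeries_scalarTo {A B : Type*} [Ring A] [Ring B] [Algebra ℂ A] [Algebra ℂ B] (φ : A →ₐ[ℂ] B)
    (c : ScalarSeries ι) : mapSeries φ.toRingHom (scalarTo A c) = scalarTo B c := by
  ext g
  exact φ.commutes _

variable [Finite ι] {m : ℕ} {W : Type*} [AddCommGroup W] [Module ℂ W] {Λ : Type} [DecidableEq Λ]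

/-- The values of the series `F a b` at the variables with labels in `Λ`. -/
noncomputable def evalFam (F : Fin (m + 1) → Fin (m + 1) → PowerSeries (Module.End ℂ W)) (s : Λ → ι) :
    OpFamily (ScalarSeries ι) Λ (m + 1) (VectorSeries ι W) :=
  fun p => Matrix.of fun a b => hahnAct ι W (evalAt (F a b) (s p))

theorem evalFam_apply (F : Fin (m + 1) → Fin (m + 1) → PowerSeries (Module.End ℂ W)) (s : Λ → ι) (p : Λ)
    (a b : Fin (m + 1)) : evalFam F s p a b = hahnAct ι W (evalAt (F a b) (s p)) := rfl

theorem sub_self_smul_add {K V : Type*} [Field K] [AddCommGroup V] [Module K V] (c : K)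
    (x y z : Module.End K V) : (c - c) • x + z = (c - c) • y + z := by
  rw [sub_self, zero_smul, zero_smul]

theorem isRTT_evalFam {F : Fin (m + 1) → Fin (m + 1) → PowerSeries (Module.End ℂ W)}
    (hF : IsYangianFamily F) (s : Λ → ι) (S : Set Λ) :
    IsRTT (fun p => tvar (s p)) S (evalFam F s) := by
  intro p _ q _ a b c d
  simp only [evalFam_apply]
  -- For equal variables the difference of parameters is zero and the exchange terms on the two
  -- sides coincide; otherwise this is the relation between series.
  by_cases h : s p = s q
  · rw [h]
    exact sub_self_smul_add _ _ _ _
  · have := congrArg (hahnAct ι W) (hF.evalAt_rel h a b c d)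
    simp only [map_add, map_mul, map_sub, hahnAct_scalarTo] at this
    simp only [← map_sub, ← Algebra.smul_def] at this
    exact this

theorem isWeight_evalFam {F : Fin (m + 1) → Fin (m + 1) → PowerSeries (Module.End ℂ W)} {w : W}
    {lam : Fin (m + 1) → PowerSeries ℂ}
    (h1 : ∀ a b : Fin (m + 1), a < b → ∀ s, PowerSeries.coeff s (F b a) w = 0)
    (h2 : ∀ a s, PowerSeries.coeff s (F a a) w = PowerSeries.coeff s (lam a) • w) (s : Λ → ι) (S : Set Λ) :
    IsWeight S (evalFam F s) (fun p a => evalAt (lam a) (s p)) (constSeries ι w) := by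
  classical
  have key : ∀ (f : PowerSeries (Module.End ℂ W)) (c : PowerSeries ℂ) (k : ι),
      (∀ n, PowerSeries.coeff n f w = PowerSeries.coeff n c • w) →
        hahnAct ι W (evalAt f k) (constSeries ι w) = evalAt c k • constSeries ι w := by
    intro f c k h
    have e : evalAt c k • constSeries ι w = hahnAct ι W (scalarTo _ (evalAt c k)) (constSeries ι w) := by
      rw [hahnAct_scalarTo]; rfl
    rw [e, hahnAct_constSeries, hahnAct_constSeries]
    congr 1
    ext g
    rw [HahnSeries.map_coeff, HahnSeries.map_coeff, scalarTo, HahnSeries.map_coeff, coeff_evalAt,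
      coeff_evalAt]
    split_ifs
    · simp only [intCoeff]
      split_ifs
      · simpa using h _
      · simp
    · simp
  intro p _
  refine ⟨fun a b hab => ?_, fun a => key _ _ _ (h2 a)⟩
  rw [evalFam_apply, key _ 0 _ (fun n => by simpa using h1 a b hab n), evalAt_zero, zero_smul]

theorem weightFunction_eq_hahnAct (ρ : Yangian m →ₐ[ℂ] Module.End ℂ W) (w : W) (ξ : Fin m → ℕ)
    (t : Fin m → ℕ → ι) : weightFunction ρ w ξ t =
      hahnAct ι W (mapSeries ρ.toRingHom (bethe ξ t)) (constSeries ι w) := by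
  rw [hahnAct_constSeries, weightFunction]
  congr 1

theorem hahnAct_betheHat (ρ : Yangian m →ₐ[ℂ] Module.End ℂ W) (w : VectorSeries ι W) (ξ : Fin m → ℕ)
    (t : Fin m → ℕ → ι) : hahnAct ι W (mapSeries ρ.toRingHom (betheHat ξ t)) w =
      flatBethe (fun p => tvar (t p.1 p.2)) (fun p => p.1.castSucc) (fun p => p.1.succ) (slots ξ)
        (evalFam (fun a b => PowerSeries.map ρ.toRingHom (Yangian.T m a b)) fun p => t p.1 p.2) w
        fun p => p.1.castSucc := by
  rw [← trace_eq_flatBethe]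
  set Θ := (hahnAct ι W).comp (mapSeries ρ.toRingHom) with hΘ
  have h1 : ∀ M : TensorMatrix ξ (HahnSeries (Expo ι) (Yangian m)),
      hahnAct ι W (mapSeries ρ.toRingHom (Matrix.trace M)) = Matrix.trace (M.map Θ) := by
    intro M
    simp only [Matrix.trace, map_sum, Matrix.diag_apply, Matrix.map_apply, hΘ, RingHom.comp_apply]
  have h2 : ((rProduct ξ t * loweringMatrix ξ (ScalarSeries ι)).map (scalarTo (Yangian m))).map Θ =
      (rProduct ξ t * loweringMatrix ξ (ScalarSeries ι)).map (algebraMap _ _) := by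
    rw [Matrix.map_map]
    congr 1
    funext c
    rw [Function.comp_apply, hΘ, RingHom.comp_apply, mapSeries_scalarTo, hahnAct_scalarTo]
  have h3 : (tProduct ξ t).map Θ = ((slots ξ).map fun p => atSlot p
      (evalFam (fun a b => PowerSeries.map ρ.toRingHom (Yangian.T m a b)) (fun p => t p.1 p.2) p)).prod := by
    rw [tProduct, ← RingHom.mapMatrix_apply, map_list_prod, List.map_map]
    congr 1
    refine List.map_congr_left fun p _ => ?_
    rw [Function.comp_apply, RingHom.mapMatrix_apply, atSlot_map _ (map_zero _)]
    congr 1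
    ext a b : 1
    rw [Matrix.map_apply, Matrix.of_apply, evalFam_apply, hΘ, RingHom.comp_apply, mapSeries_apply,
      evalAt_map]
  rw [betheHat, h1, Matrix.map_mul, h2, h3, rProduct]

/-- The weight function as the nested Bethe vector. -/
theorem weightFunction_eq (ρ : Yangian m →ₐ[ℂ] Module.End ℂ W) (w : W) {ξ : Fin m → ℕ}
    {t : Fin m → ℕ → ι} {s : Λ → ι} (hs : Function.Injective s) {e : Slot ξ → Λ}
    (he : Function.Injective e) (hst : ∀ p : Slot ξ, t p.1 p.2 = s (e p)) :
    weightFunction ρ w ξ t = nestedBethe (fun p => tvar (s p)) m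
      (fun a => (List.finRange (ξ a)).map fun i => e ⟨a, i⟩)
      (evalFam (fun a b => PowerSeries.map ρ.toRingHom (Yangian.T m a b)) s) (constSeries ι w) := by
  set P : Fin m → List Λ := fun a => (List.finRange (ξ a)).map fun i => e ⟨a, i⟩ with hP
  set F := fun a b => PowerSeries.map ρ.toRingHom (Yangian.T m a b) with hF
  have hu : Function.Injective fun p => tvar (s p) := tvar_injective.comp hs
  have hsimple : IsSimple P := by
    refine ⟨fun a => ?_, fun a b hab p hp hp' => ?_⟩
    · refine List.Nodup.map (fun i j h => ?_) (List.nodup_finRange _)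
      simpa using he h
    · simp only [hP, List.mem_map] at hp hp'
      obtain ⟨i, -, rfl⟩ := hp
      obtain ⟨j, -, h⟩ := hp'
      exact hab (congrArg Sigma.fst (he h)).symm
  -- The row and column indices are prescribed only on the image of `e`; elsewhere they get the
  -- irrelevant value zero.
  have hext : ∀ (g : Slot ξ → Fin (m + 1)) (p : Slot ξ), Function.extend e g (fun _ => 0) (e p) = g p :=
    fun g p => he.extend_apply _ _ _
  have h1 := flatBethe_eq hu hsimple (isRTT_evalFam (isYangianFamily_map ρ.toRingHom
    (isYangianFamily_T m)) s (labels P)) (α := Function.extend e (fun p => p.1.castSucc) fun _ => 0)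
    (β := Function.extend e (fun p => p.1.succ) fun _ => 0)
    (fun a p hp => by
      obtain ⟨i, -, rfl⟩ := List.mem_map.1 hp
      rw [hext])
    (fun a p hp => by
      obtain ⟨i, -, rfl⟩ := List.mem_map.1 hp
      rw [hext]) (constSeries ι w) (Function.extend e (fun p => p.1.castSucc) fun _ => 0)
  have h2 : (List.finRange m).flatMap P = (slots ξ).map e := by
    rw [slots, List.map_flatMap]
    refine List.flatMap_congr fun a _ => ?_
    rw [List.map_map]
    rfl
  rw [h2, flatBethe_relabel he (α' := fun p => p.1.castSucc) (β' := fun p => p.1.succ) _ _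
    (fun p _ => hext _ p) (fun p _ => hext _ p)] at h1
  have h3 : Function.extend e (fun p : Slot ξ => p.1.castSucc) (fun _ => 0) ∘ e = fun p => p.1.castSucc :=
    funext fun p => hext _ p
  have h4 : (fun p => evalFam F s (e p)) = evalFam F fun p : Slot ξ => t p.1 p.2 := by
    funext p
    ext a b : 1
    rw [evalFam_apply, evalFam_apply, hst]
  have h5 : (fun p : Slot ξ => (tvar (s (e p)) : ScalarSeries ι)) = fun p => tvar (t p.1 p.2) :=
    funext fun p => by rw [hst]
  rw [h3, h4, h5, ← hahnAct_betheHat] at h1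
  have h6 := flatNorm_eq (fun p => (tvar (s p) : ScalarSeries ι)) ξ P (fun a i => tvar (t a i)) (by
    intro a
    rw [hP, List.map_map, ← List.map_coe_finRange_eq_range, List.map_map]
    refine List.map_congr_left fun i _ => ?_
    rw [Function.comp_apply, Function.comp_apply, ← hst])
  -- The normalization is invertible because variables of different colors are distinct, by the
  -- injectivity of `s` and `e`.
  have h7 : flatNorm (fun p => (tvar (s p) : ScalarSeries ι)) m P ≠ 0 := by
    rw [h6]
    refine mul_ne_zero ?_ ?_
    · exact Finset.prod_ne_zero_iff.2 fun a _ => Finset.prod_ne_zero_iff.2 fun j _ =>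
        Finset.prod_ne_zero_iff.2 fun i _ => tvar_sub_add_one_ne_zero _ _
    · refine Finset.prod_ne_zero_iff.2 fun b _ => Finset.prod_ne_zero_iff.2 fun a ha =>
        Finset.prod_ne_zero_iff.2 fun i hi => Finset.prod_ne_zero_iff.2 fun j hj => ?_
      rw [Finset.mem_range] at hi hj
      intro h
      have h8 := tvar_injective (sub_eq_zero.1 h)
      rw [hst ⟨b, ⟨j, hj⟩⟩, hst ⟨a, ⟨i, hi⟩⟩] at h8
      have := congrArg Sigma.fst (he (hs h8))
      exact (Finset.mem_Iio.1 ha).ne' this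
  rw [weightFunction_eq_hahnAct, bethe, map_mul, map_mul, mapSeries_scalarTo, hahnAct_scalarTo,
    Module.End.mul_apply, Module.algebraMap_end_apply, map_smul, h1, smul_smul]
  have h8 : ∀ x y : ScalarSeries ι, x * y = 1 → ∀ z : VectorSeries ι W, (x * y) • z = z := by
    intro x y h z
    rw [h, one_smul]
  apply h8
  rw [h6] at h7 ⊢
  simp only [one_div, Finset.prod_inv_distrib]
  rw [← mul_inv]
  exact inv_mul_cancel₀ h7

end weight

/-! ### Tensor products of vector-valued series -/

section tensorSeries
variable {ι : Type*} [LinearOrder ι] [Finite ι] {n : ℕ} {V : Fin n → Type*}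
  [∀ r, AddCommGroup (V r)] [∀ r, Module ℂ (V r)]

/-- The coefficient of a vector-valued series. -/
noncomputable def vcoeff {W : Type*} [AddCommGroup W] [Module ℂ W] (y : VectorSeries ι W) (g : Expo ι) : W :=
  ((HahnModule.of ℂ).symm y).coeff g

theorem vcoeff_ext {W : Type*} [AddCommGroup W] [Module ℂ W] {y z : VectorSeries ι W}
    (h : ∀ g, vcoeff y g = vcoeff z g) : y = z :=
  HahnModule.ext _ _ (funext h)

/-- The sum may run over any finite set of decompositions of `g` that contains the relevant ones,
since a pure tensor with a zero entry vanishes. This allows a common index set for several families.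
-/
theorem vcoeff_tensorSeries (f : ∀ r, VectorSeries ι (V r)) (g : Expo ι) {F : Finset (Fin n → Expo ι)}
    (h1 : ∀ h ∈ F, ∑ r, h r = g)
    (h2 : ∀ h : Fin n → Expo ι, (∀ r, vcoeff (f r) (h r) ≠ 0) → ∑ r, h r = g → h ∈ F) :
    vcoeff (tensorSeries f) g = ∑ h ∈ F, ⨂ₜ[ℂ] r, vcoeff (f r) (h r) := by
  change (∑ h ∈ (finite_fiber f g).toFinset, ⨂ₜ[ℂ] r, vcoeff (f r) (h r)) = _
  refine Finset.sum_subset (fun h hh => ?_) fun h hF hh => ?_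
  · rw [Set.Finite.mem_toFinset] at hh
    exact h2 h hh.1 hh.2
  · rw [Set.Finite.mem_toFinset] at hh
    have : ∃ r, vcoeff (f r) (h r) = 0 := by
      by_contra h3
      exact hh ⟨fun r hr => h3 ⟨r, hr⟩, h1 h hF⟩
    obtain ⟨r, hr⟩ := this
    exact (PiTensorProduct.tprod ℂ).map_coord_zero r hr

theorem vcoeff_update (f : ∀ r, VectorSeries ι (V r)) (r : Fin n) (x : VectorSeries ι (V r))
    (h : Fin n → Expo ι) : (fun q => vcoeff (Function.update f r x q) (h q)) =
      Function.update (fun q => vcoeff (f q) (h q)) r (vcoeff x (h r)) := by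
  funext q
  by_cases hq : q = r
  · subst hq; simp
  · simp [hq]

theorem tensorSeries_update_add (f : ∀ r, VectorSeries ι (V r)) (r : Fin n)
    (x y : VectorSeries ι (V r)) : tensorSeries (Function.update f r (x + y)) =
      tensorSeries (Function.update f r x) + tensorSeries (Function.update f r y) := by
  classical
  refine vcoeff_ext fun g => ?_
  set F := (finite_fiber (Function.update f r x) g).toFinset ∪
    ((finite_fiber (Function.update f r y) g).toFinset ∪
      (finite_fiber (Function.update f r (x + y)) g).toFinset) with hF
  have hF1 : ∀ h ∈ F, ∑ q, h q = g := by
    intro h hh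
    simp only [hF, Finset.mem_union, Set.Finite.mem_toFinset] at hh
    rcases hh with hh | hh | hh <;> exact hh.2
  have e := fun z h2 => vcoeff_tensorSeries (Function.update f r z) g hF1 h2
  have e1 := e (x + y) (fun h h1 h2 => by
    simp only [hF, Finset.mem_union, Set.Finite.mem_toFinset]; exact Or.inr (Or.inr ⟨h1, h2⟩))
  have e2 := e x (fun h h1 h2 => by
    simp only [hF, Finset.mem_union, Set.Finite.mem_toFinset]; exact Or.inl ⟨h1, h2⟩)
  have e3 := e y (fun h h1 h2 => by
    simp only [hF, Finset.mem_union, Set.Finite.mem_toFinset]; exact Or.inr (Or.inl ⟨h1, h2⟩))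
  have e4 : vcoeff (tensorSeries (Function.update f r x) + tensorSeries (Function.update f r y)) g =
      vcoeff (tensorSeries (Function.update f r x)) g +
        vcoeff (tensorSeries (Function.update f r y)) g := rfl
  rw [e4, e1, e2, e3, ← Finset.sum_add_distrib]
  refine Finset.sum_congr rfl fun h _ => ?_
  rw [vcoeff_update, vcoeff_update, vcoeff_update]
  exact (PiTensorProduct.tprod ℂ).map_update_add _ r _ _

theorem sum_update_index {M : Type*} [AddCommGroup M] (h : Fin n → M) (r : Fin n) (l : M) :
    ∑ q, Function.update h r l q = l - h r + ∑ q, h q := by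
  rw [Finset.sum_update_of_mem (Finset.mem_univ r), ← Finset.add_sum_erase _ _ (Finset.mem_univ r),
    Finset.sdiff_singleton_eq_erase]
  abel

-- Both coefficients at `g` are sums of the same pure tensors. On the left `g` is split into the
-- exponent of the operator and those of the factors; on the right the exponent of the factor `r` is
-- split further into an operator part and a vector part.
set_option maxHeartbeats 1000000 in
theorem hahnAct_tensorSeries (f : ∀ r, VectorSeries ι (V r)) (r : Fin n)
    (x : HahnSeries (Expo ι) (Module.End ℂ (V r))) :
    hahnAct ι _ (mapSeries (onFactor V r).toRingHom x) (tensorSeries f) =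
      tensorSeries (Function.update f r (hahnAct ι _ x (f r))) := by
  classical
  refine vcoeff_ext fun g => ?_
  have hm : Monotone fun h : Fin n → Expo ι => ∑ r, h r :=
    fun h h' hh => Finset.sum_le_sum fun r _ => hh r
  have ht := (isPWO_pi_support f).image_of_monotone hm
  set t := (fun h : Fin n → Expo ι => ∑ r, h r) '' Set.univ.pi fun r =>
    ((HahnModule.of ℂ).symm (f r)).support with ht0
  have hts : ((HahnModule.of (Module.End ℂ (⨂[ℂ] i, V i))).symm (HahnModule.of _
      ((HahnModule.of ℂ).symm (tensorSeries f)))).support ⊆ t := by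
    intro g hg
    obtain ⟨h, hh, -⟩ := Finset.exists_ne_zero_of_sum_ne_zero hg
    rw [Set.Finite.mem_toFinset] at hh
    exact ⟨h, fun r _ => hh.1 r, hh.2⟩
  set A := Finset.VAddAntidiagonal g (Set.VAddAntidiagonal.finite_of_isPWO x.isPWO_support ht g) with hA
  have hL : vcoeff (hahnAct ι _ (mapSeries (onFactor V r).toRingHom x) (tensorSeries f)) g =
      ∑ z ∈ A.sigma fun ij => (finite_fiber f ij.2).toFinset,
        ⨂ₜ[ℂ] q, Function.update (fun q => vcoeff (f q) (z.2 q)) r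
          (x.coeff z.1.1 (vcoeff (f r) (z.2 r))) q := by
    rw [vcoeff, hahnAct_apply, HahnModule.coeff_smul_right ht hts, Finset.sum_sigma]
    have h1 : (mapSeries (onFactor V r).toRingHom x).support ⊆ x.support := fun i hi hc => hi (by
      change (onFactor V r).toRingHom (x.coeff i) = 0
      rw [hc, map_zero])
    refine (Finset.sum_subset (Finset.vaddAntidiagonal_mono_left _ h1
      (Set.VAddAntidiagonal.finite_of_isPWO x.isPWO_support ht g) _) ?_).trans ?_
    · intro ij hij hn
      have : (mapSeries (onFactor V r).toRingHom x).coeff ij.1 = 0 := by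
        by_contra h0
        apply hn
        rw [Finset.mem_vaddAntidiagonal] at hij ⊢
        exact ⟨h0, hij.2⟩
      rw [this, zero_smul]
    · refine Finset.sum_congr rfl fun ij _ => ?_
      change onFactor V r (x.coeff ij.1) (∑ h ∈ (finite_fiber f ij.2).toFinset,
        ⨂ₜ[ℂ] r, vcoeff (f r) (h r)) = _
      rw [map_sum]
      refine Finset.sum_congr rfl fun h _ => ?_
      rw [onFactor_tprod]
  set S := A.sigma fun ij => (finite_fiber f ij.2).toFinset with hS
  set F := S.image fun z => Function.update z.2 r (z.1.1 + z.2 r) with hF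
  have hmemS : ∀ (i g' : Expo ι) (h : Fin n → Expo ι), (⟨(i, g'), h⟩ : (_ : Expo ι × Expo ι) ×
      (Fin n → Expo ι)) ∈ S ↔ x.coeff i ≠ 0 ∧ (∀ q, vcoeff (f q) (h q) ≠ 0) ∧ ∑ q, h q = g' ∧ i + g' = g := by
    intro i g' h
    rw [hS, Finset.mem_sigma, hA, Finset.mem_vaddAntidiagonal, Set.Finite.mem_toFinset]
    constructor
    · rintro ⟨⟨h1, -, h3⟩, h4, h5⟩
      exact ⟨h1, h4, h5, h3⟩
    · rintro ⟨h1, h2, h3, h4⟩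
      exact ⟨⟨h1, ⟨h, fun q _ => h2 q, h3⟩, h4⟩, h2, h3⟩
  have hF1 : ∀ h' ∈ F, ∑ q, h' q = g := by
    intro h' hh
    obtain ⟨⟨⟨i, g'⟩, h⟩, hz, rfl⟩ := Finset.mem_image.1 hh
    obtain ⟨-, -, h3, h4⟩ := (hmemS _ _ _).1 hz
    change ∑ q, Function.update h r (i + h r) q = g
    rw [sum_update_index, h3, ← h4]
    abel
  have hx : ∀ e, vcoeff (hahnAct ι _ x (f r)) e = ∑ kl ∈ Finset.VAddAntidiagonal e
      (Set.VAddAntidiagonal.finite_of_isPWO x.isPWO_support ((HahnModule.of ℂ).symm (f r)).isPWO_support e),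
        x.coeff kl.1 (vcoeff (f r) kl.2) := fun e => rfl
  have hF2 : ∀ h' : Fin n → Expo ι, (∀ q, vcoeff (Function.update f r (hahnAct ι _ x (f r)) q) (h' q) ≠ 0) →
      ∑ q, h' q = g → h' ∈ F := by
    intro h' h1 h2
    have h3 := h1 r
    rw [Function.update_self, hx] at h3
    obtain ⟨⟨k, l⟩, hkl, -⟩ := Finset.exists_ne_zero_of_sum_ne_zero h3
    rw [Finset.mem_vaddAntidiagonal] at hkl
    obtain ⟨h4, h5, h6⟩ := hkl
    replace h6 : k + l = h' r := h6
    refine Finset.mem_image.2 ⟨⟨(k, ∑ q, Function.update h' r l q), Function.update h' r l⟩, ?_, ?_⟩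
    · rw [hmemS]
      refine ⟨h4, fun q => ?_, rfl, ?_⟩
      · by_cases hq : q = r
        · subst hq
          rw [Function.update_self]
          exact h5
        · have := h1 q
          rw [Function.update_of_ne hq] at this ⊢
          exact this
      · rw [sum_update_index, h2, ← h6]
        abel
    · simp [h6]
  rw [hL, vcoeff_tensorSeries _ g hF1 hF2]
  have hR : ∀ h' : Fin n → Expo ι,
      (⨂ₜ[ℂ] q, vcoeff (Function.update f r (hahnAct ι _ x (f r)) q) (h' q)) =
      ∑ kl ∈ Finset.VAddAntidiagonal (h' r) (Set.VAddAntidiagonal.finite_of_isPWO x.isPWO_support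
        ((HahnModule.of ℂ).symm (f r)).isPWO_support (h' r)),
        ⨂ₜ[ℂ] q, Function.update (fun q => vcoeff (f q) (h' q)) r (x.coeff kl.1 (vcoeff (f r) kl.2)) q := by
    intro h'
    rw [vcoeff_update, hx]
    exact (PiTensorProduct.tprod ℂ).map_update_sum _ r _ _
  simp only [hR]
  rw [Finset.sum_sigma']
  -- The exponent of the operator is added to the exponent of the factor `r`; the inverse map
  -- removes it and recomputes the total exponent of the vectors.
  refine Finset.sum_bij' (fun z _ => ⟨Function.update z.2 r (z.1.1 + z.2 r), (z.1.1, z.2 r)⟩)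
    (fun z _ => ⟨(z.2.1, ∑ q, Function.update z.1 r z.2.2 q), Function.update z.1 r z.2.2⟩) ?_ ?_ ?_ ?_ ?_
  · rintro ⟨⟨i, g'⟩, h⟩ hz
    obtain ⟨h1, h2, h3, h4⟩ := (hmemS _ _ _).1 hz
    rw [Finset.mem_sigma, Finset.mem_vaddAntidiagonal]
    refine ⟨Finset.mem_image_of_mem (fun z => Function.update z.2 r (z.1.1 + z.2 r)) hz, h1, h2 r, ?_⟩
    simp
  · rintro ⟨h', k, l⟩ hz
    rw [Finset.mem_sigma, Finset.mem_vaddAntidiagonal] at hz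
    obtain ⟨h1, h4, h5, h6⟩ := hz
    replace h6 : k + l = h' r := h6
    have h7 := hF1 _ h1
    obtain ⟨⟨⟨i, g'⟩, h⟩, hz, rfl⟩ := Finset.mem_image.1 h1
    obtain ⟨-, h8, -, -⟩ := (hmemS _ _ _).1 hz
    rw [hmemS]
    refine ⟨h4, fun q => ?_, rfl, ?_⟩
    · by_cases hq : q = r
      · subst hq
        rw [Function.update_self]
        exact h5
      · have := h8 q
        simpa [Function.update_of_ne hq] using this
    · rw [sum_update_index]
      dsimp only at h6 h7 ⊢
      rw [h7, ← h6]
      abel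
  · rintro ⟨⟨i, g'⟩, h⟩ hz
    obtain ⟨h1, h2, h3, h4⟩ := (hmemS _ _ _).1 hz
    simp [h3]
  · rintro ⟨h', k, l⟩ hz
    rw [Finset.mem_sigma, Finset.mem_vaddAntidiagonal] at hz
    obtain ⟨-, -, -, h6⟩ := hz
    replace h6 : k + l = h' r := h6
    simp [h6]
  · rintro ⟨⟨i, g'⟩, h⟩ hz
    congr 1
    funext q
    by_cases hq : q = r
    · subst hq; simp
    · simp [hq]

/-- A scalar series acts as a series of scalar operators, and such a series acts in the same way on
a factor and on the tensor product. -/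
theorem tensorSeries_update_smul (f : ∀ r, VectorSeries ι (V r)) (r : Fin n) (c : ScalarSeries ι)
    (x : VectorSeries ι (V r)) : tensorSeries (Function.update f r (c • x)) =
      c • tensorSeries (Function.update f r x) := by
  have h := hahnAct_tensorSeries (Function.update f r x) r (scalarTo _ c)
  rw [mapSeries_scalarTo, hahnAct_scalarTo, hahnAct_scalarTo, Module.algebraMap_end_apply,
    Module.algebraMap_end_apply, Function.update_self, Function.update_idem] at h
  exact h.symm

theorem tensorSeries_constSeries (v : ∀ r, V r) :
    tensorSeries (fun r => constSeries ι (v r)) = constSeries ι (⨂ₜ[ℂ] r, v r) := by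
  refine vcoeff_ext fun g => ?_
  have hc1 : ∀ r (e : Expo ι), vcoeff (constSeries ι (v r)) e = if e = 0 then v r else 0 := by
    intro r e
    change (HahnSeries.single 0 (v r)).coeff e = _
    rw [HahnSeries.coeff_single]
    split_ifs <;> rfl
  have hF2 : ∀ h : Fin n → Expo ι, (∀ r, vcoeff (constSeries ι (v r)) (h r) ≠ 0) → h = 0 := by
    intro h hh
    funext r
    by_contra h0
    exact hh r (by rw [hc1]; exact if_neg h0)
  have hc : vcoeff (constSeries ι (⨂ₜ[ℂ] r, v r)) g = if g = 0 then ⨂ₜ[ℂ] r, v r else 0 := by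
    change (HahnSeries.single 0 _).coeff g = _
    rw [HahnSeries.coeff_single]
    split_ifs <;> rfl
  rw [hc]
  by_cases hg : g = 0
  · rw [if_pos hg, vcoeff_tensorSeries _ g (F := {0}) (by simp [hg])
      (fun h h1 _ => by simp [hF2 h h1]), Finset.sum_singleton]
    simp only [hc1, Pi.zero_apply, if_true]
  · rw [if_neg hg, vcoeff_tensorSeries _ g (F := ∅) (by simp) (fun h h1 h2 => by
      rw [hF2 h h1] at h2
      exact absurd h2.symm (by simpa using hg)), Finset.sum_empty]

end tensorSeries

/-! ### Yangian operators on the tensor factors -/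

section factorOperators
variable {ι : Type*} [LinearOrder ι]

theorem commute_hahnSeries {A : Type*} [Ring A] {x y : HahnSeries (Expo ι) A}
    (h : ∀ i j, Commute (x.coeff i) (y.coeff j)) : Commute x y := by
  ext g
  rw [HahnSeries.coeff_mul, HahnSeries.coeff_mul]
  exact Finset.sum_equiv (Equiv.prodComm _ _) (fun _ => Finset.swap_mem_antidiagonal.symm)
    fun i _ => h _ _

theorem commute_evalAt [Finite ι] {A : Type*} [Ring A] {f g : PowerSeries A}
    (h : ∀ i j, Commute (PowerSeries.coeff i f) (PowerSeries.coeff j g)) (k l : ι) :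
    Commute (evalAt f k) (evalAt g l) := by
  classical
  refine commute_hahnSeries fun i j => ?_
  rw [coeff_evalAt, coeff_evalAt]
  simp only [intCoeff]
  split_ifs
  · exact h _ _
  all_goals simp

variable [Finite ι] {m n : ℕ} {Λ : Type} [DecidableEq Λ]
  (V : Fin n → Type*) [∀ r, AddCommGroup (V r)] [∀ r, Module ℂ (V r)]
  [∀ r, Module (Yangian m) (V r)] [∀ r, IsScalarTower ℂ (Yangian m) (V r)]

/-- The operators of the action of the Yangian on one factor, evaluated at the variables. -/
noncomputable def moduleFam (r : Fin n) (s : Λ → ι) :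
    OpFamily (ScalarSeries ι) Λ (m + 1) (VectorSeries ι (V r)) :=
  evalFam (fun a b => PowerSeries.map
    (Algebra.lsmul ℂ ℂ (V r) : Yangian m →ₐ[ℂ] Module.End ℂ (V r)).toRingHom (Yangian.T m a b)) s

/-- The operators of the action of the Yangian on one factor of the tensor product, evaluated at the
variables. -/
noncomputable def factorFam (s : Λ → ι) (r : Fin n) :
    OpFamily (ScalarSeries ι) Λ (m + 1) (VectorSeries ι (⨂[ℂ] r, V r)) :=
  evalFam (factorFamily (m := m) V r) s

theorem isRTT_factorFam (s : Λ → ι) (S : Set Λ) (r : Fin n) :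
    IsRTT (fun p => tvar (s p)) S (factorFam (m := m) V s r) :=
  isRTT_evalFam (isYangianFamily_map _ (isYangianFamily_T m)) s S

theorem isRTT_moduleFam (s : Λ → ι) (S : Set Λ) (r : Fin n) :
    IsRTT (fun p => tvar (s p)) S (moduleFam (m := m) V r s) :=
  isRTT_evalFam (isYangianFamily_map _ (isYangianFamily_T m)) s S

theorem commute_factorFamily {r q : Fin n} (h : r ≠ q) (a b c d : Fin (m + 1)) (i j : ℕ) :
    Commute (PowerSeries.coeff i (factorFamily (m := m) V r a b))
      (PowerSeries.coeff j (factorFamily (m := m) V q c d)) := by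
  simp only [factorFamily, PowerSeries.coeff_map]
  exact onFactor_commute V h _ _

theorem famCommute_factorFam (s : Λ → ι) : Pairwise fun r q => FamCommute
    (factorFam (m := m) V s r) (factorFam (m := m) V s q) := by
  intro r q h p p' a b c d
  exact (commute_evalAt (commute_factorFamily V h a b c d) (s p) (s p')).map (hahnAct ι _)

/-- The coproduct `∑ c, F c b * G a c` is the matrix product of `G` and `F` for commuting entries,
which is why the families of later factors stand on the left in `prodFam`. -/
theorem evalFam_tensorFamily (s : Λ → ι) {l : List (Fin n)} (hl : l.Nodup) :
    evalFam (tensorFamily (m := m) V l) s = prodFam (factorFam (m := m) V s) l := by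
  induction l with
  | nil =>
    funext p
    ext a b : 1
    rw [evalFam_apply, prodFam, Pi.one_apply, Matrix.one_apply, tensorFamily]
    dsimp only
    split_ifs
    · rw [evalAt_one, map_one]
    · rw [evalAt_zero, map_zero]
  | cons r l ih =>
    rw [List.nodup_cons] at hl
    have hc : FamCommute (prodFam (factorFam (m := m) V s) l) (factorFam (m := m) V s r) :=
      (famCommute_prodFam fun q hq => famCommute_factorFam V s (ne_of_mem_of_not_mem hq hl.1).symm).symm
    funext p
    ext a b : 1
    rw [evalFam_apply, prodFam, hc.mul_eq, tensorFamily, comulFamily, evalAt_sum, map_sum]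
    refine Finset.sum_congr rfl fun c _ => ?_
    rw [evalAt_mul, map_mul, ← ih hl.2]
    rfl

theorem map_tensorAction (a b : Fin (m + 1)) :
    PowerSeries.map (tensorAction V).toRingHom (Yangian.T m a b) =
      tensorFamily V (List.finRange n) a b := by
  ext s : 1
  rw [PowerSeries.coeff_map]
  exact Yangian.lift_T _ _ a b s

theorem isWeight_factorFam {v : ∀ r, V r} {lam : Fin n → Fin (m + 1) → PowerSeries ℂ}
    (hv : ∀ r, IsWeightSingular (v r) (lam r)) (s : Λ → ι) (S : Set Λ) (r : Fin n) :
    IsWeight S (factorFam (m := m) V s r) (fun p a => evalAt (lam r a) (s p))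
      (constSeries ι (⨂ₜ[ℂ] r, v r)) := by
  have key : ∀ a b i, PowerSeries.coeff i (factorFamily (m := m) V r a b) (⨂ₜ[ℂ] r, v r) =
      ⨂ₜ[ℂ] q, Function.update v r (PowerSeries.coeff i (Yangian.T m a b) • v r) q := by
    intro a b i
    rw [factorFamily, PowerSeries.coeff_map]
    exact onFactor_tprod V r _ v
  refine isWeight_evalFam (fun a b hab i => ?_) (fun a i => ?_) s S
  · rw [key, (hv r).singular a b hab]
    exact (PiTensorProduct.tprod ℂ).map_update_zero v r
  · rw [key, (hv r).eigen a i]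
    refine ((PiTensorProduct.tprod ℂ).map_update_smul v r _ _).trans ?_
    rw [Function.update_eq_self]

/-- The graph of `x ↦ f_1 ⊗ ⋯ ⊗ x ⊗ ⋯ ⊗ f_n`. -/
noncomputable def insertRel (f : ∀ r, VectorSeries ι (V r)) (r : Fin n) :
    Submodule (ScalarSeries ι) (VectorSeries ι (V r) × VectorSeries ι (⨂[ℂ] r, V r)) where
  carrier := {z | z.2 = tensorSeries (Function.update f r z.1)}
  zero_mem' := by
    have h := tensorSeries_update_add f r 0 0
    rw [add_zero] at h
    exact (left_eq_add.1 h).symm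
  add_mem' {x y} hx hy := by
    change x.2 + y.2 = _
    rw [show x.2 = _ from hx, show y.2 = _ from hy]
    exact (tensorSeries_update_add f r _ _).symm
  smul_mem' c x hx := by
    change c • x.2 = _
    rw [show x.2 = _ from hx]
    exact (tensorSeries_update_smul f r c _).symm

end factorOperators

/-! ### The weight function as a sum over distributions of the variables -/

section factorBethe
variable {ι : Type*} [LinearOrder ι] [Finite ι] {m n : ℕ} {Λ : Type} [DecidableEq Λ]
  (V : Fin n → Type v) [∀ r, AddCommGroup (V r)] [∀ r, Module ℂ (V r)]
  [∀ r, Module (Yangian m) (V r)] [∀ r, IsScalarTower ℂ (Yangian m) (V r)]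

/-- The map that inserts a vector at the place `r` intertwines the action on the factor with the
action on the tensor product; its graph is the relation `insertRel`. -/
theorem nestedBethe_factorFam (s : Λ → ι) (u : Λ → ScalarSeries ι) {P : Fin m → List Λ}
    (hP : IsSimple P) (f : ∀ r, VectorSeries ι (V r)) (r : Fin n) :
    nestedBethe u m P (factorFam V s r) (tensorSeries f) =
      tensorSeries (Function.update f r (nestedBethe u m P (moduleFam V r s) (f r))) := by
  refine nestedBethe_rel (V := VectorSeries ι (V r)) (V' := VectorSeries ι (⨂[ℂ] r, V r)) hP
    (R := fun _ => insertRel V f r) (T := moduleFam V r s) (T' := factorFam V s r) ?_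
    (le_refl _) (z := (f r, tensorSeries f)) ?_
  · intro X p _ _ a b z hz
    change _ = _
    rw [show z.2 = _ from hz]
    refine Eq.trans ?_ ((hahnAct_tensorSeries (Function.update f r z.1) r (evalAt (PowerSeries.map
      (Algebra.lsmul ℂ ℂ (V r) : Yangian m →ₐ[ℂ] Module.End ℂ (V r)).toRingHom (Yangian.T m a b))
      (s p))).trans ?_)
    · rw [mapSeries_apply, evalAt_map]
      rfl
    · rw [Function.update_self, Function.update_idem]
      rfl
  · change _ = _
    rw [Function.update_eq_self]

theorem distBethe_factorFam (s : Λ → ι) (u : Λ → ScalarSeries ι) (c : Λ → Fin m) (S : Finset Λ)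
    (φ : Λ → Fin n) {l : List (Fin n)} (hl : l.Nodup) (f : ∀ r, VectorSeries ι (V r)) :
    distBethe u c (factorFam V s) S φ l (tensorSeries f) = tensorSeries fun r => if r ∈ l then
      finBethe u m (colorSets c (S.filter fun p => φ p = r)) (moduleFam V r s) (f r) else f r := by
  induction l generalizing f with
  | nil => simp [distBethe]
  | cons r l ih =>
    rw [List.nodup_cons] at hl
    rw [distBethe, LinearMap.comp_apply, finBethe, nestedBethe_factorFam V s u
      (isSimple_colorSets c _), ih hl.2]
    congr 1
    funext q
    by_cases hq : q = r
    · subst hq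
      simp [hl.1, finBethe]
    · simp [hq]

/-- The formula in its unsymmetrized form: every map from the variables to the factors occurs once,
with the coefficient of its distribution. -/
theorem weightFunction_tensor {v : ∀ r, V r} {lam : Fin n → Fin (m + 1) → PowerSeries ℂ}
    (hv : ∀ r, IsWeightSingular (v r) (lam r)) (ξ : Fin m → ℕ) (t : Fin m → ℕ → ι)
    (ht : Function.Injective fun p : Slot ξ => t p.1 p.2) :
    weightFunction (tensorAction V) (⨂ₜ[ℂ] r, v r) ξ t = ∑ φ : Slot ξ → Fin n,
      distCoeff (fun p => tvar (t p.1 p.2)) (fun r p a => evalAt (lam r a) (t p.1 p.2)) Sigma.fst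
        Finset.univ Finset.univ φ • tensorSeries fun r => finBethe (fun p => tvar (t p.1 p.2)) m
          (colorSets Sigma.fst (Finset.univ.filter fun p => φ p = r))
          (moduleFam V r fun p : Slot ξ => t p.1 p.2) (constSeries ι (v r)) := by
  set s : Slot ξ → ι := fun p => t p.1 p.2 with hs
  have hu : Function.Injective fun p => (tvar (s p) : ScalarSeries ι) := tvar_injective.comp ht
  have h1 := weightFunction_eq (tensorAction V) (⨂ₜ[ℂ] r, v r) ht (e := id) Function.injective_id
    (ξ := ξ) (t := t) fun p => rfl
  simp only [map_tensorAction] at h1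
  rw [h1]
  have hfam : evalFam (fun a b => tensorFamily (m := m) V (List.finRange n) a b) s =
    prodFam (factorFam V s) (List.finRange n) := evalFam_tensorFamily V s (List.nodup_finRange n)
  change nestedBethe _ m _ (evalFam (fun a b => tensorFamily (m := m) V (List.finRange n) a b) s) _ = _
  rw [hfam]
  -- The empty tensor product is separate, because the sum over distributions requires a default
  -- factor.
  rcases Nat.eq_zero_or_pos n with hn | hn
  · subst hn
    rw [List.finRange_zero, prodFam, nestedBethe_one]
    split_ifs with h
    · have he : IsEmpty (Slot ξ) := ⟨fun p => by
        have := h p.1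
        rw [List.map_eq_nil_iff] at this
        exact List.ne_nil_of_mem (List.mem_finRange p.2) this⟩
      rw [Fintype.sum_unique]
      simp only [distCoeff, Finset.univ_eq_empty, Finset.prod_empty, mul_one]
      rw [one_smul, ← tensorSeries_constSeries]
      congr 1
      funext r
      exact r.elim0
    · have he : IsEmpty (Slot ξ → Fin 0) := by
        refine ⟨fun φ => h fun a => ?_⟩
        rw [List.map_eq_nil_iff, List.eq_nil_iff_forall_not_mem]
        exact fun i _ => (φ ⟨a, i⟩).elim0
      rw [Fintype.sum_empty]
  · have hfin : (List.finRange n).toFinset = Finset.univ := by ext; simp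
    have h2 := finBethe_prodFam (u := fun p => (tvar (s p) : ScalarSeries ι)) hu
      (fun p q => tvar_sub_add_one_ne_zero _ _) Sigma.fst (famCommute_factorFam (m := m) V s)
      (isRTT_factorFam V s Set.univ) (lam := fun r p a => evalAt (lam r a) (s p)) ⟨0, hn⟩
      (l := List.finRange n) (List.pairwise_lt_finRange n) Finset.univ
      (v := constSeries ι (⨂ₜ[ℂ] r, v r)) fun r _ => isWeight_factorFam V hv s Set.univ r
    rw [finBethe] at h2
    rw [nestedBethe_perm hu (fun p q => tvar_sub_add_one_ne_zero _ _)
      (P' := fun a => (colorSets Sigma.fst (Finset.univ : Finset (Slot ξ)) a).toList) ?_ ?_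
      ((isRTT_prodFam (famCommute_factorFam (m := m) V s)
        (isRTT_factorFam V s Set.univ) (List.nodup_finRange n)).mono (Set.subset_univ _)), h2, hfin]
    · have e : (Fintype.piFinset fun p : Slot ξ => if p ∈ Finset.univ then
          (Finset.univ : Finset (Fin n)) else {⟨0, hn⟩}) = Finset.univ := by
        ext φ; simp
      rw [e]
      refine Finset.sum_congr rfl fun φ _ => ?_
      rw [← tensorSeries_constSeries, distBethe_factorFam V s _ _ _ _ (List.nodup_finRange n)]
      simp only [List.mem_finRange, if_true]
      rfl
    · refine ⟨fun a => ?_, fun a b hab p hp hp' => ?_⟩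
      · exact (List.nodup_finRange _).map fun i j h => by simpa using h
      · obtain ⟨i, -, rfl⟩ := List.mem_map.1 hp
        obtain ⟨j, -, h⟩ := List.mem_map.1 hp'
        exact hab (congrArg Sigma.fst h).symm
    · intro a
      rw [List.perm_ext_iff_of_nodup ((List.nodup_finRange _).map fun i j h => by simpa using h)
        (Finset.nodup_toList _)]
      intro p
      rw [Finset.mem_toList, colorSets, Finset.mem_filter, List.mem_map]
      constructor
      · rintro ⟨i, -, rfl⟩
        exact ⟨Finset.mem_univ _, rfl⟩
      · rintro ⟨-, rfl⟩
        exact ⟨p.2, List.mem_finRange _, rfl⟩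

end factorBethe

/-! ### The symmetrization identity -/

section symmetrization
variable {K : Type*} [Field K]

/-- The factor of the symmetrization weight. -/
def symFactor (x y : K) : K := (x - y - 1) / (x - y)

theorem symFactor_eq {x y : K} (h : x ≠ y) : symFactor x y = 1 - (x - y)⁻¹ := by
  rw [symFactor, sub_div, div_self (sub_ne_zero.2 h), one_div]

-- The monic polynomials `∏ (X - y j - 1)` and `∏ (X - y j)` have a difference of degree less than
-- `s.card`, with the coefficient `-s.card` in degree `s.card - 1`. Lagrange interpolation at the
-- points `y i` expresses the same coefficient through the products in question, with a minus sign.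
open Polynomial in
theorem sum_prod_symFactor {κ : Type*} [DecidableEq κ] (s : Finset κ) {y : κ → K}
    (hy : Set.InjOn y s) : ∑ i ∈ s, ∏ j ∈ s.erase i, symFactor (y i) (y j) = s.card := by
  rcases s.eq_empty_or_nonempty with rfl | hs
  · simp
  set P : K[X] := ∏ j ∈ s, (X - C (y j + 1)) with hP
  set Q : K[X] := ∏ j ∈ s, (X - C (y j)) with hQ
  have hPm : P.Monic := monic_prod_X_sub_C _ s
  have hQm : Q.Monic := monic_prod_X_sub_C _ s
  have hPd : P.degree = s.card := by
    rw [degree_eq_natDegree hPm.ne_zero, hP, natDegree_finsetProd_X_sub_C_eq_card]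
  have hQd : Q.degree = s.card := by
    rw [degree_eq_natDegree hQm.ne_zero, hQ, natDegree_finsetProd_X_sub_C_eq_card]
  have hd : (P - Q).degree < s.card := by
    rw [← hPd]
    exact degree_sub_lt_left (hPd.trans hQd.symm) hPm.ne_zero (hPm.leadingCoeff.trans hQm.leadingCoeff.symm)
  have h := Lagrange.coeff_eq_sum hy hd
  rw [coeff_sub, hP, hQ, prod_X_sub_C_coeff_card_pred _ _ hs.card_pos,
    prod_X_sub_C_coeff_card_pred _ _ hs.card_pos, Finset.sum_add_distrib] at h
  simp only [Finset.sum_const, nsmul_eq_mul, mul_one] at h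
  have h2 : ∀ i ∈ s, (P - Q).eval (y i) / ∏ j ∈ s.erase i, (y i - y j) =
      -∏ j ∈ s.erase i, symFactor (y i) (y j) := by
    intro i hi
    simp only [symFactor, Finset.prod_div_distrib]
    rw [eval_sub, hP, hQ, eval_prod, eval_prod, ← Finset.mul_prod_erase _ _ hi,
      ← Finset.mul_prod_erase _ (fun j => eval (y i) (X - C (y j))) hi]
    simp only [eval_sub, eval_X, eval_C, sub_self, zero_mul, sub_zero, sub_add_cancel_left, ← sub_sub,
      neg_mul, one_mul, neg_div]
  rw [Finset.sum_congr rfl h2, Finset.sum_neg_distrib] at h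
  linear_combination h

/-- Permutations are grouped by the image `p` of zero: the factors with `i = 0` depend on `p` only,
the others sum to `k!` by induction, and the sum over `p` is `sum_prod_symFactor`. -/
theorem sum_perm_prod_symFactor {k : ℕ} {y : Fin k → K} (hy : Function.Injective y) :
    ∑ σ : Equiv.Perm (Fin k), ∏ i, ∏ j, (if i < j then symFactor (y (σ i)) (y (σ j)) else 1) =
      k.factorial := by
  induction k with
  | zero => simp
  | succ k ih =>
    rw [← Equiv.Perm.decomposeFin.symm.sum_comp, Fintype.sum_prod_type]
    have h1 : ∀ p : Fin (k + 1), ∑ e : Equiv.Perm (Fin k), ∏ i, ∏ j, (if i < j then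
        symFactor (y (Equiv.Perm.decomposeFin.symm (p, e) i))
          (y (Equiv.Perm.decomposeFin.symm (p, e) j)) else 1) =
        (∏ q ∈ Finset.univ.erase p, symFactor (y p) (y q)) * k.factorial := by
      intro p
      rw [← ih (y := fun i => y (Equiv.swap 0 p i.succ)) (hy.comp ((Equiv.swap 0 p).injective.comp
        (Fin.succ_injective _))), Finset.mul_sum]
      refine Finset.sum_congr rfl fun e _ => ?_
      rw [Fin.prod_univ_succ]
      congr 1
      · rw [Fin.prod_univ_succ, if_neg (lt_irrefl _), one_mul]
        simp only [Fin.succ_pos, if_true, Equiv.Perm.decomposeFin_symm_apply_zero,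
          Equiv.Perm.decomposeFin_symm_apply_succ]
        rw [Equiv.prod_comp e fun j : Fin k => symFactor (y p) (y (Equiv.swap 0 p j.succ))]
        refine Finset.prod_bij (fun j _ => Equiv.swap 0 p j.succ) ?_ ?_ ?_ fun _ _ => rfl
        · intro j _
          refine Finset.mem_erase.2 ⟨fun h => ?_, Finset.mem_univ _⟩
          have := (Equiv.swap 0 p).injective (h.trans (Equiv.swap_apply_left 0 p).symm)
          exact Fin.succ_ne_zero _ this
        · intro i _ j _ h
          exact Fin.succ_injective _ ((Equiv.swap 0 p).injective h)
        · intro q hq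
          have hq0 : Equiv.swap 0 p q ≠ 0 := fun h => (Finset.mem_erase.1 hq).1
            ((Equiv.swap 0 p).injective (h.trans (Equiv.swap_apply_right 0 p).symm))
          refine ⟨(Equiv.swap 0 p q).pred hq0, Finset.mem_univ _, ?_⟩
          rw [Fin.succ_pred, Equiv.swap_apply_self]
      · refine Finset.prod_congr rfl fun i _ => ?_
        rw [Fin.prod_univ_succ, if_neg (Fin.not_lt_zero _), one_mul]
        refine Finset.prod_congr rfl fun j _ => ?_
        rw [Equiv.Perm.decomposeFin_symm_apply_succ, Equiv.Perm.decomposeFin_symm_apply_succ]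
        simp only [Fin.succ_lt_succ_iff]
    simp only [h1]
    rw [← Finset.sum_mul, sum_prod_symFactor _ hy.injOn, Finset.card_univ, Fintype.card_fin,
      Nat.factorial_succ, Nat.cast_mul]

theorem sum_equiv_prod_symFactor {α β : Type*} [Fintype α] [LinearOrder α] [Fintype β] [DecidableEq β]
    (h : Fintype.card α = Fintype.card β) {y : β → K} (hy : Function.Injective y) :
    ∑ e : α ≃ β, ∏ i, ∏ j, (if i < j then symFactor (y (e i)) (y (e j)) else 1) =
      (Fintype.card α).factorial := by
  set o : Fin (Fintype.card α) ≃o α := Fintype.orderIsoFinOfCardEq α rfl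
  have g : Fin (Fintype.card α) ≃ β := Fintype.equivOfCardEq (by rw [Fintype.card_fin, h])
  rw [← sum_perm_prod_symFactor (y := fun i => y (g i)) (hy.comp g.injective),
    ← (Equiv.equivCongr o.toEquiv g).sum_comp]
  refine Finset.sum_congr rfl fun e _ => ?_
  rw [← o.toEquiv.prod_comp]
  refine Finset.prod_congr rfl fun i _ => ?_
  rw [← o.toEquiv.prod_comp]
  refine Finset.prod_congr rfl fun j _ => ?_
  simp [Equiv.equivCongr]

theorem prod_subtype_eq_prod_ite {α M : Type*} [Fintype α] [CommMonoid M] (p : α → Prop) [DecidablePred p]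
    (F : α → M) : ∏ i : {i // p i}, F i = ∏ i, if p i then F i else 1 := by
  rw [← Finset.prod_filter]
  exact (Finset.prod_subtype _ (fun i => by simp) _).symm

/-- The sum of symmetrization weights over permutations that map the fibers of `ψ` to the fibers of
`f`. -/
theorem sum_perm_fiber_symFactor {k : ℕ} {R : Type*} [Fintype R] [DecidableEq R] {f ψ : Fin k → R}
    (h : ∀ r, Fintype.card {i // ψ i = r} = Fintype.card {i // f i = r}) {y : Fin k → K}
    (hy : Function.Injective y) :
    ∑ σ : Equiv.Perm (Fin k), (if ∀ i, f (σ i) = ψ i then ∏ i, ∏ j,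
      (if i < j ∧ f (σ i) = f (σ j) then symFactor (y (σ i)) (y (σ j)) else 1) else 0) =
      ∏ r, ((Fintype.card {i // ψ i = r}).factorial : K) := by
  rw [← Finset.sum_filter]
  have h1 : ∀ r, ((Fintype.card {i // ψ i = r}).factorial : K) =
      ∑ e : {i // ψ i = r} ≃ {i // f i = r}, ∏ i, ∏ j,
        (if i < j then symFactor (y (e i)) (y (e j)) else 1) := fun r =>
    (sum_equiv_prod_symFactor (h r) (y := fun i : {i // f i = r} => y i)
      (hy.comp Subtype.val_injective)).symm
  simp only [h1]
  rw [Finset.prod_univ_sum, Fintype.piFinset_univ]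
  -- A permutation that carries the fibers of `ψ` to those of `f` is a family of bijections between
  -- fibers, so the sum factors over the fibers.
  refine Finset.sum_bij' (fun σ hσ r => σ.subtypeEquiv fun i => by
      rw [(Finset.mem_filter.1 hσ).2 i])
    (fun e _ => (Equiv.sigmaFiberEquiv ψ).symm.trans ((Equiv.sigmaCongrRight e).trans
      (Equiv.sigmaFiberEquiv f))) ?_ ?_ ?_ ?_ ?_
  · intro σ _
    exact Finset.mem_univ _
  · intro e _
    refine Finset.mem_filter.2 ⟨Finset.mem_univ _, fun i => ?_⟩
    exact (e (ψ i) ⟨i, rfl⟩).2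
  · intro σ _
    ext i
    rfl
  · intro e _
    funext r
    ext ⟨i, hi⟩ : 2
    subst hi
    rfl
  · intro σ hσ
    have hσ' := (Finset.mem_filter.1 hσ).2
    rw [← Fintype.prod_fiberwise ψ]
    refine Finset.prod_congr rfl fun r _ => Finset.prod_congr rfl fun i _ => ?_
    change _ = ∏ j : {j // ψ j = r}, (if (i : Fin k) < j then symFactor (y (σ i)) (y (σ j)) else 1)
    rw [prod_subtype_eq_prod_ite (fun j => ψ j = r) fun j =>
      if (i : Fin k) < j then symFactor (y (σ i)) (y (σ j)) else 1]
    refine Finset.prod_congr rfl fun j _ => ?_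
    rw [hσ', hσ', i.2]
    by_cases h1 : ψ j = r
    · simp [h1]
    · rw [if_neg h1, if_neg fun h' => h1 h'.2.symm]

end symmetrization

/-! ### Chains, blocks and distributions -/

section chains
variable {m n : ℕ} {ξ : Fin m → ℕ}

/-- `χ` assigns to the labels of every color the numbers of the blocks `(η_r, η_{r+1}]`, in which the
labels are. -/
def IsBlock (η : Fin (n + 1) → Fin m → ℕ) (χ : Slot ξ → Fin n) : Prop :=
  ∀ (p : Slot ξ) (r : Fin (n + 1)), (χ p).val < r.val ↔ p.2.val < η r p.1

/-- The numbers of labels of each color in the first `r` blocks. -/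
def blockSizes (φ : Slot ξ → Fin n) (r : Fin (n + 1)) (a : Fin m) : ℕ :=
  (Finset.univ.filter fun i : Fin (ξ a) => (φ ⟨a, i⟩).val < r.val).card

/-- The permutation of labels that preserves the colors. -/
def slotPerm (σ : ∀ a, Equiv.Perm (Fin (ξ a))) : Slot ξ ≃ Slot ξ := Equiv.sigmaCongrRight σ

theorem mem_chains {η : Fin (n + 1) → Fin m → ℕ} : η ∈ chains n ξ ↔ (∀ r, η r ≤ ξ) ∧
    η 0 = 0 ∧ η (Fin.last n) = ξ ∧ ∀ r : Fin n, η r.castSucc ≤ η r.succ := by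
  classical
  rw [chains, Finset.mem_filter, Finset.mem_Iic]
  rfl

theorem monotone_of_mem_chains {η : Fin (n + 1) → Fin m → ℕ} (hη : η ∈ chains n ξ) (a : Fin m) :
    Monotone fun r => η r a :=
  Fin.monotone_iff_le_succ.2 fun r => (mem_chains.1 hη).2.2.2 r a

/-- The block of a label is the predecessor of the least `r` whose bound exceeds its position. Such
an `r` exists because the chain ends at `ξ`, and it is nonzero because the chain starts at zero. -/
theorem exists_isBlock {η : Fin (n + 1) → Fin m → ℕ} (hη : η ∈ chains n ξ) :
    ∃ χ : Slot ξ → Fin n, IsBlock η χ := by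
  obtain ⟨-, h0, hl, -⟩ := mem_chains.1 hη
  have key : ∀ p : Slot ξ, ∃ k : Fin n, ∀ r : Fin (n + 1), k.val < r.val ↔ p.2.val < η r p.1 := by
    intro p
    set S : Finset (Fin (n + 1)) := Finset.univ.filter fun r => p.2.val < η r p.1 with hS
    have hne : S.Nonempty := ⟨Fin.last n, by
      rw [hS, Finset.mem_filter, hl]
      exact ⟨Finset.mem_univ _, p.2.2⟩⟩
    have hmin := Finset.min'_mem S hne
    have hmin0 : S.min' hne ≠ 0 := by
      intro h
      rw [h, hS, Finset.mem_filter, h0] at hmin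
      exact absurd hmin.2 (Nat.not_lt_zero _)
    obtain ⟨k, hk⟩ := Fin.exists_succ_eq.2 hmin0
    refine ⟨k, fun r => ?_⟩
    constructor
    · intro h
      have h1 : S.min' hne ≤ r := by
        rw [← hk, Fin.le_def, Fin.val_succ]
        exact h
      exact (Finset.mem_filter.1 hmin).2.trans_le (monotone_of_mem_chains hη p.1 h1)
    · intro h
      have h1 := Finset.min'_le S r (Finset.mem_filter.2 ⟨Finset.mem_univ _, h⟩)
      rw [← hk, Fin.le_def, Fin.val_succ] at h1
      exact h1
  choose χ hχ using key
  exact ⟨χ, hχ⟩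

theorem IsBlock.unique {η : Fin (n + 1) → Fin m → ℕ} {χ χ' : Slot ξ → Fin n} (h : IsBlock η χ)
    (h' : IsBlock η χ') : χ = χ' := by
  funext p
  have key : ∀ r : Fin (n + 1), (χ p).val < r.val ↔ (χ' p).val < r.val := fun r =>
    (h p r).trans (h' p r).symm
  have h1 := (key (χ p).succ).1 (by simp)
  have h2 := (key (χ' p).succ).2 (by simp)
  rw [Fin.val_succ] at h1 h2
  ext
  omega

theorem card_filter_val_lt {k l : ℕ} (h : l ≤ k) :
    (Finset.univ.filter fun i : Fin k => i.val < l).card = l := by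
  rw [Fin.card_filter_val_lt, min_eq_right h]

/-- A permutation does not change the number of labels sent to the first `r` factors, so `φ`
determines the chain. -/
theorem IsBlock.eq_blockSizes {η : Fin (n + 1) → Fin m → ℕ} (hη : η ∈ chains n ξ) {φ : Slot ξ → Fin n}
    {σ : ∀ a, Equiv.Perm (Fin (ξ a))} (h : IsBlock η (φ ∘ slotPerm σ)) : η = blockSizes φ := by
  funext r a
  rw [blockSizes, ← card_filter_val_lt ((mem_chains.1 hη).1 r a)]
  refine Finset.card_equiv (σ a) fun i => ?_
  simp only [Finset.mem_filter, Finset.mem_univ, true_and]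
  exact (h ⟨a, i⟩ r).symm

theorem blockSizes_mem_chains (φ : Slot ξ → Fin n) : blockSizes φ ∈ chains n ξ := by
  rw [mem_chains]
  refine ⟨fun r a => ?_, ?_, ?_, fun r a => ?_⟩
  · exact (Finset.card_le_univ _).trans_eq (Fintype.card_fin _)
  · funext a
    simp [blockSizes]
  · funext a
    simp [blockSizes]
  · refine Finset.card_le_card fun i => ?_
    simp only [Finset.mem_filter, Finset.mem_univ, true_and, Fin.val_castSucc, Fin.val_succ]
    omega

theorem card_fiber_eq (φ : Slot ξ → Fin n) (a : Fin m) (r : Fin n) :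
    Fintype.card {i // φ ⟨a, i⟩ = r} = blockSizes φ r.succ a - blockSizes φ r.castSucc a := by
  rw [Fintype.card_subtype, blockSizes, blockSizes, ← Finset.card_sdiff_of_subset]
  · congr 1
    ext i
    simp only [Finset.mem_filter, Finset.mem_univ, true_and, Finset.mem_sdiff, Fin.val_castSucc,
      Fin.val_succ, Fin.ext_iff]
    omega
  · intro i
    simp only [Finset.mem_filter, Finset.mem_univ, true_and, Fin.val_castSucc, Fin.val_succ]
    omega

/-- The factors of the symmetrization weight for labels in the same blocks. -/
noncomputable def blockWeight {K : Type*} [Field K] (x : Slot ξ → K) (χ : Slot ξ → Fin n) : K :=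
  ∏ a, ∏ i : Fin (ξ a), ∏ j : Fin (ξ a),
    if i < j ∧ χ ⟨a, i⟩ = χ ⟨a, j⟩ then symFactor (x ⟨a, i⟩) (x ⟨a, j⟩) else 1

-- The permutations counted are those that turn `φ` into the standard block function `ψ` of its
-- chain. The condition and the weight split over the colors, and within a color over the blocks.
open Classical in
theorem sum_blockWeight {K : Type*} [Field K] {x : Slot ξ → K} (hx : Function.Injective x)
    (φ : Slot ξ → Fin n) : ∑ σ : ∀ a, Equiv.Perm (Fin (ξ a)),
      (if IsBlock (blockSizes φ) (φ ∘ slotPerm σ) then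
        blockWeight (x ∘ slotPerm σ) (φ ∘ slotPerm σ) else 0) =
      ∏ a, ∏ r : Fin n, ((blockSizes φ r.succ a - blockSizes φ r.castSucc a).factorial : K) := by
  obtain ⟨ψ, hψ⟩ := exists_isBlock (blockSizes_mem_chains φ)
  have hsz : blockSizes φ = blockSizes ψ :=
    IsBlock.eq_blockSizes (σ := fun _ => 1) (blockSizes_mem_chains φ) hψ
  have hcond : ∀ σ : ∀ a, Equiv.Perm (Fin (ξ a)), IsBlock (blockSizes φ) (φ ∘ slotPerm σ) ↔
      ∀ a ∈ (Finset.univ : Finset (Fin m)), ∀ i, φ ⟨a, σ a i⟩ = ψ ⟨a, i⟩ := by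
    intro σ
    constructor
    · intro h a _ i
      exact congrFun (h.unique hψ) ⟨a, i⟩
    · intro h
      have : φ ∘ slotPerm σ = ψ := funext fun p => h p.1 (Finset.mem_univ _) p.2
      rw [this]
      exact hψ
  have hcolor : ∀ a, ∏ r : Fin n, ((blockSizes φ r.succ a - blockSizes φ r.castSucc a).factorial : K) =
      ∑ σ : Equiv.Perm (Fin (ξ a)), (if ∀ i, φ ⟨a, σ i⟩ = ψ ⟨a, i⟩ then ∏ i, ∏ j,
      (if i < j ∧ φ ⟨a, σ i⟩ = φ ⟨a, σ j⟩ then symFactor (x ⟨a, σ i⟩) (x ⟨a, σ j⟩) else 1) else 0) := by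
    intro a
    have := sum_perm_fiber_symFactor (f := fun i => φ ⟨a, i⟩) (ψ := fun i => ψ ⟨a, i⟩)
      (fun r => by rw [card_fiber_eq, card_fiber_eq, hsz]) (y := fun i => x ⟨a, i⟩)
      (hx.comp sigma_mk_injective)
    simp only [card_fiber_eq, ← hsz] at this
    rw [← this]
  simp only [hcolor]
  rw [Finset.prod_univ_sum, Fintype.piFinset_univ]
  refine Finset.sum_congr rfl fun σ _ => ?_
  rw [Finset.prod_ite_zero, if_congr (hcond σ) rfl rfl]
  split_ifs <;> rfl

end chains

/-! ### Products over intervals as products over blocks -/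

section blocks
variable {m n : ℕ} {ξ : Fin m → ℕ} {M : Type*} [CommMonoid M]

theorem prod_eq_prod_fin_ite {k : ℕ} {S : Finset ℕ} (hS : ∀ i ∈ S, i < k) (F : ℕ → M) :
    ∏ i ∈ S, F i = ∏ i : Fin k, if i.val ∈ S then F i else 1 := by
  rw [← Finset.prod_range fun i => if i ∈ S then F i else 1, Finset.prod_ite_mem]
  congr 1
  ext i
  simp only [Finset.mem_inter, Finset.mem_range]
  exact ⟨fun h => ⟨hS i h, h⟩, fun h => h.2⟩

variable {η : Fin (n + 1) → Fin m → ℕ} {χ : Slot ξ → Fin n}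

theorem IsBlock.monotone (h : IsBlock η χ) {a : Fin m} {i j : Fin (ξ a)} (hij : i ≤ j) :
    χ ⟨a, i⟩ ≤ χ ⟨a, j⟩ := by
  by_contra hlt
  rw [not_le] at hlt
  have h1 := (h ⟨a, j⟩ (χ ⟨a, i⟩).castSucc).1 hlt
  exact lt_irrefl _ ((h ⟨a, i⟩ (χ ⟨a, i⟩).castSucc).2 (lt_of_le_of_lt hij h1))

theorem IsBlock.lt_iff (h : IsBlock η χ) (a : Fin m) (i : Fin (ξ a)) (r : Fin n) :
    χ ⟨a, i⟩ < r ↔ i.val < η r.castSucc a := h ⟨a, i⟩ r.castSucc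

theorem IsBlock.gt_iff (h : IsBlock η χ) (a : Fin m) (i : Fin (ξ a)) (r : Fin n) :
    r < χ ⟨a, i⟩ ↔ η r.succ a ≤ i.val := by
  have := h ⟨a, i⟩ r.succ
  rw [Fin.val_succ] at this
  rw [← not_lt, ← this, Fin.lt_def]
  omega

theorem IsBlock.eq_iff (h : IsBlock η χ) (a : Fin m) (i : Fin (ξ a)) (r : Fin n) :
    χ ⟨a, i⟩ = r ↔ η r.castSucc a ≤ i.val ∧ i.val < η r.succ a := by
  rw [← not_lt, ← h.lt_iff, ← not_le (a := η r.succ a), ← h.gt_iff, not_lt, not_lt, and_comm]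
  exact le_antisymm_iff

theorem IsBlock.prod_range (hη : η ∈ chains n ξ) (h : IsBlock η χ) (a : Fin m) (r : Fin n)
    (F : ℕ → M) : ∏ i ∈ Finset.range (η r.castSucc a), F i =
      ∏ i : Fin (ξ a), if χ ⟨a, i⟩ < r then F i else 1 := by
  rw [prod_eq_prod_fin_ite (k := ξ a) fun i hi =>
    (Finset.mem_range.1 hi).trans_le ((mem_chains.1 hη).1 _ _)]
  refine Finset.prod_congr rfl fun i _ => if_congr ?_ rfl rfl
  rw [h.lt_iff, Finset.mem_range]

theorem IsBlock.prod_Ico_top (h : IsBlock η χ) (a : Fin m) (r : Fin n)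
    (F : ℕ → M) : ∏ i ∈ Finset.Ico (η r.succ a) (ξ a), F i =
      ∏ i : Fin (ξ a), if r < χ ⟨a, i⟩ then F i else 1 := by
  rw [prod_eq_prod_fin_ite (k := ξ a) fun i hi => (Finset.mem_Ico.1 hi).2]
  refine Finset.prod_congr rfl fun i _ => if_congr ?_ rfl rfl
  rw [h.gt_iff, Finset.mem_Ico, and_iff_left i.2]

theorem IsBlock.prod_Ico (hη : η ∈ chains n ξ) (h : IsBlock η χ) (a : Fin m)
    (F : Fin n → ℕ → M) : ∏ r : Fin n, ∏ i ∈ Finset.Ico (η r.castSucc a) (η r.succ a), F r i =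
      ∏ i : Fin (ξ a), F (χ ⟨a, i⟩) i := by
  have e : ∀ r : Fin n, ∏ i ∈ Finset.Ico (η r.castSucc a) (η r.succ a), F r i =
      ∏ i : Fin (ξ a), if χ ⟨a, i⟩ = r then F r i else 1 := by
    intro r
    rw [prod_eq_prod_fin_ite (k := ξ a) fun i hi =>
      (Finset.mem_Ico.1 hi).2.trans_le ((mem_chains.1 hη).1 _ _)]
    refine Finset.prod_congr rfl fun i _ => if_congr ?_ rfl rfl
    rw [h.eq_iff, Finset.mem_Ico]
  simp only [e]
  rw [Finset.prod_comm]
  simp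

end blocks

/-! ### Matching of the coefficients -/

section coefficients
variable {m n : ℕ} {ξ : Fin m → ℕ} {ι : Type*} [LinearOrder ι] [Finite ι]
  {η : Fin (n + 1) → Fin m → ℕ} {χ : Slot ξ → Fin n} {s : Fin m → ℕ → ι}

/-- Blocks increase with the position, so a pair `i < j` lies either in one block or in two blocks
in increasing order; the latter pairs give the equal-color part of `pairCoeff`. -/
theorem symWeight_eq (h : IsBlock η χ)
    (hs : Function.Injective fun p : Slot ξ => s p.1 p.2) :
    symWeight ξ s = blockWeight (fun p => tvar (s p.1 p.2)) χ *
      ∏ p : Slot ξ, ∏ q : Slot ξ, if χ q < χ p then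
        (if q.1 = p.1 then 1 - ((tvar (s q.1 q.2) : ScalarSeries ι) - tvar (s p.1 p.2))⁻¹ else 1)
        else 1 := by
  have hne : ∀ p q : Slot ξ, p ≠ q → (tvar (s p.1 p.2) : ScalarSeries ι) ≠ tvar (s q.1 q.2) :=
    fun p q hpq e => hpq (hs (tvar_injective e))
  have h1 : symWeight ξ s = ∏ a, ∏ i : Fin (ξ a), ∏ j : Fin (ξ a),
      if i < j then symFactor (tvar (s a i) : ScalarSeries ι) (tvar (s a j)) else 1 := by
    refine Finset.prod_congr rfl fun a _ => ?_
    rw [Finset.prod_range, Finset.prod_comm]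
    refine Finset.prod_congr rfl fun j _ => ?_
    rw [prod_eq_prod_fin_ite (k := ξ a) fun i hi => (Finset.mem_range.1 hi).trans j.2]
    refine Finset.prod_congr rfl fun i _ => if_congr ?_ rfl rfl
    rw [Finset.mem_range, Fin.lt_def]
  have h2 : (∏ p : Slot ξ, ∏ q : Slot ξ, if χ q < χ p then
        (if q.1 = p.1 then 1 - ((tvar (s q.1 q.2) : ScalarSeries ι) - tvar (s p.1 p.2))⁻¹ else 1)
        else 1) = ∏ a, ∏ i : Fin (ξ a), ∏ j : Fin (ξ a), if χ ⟨a, i⟩ < χ ⟨a, j⟩ then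
          symFactor (tvar (s a i) : ScalarSeries ι) (tvar (s a j)) else 1 := by
    rw [Fintype.prod_sigma]
    refine Finset.prod_congr rfl fun a _ => ?_
    rw [Finset.prod_comm (s := Finset.univ (α := Fin (ξ a))) (t := Finset.univ (α := Fin (ξ a)))]
    refine Finset.prod_congr rfl fun j _ => ?_
    rw [Fintype.prod_sigma, Finset.prod_eq_single a]
    · refine Finset.prod_congr rfl fun i _ => ?_
      by_cases h3 : χ ⟨a, i⟩ < χ ⟨a, j⟩
      · rw [if_pos h3, if_pos h3, if_pos rfl]
        exact (symFactor_eq (hne ⟨a, i⟩ ⟨a, j⟩ fun e => by rw [e] at h3; exact lt_irrefl _ h3)).symm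
      · rw [if_neg h3, if_neg h3]
    · intro b _ hb
      refine Finset.prod_eq_one fun i _ => ?_
      simp only [if_neg hb, ite_self]
    · intro h'
      exact absurd (Finset.mem_univ _) h'
  rw [h1, h2, blockWeight, ← Finset.prod_mul_distrib]
  refine Finset.prod_congr rfl fun a _ => ?_
  rw [← Finset.prod_mul_distrib]
  refine Finset.prod_congr rfl fun i _ => ?_
  rw [← Finset.prod_mul_distrib]
  refine Finset.prod_congr rfl fun j _ => ?_
  by_cases hij : i < j
  · rcases (h.monotone hij.le).eq_or_lt with h3 | h3
    · simp [hij, h3]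
    · simp [hij, h3, h3.ne]
  · have h3 : ¬ χ ⟨a, i⟩ < χ ⟨a, j⟩ := (h.monotone (not_lt.1 hij)).not_gt
    simp [hij, h3]

/-- The index `i` of the upper color runs over the block `r` and `j` of the lower color over the
later blocks, which is the condition `χ q < χ p` for `q` of the upper color. -/
theorem prod_neighbour_eq (hη : η ∈ chains n ξ) (h : IsBlock η χ)
    (hs : Function.Injective fun p : Slot ξ => s p.1 p.2) :
    (∏ a : Fin m, ∏ b : Fin m with b.val = a.val + 1, ∏ r : Fin n,
      ∏ i ∈ Finset.Ico (η r.castSucc b) (η r.succ b), ∏ j ∈ Finset.Ico (η r.succ a) (ξ a),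
        ((tvar (s b i) : ScalarSeries ι) - tvar (s a j) + 1) / (tvar (s b i) - tvar (s a j))) =
      ∏ p : Slot ξ, ∏ q : Slot ξ, if χ q < χ p then (if q.1.val = p.1.val + 1 then
        1 + ((tvar (s q.1 q.2) : ScalarSeries ι) - tvar (s p.1 p.2))⁻¹ else 1) else 1 := by
  rw [Fintype.prod_sigma]
  refine Finset.prod_congr rfl fun a _ => ?_
  simp only [Fintype.prod_sigma]
  rw [Finset.prod_filter, Finset.prod_comm]
  refine Finset.prod_congr rfl fun b _ => ?_
  split_ifs with hab
  · rw [h.prod_Ico hη b fun r i => ∏ j ∈ Finset.Ico (η r.succ a) (ξ a),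
      ((tvar (s b i) : ScalarSeries ι) - tvar (s a j) + 1) / (tvar (s b i) - tvar (s a j)),
      Finset.prod_comm]
    refine Finset.prod_congr rfl fun i _ => ?_
    rw [h.prod_Ico_top]
    refine Finset.prod_congr rfl fun j _ => ?_
    have hne : (tvar (s b i) : ScalarSeries ι) - tvar (s a j) ≠ 0 := by
      intro e
      have h3 := hs (a₁ := ⟨b, i⟩) (a₂ := ⟨a, j⟩) (tvar_injective (sub_eq_zero.1 e))
      have h4 : b = a := congrArg Sigma.fst h3
      rw [h4] at hab
      omega
    split_ifs
    · rw [add_div, div_self hne, one_div]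
    · rfl
  · symm
    refine Finset.prod_eq_one fun i _ => Finset.prod_eq_one fun j _ => ite_self _

theorem prod_eigen_eq (hη : η ∈ chains n ξ) (h : IsBlock η χ) (lam : Fin n → Fin (m + 1) → PowerSeries ℂ) :
    (∏ a : Fin m, ∏ r : Fin n, ((∏ i ∈ Finset.range (η r.castSucc a),
        evalAt (lam r a.castSucc) (s a i)) *
      ∏ j ∈ Finset.Ico (η r.succ a) (ξ a), evalAt (lam r a.succ) (s a j))) =
      ∏ p : Slot ξ, ∏ r : Fin n,
        eigenCoeff (fun r p a => evalAt (lam r a) (s p.1 p.2)) Sigma.fst p (χ p) r := by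
  rw [Fintype.prod_sigma]
  refine Finset.prod_congr rfl fun a _ => ?_
  rw [Finset.prod_comm (s := Finset.univ (α := Fin (ξ a)))]
  refine Finset.prod_congr rfl fun r _ => ?_
  rw [h.prod_range hη, h.prod_Ico_top, ← Finset.prod_mul_distrib]
  refine Finset.prod_congr rfl fun i _ => ?_
  rw [eigenCoeff]
  rcases lt_trichotomy r (χ ⟨a, i⟩) with h1 | h1 | h1
  · simp [h1, h1.not_gt]
  · simp [h1]
  · simp [h1, h1.not_gt]

theorem coefficient_eq (hη : η ∈ chains n ξ) (h : IsBlock η χ)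
    (hs : Function.Injective fun p : Slot ξ => s p.1 p.2) (lam : Fin n → Fin (m + 1) → PowerSeries ℂ) :
    symWeight ξ s * ((∏ a : Fin m, ∏ b : Fin m with b.val = a.val + 1, ∏ r : Fin n,
      ∏ i ∈ Finset.Ico (η r.castSucc b) (η r.succ b), ∏ j ∈ Finset.Ico (η r.succ a) (ξ a),
        ((tvar (s b i) : ScalarSeries ι) - tvar (s a j) + 1) / (tvar (s b i) - tvar (s a j))) *
      ∏ a : Fin m, ∏ r : Fin n, ((∏ i ∈ Finset.range (η r.castSucc a),
          evalAt (lam r a.castSucc) (s a i)) *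
        ∏ j ∈ Finset.Ico (η r.succ a) (ξ a), evalAt (lam r a.succ) (s a j))) =
      blockWeight (fun p => tvar (s p.1 p.2)) χ *
        distCoeff (fun p => tvar (s p.1 p.2)) (fun r p a => evalAt (lam r a) (s p.1 p.2)) Sigma.fst
          Finset.univ Finset.univ χ := by
  rw [symWeight_eq h hs, prod_neighbour_eq hη h hs, prod_eigen_eq hη h, distCoeff, mul_assoc, ← mul_assoc _ _
    (∏ p, ∏ r, eigenCoeff _ Sigma.fst p (χ p) r), ← Finset.prod_mul_distrib]
  congr 2
  refine Finset.prod_congr rfl fun p _ => ?_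
  rw [← Finset.prod_mul_distrib]
  refine Finset.prod_congr rfl fun q _ => ?_
  by_cases h1 : χ q < χ p
  · rw [if_pos h1, if_pos h1, if_pos h1, pairCoeff]
  · rw [if_neg h1, if_neg h1, if_neg h1, one_mul]

/-- The coefficient is defined label by label, so a renaming of labels that keeps the colors does
not change it. This returns from the permuted variables to the original ones. -/
theorem distCoeff_comp_equiv {K : Type*} [Field K] {Λ R : Type} [Fintype Λ] [LinearOrder R] {m : ℕ} (u : Λ → K)
    (lam : R → Λ → Fin (m + 1) → K) (c : Λ → Fin m) (L : Finset R) (φ : Λ → R) (g : Λ ≃ Λ)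
    (hg : ∀ p, c (g p) = c p) :
    distCoeff (u ∘ g) (fun r p => lam r (g p)) c Finset.univ L (φ ∘ g) =
      distCoeff u lam c Finset.univ L φ := by
  rw [distCoeff, distCoeff]
  congr 1
  · refine Fintype.prod_equiv g _ _ fun p => Fintype.prod_equiv g _ _ fun q => ?_
    simp only [Function.comp_apply, pairCoeff, hg]
  · refine Fintype.prod_equiv g _ _ fun p => Finset.prod_congr rfl fun r _ => ?_
    simp only [Function.comp_apply, eigenCoeff, hg]

end coefficients

/-! ### Rearrangement of the double sum -/

section generic
variable {K M : Type*} [Field K] [AddCommGroup M] [Module K M]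

theorem sum_sum_eq_of_coefficients {H S Φ : Type*} [Fintype S] [Fintype Φ] {C : Finset H} {X : H → S → M}
    {D : Φ → M} {c : H → S → Φ → K} (hX : ∀ η ∈ C, ∀ σ, X η σ = ∑ φ, c η σ φ • D φ)
    (hc : ∀ φ, ∑ η ∈ C, ∑ σ, c η σ φ = 1) : ∑ η ∈ C, ∑ σ, X η σ = ∑ φ, D φ := by
  rw [Finset.sum_congr rfl fun η hη => Finset.sum_congr rfl fun σ _ => hX η hη σ]
  simp only [Finset.sum_comm (s := Finset.univ (α := S)) (t := Finset.univ (α := Φ))]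
  rw [Finset.sum_comm]
  refine Finset.sum_congr rfl fun φ _ => ?_
  simp only [← Finset.sum_smul]
  rw [hc, one_smul]

open Classical in
theorem smul_eq_sum_ite {Φ : Type*} [Fintype Φ] (p : Φ → Prop) {ψ : Φ} (hψ : p ψ)
    (hu : ∀ φ, p φ → φ = ψ) (a b c : K) (y : Φ → M) (x : Φ → K) (w : Φ → K) (h : b * c = w ψ * x ψ) :
    a • b • c • y ψ = ∑ φ, (if p φ then a * w φ else 0) • x φ • y φ := by
  rw [Finset.sum_eq_single ψ, if_pos hψ, smul_smul, smul_smul, smul_smul, mul_assoc, h, mul_assoc]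
  · intro φ _ hne
    rw [if_neg fun h => hne (hu φ h), zero_smul]
  · intro h
    exact absurd (Finset.mem_univ _) h

end generic

/-! ### Assembly of the formula -/

section final
variable {ι : Type*} [LinearOrder ι] [Finite ι] {m n : ℕ}
  (V : Fin n → Type v) [∀ r, AddCommGroup (V r)] [∀ r, Module ℂ (V r)]
  [∀ r, Module (Yangian m) (V r)] [∀ r, IsScalarTower ℂ (Yangian m) (V r)]
  {ξ : Fin m → ℕ} {t : Fin m → ℕ → ι}

theorem charZero_scalarSeries : CharZero (ScalarSeries ι) :=
  charZero_of_injective_algebraMap (R := ℂ) (algebraMap ℂ (ScalarSeries ι)).injective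

theorem permVars_apply (σ : ∀ a, Equiv.Perm (Fin (ξ a))) (t : Fin m → ℕ → ι) (p : Slot ξ) :
    permVars ξ σ t p.1 p.2 = t (slotPerm σ p).1 (slotPerm σ p).2 := by
  rw [permVars, dif_pos p.2.2]
  rfl

/-- The permuted variables in the block `r` are exactly the labels that `φ` sends to `r`. They occur
in some order, which is irrelevant by `nestedBethe_perm`. -/
theorem weightFunction_block (v : ∀ r, V r) (ht : Function.Injective fun p : Slot ξ => t p.1 p.2)
    {η : Fin (n + 1) → Fin m → ℕ} (hη : η ∈ chains n ξ) {σ : ∀ a, Equiv.Perm (Fin (ξ a))}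
    {φ : Slot ξ → Fin n} (h : IsBlock η (φ ∘ slotPerm σ)) (r : Fin n) :
    weightFunction (Algebra.lsmul ℂ ℂ (V r)) (v r) (fun a => η r.succ a - η r.castSucc a)
      (fun a i => permVars ξ σ t a (η r.castSucc a + i)) =
      finBethe (fun p : Slot ξ => tvar (t p.1 p.2)) m
        (colorSets Sigma.fst (Finset.univ.filter fun p => φ p = r))
        (moduleFam V r fun p : Slot ξ => t p.1 p.2) (constSeries ι (v r)) := by
  have hlt : ∀ (a : Fin m) (i : Fin (η r.succ a - η r.castSucc a)), η r.castSucc a + i < ξ a := by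
    intro a i
    have h1 : η r.succ a ≤ ξ a := (mem_chains.1 hη).1 r.succ a
    have h2 : i.val < η r.succ a - η r.castSucc a := i.2
    omega
  set e : Slot (fun a => η r.succ a - η r.castSucc a) → Slot ξ :=
    fun q => slotPerm σ ⟨q.1, ⟨η r.castSucc q.1 + q.2, hlt q.1 q.2⟩⟩ with he
  have hinj : Function.Injective e := by
    rintro ⟨a, i⟩ ⟨b, j⟩ hab
    have h1 := (slotPerm σ).injective hab
    have h2 : a = b := congrArg Sigma.fst h1
    subst h2
    have h3 := congrArg Fin.val (eq_of_heq (Sigma.mk.inj h1).2)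
    have h4 : i = j := by
      ext
      simpa using h3
    rw [h4]
  have hs : IsSimple fun a => (List.finRange (η r.succ a - η r.castSucc a)).map fun i => e ⟨a, i⟩ := by
    refine ⟨fun a => ?_, fun a b hab p hp hp' => ?_⟩
    · exact (List.nodup_finRange _).map (hinj.comp sigma_mk_injective)
    · obtain ⟨i, -, rfl⟩ := List.mem_map.1 hp
      obtain ⟨j, -, h'⟩ := List.mem_map.1 hp'
      exact hab (congrArg Sigma.fst (hinj h')).symm
  rw [weightFunction_eq (Algebra.lsmul ℂ ℂ (V r)) (v r) ht hinj fun q => permVars_apply σ t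
    ⟨q.1, ⟨η r.castSucc q.1 + q.2, hlt q.1 q.2⟩⟩, finBethe]
  refine nestedBethe_perm (tvar_injective.comp ht) (fun p q => tvar_sub_add_one_ne_zero _ _) hs
    (fun a => ?_) (isRTT_moduleFam V _ _ r) _
  rw [List.perm_ext_iff_of_nodup (hs.nodup a) (Finset.nodup_toList _)]
  intro p
  rw [Finset.mem_toList, colorSets, Finset.mem_filter, Finset.mem_filter, List.mem_map]
  constructor
  · rintro ⟨i, -, rfl⟩
    refine ⟨⟨Finset.mem_univ _, ?_⟩, rfl⟩
    refine (h.eq_iff a ⟨η r.castSucc a + i, hlt a i⟩ r).2 ⟨Nat.le_add_right _ _, ?_⟩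
    have : i.val < η r.succ a - η r.castSucc a := i.2
    change η r.castSucc a + i < _
    omega
  · rintro ⟨⟨-, h1⟩, rfl⟩
    obtain ⟨⟨a, i⟩, rfl⟩ := (slotPerm σ).surjective p
    obtain ⟨h2, h3⟩ := (h.eq_iff a i r).1 h1
    refine ⟨⟨i - η r.castSucc a, ?_⟩, List.mem_finRange _, ?_⟩
    · change i - η r.castSucc a < η r.succ a - η r.castSucc a
      omega
    · change slotPerm σ ⟨a, ⟨η r.castSucc a + (i - η r.castSucc a), _⟩⟩ = _
      congr 2
      ext
      exact Nat.add_sub_cancel' h2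

/-- Only the chain `blockSizes φ` contributes, and for it the factorials cancel the sum of the block
weights. -/
theorem sum_chains_blockWeight {K : Type*} [Field K] [CharZero K] {x : Slot ξ → K}
    (hx : Function.Injective x) (φ : Slot ξ → Fin n) [∀ (η : Fin (n + 1) → Fin m → ℕ)
      (χ : Slot ξ → Fin n), Decidable (IsBlock η χ)] :
    ∑ η ∈ chains n ξ, ∑ σ : ∀ a, Equiv.Perm (Fin (ξ a)), (if IsBlock η (φ ∘ slotPerm σ) then
      (∏ a : Fin m, ∏ r : Fin n, (1 / ((η r.succ a - η r.castSucc a).factorial : K))) *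
        blockWeight (x ∘ slotPerm σ) (φ ∘ slotPerm σ) else 0) = 1 := by
  rw [Finset.sum_eq_single (blockSizes φ)]
  · have h0 : (∏ a, ∏ r : Fin n,
        ((blockSizes φ r.succ a - blockSizes φ r.castSucc a).factorial : K)) ≠ 0 :=
      Finset.prod_ne_zero_iff.2 fun a _ => Finset.prod_ne_zero_iff.2 fun r _ =>
        Nat.cast_ne_zero.2 (Nat.factorial_ne_zero _)
    simp only [one_div, Finset.prod_inv_distrib]
    refine Eq.trans ?_ (inv_mul_cancel₀ h0)
    rw [← sum_blockWeight hx φ, Finset.mul_sum]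
    refine Finset.sum_congr rfl fun σ _ => ?_
    rw [sum_blockWeight hx φ]
    split_ifs <;> simp
  · intro η hη hne
    refine Finset.sum_eq_zero fun σ _ => if_neg fun h => hne (h.eq_blockSizes hη)
  · intro h
    exact absurd (blockSizes_mem_chains φ) h

end final
end NestedBethe

theorem corollary3p6 (m n : ℕ) {V : Fin n → Type*}
    [∀ r, AddCommGroup (V r)] [∀ r, Module ℂ (V r)] [∀ r, Module (Yangian m) (V r)]
    [∀ r, IsScalarTower ℂ (Yangian m) (V r)]
    (v : ∀ r, V r) (lam : Fin n → Fin (m + 1) → PowerSeries ℂ)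
    (hv : ∀ r, IsWeightSingular (v r) (lam r))
    (ξ : Fin m → ℕ) {ι : Type*} [LinearOrder ι] [Finite ι] (t : Fin m → ℕ → ι)
    (ht : Function.Injective fun p : Slot ξ => t p.1 p.2) :
    weightFunction (tensorAction V) (⨂ₜ[ℂ] r, v r) ξ t =
      ∑ η ∈ chains n ξ,
        (∏ a : Fin m, ∏ r : Fin n,
            (1 / ((η r.succ a - η r.castSucc a).factorial : ScalarSeries ι))) •
          symBar ξ (fun s =>
            ((∏ a : Fin m, ∏ b : Fin m with b.val = a.val + 1, ∏ r : Fin n,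
                ∏ i ∈ Finset.Ico (η r.castSucc b) (η r.succ b),
                  ∏ j ∈ Finset.Ico (η r.succ a) (ξ a),
                    (tvar (s b i) - tvar (s a j) + 1) / (tvar (s b i) - tvar (s a j))) *
              ∏ a : Fin m, ∏ r : Fin n,
                ((∏ i ∈ Finset.range (η r.castSucc a),
                    evalAt (lam r a.castSucc) (s a i)) *
                  ∏ j ∈ Finset.Ico (η r.succ a) (ξ a),
                    evalAt (lam r a.succ) (s a j))) •
              tensorSeries fun r =>
                weightFunction (Algebra.lsmul ℂ ℂ (V r)) (v r)
                  (fun a => η r.succ a - η r.castSucc a)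
                  (fun a i => s a (η r.castSucc a + i))) t := by
  classical
  have hchar : CharZero (ScalarSeries ι) := charZero_scalarSeries
  rw [weightFunction_tensor V hv ξ t ht]
  have hu : Function.Injective fun p : Slot ξ => (tvar (t p.1 p.2) : ScalarSeries ι) :=
    tvar_injective.comp ht
  simp only [symBar, Finset.smul_sum]
  -- Each term of the right side, indexed by `η` and `σ`, is a multiple of the term of a single
  -- distribution; it remains that the multiples for every distribution sum to one.
  refine (sum_sum_eq_of_coefficients (K := ScalarSeries ι) (c := fun η σ φ =>
    if IsBlock η (φ ∘ slotPerm σ) then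
      (∏ a : Fin m, ∏ r : Fin n, (1 / ((η r.succ a - η r.castSucc a).factorial : ScalarSeries ι))) *
        blockWeight ((fun p : Slot ξ => (tvar (t p.1 p.2) : ScalarSeries ι)) ∘ slotPerm σ)
          (φ ∘ slotPerm σ) else 0) ?_ fun φ => sum_chains_blockWeight hu φ).symm
  intro η hη σ
  obtain ⟨χ, hχ⟩ := exists_isBlock hη
  -- The distribution that belongs to `η` and `σ`: the variable at a position of the permuted list
  -- goes to the block of that position.
  have hφ : IsBlock η ((χ ∘ (slotPerm σ).symm) ∘ slotPerm σ) := by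
    rw [Function.comp_assoc, Equiv.symm_comp_self, Function.comp_id]
    exact hχ
  have hs : ∀ p : Slot ξ, permVars ξ σ t p.1 p.2 = t (slotPerm σ p).1 (slotPerm σ p).2 :=
    permVars_apply σ t
  have hinj : Function.Injective fun p : Slot ξ => permVars ξ σ t p.1 p.2 := by
    simp only [hs]
    exact ht.comp (slotPerm σ).injective
  have h1 := coefficient_eq hη hφ hinj lam
  have h2 := distCoeff_comp_equiv (fun p : Slot ξ => (tvar (t p.1 p.2) : ScalarSeries ι))
    (fun r p a => evalAt (lam r a) (t p.1 p.2)) Sigma.fst Finset.univ (χ ∘ (slotPerm σ).symm)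
    (slotPerm σ) fun p => rfl
  have e1 : (fun p : Slot ξ => (tvar (permVars ξ σ t p.1 p.2) : ScalarSeries ι)) =
      (fun p : Slot ξ => (tvar (t p.1 p.2) : ScalarSeries ι)) ∘ slotPerm σ :=
    funext fun p => by rw [hs]; rfl
  have e2 : (fun (r : Fin n) (p : Slot ξ) (a : Fin (m + 1)) => evalAt (lam r a) (permVars ξ σ t p.1 p.2)) =
      fun r p a => evalAt (lam r a) (t (slotPerm σ p).1 (slotPerm σ p).2) :=
    funext fun r => funext fun p => funext fun a => by rw [hs]
  rw [e1, e2, h2] at h1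
  have h3 := funext fun r => weightFunction_block V v ht hη hφ r
  rw [h3]
  have key := smul_eq_sum_ite (K := ScalarSeries ι) (M := VectorSeries ι (⨂[ℂ] r, V r))
    (fun φ : Slot ξ → Fin n => IsBlock η (φ ∘ slotPerm σ)) hφ (fun φ h => by
      have := h.unique hφ
      exact (slotPerm σ).surjective.injective_comp_right this)
    (∏ a : Fin m, ∏ r : Fin n, (1 / ((η r.succ a - η r.castSucc a).factorial : ScalarSeries ι))) 
    (symWeight ξ (permVars ξ σ t)) _
    (fun φ => tensorSeries fun r => finBethe (fun p : Slot ξ => tvar (t p.1 p.2)) m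
          (colorSets Sigma.fst (Finset.univ.filter fun p => φ p = r))
          (moduleFam V r fun p : Slot ξ => t p.1 p.2) (constSeries ι (v r)))
    (distCoeff (fun p : Slot ξ => (tvar (t p.1 p.2) : ScalarSeries ι))
    (fun r p a => evalAt (lam r a) (t p.1 p.2)) Sigma.fst Finset.univ Finset.univ)
    (fun φ => blockWeight ((fun p : Slot ξ => (tvar (t p.1 p.2) : ScalarSeries ι)) ∘ slotPerm σ)
          (φ ∘ slotPerm σ)) h1
  convert key using 1
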